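/- Let $(X,D)$ be a log pair with smooth boundary: $X$ is a smooth projective complex manifold and $D\subset X$ is a smooth divisor. For a locally free sheaf $F$ write $\mathbb P^*(F)=\mathrm{Proj}(\mathrm{Sym}\,F)$ for the bundle of rank one quotients of $F$, so that $\mathbb P(V)=\mathbb P^*(V^*)$ is the bundle of lines in a vector bundle $V$. Let $p:Y=\mathbb P(T_X(-\log D))=\mathbb P^*(\Omega_X(\log D))\to X$ and $p_0:Y_0=\mathbb P(T_X)=\mathbb P^*(\Omega_X)\to X$, with tautological line bundles $\mathcal O_Y(1)$ and $\mathcal O_{Y_0}(1)$. The Poincaré residue $\Omega_X(\log D)\to\mathcal O_D$ defines a section of $p^{-1}(D)\to D$; let $Z\subset Y$ be its image. The restriction $\Omega_X\to\Omega_D$ of differential forms defines a closed immersion $\mathbb P(T_D)=\mathbb P^*(\Omega_D)\hookrightarrow Y_0$; let $Z_0\subset Y_0$ be its image. Over $X\setminus D$ the inclusion $\Omega_X\to\Omega_X(\log D)$ is an isomorphism, which gives the natural birational map $Y\dashrightarrow Y_0$; it is an isomorphism from $p^{-1}(X\setminus D)$ onto $p_0^{-1}(X\setminus D)$. Let $\pi:\mathrm{Bl}_ZY\to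 Y$ and $\pi_0:\mathrm{Bl}_{Z_0}Y_0\to Y_0$ be the blowing-ups, with exceptional divisors $E$ and $E_0$. Then: 1. The natural birational map $Y\dashrightarrow Y_0$ induces an isomorphism of $X$-schemes $\mathrm{Bl}_ZY\cong\mathrm{Bl}_{Z_0}Y_0$. Under it, the strict transform of $p^{-1}(D)$ under $\pi$ corresponds to $E_0$, and the strict transform of $p_0^{-1}(D)$ under $\pi_0$ corresponds to $E$. 2. On $\widetilde Y=\mathrm{Bl}_ZY\cong\mathrm{Bl}_{Z_0}Y_0$ there is an isomorphism of line bundles $\pi^*\mathcal O_Y(1)\cong\pi_0^*\mathcal O_{Y_0}(1)\otimes\mathcal O_{\widetilde Y}(E)$. 3. There is an isomorphism $N^*_{Z/Y}\cong p^*(\Omega_X|_D)$ of $\mathcal O_Z$-modules, with the property in 4. 4. The morphism $\pi_0$ induces an isomorphism of $D$-schemes $E\to p_0^{-1}(D)\cong\mathbb P^*(\Omega_X|_D)=\mathbb P(T_X|_D)$, and it is determined by the isomorphism in 3: that isomorphism, followed by the canonical surjection of the pullback of $N^*_{Z/Y}$ to $E$ onto $N^*_{E/\widetilde Y}=\mathcal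 O_{\widetilde Y}(-E)|_E$, makes $E$ the projective bundle $\mathbb P^*(\Omega_X|_D)$ over $D$, and this quotient of the pullback of $\Omega_X$ to $E$ is the one that defines $\pi_0|_E:E\to Y_0=\mathbb P^*(\Omega_X)$. -/

import Mathlib

open CategoryTheory Limits AlgebraicGeometry TopologicalSpace Opposite

namespace LogResolution

noncomputable section

universe u

/-! ### Sheaves of modules: sheafification, tensor product, invertible sheaves -/

/-- The sheaf of modules associated with a presheaf of modules. -/
def sheafify {X : Scheme.{u}} (P : X.PresheafOfModules) : X.Modules :=
  (PresheafOfModules.sheafification (𝟙 X.ringCatSheaf.obj)).obj P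

/-- The canonical map from a presheaf of modules to its associated sheaf. -/
def toSheafify {X : Scheme.{u}} (P : X.PresheafOfModules) : P ⟶ (sheafify P).val :=
  (PresheafOfModules.sheafificationHomEquiv (𝟙 X.ringCatSheaf.obj)
    (P := P) (F := sheafify P)) (𝟙 _)

/-- The map from the associated sheaf given by a map from `P` to a sheaf. -/
def sheafifyDesc {X : Scheme.{u}} {P : X.PresheafOfModules} {M : X.Modules} (f : P ⟶ M.val) :
    sheafify P ⟶ M :=
  (PresheafOfModules.sheafificationHomEquiv (𝟙 X.ringCatSheaf.obj) (P := P) (F := M)).symm f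

/-- The tensor product of two `𝒪_X`-modules: the sheaf associated with
`U ↦ M(U) ⊗ N(U)`. -/
def tensor {X : Scheme.{u}} (M N : X.Modules) : X.Modules :=
  sheafify (PresheafOfModules.Monoidal.tensorObj (R := X.presheaf) M.val N.val)

/-- The structure sheaf, as a module over itself. -/
abbrev structureSheaf (X : Scheme.{u}) : X.Modules := SheafOfModules.unit X.ringCatSheaf

/-- Line bundles: modules that are locally isomorphic to the structure sheaf. -/
def IsInvertible {X : Scheme.{u}} (L : X.Modules) : Prop :=
  ∀ x : X, ∃ U : X.Opens, x ∈ U ∧ Nonempty (L.restrict U.ι ≅ structureSheaf U)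

/-- A map of presheaves of modules whose values lie in a sub-presheaf factors through it. -/
def submoduleLift {X : Scheme.{u}} {P M : X.PresheafOfModules} (N : M.Submodule) (f : P ⟶ M)
    (h : ∀ (V : X.Opensᵒᵖ) (x : P.obj V), f.app V x ∈ N.obj V) : P ⟶ N.toPresheafOfModules where
  app V := ModuleCat.ofHom ((f.app V).hom.codRestrict (N.obj V) (h V))
  naturality {V W} g := by
    ext x
    exact Subtype.ext (PresheafOfModules.naturality_apply f g x)

/-! ### Complements and sections away from a closed subscheme -/

/-- The open complement of (the closure of) the image of a morphism; for a closed immersion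
this is the complement of the closed subscheme. -/
def complement {X Z : Scheme.{u}} (z : Z ⟶ X) : X.Opens :=
  ⟨(closure (Set.range z))ᶜ, isClosed_closure.isOpen_compl⟩

/-- `j_* (M|_U)` where `j : U ⟶ X` is the inclusion: its sections over `V` are the sections of
`M` over `U ∩ V`. -/
def awayFrom {X : Scheme.{u}} (M : X.Modules) (U : X.Opens) : X.Modules :=
  (Scheme.Modules.pushforward U.ι).obj (M.restrict U.ι)

/-- The restriction map `M ⟶ j_* (M|_U)`. -/
def toAwayFrom {X : Scheme.{u}} (M : X.Modules) (U : X.Opens) : M ⟶ awayFrom M U :=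
  (Scheme.Modules.restrictAdjunction U.ι).unit.app M

/-! ### The sheaf of differentials -/

/-- The structure of a presheaf of `R`-algebras on `𝒪_X`, for a scheme `X` over `Spec R`. -/
def constHom {X : Scheme.{u}} {R : CommRingCat.{u}} (s : X ⟶ Spec R) :
    (Functor.const (X.Opens)ᵒᵖ).obj R ⟶ X.presheaf where
  app U := (Scheme.ΓSpecIso R).inv ≫ s.appTop ≫ X.presheaf.map (homOfLE le_top).op
  naturality U V f := by
    simp [← Functor.map_comp]
    rfl

/-- The presheaf `U ↦ Ω_{𝒪_X(U) / R}` of Kähler differentials. -/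
def differentialsPresheaf {X : Scheme.{u}} {R : CommRingCat.{u}} (s : X ⟶ Spec R) :
    X.PresheafOfModules :=
  PresheafOfModules.DifferentialsConstruction.relativeDifferentials' (constHom s)

/-- The cotangent sheaf `Ω_X = Ω_{X/R}`. -/
def differentials {X : Scheme.{u}} {R : CommRingCat.{u}} (s : X ⟶ Spec R) : X.Modules :=
  sheafify (differentialsPresheaf s)

/-- The universal derivation `d : 𝒪_X ⟶ Ω_X`. -/
def universalDerivation {X : Scheme.{u}} {R : CommRingCat.{u}} (s : X ⟶ Spec R) :
    (differentials s).val.Derivation' (constHom s) :=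
  (PresheafOfModules.DifferentialsConstruction.derivation' (constHom s)).postcomp
    (toSheafify (differentialsPresheaf s))

/-- The universal derivation on sections over `U`. -/
def dSection {X : Scheme.{u}} {R : CommRingCat.{u}} (s : X ⟶ Spec R) (U : X.Opens) :
    Γ(X, U) →+ Γ(differentials s, U) :=
  (universalDerivation s).d (X := op U)

theorem dSection_mul {X : Scheme.{u}} {R : CommRingCat.{u}} (s : X ⟶ Spec R) (U : X.Opens)
    (a b : Γ(X, U)) :
    dSection s U (a * b) = a • dSection s U b + b • dSection s U a :=
  (universalDerivation s).d_mul (X := op U) a b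

theorem dSection_res {X : Scheme.{u}} {R : CommRingCat.{u}} (s : X ⟶ Spec R) {U V : X.Opens}
    (h : V ≤ U) (a : Γ(X, U)) :
    dSection s V (X.presheaf.map (homOfLE h).op a) =
      (differentials s).presheaf.map (homOfLE h).op (dSection s U a) :=
  (universalDerivation s).d_map (homOfLE h).op a

theorem dSection_const {X : Scheme.{u}} {R : CommRingCat.{u}} (s : X ⟶ Spec R) (U : X.Opens)
    (a : R) : dSection s U ((constHom s).app (op U) a) = 0 :=
  PresheafOfModules.Derivation'.d_app (universalDerivation s) (X := op U) a

/-- For a morphism `f : X ⟶ Y` over `Spec R`, the derivation `r ↦ d (f^♯ r)` of `𝒪_Y` with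
values in `f_* Ω_X`. -/
def differentialsPushDerivation {X Y : Scheme.{u}} {R : CommRingCat.{u}} {sX : X ⟶ Spec R}
    {sY : Y ⟶ Spec R} (f : X ⟶ Y) (hf : f ≫ sY = sX) :
    ((Scheme.Modules.pushforward f).obj (differentials sX)).val.Derivation' (constHom sY) where
  d {U} := (dSection sX (f ⁻¹ᵁ U.unop)).comp (f.app U.unop).hom.toAddMonoidHom
  d_mul {U} a b := by
    have h1 := (f.app U.unop).hom.map_mul a b
    exact (congrArg _ h1).trans
      (dSection_mul sX (f ⁻¹ᵁ U.unop) (f.app U.unop a) (f.app U.unop b))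
  d_map {U V} g a := by
    have h1 := ConcreteCategory.congr_hom (f.naturality g) a
    have h2 := dSection_res sX (f.preimage_mono (leOfHom g.unop)) (f.app U.unop a)
    exact (congrArg _ h1).trans h2
  d_app {U} a := by
    have h1 : f.app U.unop ((constHom sY).app U a) =
        (constHom sX).app (op (f ⁻¹ᵁ U.unop)) a := by
      subst hf
      have h2 := f.naturality (homOfLE (le_top : U.unop ≤ ⊤)).op
      have h3 : ((Scheme.ΓSpecIso R).inv ≫ sY.appTop ≫
          Y.presheaf.map (homOfLE (le_top : U.unop ≤ ⊤)).op) ≫ f.app U.unop =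
          (Scheme.ΓSpecIso R).inv ≫ (f ≫ sY).appTop ≫
            X.presheaf.map (homOfLE (le_top : f ⁻¹ᵁ U.unop ≤ ⊤)).op := by
        rw [Category.assoc, Category.assoc, h2, Scheme.Hom.comp_appTop, Category.assoc]
        rfl
      exact ConcreteCategory.congr_hom h3 a
    exact (congrArg _ h1).trans (dSection_const sX _ a)

/-- The map `Ω_Y ⟶ f_* Ω_X`, `d r ↦ d (f^♯ r)`. -/
def differentialsPush {X Y : Scheme.{u}} {R : CommRingCat.{u}} {sX : X ⟶ Spec R}
    {sY : Y ⟶ Spec R} (f : X ⟶ Y) (hf : f ≫ sY = sX) :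
    differentials sY ⟶ (Scheme.Modules.pushforward f).obj (differentials sX) :=
  sheafifyDesc ((PresheafOfModules.DifferentialsConstruction.isUniversal' (constHom sY)).desc
    (differentialsPushDerivation f hf))

/-- The pullback of differential forms `f^* Ω_Y ⟶ Ω_X`. -/
def differentialsPull {X Y : Scheme.{u}} {R : CommRingCat.{u}} {sX : X ⟶ Spec R}
    {sY : Y ⟶ Spec R} (f : X ⟶ Y) (hf : f ≫ sY = sX) :
    (Scheme.Modules.pullback f).obj (differentials sY) ⟶ differentials sX :=
  ((Scheme.Modules.pullbackPushforwardAdjunction f).homEquiv _ _).symm (differentialsPush f hf)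

/-! ### Logarithmic differentials -/

/-- The sections over `V` of `j_* Ω_U` that are restrictions of sections of `Ω_X` over `V`, or
logarithmic differentials `df / f` of functions `f` on `V` that are invertible on `U ∩ V`. -/
def logGenerators {X : Scheme.{u}} {R : CommRingCat.{u}} (s : X ⟶ Spec R) (U V : X.Opens) :
    Set Γ(awayFrom (differentials s) U, V) :=
  Set.range ((toAwayFrom (differentials s) U).app V) ∪
    {w | ∃ f : Γ(X, V), IsUnit (X.presheaf.map (homOfLE (inf_le_left : V ⊓ U ≤ V)).op f) ∧
      f • w = (toAwayFrom (differentials s) U).app V (dSection s V f)}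

/-- The sub-presheaf of modules of `j_* Ω_U` generated by `logGenerators`. -/
def logSubmodule {X : Scheme.{u}} {R : CommRingCat.{u}} (s : X ⟶ Spec R) (U : X.Opens) :
    (awayFrom (differentials s) U).val.Submodule where
  obj V := Submodule.span (X.ringCatSheaf.obj.obj V) (logGenerators s U V.unop)
  map {V W} g := by
    have hg : W.unop ≤ V.unop := leOfHom g.unop
    refine Submodule.span_le.mpr ?_
    rintro w (⟨x, rfl⟩ | ⟨f, hf, hw⟩)
    · refine Submodule.subset_span (Or.inl ⟨(differentials s).presheaf.map g x, ?_⟩)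
      exact ConcreteCategory.congr_hom
        ((toAwayFrom (differentials s) U).mapPresheaf.naturality g) x
    · refine Submodule.subset_span (Or.inr ⟨X.presheaf.map g f, ?_, ?_⟩)
      · have := hf.map (X.presheaf.map (homOfLE (inf_le_inf_right U hg)).op).hom
        rw [← CommRingCat.comp_apply, ← Functor.map_comp] at this ⊢
        exact this
      · have h1 := congrArg ((awayFrom (differentials s) U).presheaf.map g) hw
        have h2 := Scheme.Modules.map_smul (awayFrom (differentials s) U) g.unop f w
        have h3 := ConcreteCategory.congr_hom
          ((toAwayFrom (differentials s) U).mapPresheaf.naturality g) (dSection s V.unop f)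
        have h4 := dSection_res s hg f
        exact h2.symm.trans (h1.trans (h3.symm.trans (congrArg _ h4.symm)))

/-- The logarithmic cotangent sheaf `Ω_X(log D)`, for `i : D ⟶ X`: the `𝒪_X`-submodule of
`j_* Ω_{X ∖ D}` generated by `Ω_X` and by the logarithmic differentials `df / f` of local
functions that are invertible outside of `D`. -/
def logDifferentials {X D : Scheme.{u}} {R : CommRingCat.{u}} (s : X ⟶ Spec R) (i : D ⟶ X) :
    X.Modules :=
  sheafify (logSubmodule s (complement i)).toPresheafOfModules

/-- The canonical map `Ω_X ⟶ Ω_X(log D)`. -/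
def toLog {X D : Scheme.{u}} {R : CommRingCat.{u}} (s : X ⟶ Spec R) (i : D ⟶ X) :
    differentials s ⟶ logDifferentials s i :=
  ⟨submoduleLift (logSubmodule s (complement i))
      (toAwayFrom (differentials s) (complement i)).val
      (fun _ x ↦ Submodule.subset_span (Or.inl ⟨x, rfl⟩)) ≫ toSheafify _⟩

/-! ### Ideal sheaves, conormal sheaves, effective Cartier divisors -/

/-- The map `𝒪_Y ⟶ f_* 𝒪_X`. -/
def structureMap {X Y : Scheme.{u}} (f : X ⟶ Y) :
    structureSheaf Y ⟶ (Scheme.Modules.pushforward f).obj (structureSheaf X) :=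
  SheafOfModules.unitToPushforwardObjUnit f.toRingCatSheafHom

/-- The ideal sheaf `I_Z` of a closed immersion `z : Z ⟶ Y`, as an `𝒪_Y`-module. -/
def idealModule {Y Z : Scheme.{u}} (z : Z ⟶ Y) : Y.Modules := kernel (structureMap z)

/-- The conormal sheaf `N^*_{Z/Y} = I_Z / I_Z ^ 2 = z^* I_Z` of a closed immersion `z : Z ⟶ Y`,
as an `𝒪_Z`-module. -/
def conormal {Y Z : Scheme.{u}} (z : Z ⟶ Y) : Z.Modules :=
  (Scheme.Modules.pullback z).obj (idealModule z)

theorem idealModule_push_eq_zero {B Y E Z : Scheme.{u}} {e : E ⟶ B} {g : E ⟶ Z} {π : B ⟶ Y}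
    {z : Z ⟶ Y} (h : e ≫ π = g ≫ z) :
    (kernel.ι (structureMap z) ≫ structureMap π) ≫
      (Scheme.Modules.pushforward π).map (structureMap e) = 0 := by
  ext U x
  have key : ∀ y : Γ(Y, U), z.app U y = 0 → e.app (π ⁻¹ᵁ U) (π.app U y) = 0 := by
    intro y h0
    have h1 : π.app U ≫ e.app (π ⁻¹ᵁ U) =
        (z.app U ≫ g.app (z ⁻¹ᵁ U)) ≫ E.presheaf.map (eqToHom (congrArg (· ⁻¹ᵁ U) h)).op := by
      rw [← Scheme.Hom.comp_app, ← Scheme.Hom.comp_app, Scheme.Hom.congr_app h U]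
      rfl
    have h2 := ConcreteCategory.congr_hom h1 y
    have h3 : E.presheaf.map (eqToHom (congrArg (· ⁻¹ᵁ U) h)).op
        (g.app (z ⁻¹ᵁ U) (z.app U y)) = 0 := by
      rw [h0, map_zero]
      exact map_zero (E.presheaf.map (eqToHom (congrArg (· ⁻¹ᵁ U) h)).op).hom
    exact h2.trans h3
  exact key _ (ConcreteCategory.congr_hom (congrArg (fun t ↦ Scheme.Modules.Hom.app t U)
    (kernel.condition (structureMap z))) x)

/-- For a commutative square `e ≫ π = g ≫ z` the canonical map `π^* I_Z ⟶ I_E`. -/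
def pullbackIdeal {B Y E Z : Scheme.{u}} {e : E ⟶ B} {g : E ⟶ Z} {π : B ⟶ Y} {z : Z ⟶ Y}
    (h : e ≫ π = g ≫ z) :
    (Scheme.Modules.pullback π).obj (idealModule z) ⟶ idealModule e :=
  kernel.lift (structureMap e)
    (((Scheme.Modules.pullbackPushforwardAdjunction π).homEquiv _ _).symm
      (kernel.ι (structureMap z) ≫ structureMap π)) (by
    apply ((Scheme.Modules.pullbackPushforwardAdjunction π).homEquiv _ _).injective
    rw [Adjunction.homEquiv_naturality_right, Equiv.apply_symm_apply]
    refine (idealModule_push_eq_zero h).trans ?_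
    rw [Adjunction.homEquiv_unit, Functor.map_zero, comp_zero]
    rfl)

/-- For a commutative square `e ≫ π = g ≫ z` the canonical map of conormal sheaves
`g^* N^*_{Z/Y} ⟶ N^*_{E/B}`. -/
def conormalMap {B Y E Z : Scheme.{u}} {e : E ⟶ B} {g : E ⟶ Z} {π : B ⟶ Y} {z : Z ⟶ Y}
    (h : e ≫ π = g ≫ z) :
    (Scheme.Modules.pullback g).obj (conormal z) ⟶ conormal e :=
  (Scheme.Modules.pullbackComp g z).hom.app (idealModule z) ≫
    (Scheme.Modules.pullbackCongr h.symm).hom.app (idealModule z) ≫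
      (Scheme.Modules.pullbackComp e π).inv.app (idealModule z) ≫
        (Scheme.Modules.pullback e).map (pullbackIdeal h)

/-- Effective Cartier divisors: closed subschemes that are locally defined by one equation that
is not a zero divisor. -/
structure IsEffectiveCartier {X D : Scheme.{u}} (i : D ⟶ X) : Prop where
  isClosedImmersion : IsClosedImmersion i
  exists_equation : ∀ x : X, ∃ V : X.affineOpens, x ∈ V.1 ∧
    ∃ f ∈ nonZeroDivisors Γ(X, V.1), i.ker.ideal V = Ideal.span {f}

/-- The sub-presheaf of `j_* 𝒪_{X ∖ D}` of the functions `a` with `I_D a ⊆ 𝒪_X`. -/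
def divisorSubmodule {X D : Scheme.{u}} (i : D ⟶ X) :
    (awayFrom (structureSheaf X) (complement i)).val.Submodule where
  obj V :=
    let M := awayFrom (structureSheaf X) (complement i)
    let N : Submodule Γ(X, V.unop) Γ(M, V.unop) :=
    { carrier := {a | ∀ (W : X.Opens) (h : W ≤ V.unop) (f : Γ(X, W)), i.app W f = 0 →
        f • M.presheaf.map (homOfLE h).op a ∈
          Set.range ((toAwayFrom (structureSheaf X) (complement i)).app W)}
      add_mem' := by
        intro a b ha hb W h f hf
        obtain ⟨x, hx⟩ := ha W h f hf
        obtain ⟨y, hy⟩ := hb W h f hf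
        refine ⟨x + y, ?_⟩
        rw [map_add, map_add, smul_add, hx, hy]
      zero_mem' := by
        intro W h f hf
        exact ⟨0, by rw [map_zero, map_zero, smul_zero]⟩
      smul_mem' := by
        intro c a ha W h f hf
        obtain ⟨x, hx⟩ := ha W h f hf
        refine ⟨X.presheaf.map (homOfLE h).op c • x, ?_⟩
        rw [Scheme.Modules.Hom.app_smul, hx, Scheme.Modules.map_smul, smul_comm] }
    N
  map {V W} g := by
    intro a ha W' h f hf
    have h1 := ha W' (h.trans (leOfHom g.unop)) f hf
    have h2 := ConcreteCategory.congr_hom ((awayFrom (structureSheaf X)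
      (complement i)).presheaf.map_comp g (homOfLE h).op) a
    exact (congrArg (fun t ↦ f • t) h2) ▸ h1

/-- The line bundle `𝒪_X(D)` of an effective Cartier divisor `i : D ⟶ X`: the sheaf of functions
on the complement of `D` with at most a simple pole along `D`. -/
def divisorSheaf {X D : Scheme.{u}} (i : D ⟶ X) : X.Modules :=
  sheafify (divisorSubmodule i).toPresheafOfModules

/-! ### Log pairs and the residue -/

/-- `X` is projective over `ℂ`: it is isomorphic, over `ℂ`, to a closed subscheme of a projective
space. -/
def IsProjective {X : Scheme.{0}} (s : X ⟶ Spec (CommRingCat.of ℂ)) : Prop :=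
  letI := fun N : ℕ ↦ MvPolynomial.gradedAlgebra (σ := Fin (N + 1)) (R := ℂ)
  ∃ (N : ℕ) (j : X ⟶ Proj (MvPolynomial.homogeneousSubmodule (Fin (N + 1)) ℂ)),
    IsClosedImmersion j ∧
      j ≫ Proj.toSpecZero (MvPolynomial.homogeneousSubmodule (Fin (N + 1)) ℂ) ≫
        Spec.map (CommRingCat.ofHom
          (algebraMap ℂ (MvPolynomial.homogeneousSubmodule (Fin (N + 1)) ℂ 0))) = s

/-- `(X, D)` is a log pair with smooth boundary: `X` is a smooth projective complex variety, and
`D` is a smooth divisor of `X`. -/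
structure IsLogPairWithSmoothBoundary {X D : Scheme.{0}} (s : X ⟶ Spec (CommRingCat.of ℂ))
    (i : D ⟶ X) : Prop where
  smooth : Smooth s
  projective : IsProjective s
  divisor : IsEffectiveCartier i
  smooth_boundary : Smooth (i ≫ s)

/-- `res : Ω_X(log D) ⟶ i_* 𝒪_D` is the Poincaré residue: it is zero on `Ω_X` and maps `df / f`
to `1` for every local equation `f` of `D`. (Forms `w` with `f w = df` are equal to `df / f`.) -/
structure IsPoincareResidue {X D : Scheme.{u}} {R : CommRingCat.{u}} (s : X ⟶ Spec R) (i : D ⟶ X)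
    (res : logDifferentials s i ⟶ (Scheme.Modules.pushforward i).obj (structureSheaf D)) :
    Prop where
  zero : toLog s i ≫ res = 0
  one : ∀ (V : X.affineOpens) (f : Γ(X, V.1)), i.ker.ideal V = Ideal.span {f} →
    ∀ w : Γ(logDifferentials s i, V.1), f • w = (toLog s i).app V.1 (dSection s V.1 f) →
      res.app V.1 w = (1 : Γ(D, i ⁻¹ᵁ V.1))

/-- The restriction to `D` of a map `F ⟶ i_* 𝒪_D`, as a map `F|_D ⟶ 𝒪_D`. -/
def restrictToDivisor {X D : Scheme.{u}} (i : D ⟶ X) {F : X.Modules}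
    (res : F ⟶ (Scheme.Modules.pushforward i).obj (structureSheaf D)) :
    (Scheme.Modules.pullback i).obj F ⟶ structureSheaf D :=
  ((Scheme.Modules.pullbackPushforwardAdjunction i).homEquiv _ _).symm res

/-! ### Projective bundles -/

/-- The pullback `(p ∘ g)^* F ≅ g^* p^* F ⟶ g^* L` of a map `q : p^* F ⟶ L`. -/
def pullbackQuotient {X P T : Scheme.{u}} {F : X.Modules} {p : P ⟶ X} {L : P.Modules}
    (q : (Scheme.Modules.pullback p).obj F ⟶ L) (g : T ⟶ P) :
    (Scheme.Modules.pullback (g ≫ p)).obj F ⟶ (Scheme.Modules.pullback g).obj L :=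
  (Scheme.Modules.pullbackComp g p).inv.app F ≫ (Scheme.Modules.pullback g).map q

/-- `g : T ⟶ P` is a morphism of `X`-schemes, and the pullback along `g` of `q : p^* F ⟶ L` is
isomorphic, as a quotient of `f^* F`, to `r : f^* F ⟶ M`. -/
def Classifies {X P T : Scheme.{u}} {F : X.Modules} {p : P ⟶ X} {L : P.Modules}
    (q : (Scheme.Modules.pullback p).obj F ⟶ L) (g : T ⟶ P) {f : T ⟶ X} {M : T.Modules}
    (r : (Scheme.Modules.pullback f).obj F ⟶ M) : Prop :=
  ∃ (h : g ≫ p = f) (θ : (Scheme.Modules.pullback g).obj L ≅ M),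
    pullbackQuotient q g ≫ θ.hom = (Scheme.Modules.pullbackCongr h).hom.app F ≫ r

/-- `p : P ⟶ X` with `q : p^* F ⟶ L` is the projective bundle `ℙ^*(F) = Proj (Sym F)` of rank one
quotients of `F`, with its tautological quotient `p^* F ⟶ 𝒪(1)`: for every `f : T ⟶ X`, the
`X`-morphisms `T ⟶ P` correspond to the line bundle quotients of `f^* F`. If `F` is the dual of a
vector bundle `V`, this is the bundle `ℙ(V)` of lines in `V`. -/
structure IsProjectiveBundle {X P : Scheme.{u}} (F : X.Modules) (p : P ⟶ X) {L : P.Modules}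
    (q : (Scheme.Modules.pullback p).obj F ⟶ L) : Prop where
  isInvertible : IsInvertible L
  epi : Epi q
  existsUnique : ∀ (T : Scheme.{u}) (f : T ⟶ X) (M : T.Modules)
    (r : (Scheme.Modules.pullback f).obj F ⟶ M), IsInvertible M → Epi r →
      ∃! g : T ⟶ P, Classifies q g r

/-! ### Blowing-up -/

/-- `π : B ⟶ Y` is the blowing-up of the closed subscheme `z : Z ⟶ Y`: the inverse image of `Z`
is an effective Cartier divisor (the exceptional divisor), and `π` is universal for this. -/
structure IsBlowup {Y Z B : Scheme.{u}} (z : Z ⟶ Y) (π : B ⟶ Y) : Prop where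
  isEffectiveCartier : IsEffectiveCartier (pullback.fst π z)
  existsUnique : ∀ (T : Scheme.{u}) (f : T ⟶ Y), IsEffectiveCartier (pullback.fst f z) →
    ∃! g : T ⟶ B, g ≫ π = f

/-- The exceptional divisor `E = π⁻¹(Z) ⟶ B`. -/
abbrev exceptional {Y Z B : Scheme.{u}} (z : Z ⟶ Y) (π : B ⟶ Y) : pullback π z ⟶ B :=
  pullback.fst π z

/-- The strict transform in `B` of a closed subscheme `w : W ⟶ Y`, given by its ideal sheaf: the
scheme-theoretic closure of `π⁻¹(W ∖ Z)`. -/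
def strictTransform {Y Z B W : Scheme.{u}} (z : Z ⟶ Y) (π : B ⟶ Y) (w : W ⟶ Y) :
    B.IdealSheafData :=
  ((pullback.fst π w ⁻¹ᵁ complement (exceptional z π)).ι ≫ pullback.fst π w).ker

end

end LogResolution

open LogResolution

open CategoryTheory Limits AlgebraicGeometry TopologicalSpace Opposite

namespace LogResolution

noncomputable section

universe u

/-! ### Sections and restrictions -/

/-- Restriction of sections of a module. -/
def mres {X : Scheme.{u}} (M : X.Modules) {U W : X.Opens} (h : W ≤ U) : Γ(M, U) →+ Γ(M, W) :=
  (M.presheaf.map (homOfLE h).op).hom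

/-- Restriction of functions. -/
def fres {X : Scheme.{u}} {U W : X.Opens} (h : W ≤ U) : Γ(X, U) →+* Γ(X, W) :=
  (X.presheaf.map (homOfLE h).op).hom

/-- Pullback of functions. -/
def fpull {X Y : Scheme.{u}} (f : X ⟶ Y) {V : Y.Opens} {W : X.Opens} (e : W ≤ f ⁻¹ᵁ V) :
    Γ(Y, V) →+* Γ(X, W) :=
  (f.appLE V W e).hom

section basic

variable {X Y Z : Scheme.{u}} (M N : X.Modules) {U V W : X.Opens}

@[simp] theorem mres_mres (h : V ≤ U) (h' : W ≤ V) (s : Γ(M, U)) :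
    mres M h' (mres M h s) = mres M (h'.trans h) s := by
  simp only [mres]
  rw [← AddCommGrpCat.comp_apply, ← Functor.map_comp]
  rfl

@[simp] theorem mres_self (h : U ≤ U) (s : Γ(M, U)) : mres M h s = s := by
  have : M.presheaf.map (homOfLE h).op = 𝟙 _ := M.presheaf.map_id _
  simp only [mres, this]
  rfl

@[simp] theorem fres_fres (h : V ≤ U) (h' : W ≤ V) (s : Γ(X, U)) :
    fres h' (fres h s) = fres (h'.trans h) s := by
  simp only [fres]
  rw [← CommRingCat.comp_apply, ← Functor.map_comp]
  rfl

@[simp] theorem fres_self (h : U ≤ U) (s : Γ(X, U)) : fres h s = s := by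
  have : X.presheaf.map (homOfLE h).op = 𝟙 _ := X.presheaf.map_id _
  simp only [fres, this]
  rfl

@[simp] theorem mres_smul (h : W ≤ U) (a : Γ(X, U)) (s : Γ(M, U)) :
    mres M h (a • s) = fres h a • mres M h s :=
  Scheme.Modules.map_smul M (homOfLE h) a s

variable {M N}

theorem mres_app (φ : M ⟶ N) (h : W ≤ U) (s : Γ(M, U)) :
    mres N h (φ.app U s) = φ.app W (mres M h s) :=
  (ConcreteCategory.congr_hom (φ.mapPresheaf.naturality (homOfLE h).op) s).symm

@[simp] theorem fpull_fres (f : X ⟶ Y) {V V' : Y.Opens} {W : X.Opens} (h : V' ≤ V)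
    (e : W ≤ f ⁻¹ᵁ V') (a : Γ(Y, V)) :
    fpull f e (fres h a) = fpull f (e.trans (f.preimage_mono h)) a := by
  simp only [fpull, fres]
  rw [← CommRingCat.comp_apply, Scheme.Hom.map_appLE]

@[simp] theorem fres_fpull (f : X ⟶ Y) {V : Y.Opens} {W W' : X.Opens} (h : W' ≤ W)
    (e : W ≤ f ⁻¹ᵁ V) (a : Γ(Y, V)) :
    fres h (fpull f e a) = fpull f (h.trans e) a := by
  simp only [fpull, fres]
  rw [← CommRingCat.comp_apply, Scheme.Hom.appLE_map]

theorem fpull_comp (f : X ⟶ Y) (g : Y ⟶ Z) {V : Z.Opens} {V' : Y.Opens} {W : X.Opens}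
    (e : V' ≤ g ⁻¹ᵁ V) (e' : W ≤ f ⁻¹ᵁ V') (a : Γ(Z, V)) :
    fpull f e' (fpull g e a) =
      fpull (f ≫ g) (e'.trans (f.preimage_mono e) : W ≤ (f ≫ g) ⁻¹ᵁ V) a := by
  simp only [fpull]
  rw [← CommRingCat.comp_apply, Scheme.Hom.appLE_comp_appLE]

theorem fpull_congr {f g : X ⟶ Y} (h : f = g) {V : Y.Opens} {W : X.Opens}
    (e : W ≤ f ⁻¹ᵁ V) (a : Γ(Y, V)) : fpull f e a = fpull g (h ▸ e) a := by
  subst h; rfl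

theorem app_eq_fpull (f : X ⟶ Y) {V : Y.Opens} (a : Γ(Y, V)) :
    f.app V a = fpull f (le_refl (f ⁻¹ᵁ V)) a := by
  simp [fpull, Scheme.Hom.appLE]

/-! ### Gluing -/

theorem section_ext {s t : Γ(M, U)}
    (h : ∀ x ∈ U, ∃ (W : X.Opens) (h : W ≤ U), x ∈ W ∧ mres M h s = mres M h t) : s = t := by
  choose W hW hxW e using h
  refine TopCat.Sheaf.eq_of_locally_eq' ⟨M.presheaf, M.isSheaf⟩ (fun x : U ↦ W x.1 x.2) U
    (fun x ↦ homOfLE (hW x.1 x.2)) ?_ s t (fun x ↦ e x.1 x.2)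
  intro x hx
  exact Opens.mem_iSup.mpr ⟨⟨x, hx⟩, hxW x hx⟩

theorem section_glue {ι : Type u} (U : X.Opens) (W : ι → X.Opens) (hW : ∀ i, W i ≤ U)
    (hU : U ≤ iSup W) (s : ∀ i, Γ(M, W i))
    (h : ∀ i j, mres M inf_le_left (s i) = mres M (inf_le_right : W i ⊓ W j ≤ W j) (s j)) :
    ∃ t : Γ(M, U), ∀ i, mres M (hW i) t = s i :=
  (TopCat.Sheaf.existsUnique_gluing' ⟨M.presheaf, M.isSheaf⟩ W U
    (fun i ↦ homOfLE (hW i)) hU s h).exists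

/-- Gluing of locally unique sections. -/
theorem section_glue_pred (U : X.Opens) (P : ∀ W : X.Opens, Γ(M, W) → Prop)
    (hex : ∀ x ∈ U, ∃ W : X.Opens, W ≤ U ∧ x ∈ W ∧ ∃ s, P W s)
    (huniq : ∀ (W W' : X.Opens) (s : Γ(M, W)) (s' : Γ(M, W')), W ≤ U → W' ≤ U → P W s → P W' s' →
      mres M inf_le_left s = mres M (inf_le_right : W ⊓ W' ≤ W') s') :
    ∃ t : Γ(M, U), ∀ (W : X.Opens) (h : W ≤ U) (s : Γ(M, W)), P W s → mres M h t = s := by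
  choose W hWU hxW s hs using hex
  obtain ⟨t, ht⟩ := section_glue U (fun x : U ↦ W x.1 x.2) (fun x ↦ hWU _ _)
    (fun x hx ↦ Opens.mem_iSup.mpr ⟨⟨x, hx⟩, hxW x hx⟩) (fun x : U ↦ s x.1 x.2)
    (fun x y ↦ huniq _ _ _ _ (hWU _ _) (hWU _ _) (hs _ _) (hs _ _))
  refine ⟨t, fun W' h' s' hs' ↦ section_ext fun x hx ↦
    ⟨W' ⊓ W x (h' hx), inf_le_left, ⟨hx, hxW x _⟩, ?_⟩⟩
  rw [huniq _ _ _ _ h' (hWU x _) hs' (hs x (h' hx)), mres_mres, ← ht ⟨x, h' hx⟩, mres_mres]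

theorem fun_ext {s t : Γ(X, U)}
    (h : ∀ x ∈ U, ∃ (W : X.Opens) (h : W ≤ U), x ∈ W ∧ fres h s = fres h t) : s = t :=
  section_ext (M := structureSheaf X) h

theorem fun_glue_pred (U : X.Opens) (P : ∀ W : X.Opens, Γ(X, W) → Prop)
    (hex : ∀ x ∈ U, ∃ W : X.Opens, W ≤ U ∧ x ∈ W ∧ ∃ s, P W s)
    (huniq : ∀ (W W' : X.Opens) (s : Γ(X, W)) (s' : Γ(X, W')), W ≤ U → W' ≤ U → P W s → P W' s' →
      fres inf_le_left s = fres (inf_le_right : W ⊓ W' ≤ W') s') :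
    ∃ t : Γ(X, U), ∀ (W : X.Opens) (h : W ≤ U) (s : Γ(X, W)), P W s → fres h t = s :=
  section_glue_pred (M := structureSheaf X) U P hex huniq

end basic

/-! ### Construction of morphisms of modules -/

section hom

variable {X : Scheme.{u}} {A G : X.Modules}

/-- A morphism of modules given by additive maps on sections. -/
def homMk (φ : ∀ U : X.Opens, Γ(A, U) → Γ(G, U))
    (hadd : ∀ U a b, φ U (a + b) = φ U a + φ U b)
    (hsmul : ∀ U (c : Γ(X, U)) a, φ U (c • a) = c • φ U a)
    (hres : ∀ (U V : X.Opens) (h : V ≤ U) a, mres G h (φ U a) = φ V (mres A h a)) : A ⟶ G :=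
  ⟨{ app := fun U ↦ ModuleCat.ofHom (X := A.val.obj U) (Y := G.val.obj U)
        { toFun := φ U.unop
          map_add' := hadd U.unop
          map_smul' := hsmul U.unop }
     naturality := by
      intro U V g
      ext a
      exact (hres U.unop V.unop (leOfHom g.unop) a).symm }⟩

@[simp] theorem homMk_app (φ : ∀ U : X.Opens, Γ(A, U) → Γ(G, U)) (hadd hsmul hres) (U : X.Opens)
    (a : Γ(A, U)) : (homMk φ hadd hsmul hres).app U a = φ U a := rfl

theorem modHom_ext {φ ψ : A ⟶ G} (h : ∀ (U : X.Opens) (a : Γ(A, U)), φ.app U a = ψ.app U a) :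
    φ = ψ := by
  ext U a
  exact h U a

theorem modHom_ext_local {φ ψ : A ⟶ G} (h : ∀ (U : X.Opens) (a : Γ(A, U)), ∀ x ∈ U,
    ∃ (W : X.Opens) (hW : W ≤ U), x ∈ W ∧ φ.app W (mres A hW a) = ψ.app W (mres A hW a)) :
    φ = ψ := by
  refine modHom_ext fun U a ↦ section_ext fun x hx ↦ ?_
  obtain ⟨W, hW, hxW, e⟩ := h U a x hx
  exact ⟨W, hW, hxW, by rw [mres_app, mres_app, e]⟩

/-- A morphism of modules given by a linear relation between sections which is functional, and
locally total. -/
theorem exists_hom_of_relation (P : ∀ U : X.Opens, Γ(A, U) → Γ(G, U) → Prop)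
    (hres : ∀ (U V : X.Opens) (h : V ≤ U) a b, P U a b → P V (mres A h a) (mres G h b))
    (hadd : ∀ (U : X.Opens) a b a' b', P U a b → P U a' b' → P U (a + a') (b + b'))
    (hsmul : ∀ (U : X.Opens) (c : Γ(X, U)) a b, P U a b → P U (c • a) (c • b))
    (hzero : ∀ (U : X.Opens) b, P U 0 b → b = 0)
    (hex : ∀ (U : X.Opens) a, ∀ x ∈ U, ∃ (V : X.Opens) (h : V ≤ U), x ∈ V ∧
      ∃ b, P V (mres A h a) b) :
    ∃ φ : A ⟶ G, ∀ (U : X.Opens) a b, P U a b → φ.app U a = b := by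
  have huniq : ∀ (U : X.Opens) a b b', P U a b → P U a b' → b = b' := by
    intro U a b b' h h'
    have h1 := hadd U _ _ _ _ h (hsmul U (-1) _ _ h')
    rw [neg_one_smul, neg_one_smul, add_neg_cancel] at h1
    exact add_neg_eq_zero.mp (hzero _ _ h1)
  have hglue : ∀ (U : X.Opens) (a : Γ(A, U)), ∃ t : Γ(G, U), ∀ (W : X.Opens) (h : W ≤ U)
      (b : Γ(G, W)), P W (mres A h a) b → mres G h t = b := by
    intro U a
    obtain ⟨t, ht⟩ := section_glue_pred (M := G) U
      (fun W b ↦ ∃ h : W ≤ U, P W (mres A h a) b) (fun x hx ↦ by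
        obtain ⟨V, h, hxV, b, hb⟩ := hex U a x hx
        exact ⟨V, h, hxV, b, h, hb⟩) (by
        rintro W W' b b' _ _ ⟨h, hb⟩ ⟨h', hb'⟩
        have h1 := hres W (W ⊓ W') inf_le_left _ _ hb
        have h2 := hres W' (W ⊓ W') inf_le_right _ _ hb'
        rw [mres_mres] at h1 h2
        exact huniq _ _ _ _ h1 h2)
    exact ⟨t, fun W h b hb ↦ ht W h b ⟨h, hb⟩⟩
  choose φ hφ using hglue
  refine ⟨homMk φ ?_ ?_ ?_, fun U a b h ↦ ?_⟩
  · intro U a b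
    refine section_ext fun x hx ↦ ?_
    obtain ⟨V, h, hxV, c, hc⟩ := hex U a x hx
    obtain ⟨V', h', hxV', c', hc'⟩ := hex U b x hx
    have e1 := hres V (V ⊓ V') inf_le_left _ _ hc
    have e2 := hres V' (V ⊓ V') inf_le_right _ _ hc'
    rw [mres_mres] at e1 e2
    have e3 := hadd _ _ _ _ _ e1 e2
    rw [← map_add] at e3
    exact ⟨V ⊓ V', inf_le_left.trans h, ⟨hxV, hxV'⟩, by
      rw [map_add, hφ _ _ _ _ _ e1, hφ _ _ _ _ _ e2, hφ _ _ _ _ _ e3]⟩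
  · intro U c a
    refine section_ext fun x hx ↦ ?_
    obtain ⟨V, h, hxV, b, hb⟩ := hex U a x hx
    have e1 := hsmul _ (fres h c) _ _ hb
    rw [← mres_smul] at e1
    exact ⟨V, h, hxV, by rw [mres_smul, hφ _ _ _ _ _ e1, hφ _ _ _ _ _ hb]⟩
  · intro U V h a
    refine section_ext fun x hx ↦ ?_
    obtain ⟨W, hW, hxW, b, hb⟩ := hex V (mres A h a) x hx
    refine ⟨W, hW, hxW, ?_⟩
    rw [hφ _ _ _ _ _ hb, mres_mres]
    rw [mres_mres] at hb
    exact hφ _ _ _ _ _ hb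
  · rw [homMk_app, ← hφ U a U le_rfl b (by rwa [mres_self]), mres_self]

/-- A morphism of modules which is locally bijective on sections is an isomorphism. -/
theorem modHom_isIso (φ : A ⟶ G)
    (hinj : ∀ (U : X.Opens) (a : Γ(A, U)), φ.app U a = 0 → ∀ x ∈ U,
      ∃ (W : X.Opens) (h : W ≤ U), x ∈ W ∧ mres A h a = 0)
    (hsurj : ∀ (U : X.Opens) (b : Γ(G, U)), ∀ x ∈ U,
      ∃ (W : X.Opens) (h : W ≤ U), x ∈ W ∧ ∃ a, φ.app W a = mres G h b) : IsIso φ := by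
  have hinj' : ∀ U, Function.Injective (φ.app U) := by
    intro U
    refine (injective_iff_map_eq_zero (φ.app U).hom).mpr fun a ha ↦ section_ext fun x hx ↦ ?_
    obtain ⟨W, h, hxW, e⟩ := hinj U a ha x hx
    exact ⟨W, h, hxW, by rw [e, map_zero]⟩
  rw [Scheme.Modules.Hom.isIso_iff_isIso_app]
  intro U
  rw [ConcreteCategory.isIso_iff_bijective]
  refine ⟨hinj' U, fun b ↦ ?_⟩
  obtain ⟨t, ht⟩ := section_glue_pred (M := A) U
    (fun W a ↦ ∃ h : W ≤ U, φ.app W a = mres G h b) (fun x hx ↦ by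
      obtain ⟨W, h, hxW, a, ha⟩ := hsurj U b x hx
      exact ⟨W, h, hxW, a, h, ha⟩) (by
      rintro W W' a a' _ _ ⟨h, ha⟩ ⟨h', ha'⟩
      apply hinj'
      rw [← mres_app, ← mres_app, ha, ha', mres_mres, mres_mres])
  refine ⟨t, section_ext fun x hx ↦ ?_⟩
  obtain ⟨W, h, hxW, a, ha⟩ := hsurj U b x hx
  exact ⟨W, h, hxW, by rw [mres_app, ht W h a ⟨h, ha⟩, ha]⟩

end hom

/-! ### Local bases -/

section bases

variable {X Y : Scheme.{u}} {F M N : X.Modules} {V W : X.Opens} {ι : Type*} [Fintype ι]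

/-- The sections `e` form a basis of `F` over `V`. -/
def IsBasisOn (F : X.Modules) (V : X.Opens) (e : ι → Γ(F, V)) : Prop :=
  ∀ (W : X.Opens) (h : W ≤ V),
    Function.Bijective (fun c : ι → Γ(X, W) ↦ ∑ i, c i • mres F h (e i))

/-- The section `s` generates `M` freely over `V`. -/
def IsGen (M : X.Modules) (V : X.Opens) (s : Γ(M, V)) : Prop :=
  ∀ (W : X.Opens) (h : W ≤ V), Function.Bijective (fun c : Γ(X, W) ↦ c • mres M h s)

theorem isGen_iff_isBasisOn {s : Γ(M, V)} : IsGen M V s ↔ IsBasisOn M V (fun _ : Unit ↦ s) := by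
  refine forall₂_congr fun W h ↦ ?_
  rw [← Function.Bijective.of_comp_iff (fun c : Γ(X, W) ↦ c • mres M h s)
    (Equiv.funUnique Unit Γ(X, W)).bijective]
  have : (fun c : Unit → Γ(X, W) ↦ ∑ i, c i • mres M h s) =
      ((fun c : Γ(X, W) ↦ c • mres M h s) ∘ (Equiv.funUnique Unit Γ(X, W))) := by
    funext c
    simp
  rw [this]

theorem IsBasisOn.mono {e : ι → Γ(F, V)} (he : IsBasisOn F V e) (h : W ≤ V) :
    IsBasisOn F W (fun i ↦ mres F h (e i)) := by
  intro W' h'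
  simp only [mres_mres]
  exact he W' (h'.trans h)

theorem IsGen.mono {s : Γ(M, V)} (hs : IsGen M V s) (h : W ≤ V) : IsGen M W (mres M h s) := by
  intro W' h'
  simp only [mres_mres]
  exact hs W' (h'.trans h)

theorem IsBasisOn.exists_repr {e : ι → Γ(F, V)} (he : IsBasisOn F V e) (h : W ≤ V)
    (s : Γ(F, W)) : ∃ c : ι → Γ(X, W), s = ∑ i, c i • mres F h (e i) := by
  obtain ⟨c, hc⟩ := (he W h).2 s
  exact ⟨c, hc.symm⟩

theorem IsBasisOn.repr_ext {e : ι → Γ(F, V)} (he : IsBasisOn F V e) (h : W ≤ V)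
    {c c' : ι → Γ(X, W)} (h' : ∑ i, c i • mres F h (e i) = ∑ i, c' i • mres F h (e i)) : c = c' :=
  (he W h).1 h'

theorem IsBasisOn.repr_eq_zero {e : ι → Γ(F, V)} (he : IsBasisOn F V e) (h : W ≤ V)
    {c : ι → Γ(X, W)} (h' : ∑ i, c i • mres F h (e i) = 0) (i : ι) : c i = 0 := by
  have : c = 0 := he.repr_ext h (by simp [h'])
  rw [this]; rfl

theorem IsGen.exists_smul {s : Γ(M, V)} (hs : IsGen M V s) (h : W ≤ V) (m : Γ(M, W)) :
    ∃ c : Γ(X, W), m = c • mres M h s := by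
  obtain ⟨c, hc⟩ := (hs W h).2 m
  exact ⟨c, hc.symm⟩

theorem IsGen.smul_ext {s : Γ(M, V)} (hs : IsGen M V s) (h : W ≤ V) {c c' : Γ(X, W)}
    (h' : c • mres M h s = c' • mres M h s) : c = c' := (hs W h).1 h'

theorem IsGen.eq_zero_of_smul {s : Γ(M, V)} (hs : IsGen M V s) (h : W ≤ V) {c : Γ(X, W)}
    (h' : c • mres M h s = 0) : c = 0 := hs.smul_ext h (by rw [h', zero_smul])

theorem mres_sum_smul (h : W ≤ V) (c : ι → Γ(X, V)) (e : ι → Γ(F, V)) :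
    mres F h (∑ i, c i • e i) = ∑ i, fres h (c i) • mres F h (e i) := by
  rw [map_sum]
  simp

/-- Local criterion for bases. -/
theorem isBasisOn_of_local {e : ι → Γ(F, V)}
    (hinj : ∀ (W : X.Opens) (h : W ≤ V) (c : ι → Γ(X, W)), ∑ i, c i • mres F h (e i) = 0 →
      ∀ x ∈ W, ∃ (W' : X.Opens) (h' : W' ≤ W), x ∈ W' ∧ ∀ i, fres h' (c i) = 0)
    (hsurj : ∀ (W : X.Opens) (_ : W ≤ V) (s : Γ(F, W)), ∀ x ∈ W,
      ∃ (W' : X.Opens) (h' : W' ≤ W) (h'' : W' ≤ V), x ∈ W' ∧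
        ∃ c : ι → Γ(X, W'), mres F h' s = ∑ i, c i • mres F h'' (e i)) :
    IsBasisOn F V e := by
  have hinj' : ∀ (W : X.Opens) (h : W ≤ V) (c : ι → Γ(X, W)),
      ∑ i, c i • mres F h (e i) = 0 → c = 0 := by
    intro W h c hc
    funext i
    refine fun_ext fun x hx ↦ ?_
    obtain ⟨W', h', hxW', e'⟩ := hinj W h c hc x hx
    exact ⟨W', h', hxW', by rw [e' i]; simp⟩
  have hinj'' : ∀ (W : X.Opens) (h : W ≤ V) (c c' : ι → Γ(X, W)),
      ∑ i, c i • mres F h (e i) = ∑ i, c' i • mres F h (e i) → c = c' := by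
    intro W h c c' hc
    rw [← sub_eq_zero]
    refine hinj' W h _ ?_
    simp only [Pi.sub_apply, sub_smul, Finset.sum_sub_distrib, hc, sub_self]
  intro W h
  refine ⟨fun c c' hc ↦ hinj'' W h c c' hc, fun s ↦ ?_⟩
  have key : ∀ i, ∃ t : Γ(X, W), ∀ (W' : X.Opens) (h' : W' ≤ W) (a : Γ(X, W')),
      (∃ c : ι → Γ(X, W'), mres F h' s = ∑ i, c i • mres F (h'.trans h) (e i) ∧ c i = a) →
        fres h' t = a := by
    intro i
    obtain ⟨t, ht⟩ := fun_glue_pred W (fun W' a ↦ ∃ (h' : W' ≤ W) (c : ι → Γ(X, W')),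
      mres F h' s = ∑ i, c i • mres F (h'.trans h) (e i) ∧ c i = a) (fun x hx ↦ by
        obtain ⟨W', h', h'', hxW', c, hc⟩ := hsurj W h s x hx
        exact ⟨W', h', hxW', c i, h', c, hc, rfl⟩) (by
        rintro W' W'' _ _ _ _ ⟨h', c, hc, rfl⟩ ⟨h'', c', hc', rfl⟩
        have e1 := congrArg (mres F (inf_le_left : W' ⊓ W'' ≤ W')) hc
        have e2 := congrArg (mres F (inf_le_right : W' ⊓ W'' ≤ W'')) hc'
        rw [mres_sum_smul, mres_mres] at e1 e2
        simp only [mres_mres] at e1 e2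
        exact congrFun (hinj'' _ _ _ _ (e1.symm.trans e2)) i)
    exact ⟨t, fun W' h' a ⟨c, hc⟩ ↦ ht W' h' a ⟨h', c, hc⟩⟩
  choose t ht using key
  refine ⟨t, section_ext fun x hx ↦ ?_⟩
  obtain ⟨W', h', h'', hxW', c, hc⟩ := hsurj W h s x hx
  refine ⟨W', h', hxW', ?_⟩
  rw [hc]
  dsimp only
  rw [mres_sum_smul]
  simp only [mres_mres]
  exact Finset.sum_congr rfl fun i _ ↦ by rw [ht i W' h' (c i) ⟨c, hc, rfl⟩]

theorem IsBasisOn.of_cover {e : ι → Γ(F, V)}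
    (h : ∀ x ∈ V, ∃ (W : X.Opens) (h : W ≤ V), x ∈ W ∧ IsBasisOn F W (fun i ↦ mres F h (e i))) :
    IsBasisOn F V e := by
  refine isBasisOn_of_local (fun W hW c hc x hx ↦ ?_) (fun W hW s x hx ↦ ?_)
  · obtain ⟨W', h', hxW', he⟩ := h x (hW hx)
    refine ⟨W ⊓ W', inf_le_left, ⟨hx, hxW'⟩, fun i ↦ ?_⟩
    refine he.repr_eq_zero (W := W ⊓ W') inf_le_right (c := fun i ↦ fres inf_le_left (c i)) ?_ i
    have := congrArg (mres F (inf_le_left : W ⊓ W' ≤ W)) hc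
    rw [mres_sum_smul, map_zero] at this
    simpa using this
  · obtain ⟨W', h', hxW', he⟩ := h x (hW hx)
    obtain ⟨c, hc⟩ := he.exists_repr (W := W ⊓ W') inf_le_right (mres F inf_le_left s)
    exact ⟨W ⊓ W', inf_le_left, inf_le_left.trans hW, ⟨hx, hxW'⟩, c, by simpa using hc⟩

theorem IsGen.of_cover {s : Γ(M, V)}
    (h : ∀ x ∈ V, ∃ (W : X.Opens) (h : W ≤ V), x ∈ W ∧ IsGen M W (mres M h s)) :
    IsGen M V s := by
  rw [isGen_iff_isBasisOn]
  refine IsBasisOn.of_cover fun x hx ↦ ?_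
  obtain ⟨W, hW, hxW, h1⟩ := h x hx
  exact ⟨W, hW, hxW, isGen_iff_isBasisOn.mp h1⟩

theorem IsGen.unit_smul {s : Γ(M, V)} (hs : IsGen M V s) {c : Γ(X, V)} (hc : IsUnit c) :
    IsGen M V (c • s) := by
  intro W h
  obtain ⟨u, hu⟩ := hc.map (fres h)
  have : (fun a : Γ(X, W) ↦ a • mres M h (c • s)) =
      (fun a : Γ(X, W) ↦ a • mres M h s) ∘ (fun a ↦ a * u) := by
    funext a
    simp [← hu, mul_smul]
  rw [this]
  exact (hs W h).comp u.mulRight_bijective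

theorem IsGen.isUnit_of_isGen_smul {s : Γ(M, V)} (hs : IsGen M V s) {c : Γ(X, V)}
    (hc : IsGen M V (c • s)) : IsUnit c := by
  obtain ⟨d, hd⟩ := hc.exists_smul le_rfl s
  rw [mres_self, smul_smul] at hd
  have : d * c = 1 := hs.smul_ext le_rfl (by rw [mres_self, ← hd, one_smul])
  exact IsUnit.of_mul_eq_one_right _ this

theorem isGen_one : IsGen (structureSheaf X) V (1 : Γ(X, V)) := by
  intro W h
  have : (fun c : Γ(X, W) ↦ c • mres (structureSheaf X) h (1 : Γ(X, V))) = id := by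
    funext c
    change c * fres h 1 = c
    simp
  rw [this]
  exact Function.bijective_id

/-- A morphism which maps a generator to a generator is bijective on sections. -/
theorem bijective_app_of_isGen (φ : M ⟶ N) {s : Γ(M, V)} (hs : IsGen M V s)
    (hs' : IsGen N V (φ.app V s)) (h : W ≤ V) : Function.Bijective (φ.app W) := by
  have : (fun c : Γ(X, W) ↦ c • mres N h (φ.app V s)) =
      φ.app W ∘ (fun c : Γ(X, W) ↦ c • mres M h s) := by
    funext c
    simp [mres_app]
  have h1 := hs' W h
  rw [this] at h1
  exact (Function.Bijective.of_comp_iff _ (hs W h)).mp h1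

theorem isIso_of_isGen (φ : M ⟶ N) (h : ∀ x : X, ∃ (V : X.Opens) (s : Γ(M, V)), x ∈ V ∧
    IsGen M V s ∧ IsGen N V (φ.app V s)) : IsIso φ := by
  refine modHom_isIso φ (fun U a ha x hx ↦ ?_) (fun U b x hx ↦ ?_)
  · obtain ⟨V, s, hxV, h1, h2⟩ := h x
    refine ⟨U ⊓ V, inf_le_left, ⟨hx, hxV⟩, ?_⟩
    refine (bijective_app_of_isGen φ h1 h2 inf_le_right).1 ?_
    rw [← mres_app, ha, map_zero, map_zero]
  · obtain ⟨V, s, hxV, h1, h2⟩ := h x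
    refine ⟨U ⊓ V, inf_le_left, ⟨hx, hxV⟩, ?_⟩
    exact (bijective_app_of_isGen φ h1 h2 inf_le_right).2 _

theorem isIso_of_isBasisOn (φ : M ⟶ N) (h : ∀ x : X, ∃ (V : X.Opens) (κ : Type) (_ : Fintype κ)
    (s : κ → Γ(M, V)), x ∈ V ∧
    IsBasisOn M V s ∧ IsBasisOn N V (fun i ↦ φ.app V (s i))) : IsIso φ := by
  have key : ∀ (V : X.Opens) (κ : Type) (_ : Fintype κ)
    (s : κ → Γ(M, V)), IsBasisOn M V s → IsBasisOn N V (fun i ↦ φ.app V (s i)) →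
      ∀ (W : X.Opens) (_ : W ≤ V), Function.Bijective (φ.app W) := by
    intro V κ _ s h1 h2 W h
    have : (fun c : κ → Γ(X, W) ↦ ∑ i, c i • mres N h (φ.app V (s i))) =
        φ.app W ∘ (fun c : κ → Γ(X, W) ↦ ∑ i, c i • mres M h (s i)) := by
      funext c
      simp [mres_app]
    have h3 := h2 W h
    rw [this] at h3
    exact (Function.Bijective.of_comp_iff _ (h1 W h)).mp h3
  refine modHom_isIso φ (fun U a ha x hx ↦ ?_) (fun U b x hx ↦ ?_)
  · obtain ⟨V, κ, _, s, hxV, h1, h2⟩ := h x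
    refine ⟨U ⊓ V, inf_le_left, ⟨hx, hxV⟩, (key V κ _ s h1 h2 _ inf_le_right).1 ?_⟩
    rw [← mres_app, ha, map_zero, map_zero]
  · obtain ⟨V, κ, _, s, hxV, h1, h2⟩ := h x
    exact ⟨U ⊓ V, inf_le_left, ⟨hx, hxV⟩, (key V κ _ s h1 h2 _ inf_le_right).2 _⟩

end bases

/-! ### Sections of the pullback -/

section pullback

variable {X Y Z : Scheme.{u}} (f : X ⟶ Y) {F F' : Y.Modules} {M N : X.Modules}

/-- The pullback of a section over `V`, as a section over the inverse image of `V`. -/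
def spullTop (F : Y.Modules) (V : Y.Opens) :
    Γ(F, V) →+ Γ((Scheme.Modules.pullback f).obj F, f ⁻¹ᵁ V) :=
  (((Scheme.Modules.pullbackPushforwardAdjunction f).unit.app F).app V).hom

/-- The pullback of a section. -/
def spull (F : Y.Modules) {V : Y.Opens} {W : X.Opens} (e : W ≤ f ⁻¹ᵁ V) (s : Γ(F, V)) :
    Γ((Scheme.Modules.pullback f).obj F, W) :=
  mres _ e (spullTop f F V s)

variable {f} {V V' : Y.Opens} {W W' : X.Opens}

@[simp] theorem mres_spull (e : W ≤ f ⁻¹ᵁ V) (h : W' ≤ W) (s : Γ(F, V)) :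
    mres _ h (spull f F e s) = spull f F (h.trans e) s := by
  rw [spull, spull, mres_mres]

@[simp] theorem spull_mres (h : V' ≤ V) (e : W ≤ f ⁻¹ᵁ V') (s : Γ(F, V)) :
    spull f F e (mres F h s) = spull f F (e.trans (f.preimage_mono h)) s := by
  have h1 : spullTop f F V' (mres F h s) = mres _ (f.preimage_mono h) (spullTop f F V s) :=
    (mres_app ((Scheme.Modules.pullbackPushforwardAdjunction f).unit.app F) h s).symm
  rw [spull, spull, h1, mres_mres]

theorem spull_add (e : W ≤ f ⁻¹ᵁ V) (s s' : Γ(F, V)) :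
    spull f F e (s + s') = spull f F e s + spull f F e s' := by
  simp only [spull, map_add]

theorem spull_zero (e : W ≤ f ⁻¹ᵁ V) :
    spull f F e 0 = 0 := by
  simp only [spull, map_zero]

theorem spull_smul (e : W ≤ f ⁻¹ᵁ V) (a : Γ(Y, V)) (s : Γ(F, V)) :
    spull f F e (a • s) = fpull f e a • spull f F e s := by
  have h1 : spullTop f F V (a • s) = f.app V a • spullTop f F V s :=
    Scheme.Modules.Hom.app_smul ((Scheme.Modules.pullbackPushforwardAdjunction f).unit.app F) a s
  rw [spull, h1, mres_smul, app_eq_fpull, fres_fpull]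
  rfl

theorem spull_sum {ι : Type*} [Fintype ι] (e : W ≤ f ⁻¹ᵁ V) (c : ι → Γ(Y, V)) (s : ι → Γ(F, V)) :
    spull f F e (∑ i, c i • s i) = ∑ i, fpull f e (c i) • spull f F e (s i) := by
  have h : ∀ t : Finset ι, spull f F e (∑ i ∈ t, c i • s i) =
      ∑ i ∈ t, fpull f e (c i) • spull f F e (s i) := by
    classical
    intro t
    induction t using Finset.induction_on with
    | empty => simp [spull_zero]
    | insert a t ha ih => rw [Finset.sum_insert ha, Finset.sum_insert ha, spull_add, ih, spull_smul]
  exact h _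

@[simp] theorem pullback_map_spull (φ : F ⟶ F') (e : W ≤ f ⁻¹ᵁ V) (s : Γ(F, V)) :
    ((Scheme.Modules.pullback f).map φ).app W (spull f F e s) = spull f F' e (φ.app V s) := by
  rw [spull, spull, ← mres_app]
  congr 1
  exact (ConcreteCategory.congr_hom (congrArg (fun t ↦ Scheme.Modules.Hom.app t V)
    ((Scheme.Modules.pullbackPushforwardAdjunction f).unit.naturality φ)) s).symm

theorem homEquiv_symm_spull (φ : F ⟶ (Scheme.Modules.pushforward f).obj M)
    (e : W ≤ f ⁻¹ᵁ V) (s : Γ(F, V)) :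
    (((Scheme.Modules.pullbackPushforwardAdjunction f).homEquiv _ _).symm φ).app W
      (spull f F e s) = mres M e (φ.app V s) := by
  rw [spull, ← mres_app]
  congr 1
  have h := ((Scheme.Modules.pullbackPushforwardAdjunction f).homEquiv _ _).apply_symm_apply φ
  rw [Adjunction.homEquiv_unit] at h
  exact ConcreteCategory.congr_hom (congrArg (fun t ↦ Scheme.Modules.Hom.app t V) h) s

theorem pullback_hom_ext {r r' : (Scheme.Modules.pullback f).obj F ⟶ M}
    (h : ∀ (V : Y.Opens) (s : Γ(F, V)),
      r.app _ (spull f F (le_refl (f ⁻¹ᵁ V)) s) = r'.app _ (spull f F (le_refl (f ⁻¹ᵁ V)) s)) :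
    r = r' := by
  apply ((Scheme.Modules.pullbackPushforwardAdjunction f).homEquiv _ _).injective
  rw [Adjunction.homEquiv_unit, Adjunction.homEquiv_unit]
  refine modHom_ext fun V s ↦ ?_
  have := h V s
  simp only [spull, mres_self] at this
  exact this

theorem pullback_hom_ext_local {r r' : (Scheme.Modules.pullback f).obj F ⟶ M}
    (h : ∀ (V : Y.Opens) (s : Γ(F, V)), ∀ x ∈ f ⁻¹ᵁ V,
      ∃ (W : X.Opens) (hW : W ≤ f ⁻¹ᵁ V), x ∈ W ∧
        r.app _ (spull f F hW s) = r'.app _ (spull f F hW s)) :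
    r = r' := by
  refine pullback_hom_ext fun V s ↦ section_ext fun x hx ↦ ?_
  obtain ⟨W, hW, hxW, e⟩ := h V s x hx
  exact ⟨W, hW, hxW, by rw [mres_app, mres_app, mres_spull, e]⟩

theorem pullbackComp_inv_spull (g : Y ⟶ Z) {G : Z.Modules} {V : Z.Opens} {W : X.Opens}
    (e : W ≤ (f ≫ g) ⁻¹ᵁ V) (s : Γ(G, V)) :
    ((Scheme.Modules.pullbackComp f g).inv.app G).app W (spull (f ≫ g) G e s) =
      spull f _ (V := g ⁻¹ᵁ V) e (spull g G le_rfl s) := by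
  have h := Scheme.Modules.conjugateEquiv_pullbackComp_inv f g
  have h1 := unit_conjugateEquiv ((Scheme.Modules.pullbackPushforwardAdjunction g).comp
    (Scheme.Modules.pullbackPushforwardAdjunction f))
      (Scheme.Modules.pullbackPushforwardAdjunction (f ≫ g)) (Scheme.Modules.pullbackComp f g).inv G
  rw [h] at h1
  have h2 := ConcreteCategory.congr_hom (congrArg (fun t ↦ Scheme.Modules.Hom.app t V) h1) s
  rw [spull, ← mres_app]
  refine congrArg (mres _ e) (h2.symm.trans ?_)
  rw [spull, mres_self]
  rfl

theorem pullbackComp_hom_spull (g : Y ⟶ Z) {G : Z.Modules} {V : Z.Opens} {V' : Y.Opens}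
    {W : X.Opens} (e : V' ≤ g ⁻¹ᵁ V) (e' : W ≤ f ⁻¹ᵁ V') (s : Γ(G, V)) :
    ((Scheme.Modules.pullbackComp f g).hom.app G).app W (spull f _ e' (spull g G e s)) =
      spull (f ≫ g) G (e'.trans (f.preimage_mono e)) s := by
  have h := pullbackComp_inv_spull (f := f) g (e'.trans (f.preimage_mono e)) s
  have h2 : spull f ((Scheme.Modules.pullback g).obj G) e' (spull g G e s) =
      spull f _ (e'.trans (f.preimage_mono e)) (spull g G (le_refl (g ⁻¹ᵁ V)) s) := by
    rw [← mres_spull (le_refl (g ⁻¹ᵁ V)) e, spull_mres]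
  rw [h2]
  refine (congrArg _ h.symm).trans ?_
  have h3 := congrArg (fun t ↦ Scheme.Modules.Hom.app t W)
    ((Scheme.Modules.pullbackComp f g).inv_hom_id_app G)
  exact ConcreteCategory.congr_hom h3 _

theorem pullbackCongr_hom_spull {g : X ⟶ Y} (h : f = g) (e : W ≤ f ⁻¹ᵁ V) (s : Γ(F, V)) :
    ((Scheme.Modules.pullbackCongr h).hom.app F).app W (spull f F e s) =
      spull g F (h ▸ e) s := by
  subst h
  rfl

theorem pullback_hom_zero_iff {r : (Scheme.Modules.pullback f).obj F ⟶ M} :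
    r = 0 ↔ ∀ (V : Y.Opens) (s : Γ(F, V)), r.app _ (spull f F (le_refl (f ⁻¹ᵁ V)) s) = 0 :=
  ⟨fun h V s ↦ by rw [h]; rfl, fun h ↦ pullback_hom_ext fun V s ↦ (h V s).trans rfl⟩

end pullback

section identifications

variable {X Y : Scheme.{u}}

/-- Sections of the structure sheaf are functions. -/
def unitSec (U : X.Opens) : Γ(structureSheaf X, U) ≃+ Γ(X, U) := AddEquiv.refl _

@[simp] theorem unitSec_smul {U : X.Opens} (c : Γ(X, U)) (b : Γ(structureSheaf X, U)) :
    unitSec U (c • b) = c * unitSec U b := rfl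

@[simp] theorem unitSec_res {U W : X.Opens} (h : W ≤ U) (b : Γ(structureSheaf X, U)) :
    unitSec W (mres _ h b) = fres h (unitSec U b) := rfl

/-- Sections of the pushforward. -/
def pushSec (f : X ⟶ Y) (M : X.Modules) (V : Y.Opens) :
    Γ((Scheme.Modules.pushforward f).obj M, V) ≃+ Γ(M, f ⁻¹ᵁ V) := AddEquiv.refl _

@[simp] theorem pushSec_smul {f : X ⟶ Y} {M : X.Modules} {V : Y.Opens} (c : Γ(Y, V))
    (b : Γ((Scheme.Modules.pushforward f).obj M, V)) :
    pushSec f M V (c • b) = fpull f le_rfl c • pushSec f M V b := by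
  rw [← app_eq_fpull]; rfl

@[simp] theorem pushSec_res {f : X ⟶ Y} {M : X.Modules} {V W : Y.Opens} (h : W ≤ V)
    (b : Γ((Scheme.Modules.pushforward f).obj M, V)) :
    pushSec f M W (mres _ h b) = mres M (f.preimage_mono h) (pushSec f M V b) := rfl

/-- A morphism from a pullback, given by a linear relation which is functional, and locally
total. -/
theorem exists_pullbackHom_of_relation {f : X ⟶ Y} {F : Y.Modules} {M : X.Modules}
    (P : ∀ U : Y.Opens, Γ(F, U) → Γ(M, f ⁻¹ᵁ U) → Prop)
    (hres : ∀ (U V : Y.Opens) (h : V ≤ U) a b, P U a b →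
      P V (mres F h a) (mres M (f.preimage_mono h) b))
    (hadd : ∀ (U : Y.Opens) a b a' b', P U a b → P U a' b' → P U (a + a') (b + b'))
    (hsmul : ∀ (U : Y.Opens) (c : Γ(Y, U)) a b, P U a b → P U (c • a) (fpull f le_rfl c • b))
    (hzero : ∀ (U : Y.Opens) b, P U 0 b → b = 0)
    (hex : ∀ (U : Y.Opens) a, ∀ x ∈ U, ∃ (V : Y.Opens) (h : V ≤ U), x ∈ V ∧
      ∃ b, P V (mres F h a) b) :
    ∃ r : (Scheme.Modules.pullback f).obj F ⟶ M, ∀ (U : Y.Opens) a b, P U a b →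
      r.app _ (spull f F le_rfl a) = b := by
  obtain ⟨φ, hφ⟩ := exists_hom_of_relation (A := F) (G := (Scheme.Modules.pushforward f).obj M)
    (fun U a b ↦ P U a (pushSec f M U b)) (fun U V h a b ↦ hres U V h a _)
    (fun U a b a' b' ↦ hadd U a _ a' _)
    (fun U c a b h ↦ (pushSec_smul c b).symm ▸ hsmul U c a _ h) (fun U b ↦ hzero U _)
    (fun U a x hx ↦ hex U a x hx)
  refine ⟨((Scheme.Modules.pullbackPushforwardAdjunction f).homEquiv _ _).symm φ,
    fun U s b hb ↦ ?_⟩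
  exact (homEquiv_symm_spull φ le_rfl s).trans ((mres_self M le_rfl _).trans (hφ U s b hb))

/-- The open `U ∩ W`, in the form that occurs in the sections of `awayFrom`. -/
abbrev away (U W : X.Opens) : X.Opens := U.ι ''ᵁ (U.ι ⁻¹ᵁ W)

/-- Functions on an open subscheme. -/
def openSec (U : X.Opens) (W : U.toScheme.Opens) : Γ(U.toScheme, W) ≃+* Γ(X, U.ι ''ᵁ W) :=
  RingEquiv.refl _

/-- Sections of the restriction to an open subscheme. -/
def restrictSec (M : X.Modules) (U : X.Opens) (W : U.toScheme.Opens) :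
    Γ(M.restrict U.ι, W) ≃+ Γ(M, U.ι ''ᵁ W) := AddEquiv.refl _

@[simp] theorem restrictSec_smul {M : X.Modules} {U : X.Opens} {W : U.toScheme.Opens}
    (c : Γ(U.toScheme, W)) (b : Γ(M.restrict U.ι, W)) :
    restrictSec M U W (c • b) = openSec U W c • restrictSec M U W b := by
  have h : restrictSec M U W (c • b) = (U.ι.appIso _).inv c • restrictSec M U W b := rfl
  rw [h, Scheme.Opens.ι_appIso]
  rfl

@[simp] theorem restrictSec_res {M : X.Modules} {U : X.Opens} {W W' : U.toScheme.Opens}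
    (h : W' ≤ W) (b : Γ(M.restrict U.ι, W)) :
    restrictSec M U W' (mres _ h b) = mres M (U.ι.image_mono h) (restrictSec M U W b) := rfl

@[simp] theorem openSec_res {U : X.Opens} {W W' : U.toScheme.Opens}
    (h : W' ≤ W) (b : Γ(U.toScheme, W)) :
    openSec U W' (fres h b) = fres (U.ι.image_mono h) (openSec U W b) := rfl

variable (M : X.Modules) (U : X.Opens)

theorem away_le (W : X.Opens) : away U W ≤ W := U.ι.image_preimage_le W

theorem away_eq (W : X.Opens) : away U W = U ⊓ W := by
  ext x
  constructor
  · rintro ⟨y, hy, rfl⟩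
    exact ⟨y.2, hy⟩
  · rintro ⟨h1, h2⟩
    exact ⟨⟨x, h1⟩, h2, rfl⟩

theorem away_le_left (W : X.Opens) : away U W ≤ U := by
  rw [away_eq]; exact inf_le_left

theorem away_mono {W W' : X.Opens} (h : W ≤ W') : away U W ≤ away U W' := by
  rw [away_eq, away_eq]; exact inf_le_inf_left _ h

theorem mem_away {W : X.Opens} {x : X} : x ∈ away U W ↔ x ∈ U ∧ x ∈ W := by
  rw [away_eq]; rfl

/-- Sections of `awayFrom`. -/
def awaySec (W : X.Opens) : Γ(awayFrom M U, W) ≃+ Γ(M, away U W) := AddEquiv.refl _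

variable {M U}

@[simp] theorem awaySec_smul {W : X.Opens} (c : Γ(X, W)) (b : Γ(awayFrom M U, W)) :
    awaySec M U W (c • b) = fres (away_le U W) c • awaySec M U W b := by
  have h : awaySec M U W (c • b) = (U.ι.appIso _).inv (U.ι.app W c) • awaySec M U W b := rfl
  rw [h, Scheme.Opens.ι_appIso, Scheme.Opens.ι_app]
  rfl

@[simp] theorem awaySec_res {W W' : X.Opens} (h : W' ≤ W) (b : Γ(awayFrom M U, W)) :
    awaySec M U W' (mres (awayFrom M U) h b) = mres M (away_mono U h) (awaySec M U W b) := rfl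

@[simp] theorem awaySec_toAwayFrom {W : X.Opens} (b : Γ(M, W)) :
    awaySec M U W ((toAwayFrom M U).app W b) = mres M (away_le U W) b := rfl

end identifications

section pullbackBasis

variable {X Y : Scheme.{u}} {F : Y.Modules} {V : Y.Opens} {ι : Type*} [Fintype ι]

theorem away_preimage_le (f : X ⟶ Y) (U V : Y.Opens) :
    away (f ⁻¹ᵁ V) (f ⁻¹ᵁ U) ≤ f ⁻¹ᵁ (U ⊓ V) := fun _ hx ↦
  ⟨((mem_away _).mp hx).2, ((mem_away _).mp hx).1⟩

theorem IsBasisOn.exists_coord {e : ι → Γ(F, V)} (he : IsBasisOn F V e) (f : X ⟶ Y) (i : ι) :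
    ∃ lam : (Scheme.Modules.pullback f).obj F ⟶ awayFrom (structureSheaf X) (f ⁻¹ᵁ V),
      ∀ (U : Y.Opens) (s : Γ(F, U)) (c : ι → Γ(Y, U ⊓ V)),
        mres F inf_le_left s = ∑ j, c j • mres F inf_le_right (e j) →
          unitSec _ (awaySec _ _ _ (lam.app (f ⁻¹ᵁ U) (spull f F le_rfl s))) =
            fpull f (away_preimage_le f U V) (c i) := by
  refine (exists_pullbackHom_of_relation (f := f) (F := F)
    (M := awayFrom (structureSheaf X) (f ⁻¹ᵁ V))
    (fun U s b ↦ ∃ c : ι → Γ(Y, U ⊓ V),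
      mres F inf_le_left s = ∑ j, c j • mres F inf_le_right (e j) ∧
        unitSec _ (awaySec _ _ _ b) = fpull f (away_preimage_le f U V) (c i)) ?_ ?_ ?_ ?_ ?_).imp fun φ hφ U s c hc ↦ ?_
  · rintro U U' h a b ⟨c, hc, hb⟩
    refine ⟨fun j ↦ fres (inf_le_inf_right V h) (c j), ?_, ?_⟩
    · have := congrArg (mres F (inf_le_inf_right V h)) hc
      rw [mres_sum_smul] at this
      simpa using this
    · simp [hb]
  · rintro U a b a' b' ⟨c, hc, hb⟩ ⟨c', hc', hb'⟩
    refine ⟨c + c', ?_, ?_⟩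
    · rw [map_add, hc, hc', ← Finset.sum_add_distrib]
      simp [add_smul]
    · simp [hb, hb']
  · rintro U d a b ⟨c, hc, hb⟩
    refine ⟨fun j ↦ fres inf_le_left d * c j, ?_, ?_⟩
    · rw [mres_smul, hc, Finset.smul_sum]
      simp [mul_smul]
    · simp [hb]
  · rintro U b ⟨c, hc, hb⟩
    have h0 := he.repr_eq_zero inf_le_right (hc.symm.trans (map_zero _)) i
    rw [h0, map_zero] at hb
    simpa using hb
  · intro U a x hx
    obtain ⟨c, hc⟩ := he.exists_repr (W := U ⊓ V) inf_le_right (mres F inf_le_left a)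
    exact ⟨U, le_rfl, hx, (awaySec _ _ _).symm
      ((unitSec _).symm (fpull f (away_preimage_le f U V) (c i))), c, by simpa using hc, by simp⟩
  · rw [hφ U s ((awaySec _ _ _).symm
      ((unitSec _).symm (fpull f (away_preimage_le f U V) (c i)))) ⟨c, hc, by simp⟩]
    simp

theorem hom_sum_app {A G : X.Modules} (φ : ι → (A ⟶ G)) (W : X.Opens) (s : Γ(A, W)) :
    (∑ i, φ i).app W s = ∑ i, (φ i).app W s := by
  classical
  have h : ∀ t : Finset ι, (∑ i ∈ t, φ i).app W s = ∑ i ∈ t, (φ i).app W s := by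
    intro t
    induction t using Finset.induction_on with
    | empty => simp
    | insert a t ha ih =>
      rw [Finset.sum_insert ha, Finset.sum_insert ha, ← ih]
      rfl
  exact h _

/-- A criterion for a basis of sections of a pullback, by means of the dual basis. -/
theorem isBasisOn_of_dual {f : X ⟶ Y} {W₀ : X.Opens}
    {b : ι → Γ((Scheme.Modules.pullback f).obj F, W₀)}
    (lam : ι → ((Scheme.Modules.pullback f).obj F ⟶ awayFrom (structureSheaf X) W₀))
    (hb : ∀ i, unitSec _ (awaySec _ _ _ ((lam i).app W₀ (b i))) = 1)
    (hb' : ∀ i j, j ≠ i → unitSec _ (awaySec _ _ _ ((lam i).app W₀ (b j))) = 0)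
    (h : ∀ (U : Y.Opens) (s : Γ(F, U)),
      mres _ (away_le W₀ (f ⁻¹ᵁ U)) (spull f F le_rfl s) =
        ∑ i, unitSec _ (awaySec _ _ _ ((lam i).app (f ⁻¹ᵁ U) (spull f F le_rfl s))) •
          mres _ (away_le_left W₀ (f ⁻¹ᵁ U)) (b i)) :
    IsBasisOn ((Scheme.Modules.pullback f).obj F) W₀ b := by
  refine isBasisOn_of_local (fun W hW c hc x hx ↦ ?_) (fun W hW s x hx ↦ ?_)
  · refine ⟨away W₀ W, away_le W₀ W, (mem_away W₀).mpr ⟨hW hx, hx⟩, fun i ↦ ?_⟩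
    have h1 := congrArg (fun s ↦ unitSec _ (awaySec _ _ _ ((lam i).app W s))) hc
    simp only [map_zero, map_sum, Scheme.Modules.Hom.app_smul, ← mres_app, awaySec_smul,
      unitSec_smul, awaySec_res, unitSec_res] at h1
    rw [← h1, Finset.sum_eq_single i]
    · erw [hb]
      simp
    · intro j _ hj
      erw [hb' i j hj]
      simp
    · simp
  · let mu (i : ι) : awayFrom (structureSheaf X) W₀ ⟶
        awayFrom ((Scheme.Modules.pullback f).obj F) W₀ :=
      homMk (fun U a ↦ (awaySec _ _ _).symm (unitSec _ (awaySec _ _ _ a) •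
          mres _ (away_le_left W₀ U) (b i)))
        (fun U a b ↦ by simp [add_smul])
        (fun U c a ↦ by
          apply (awaySec _ _ _).injective
          simp [mul_smul])
        (fun U V h a ↦ by
          apply (awaySec _ _ _).injective
          simp)
    have hmu : ∀ i W s, awaySec _ _ _ ((lam i ≫ mu i).app W s) =
        unitSec _ (awaySec _ _ _ ((lam i).app W s)) • mres _ (away_le_left W₀ W) (b i) := by
      intro i W s
      rfl
    have key : toAwayFrom ((Scheme.Modules.pullback f).obj F) W₀ = ∑ i, lam i ≫ mu i := by
      refine pullback_hom_ext fun U s ↦ ?_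
      apply (awaySec _ _ _).injective
      rw [hom_sum_app, awaySec_toAwayFrom, map_sum]
      simp only [hmu]
      exact h U s
    have h1 := congrArg (fun t ↦ awaySec _ _ _ (Scheme.Modules.Hom.app t W s)) key
    simp only [hom_sum_app, awaySec_toAwayFrom, map_sum, hmu] at h1
    refine ⟨away W₀ W, away_le W₀ W, away_le_left W₀ W, (mem_away W₀).mpr ⟨hW hx, hx⟩,
      fun i ↦ unitSec _ (awaySec _ _ _ ((lam i).app W s)), ?_⟩
    simpa using h1

/-- The pullback of a basis is a basis. -/
theorem IsBasisOn.pullback {e : ι → Γ(F, V)} (he : IsBasisOn F V e) (f : X ⟶ Y) :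
    IsBasisOn ((Scheme.Modules.pullback f).obj F) (f ⁻¹ᵁ V) (fun i ↦ spull f F le_rfl (e i)) := by
  classical
  choose lam hlam using he.exists_coord f
  have hlame : ∀ i j, unitSec _ (awaySec _ _ _ ((lam i).app (f ⁻¹ᵁ V) (spull f F le_rfl (e j)))) =
      (if j = i then 1 else 0) := by
    intro i j
    rw [hlam i V (e j) (fun k ↦ if j = k then 1 else 0)]
    · split_ifs <;> simp
    · simp
  refine isBasisOn_of_dual lam (fun i ↦ by simp [hlame]) (fun i j hj ↦ by simp [hlame, hj])
    fun U s ↦ ?_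
  obtain ⟨c, hc⟩ := he.exists_repr (W := U ⊓ V) inf_le_right (mres F inf_le_left s)
  have h2 : spull f F ((away_le (f ⁻¹ᵁ V) (f ⁻¹ᵁ U)).trans le_rfl) s =
      spull f F (away_preimage_le f U V) (mres F (inf_le_left : U ⊓ V ≤ U) s) := by
    rw [spull_mres]
  rw [mres_spull, h2, hc, spull_sum]
  exact Finset.sum_congr rfl fun i _ ↦ by rw [spull_mres, hlam i U s c hc, mres_spull]

theorem IsGen.pullback {s : Γ(F, V)} (hs : IsGen F V s) (f : X ⟶ Y) :
    IsGen ((Scheme.Modules.pullback f).obj F) (f ⁻¹ᵁ V) (spull f F le_rfl s) :=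
  isGen_iff_isBasisOn.mpr ((isGen_iff_isBasisOn.mp hs).pullback f)

end pullbackBasis

section invertible

variable {X Y : Scheme.{u}}

theorem isInvertible_iff {M : X.Modules} :
    IsInvertible M ↔ ∀ x : X, ∃ (V : X.Opens) (s : Γ(M, V)), x ∈ V ∧ IsGen M V s := by
  constructor
  · intro h x
    obtain ⟨U, hxU, ⟨φ⟩⟩ := h x
    have hbij : ∀ W : U.toScheme.Opens, Function.Bijective (φ.inv.app W) := fun W ↦ by
      rw [← ConcreteCategory.isIso_iff_bijective]
      infer_instance
    let s : Γ(M, U.ι ''ᵁ ⊤) := φ.inv.app ⊤ ((unitSec _).symm 1)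
    refine ⟨U.ι ''ᵁ ⊤, s, ⟨⟨x, hxU⟩, trivial, rfl⟩, fun W hW ↦ ?_⟩
    obtain ⟨W', rfl⟩ : ∃ W' : U.toScheme.Opens, W = U.ι ''ᵁ W' := by
      refine ⟨U.ι ⁻¹ᵁ W, le_antisymm (fun y hy ↦ ?_) (away_le U W)⟩
      obtain ⟨z, -, rfl⟩ := hW hy
      exact ⟨z, hy, rfl⟩
    have h1 : (fun c : Γ(X, U.ι ''ᵁ W') ↦ c • mres M hW s) =
        restrictSec M U W' ∘ (φ.inv.app W') ∘ (unitSec W').symm ∘ (openSec U W').symm := by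
      funext c
      have h2 : (unitSec (X := U) W').symm ((openSec U W').symm c) = (openSec U W').symm c •
        mres _ le_top ((unitSec (X := U) ⊤).symm 1) := by
        apply (unitSec _).injective
        simp
      simp only [Function.comp_apply]
      rw [h2, Scheme.Modules.Hom.app_smul, ← mres_app, restrictSec_smul]
      simp
      rfl
    rw [h1]
    exact (restrictSec M U W').bijective.comp ((hbij W').comp
      ((unitSec W').symm.bijective.comp (openSec U W').symm.bijective))
  · intro h x
    obtain ⟨V, s, hxV, hs⟩ := h x
    refine ⟨V, hxV, ?_⟩
    have hle : ∀ U : V.toScheme.Opens, V.ι ''ᵁ U ≤ V := by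
      rintro U _ ⟨y, -, rfl⟩
      exact y.2
    let φ : structureSheaf V ⟶ M.restrict V.ι :=
      homMk (fun U b ↦ (restrictSec M V U).symm (openSec V U (unitSec U b) • mres M (hle U) s))
        (fun U a b ↦ by simp [add_smul])
        (fun U c a ↦ by
          apply (restrictSec M V U).injective
          simp [mul_smul])
        (fun U W h a ↦ by
          apply (restrictSec M V W).injective
          simp)
    have : IsIso φ := by
      rw [Scheme.Modules.Hom.isIso_iff_isIso_app]
      intro U
      rw [ConcreteCategory.isIso_iff_bijective]
      have h1 : ⇑(ConcreteCategory.hom (φ.app U)) = (restrictSec M V U).symm ∘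
        (fun c ↦ c • mres M (hle U) s) ∘ openSec V U ∘ unitSec U := rfl
      rw [h1]
      exact (restrictSec M V U).symm.bijective.comp ((hs _ (hle U)).comp
        ((openSec V U).bijective.comp (unitSec U).bijective))
    exact ⟨(asIso φ).symm⟩

theorem isInvertible_structureSheaf : IsInvertible (structureSheaf X) :=
  isInvertible_iff.mpr fun _ ↦ ⟨⊤, _, trivial, isGen_one⟩

theorem IsInvertible.pullback {M : Y.Modules} (h : IsInvertible M) (f : X ⟶ Y) :
    IsInvertible ((Scheme.Modules.pullback f).obj M) := by
  rw [isInvertible_iff] at h ⊢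
  intro x
  obtain ⟨V, s, hxV, hs⟩ := h (f x)
  exact ⟨f ⁻¹ᵁ V, _, hxV, hs.pullback f⟩

variable {F : Y.Modules} {M : X.Modules} {f : X ⟶ Y}

theorem epi_of_isGen (r : (Scheme.Modules.pullback f).obj F ⟶ M)
    (h : ∀ x : X, ∃ (V : Y.Opens) (s : Γ(F, V)) (W : X.Opens) (hW : W ≤ f ⁻¹ᵁ V), x ∈ W ∧
      IsGen M W (r.app W (spull f F hW s))) : Epi r := by
  refine Preadditive.epi_of_cancel_zero _ fun g hg ↦ modHom_ext_local fun U a x hx ↦ ?_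
  obtain ⟨V, s, W, hW, hxW, hs⟩ := h x
  obtain ⟨c, hc⟩ := hs.exists_smul (W := U ⊓ W) inf_le_right (mres M inf_le_left a)
  refine ⟨U ⊓ W, inf_le_left, ⟨hx, hxW⟩, ?_⟩
  have : g.app _ (r.app W (spull f F hW s)) = 0 :=
    ConcreteCategory.congr_hom (congrArg (fun t ↦ Scheme.Modules.Hom.app t W) hg) _
  rw [hc, Scheme.Modules.Hom.app_smul, ← mres_app, this]
  simp

theorem fpull_fromSpecResidueField_eq_zero {x : X} {W : X.Opens} (c : Γ(X, W))
    {T : (Spec (X.residueField x)).Opens} (hT : T ≤ X.fromSpecResidueField x ⁻¹ᵁ W)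
    (h : x ∉ X.basicOpen c) : fpull (X.fromSpecResidueField x) hT c = 0 := by
  have h1 : X.fromSpecResidueField x ⁻¹ᵁ X.basicOpen c = ⊥ := by
    rw [eq_bot_iff]
    intro y hy
    have h2 : X.fromSpecResidueField x y ∈ X.basicOpen c := hy
    have h3 : X.fromSpecResidueField x y = x := by
      have := Set.mem_range_self (f := X.fromSpecResidueField x) y
      rw [Scheme.range_fromSpecResidueField] at this
      exact this
    exact (h (h3 ▸ h2)).elim
  rw [Scheme.preimage_basicOpen, basicOpen_eq_bot_iff, app_eq_fpull] at h1
  have h2 := congrArg (fres hT) h1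
  rwa [map_zero, fres_fpull] at h2

/-- If `r` is an epimorphism to an invertible sheaf, then this sheaf is locally generated by an
image of a section. -/
theorem exists_isGen_of_epi (hM : IsInvertible M) (r : (Scheme.Modules.pullback f).obj F ⟶ M)
    [Epi r] (x : X) : ∃ (V : Y.Opens) (s : Γ(F, V)) (W : X.Opens) (hW : W ≤ f ⁻¹ᵁ V), x ∈ W ∧
      IsGen M W (r.app W (spull f F hW s)) := by
  by_contra! hcon
  obtain ⟨W₀, m, hxW₀, hm⟩ := isInvertible_iff.mp hM x
  set g := X.fromSpecResidueField x
  have hg : ∀ y, g y = x := fun y ↦ by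
    have := Set.mem_range_self (f := X.fromSpecResidueField x) y
    rw [Scheme.range_fromSpecResidueField] at this
    exact this
  have hle : ∀ U : X.Opens, g ⁻¹ᵁ U ≤ g ⁻¹ᵁ (U ⊓ W₀) := fun U y hy ↦
    ⟨hy, by change g y ∈ W₀; rw [hg]; exact hxW₀⟩
  obtain ⟨φ, hφ⟩ := exists_hom_of_relation (A := M)
    (G := (Scheme.Modules.pushforward g).obj (structureSheaf _))
    (fun U a b ↦ ∃ c : Γ(X, U ⊓ W₀), mres M inf_le_left a = c • mres M inf_le_right m ∧
      unitSec _ (pushSec _ _ _ b) = fpull g (hle U) c)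
    (by
      rintro U U' h a b ⟨c, hc, hb⟩
      refine ⟨fres (inf_le_inf_right W₀ h) c, ?_, by simp [hb, -Scheme.Modules.pushforward_obj_obj]⟩
      have := congrArg (mres M (inf_le_inf_right W₀ h)) hc
      simpa using this)
    (by
      rintro U a b a' b' ⟨c, hc, hb⟩ ⟨c', hc', hb'⟩
      exact ⟨c + c', by rw [map_add, hc, hc', add_smul], by simp [hb, hb', -Scheme.Modules.pushforward_obj_obj]⟩)
    (by
      rintro U d a b ⟨c, hc, hb⟩
      exact ⟨fres inf_le_left d * c, by rw [mres_smul, hc, mul_smul], by simp [hb, -Scheme.Modules.pushforward_obj_obj]⟩)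
    (by
      rintro U b ⟨c, hc, hb⟩
      have h0 := hm.eq_zero_of_smul inf_le_right (hc.symm.trans (map_zero _))
      rw [h0, map_zero] at hb
      simpa [-Scheme.Modules.pushforward_obj_obj] using hb)
    (by
      intro U a y hy
      obtain ⟨c, hc⟩ := hm.exists_smul (W := U ⊓ W₀) inf_le_right (mres M inf_le_left a)
      exact ⟨U, le_rfl, hy, (pushSec _ _ _).symm ((unitSec _).symm (fpull g (hle U) c)), c,
        by simpa using hc, by simp [-Scheme.Modules.pushforward_obj_obj]⟩)
  have h0 : r ≫ φ = 0 := by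
    refine pullback_hom_ext fun V s ↦ ?_
    obtain ⟨c, hc⟩ := hm.exists_smul (W := f ⁻¹ᵁ V ⊓ W₀) inf_le_right
      (mres M inf_le_left (r.app _ (spull f F le_rfl s)))
    have hc0 : fpull g (hle (f ⁻¹ᵁ V)) c = 0 := by
      refine fpull_fromSpecResidueField_eq_zero c _ fun hx ↦ ?_
      have hle' : X.basicOpen c ≤ f ⁻¹ᵁ V ⊓ W₀ := X.basicOpen_le c
      refine hcon V s (X.basicOpen c) (hle'.trans inf_le_left) hx ?_
      have h1 := congrArg (mres M hle') hc
      rw [mres_mres, mres_app, mres_spull] at h1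
      rw [h1, mres_smul, mres_mres]
      exact (hm.mono (hle'.trans inf_le_right)).unit_smul
        (RingedSpace.isUnit_res_basicOpen _ c)
    exact hφ _ _ 0 ⟨c, hc, by simp [hc0, -Scheme.Modules.pushforward_obj_obj]⟩
  have h1 : φ = 0 := by rwa [← cancel_epi r, comp_zero]
  have h2 := hφ W₀ m ((pushSec _ _ _).symm ((unitSec _).symm 1)) ⟨1, by simp, by simp [-Scheme.Modules.pushforward_obj_obj]⟩
  rw [h1] at h2
  have h3 : (1 : Γ(Spec (X.residueField x), g ⁻¹ᵁ W₀)) = 0 :=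
    ((unitSec _).symm.injective ((pushSec _ _ _).symm.injective
      (h2.symm.trans ((map_zero (pushSec g (structureSheaf _) W₀).symm).symm.trans
        (congrArg _ (map_zero (unitSec (g ⁻¹ᵁ W₀)).symm).symm)))))
  have h4 : Nonempty (g ⁻¹ᵁ W₀) := by
    have : x ∈ Set.range g := by
      rw [Scheme.range_fromSpecResidueField]; rfl
    obtain ⟨y, hy⟩ := this
    exact ⟨⟨y, by change g y ∈ W₀; rw [hy]; exact hxW₀⟩⟩
  have : Nontrivial Γ(Spec (X.residueField x), g ⁻¹ᵁ W₀) := inferInstance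
  exact one_ne_zero h3

end invertible

/-! ### Sections of quotients of pullbacks -/

section qsec

variable {X Y T : Scheme.{u}} {f : X ⟶ Y} {F : Y.Modules} {M M' : X.Modules}
  (r : (Scheme.Modules.pullback f).obj F ⟶ M) {V V' : Y.Opens} {W W' : X.Opens}

/-- The image of a section of `F` under a map `f^* F ⟶ M`. -/
def qsec (e : W ≤ f ⁻¹ᵁ V) (s : Γ(F, V)) : Γ(M, W) := r.app W (spull f F e s)

@[simp] theorem mres_qsec (e : W ≤ f ⁻¹ᵁ V) (h : W' ≤ W) (s : Γ(F, V)) :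
    mres M h (qsec r e s) = qsec r (h.trans e) s := by
  rw [qsec, mres_app, mres_spull, qsec]

@[simp] theorem qsec_mres (h : V' ≤ V) (e : W ≤ f ⁻¹ᵁ V') (s : Γ(F, V)) :
    qsec r e (mres F h s) = qsec r (e.trans (f.preimage_mono h)) s := by
  rw [qsec, spull_mres, qsec]

theorem qsec_add (e : W ≤ f ⁻¹ᵁ V) (s s' : Γ(F, V)) :
    qsec r e (s + s') = qsec r e s + qsec r e s' := by
  rw [qsec, spull_add, map_add, qsec, qsec]

theorem qsec_zero (e : W ≤ f ⁻¹ᵁ V) : qsec r e 0 = 0 := by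
  rw [qsec, spull_zero, map_zero]

theorem qsec_smul (e : W ≤ f ⁻¹ᵁ V) (a : Γ(Y, V)) (s : Γ(F, V)) :
    qsec r e (a • s) = fpull f e a • qsec r e s := by
  rw [qsec, spull_smul, Scheme.Modules.Hom.app_smul, qsec]

theorem app_sum_smul (φ : M ⟶ M') {ι : Type*} [Fintype ι] (c : ι → Γ(X, W)) (s : ι → Γ(M, W)) :
    φ.app W (∑ i, c i • s i) = ∑ i, c i • φ.app W (s i) := by
  rw [map_sum]
  exact Finset.sum_congr rfl fun i _ ↦ Scheme.Modules.Hom.app_smul φ _ _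

theorem qsec_sum {ι : Type*} [Fintype ι] (e : W ≤ f ⁻¹ᵁ V) (c : ι → Γ(Y, V)) (s : ι → Γ(F, V)) :
    qsec r e (∑ i, c i • s i) = ∑ i, fpull f e (c i) • qsec r e (s i) := by
  rw [qsec, spull_sum, app_sum_smul]
  rfl

theorem qsec_comp (φ : M ⟶ M') (e : W ≤ f ⁻¹ᵁ V) (s : Γ(F, V)) :
    qsec (r ≫ φ) e s = φ.app W (qsec r e s) := by
  simp [qsec]

theorem qsec_pullbackQuotient {L : X.Modules} (q : (Scheme.Modules.pullback f).obj F ⟶ L)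
    (g : T ⟶ X) {U : T.Opens} (e : W ≤ f ⁻¹ᵁ V) (e' : U ≤ g ⁻¹ᵁ W) (s : Γ(F, V)) :
    qsec (pullbackQuotient q g) (e'.trans (g.preimage_mono e)) s =
      spull g L e' (qsec q e s) := by
  have h1 := pullbackComp_inv_spull (f := g) f (G := F) (V := V) (W := U)
    (e'.trans (g.preimage_mono e)) s
  rw [qsec, pullbackQuotient, Scheme.Modules.Hom.comp_app, AddCommGrpCat.comp_apply, h1]
  refine (pullback_map_spull (f := g) q _ _).trans ?_
  have h2 := spull_mres (f := g) (F := L) e e' (q.app _ (spull f F le_rfl s))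
  rw [mres_app, mres_spull] at h2
  rw [qsec, h2]

theorem qsec_pullbackCongr {g f : T ⟶ Y} (h : g = f) {M : T.Modules}
    (r : (Scheme.Modules.pullback f).obj F ⟶ M) {U : T.Opens} (e : U ≤ g ⁻¹ᵁ V) (s : Γ(F, V)) :
    qsec ((Scheme.Modules.pullbackCongr h).hom.app F ≫ r) e s = qsec r (h ▸ e) s := by
  rw [qsec, Scheme.Modules.Hom.comp_app, AddCommGrpCat.comp_apply, pullbackCongr_hom_spull, qsec]

/-- Two quotients with the same local coordinates are isomorphic. -/
theorem exists_iso_of_coords {r : (Scheme.Modules.pullback f).obj F ⟶ M}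
    {r' : (Scheme.Modules.pullback f).obj F ⟶ M'}
    (H : ∀ x : X, ∃ (V : Y.Opens) (ι : Type) (_ : Fintype ι) (e : ι → Γ(F, V)) (j : ι)
      (W : X.Opens) (hW : W ≤ f ⁻¹ᵁ V) (a : ι → Γ(X, W)), x ∈ W ∧ IsBasisOn F V e ∧
        IsGen M W (qsec r hW (e j)) ∧ IsGen M' W (qsec r' hW (e j)) ∧
        (∀ i, qsec r hW (e i) = a i • qsec r hW (e j)) ∧
        (∀ i, qsec r' hW (e i) = a i • qsec r' hW (e j))) :
    ∃ θ : M ≅ M', r ≫ θ.hom = r' := by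
  have key : ∀ (U : X.Opens) (b : Γ((Scheme.Modules.pullback f).obj F, U)),
      r.app U b = 0 → r'.app U b = 0 := by
    intro U b hb
    refine section_ext fun x hx ↦ ?_
    obtain ⟨V, ι, _, e, j, W, hW, a, hxW, he, hs, hs', ha, ha'⟩ := H x
    obtain ⟨c, hc⟩ := (he.pullback f).exists_repr (W := U ⊓ W) (inf_le_right.trans hW)
      (mres _ inf_le_left b)
    simp only [mres_spull] at hc
    have hi : ∀ i, r.app (U ⊓ W) (spull f F (inf_le_right.trans hW) (e i)) =
        fres (inf_le_right : U ⊓ W ≤ W) (a i) • mres M inf_le_right (qsec r hW (e j)) := by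
      intro i
      rw [← mres_smul, ← ha, mres_qsec, qsec]
    have hi' : ∀ i, r'.app (U ⊓ W) (spull f F (inf_le_right.trans hW) (e i)) =
        fres (inf_le_right : U ⊓ W ≤ W) (a i) • mres M' inf_le_right (qsec r' hW (e j)) := by
      intro i
      rw [← mres_smul, ← ha', mres_qsec, qsec]
    refine ⟨U ⊓ W, inf_le_left, ⟨hx, hxW⟩, ?_⟩
    have h1 := congrArg (mres M (inf_le_left : U ⊓ W ≤ U)) hb
    rw [map_zero, mres_app, hc, app_sum_smul] at h1
    simp only [hi, smul_smul] at h1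
    rw [← Finset.sum_smul] at h1
    have h2 := hs.eq_zero_of_smul _ h1
    rw [map_zero, mres_app, hc, app_sum_smul]
    simp only [hi', smul_smul]
    rw [← Finset.sum_smul, h2, zero_smul]
  obtain ⟨φ, hφ⟩ := exists_hom_of_relation (A := M) (G := M')
    (fun U m m' ↦ ∀ x ∈ U, ∃ (W : X.Opens) (h : W ≤ U), x ∈ W ∧
      ∃ b, r.app W b = mres M h m ∧ r'.app W b = mres M' h m')
    (by
      intro U V h m m' hm x hx
      obtain ⟨W, hW, hxW, b, hb, hb'⟩ := hm x (h hx)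
      refine ⟨W ⊓ V, inf_le_right, ⟨hxW, hx⟩, mres _ inf_le_left b, ?_, ?_⟩
      · rw [← mres_app, hb, mres_mres, mres_mres]
      · rw [← mres_app, hb', mres_mres, mres_mres])
    (by
      intro U m m' n n' hm hn x hx
      obtain ⟨W, hW, hxW, b, hb, hb'⟩ := hm x hx
      obtain ⟨W₁, hW₁, hxW₁, b₁, hb₁, hb₁'⟩ := hn x hx
      refine ⟨W ⊓ W₁, inf_le_left.trans hW, ⟨hxW, hxW₁⟩,
        mres _ inf_le_left b + mres _ inf_le_right b₁, ?_, ?_⟩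
      · rw [map_add, map_add, ← mres_app, ← mres_app, hb, hb₁, mres_mres, mres_mres]
      · rw [map_add, map_add, ← mres_app, ← mres_app, hb', hb₁', mres_mres, mres_mres])
    (by
      intro U c m m' hm x hx
      obtain ⟨W, hW, hxW, b, hb, hb'⟩ := hm x hx
      refine ⟨W, hW, hxW, fres hW c • b, ?_, ?_⟩
      · rw [Scheme.Modules.Hom.app_smul, hb, mres_smul]
      · rw [Scheme.Modules.Hom.app_smul, hb', mres_smul])
    (by
      intro U m' hm
      refine section_ext fun x hx ↦ ?_
      obtain ⟨W, hW, hxW, b, hb, hb'⟩ := hm x hx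
      refine ⟨W, hW, hxW, ?_⟩
      rw [← hb', key W b (by rw [hb, map_zero]), map_zero])
    (by
      intro U m x hx
      obtain ⟨V, ι, _, e, j, W, hW, a, hxW, he, hs, hs', ha, ha'⟩ := H x
      obtain ⟨c, hc⟩ := hs.exists_smul (W := U ⊓ W) inf_le_right (mres M inf_le_left m)
      refine ⟨U ⊓ W, inf_le_left, ⟨hx, hxW⟩, c • mres M' inf_le_right (qsec r' hW (e j)),
        fun y hy ↦ ⟨U ⊓ W, le_rfl, hy, c • spull f F (inf_le_right.trans hW) (e j), ?_, ?_⟩⟩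
      · rw [Scheme.Modules.Hom.app_smul, mres_self, hc, mres_qsec]
        rfl
      · rw [Scheme.Modules.Hom.app_smul, mres_self, mres_qsec]
        rfl)
  have hr : ∀ (U : X.Opens) (b : Γ((Scheme.Modules.pullback f).obj F, U)),
      φ.app U (r.app U b) = r'.app U b := fun U b ↦
    hφ U _ _ fun x hx ↦ ⟨U, le_rfl, hx, b, by simp, by simp⟩
  have : IsIso φ := by
    refine isIso_of_isGen φ fun x ↦ ?_
    obtain ⟨V, ι, _, e, j, W, hW, a, hxW, he, hs, hs', ha, ha'⟩ := H x
    refine ⟨W, _, hxW, hs, ?_⟩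
    rw [qsec, hr]
    exact hs'
  exact ⟨asIso φ, modHom_ext fun U b ↦ by simpa using hr U b⟩

end qsec

/-! ### The locus where a section generates -/

section genLocus

variable {X : Scheme.{u}} (M : X.Modules) {V : X.Opens} (s : Γ(M, V))

/-- The largest open subset where a section is a free generator. -/
def genLocus : X.Opens := sSup {W | ∃ h : W ≤ V, IsGen M W (mres M h s)}

variable {M s}

theorem genLocus_le : genLocus M s ≤ V := sSup_le fun _ ⟨h, _⟩ ↦ h

theorem le_genLocus {W : X.Opens} (h : W ≤ V) (hW : IsGen M W (mres M h s)) :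
    W ≤ genLocus M s := le_sSup ⟨h, hW⟩

theorem isGen_genLocus : IsGen M (genLocus M s) (mres M genLocus_le s) := by
  refine IsGen.of_cover fun x hx ↦ ?_
  obtain ⟨W, ⟨h, hW⟩, hx⟩ := Opens.mem_sSup.mp hx
  exact ⟨W, le_genLocus h hW, hx, by rw [mres_mres]; exact hW⟩

theorem isUnit_fres_basicOpen {W : X.Opens} (a : Γ(X, W)) :
    IsUnit (fres (X.basicOpen_le a) a) :=
  RingedSpace.isUnit_res_basicOpen _ a

theorem le_basicOpen_of_isUnit {W W' : X.Opens} (h : W' ≤ W) {a : Γ(X, W)}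
    (ha : IsUnit (fres h a)) : W' ≤ X.basicOpen a := by
  have h1 : X.basicOpen (fres h a) = W' := X.basicOpen_of_isUnit ha
  have h2 : X.basicOpen (fres h a) = W' ⊓ X.basicOpen a := X.basicOpen_res a (homOfLE h).op
  rw [h2] at h1
  exact inf_eq_left.mp h1

theorem basicOpen_fpull {X Y : Scheme.{u}} (f : X ⟶ Y) {V : Y.Opens} {W : X.Opens}
    (e : W ≤ f ⁻¹ᵁ V) (a : Γ(Y, V)) :
    X.basicOpen (fpull f e a) = W ⊓ f ⁻¹ᵁ Y.basicOpen a := by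
  rw [Scheme.preimage_basicOpen]
  have : fpull f e a = X.presheaf.map (homOfLE e).op (f.app V a) := by
    rw [app_eq_fpull]
    exact (fres_fpull f e le_rfl a).symm
  rw [this, Scheme.basicOpen_res]

theorem exists_mem_basicOpen_of_sum {ι : Type*} [Fintype ι] {W : X.Opens} {x : X} (hx : x ∈ W)
    {c a : ι → Γ(X, W)} (h : IsUnit (∑ i, c i * a i)) : ∃ i, x ∈ X.basicOpen (a i) := by
  by_contra! hcon
  simp only [X.mem_basicOpen _ x hx] at hcon
  have h1 : X.presheaf.germ W x hx (∑ i, c i * a i) ∈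
      IsLocalRing.maximalIdeal (X.presheaf.stalk x) := by
    rw [map_sum]
    refine Ideal.sum_mem _ fun i _ ↦ ?_
    rw [map_mul]
    exact Ideal.mul_mem_left _ _ (by simpa using hcon i)
  exact h1 (h.map (X.presheaf.germ W x hx).hom)

theorem isGen_of_smul_unit {W : X.Opens} {m m' : Γ(M, W)} (hm : IsGen M W m) {a : Γ(X, W)}
    (h : m' = a • m) : IsGen M (X.basicOpen a) (mres M (X.basicOpen_le a) m') := by
  rw [h, mres_smul]
  exact (hm.mono _).unit_smul (isUnit_fres_basicOpen a)

end genLocus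

/-! ### Gluing of morphisms -/

section glueHom

variable {T Y : Scheme.{u}}

theorem hom_ext_local {g g' : T ⟶ Y}
    (h : ∀ x : T, ∃ W : T.Opens, x ∈ W ∧ W.ι ≫ g = W.ι ≫ g') : g = g' := by
  choose W hxW hW using h
  exact Scheme.Cover.hom_ext (T.openCoverOfIsOpenCover W
    (TopologicalSpace.IsOpenCover.mk (eq_top_iff.mpr fun x _ ↦
      Opens.mem_iSup.mpr ⟨x, hxW x⟩))) _ _ hW

theorem exists_hom_of_local (P : ∀ W : T.Opens, (W.toScheme ⟶ Y) → Prop)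
    (hex : ∀ x : T, ∃ W : T.Opens, x ∈ W ∧ ∃ g, P W g)
    (huniq : ∀ (W W' : T.Opens) (g : W.toScheme ⟶ Y) (g' : W'.toScheme ⟶ Y), P W g → P W' g' →
      T.homOfLE inf_le_left ≫ g = T.homOfLE (inf_le_right : W ⊓ W' ≤ W') ≫ g') :
    ∃ g : T ⟶ Y, ∀ (W : T.Opens) g', P W g' → W.ι ≫ g = g' := by
  choose W hxW g hg using hex
  let 𝒰 := T.openCoverOfIsOpenCover W (TopologicalSpace.IsOpenCover.mk (eq_top_iff.mpr fun x _ ↦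
      Opens.mem_iSup.mpr ⟨x, hxW x⟩))
  have hcov : ∀ x y : T, pullback.fst (W x).ι (W y).ι ≫ g x = pullback.snd (W x).ι (W y).ι ≫ g y := by
    intro x y
    have h1 := huniq _ _ _ _ (hg x) (hg y)
    have h2 := isPullback_opens_inf (W x) (W y)
    rw [← cancel_epi h2.isoPullback.hom, ← Category.assoc, ← Category.assoc,
      h2.isoPullback_hom_fst, h2.isoPullback_hom_snd, h1]
  let G := Scheme.Cover.glueMorphisms 𝒰 g hcov
  have hG : ∀ x, (W x).ι ≫ G = g x := fun x ↦ Scheme.Cover.ι_glueMorphisms 𝒰 g hcov x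
  refine ⟨G, fun W' g' hg' ↦ hom_ext_local fun y ↦ ?_⟩
  let x := W'.ι y
  refine ⟨W'.ι ⁻¹ᵁ W x, hxW x, ?_⟩
  let k : (W'.ι ⁻¹ᵁ W x).toScheme ⟶ (W x ⊓ W' : T.Opens).toScheme :=
    IsOpenImmersion.lift (W x ⊓ W').ι ((W'.ι ⁻¹ᵁ W x).ι ≫ W'.ι) (by
      rintro _ ⟨z, rfl⟩
      rw [Scheme.Opens.range_ι]
      exact ⟨z.2, z.1.2⟩)
  have hk : k ≫ (W x ⊓ W').ι = (W'.ι ⁻¹ᵁ W x).ι ≫ W'.ι := IsOpenImmersion.lift_fac _ _ _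
  have hk1 : k ≫ T.homOfLE inf_le_left ≫ (W x).ι = (W'.ι ⁻¹ᵁ W x).ι ≫ W'.ι := by
    rw [Scheme.homOfLE_ι, hk]
  have hk2 : k ≫ T.homOfLE inf_le_right = (W'.ι ⁻¹ᵁ W x).ι := by
    rw [← cancel_mono W'.ι, Category.assoc, Scheme.homOfLE_ι, hk]
  rw [← Category.assoc, ← hk1, Category.assoc, Category.assoc, hG,
    huniq _ _ _ _ (hg x) hg', ← Category.assoc, hk2]

end glueHom

/-! ### Local coordinates on projective bundles -/

section chart

variable {X P T : Scheme.{u}} {F : X.Modules} {p : P ⟶ X} {L : P.Modules}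
  (q : (Scheme.Modules.pullback p).obj F ⟶ L) {V : X.Opens} {ι : Type}
  (e : ι → Γ(F, V)) (j : ι)

/-- The open subset where the section `e j` generates the tautological quotient. -/
def chart : P.Opens := genLocus L (qsec q (le_refl (p ⁻¹ᵁ V)) (e j))

theorem chart_le : chart q e j ≤ p ⁻¹ᵁ V := genLocus_le

theorem isGen_chart : IsGen L (chart q e j) (qsec q (chart_le q e j) (e j)) := by
  have := isGen_genLocus (M := L) (s := qsec q (le_refl (p ⁻¹ᵁ V)) (e j))
  rwa [mres_qsec] at this

variable {q e j} in
theorem le_chart {W : P.Opens} (h : W ≤ p ⁻¹ᵁ V) (hW : IsGen L W (qsec q h (e j))) :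
    W ≤ chart q e j := le_genLocus h (by rwa [mres_qsec])

/-- The coordinate `e i / e j`. -/
def coord (i : ι) : Γ(P, chart q e j) :=
  ((isGen_chart q e j).exists_smul le_rfl (qsec q (chart_le q e j) (e i))).choose

theorem coord_smul (i : ι) {W : P.Opens} (h : W ≤ chart q e j) :
    qsec q (h.trans (chart_le q e j)) (e i) =
      fres h (coord q e j i) • qsec q (h.trans (chart_le q e j)) (e j) := by
  have h1 : qsec q (chart_le q e j) (e i) = coord q e j i • mres L le_rfl _ :=
    ((isGen_chart q e j).exists_smul le_rfl (qsec q (chart_le q e j) (e i))).choose_spec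
  have h2 := congrArg (mres L h) h1
  rw [mres_smul, mres_mres, mres_qsec, mres_qsec] at h2
  exact h2

theorem coord_eq {W : P.Opens} (h : W ≤ chart q e j) {i : ι} {a : Γ(P, W)}
    (ha : qsec q (h.trans (chart_le q e j)) (e i) =
      a • qsec q (h.trans (chart_le q e j)) (e j)) : fres h (coord q e j i) = a := by
  refine ((isGen_chart q e j).mono h).smul_ext le_rfl ?_
  rw [mres_self, mres_qsec, ← ha, ← coord_smul]

theorem coord_self : coord q e j j = 1 := by
  have := coord_eq q e j (le_refl (chart q e j)) (i := j) (a := 1) (by rw [one_smul])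
  rwa [fres_self] at this

variable {q e}

variable [Fintype ι]

theorem exists_mem_chart (hL : IsInvertible L) [Epi q] (he : IsBasisOn F V e) {y : P}
    (hy : y ∈ p ⁻¹ᵁ V) : ∃ j, y ∈ chart q e j := by
  obtain ⟨V', s, W, hW, hyW, hs⟩ := exists_isGen_of_epi hL q y
  obtain ⟨c, hc⟩ := he.exists_repr (W := V' ⊓ V) inf_le_right (mres F inf_le_left s)
  have hW0 : W ⊓ p ⁻¹ᵁ V ≤ p ⁻¹ᵁ (V' ⊓ V) := fun z hz ↦ ⟨hW hz.1, hz.2⟩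
  have hW1 : W ⊓ p ⁻¹ᵁ V ≤ p ⁻¹ᵁ V := inf_le_right
  have hm : IsGen L (W ⊓ p ⁻¹ᵁ V) (qsec q (hW0.trans (p.preimage_mono inf_le_left)) s) := by
    have := hs.mono (inf_le_left : W ⊓ p ⁻¹ᵁ V ≤ W)
    rwa [mres_app, mres_spull] at this
  have h1 : qsec q (hW0.trans (p.preimage_mono inf_le_left)) s =
      ∑ i, fpull p hW0 (c i) • qsec q hW1 (e i) := by
    rw [← qsec_mres q inf_le_left hW0 s, hc, qsec_sum]
    simp only [qsec_mres]
  choose a ha using fun i ↦ hm.exists_smul le_rfl (qsec q hW1 (e i))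
  simp only [mres_self] at ha
  have h2 : ∑ i, fpull p hW0 (c i) * a i = 1 := by
    refine hm.smul_ext le_rfl ?_
    rw [mres_self, one_smul, Finset.sum_smul]
    refine Eq.trans ?_ h1.symm
    exact Finset.sum_congr rfl fun i _ ↦ by rw [mul_smul, ← ha]
  obtain ⟨i, hi⟩ := exists_mem_basicOpen_of_sum (W := W ⊓ p ⁻¹ᵁ V) ⟨hyW, hy⟩ (h2 ▸ isUnit_one)
  refine ⟨i, le_chart ((P.basicOpen_le (a i)).trans hW1) ?_ hi⟩
  have := isGen_of_smul_unit hm (ha i)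
  rwa [mres_qsec] at this

section classifies

variable {g : T ⟶ P} {f : T ⟶ X} {M : T.Modules} {r : (Scheme.Modules.pullback f).obj F ⟶ M}

theorem Classifies.exists_iso (h : Classifies q g r) :
    ∃ θ : (Scheme.Modules.pullback g).obj L ≅ M, ∀ {V : X.Opens} (s : Γ(F, V)) {W : P.Opens}
      (e : W ≤ p ⁻¹ᵁ V) {U : T.Opens} (e' : U ≤ g ⁻¹ᵁ W) (e'' : U ≤ f ⁻¹ᵁ V),
      θ.hom.app U (spull g L e' (qsec q e s)) = qsec r e'' s := by
  obtain ⟨hf, θ, hθ⟩ := h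
  subst hf
  refine ⟨θ, fun s W e U e' e'' ↦ ?_⟩
  rw [← qsec_pullbackQuotient, ← qsec_comp, hθ, qsec_pullbackCongr]

theorem Classifies.le_chart (h : Classifies q g r) (hL : IsInvertible L) [Epi q]
    (he : IsBasisOn F V e) {W : T.Opens} (hW : W ≤ f ⁻¹ᵁ V) (hr : IsGen M W (qsec r hW (e j))) :
    W ≤ g ⁻¹ᵁ chart q e j := by
  intro x hx
  obtain ⟨θ, hθ⟩ := h.exists_iso
  obtain ⟨hf, -⟩ := h
  have hgx : g x ∈ p ⁻¹ᵁ V := by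
    have := hW hx
    rw [← hf] at this
    exact this
  obtain ⟨k, hk⟩ := exists_mem_chart (q := q) hL he hgx
  have h1 := coord_smul q e k j (le_refl _)
  have hle : W ⊓ g ⁻¹ᵁ chart q e k ≤ f ⁻¹ᵁ V := inf_le_left.trans hW
  have h2 := congrArg (fun m ↦ θ.hom.app (W ⊓ g ⁻¹ᵁ chart q e k) (spull g L inf_le_right m)) h1
  simp only [spull_smul, Scheme.Modules.Hom.app_smul, fres_self] at h2
  rw [hθ _ _ _ hle, hθ _ _ _ hle] at h2
  have h3 := hr.mono (inf_le_left : W ⊓ g ⁻¹ᵁ chart q e k ≤ W)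
  rw [mres_qsec] at h3
  obtain ⟨b, hb⟩ := h3.exists_smul le_rfl (qsec r hle (e k))
  rw [mres_self] at hb
  have h4 : fpull g inf_le_right (coord q e k j) * b = 1 := by
    refine h3.smul_ext le_rfl ?_
    rw [mres_self, mul_smul, ← hb, one_smul]
    exact h2.symm
  have h5 := le_basicOpen_of_isUnit (le_refl _) (a := fpull g inf_le_right (coord q e k j))
    (by rw [fres_self]; exact IsUnit.of_mul_eq_one _ h4)
  rw [basicOpen_fpull] at h5
  have h6 : g x ∈ P.basicOpen (coord q e k j) := (h5 ⟨hx, hk⟩).2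
  refine LogResolution.le_chart ((P.basicOpen_le _).trans (chart_le q e k)) ?_ h6
  have h7 := coord_smul q e k j (le_refl _)
  rw [fres_self] at h7
  have := isGen_of_smul_unit (isGen_chart q e k) h7
  rwa [mres_qsec] at this

theorem Classifies.fpull_coord (h : Classifies q g r) {W : T.Opens} (hW : W ≤ f ⁻¹ᵁ V)
    (hr : IsGen M W (qsec r hW (e j))) {i : ι} {a : Γ(T, W)}
    (ha : qsec r hW (e i) = a • qsec r hW (e j)) (hc : W ≤ g ⁻¹ᵁ chart q e j) :
    fpull g hc (coord q e j i) = a := by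
  obtain ⟨θ, hθ⟩ := h.exists_iso
  have h1 := coord_smul q e j i (le_refl _)
  have h2 := congrArg (fun m ↦ θ.hom.app W (spull g L hc m)) h1
  simp only [spull_smul, Scheme.Modules.Hom.app_smul, fres_self] at h2
  rw [hθ _ _ _ hW, hθ _ _ _ hW, ha] at h2
  exact (hr.smul_ext le_rfl (by rw [mres_self]; exact h2)).symm

theorem classifies_of_coords (hf : g ≫ p = f)
    (H : ∀ x : T, ∃ (V : X.Opens) (ι : Type) (_ : Fintype ι) (e : ι → Γ(F, V)) (j : ι)
      (W : T.Opens) (hW : W ≤ f ⁻¹ᵁ V) (hg : W ≤ g ⁻¹ᵁ chart q e j), x ∈ W ∧ IsBasisOn F V e ∧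
        IsGen M W (qsec r hW (e j)) ∧
        ∀ i, qsec r hW (e i) = fpull g hg (coord q e j i) • qsec r hW (e j)) :
    Classifies q g r := by
  subst hf
  have key := exists_iso_of_coords (r := pullbackQuotient q g) (r' := r) (by
    intro x
    obtain ⟨V, ι, _, e, j, W, hW, hg, hx, he, hr, ha⟩ := H x
    refine ⟨V, ι, _, e, j, W, hW, fun i ↦ fpull g hg (coord q e j i), hx, he, ?_, hr, ?_, ha⟩
    · have := (isGen_chart q e j).pullback g
      have := this.mono hg
      rw [mres_spull] at this
      rw [qsec_pullbackQuotient q g (chart_le q e j) hg]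
      exact this
    · intro i
      have h1 := coord_smul q e j i (le_refl _)
      rw [qsec_pullbackQuotient q g (chart_le q e j) hg,
        qsec_pullbackQuotient q g (chart_le q e j) hg, h1, spull_smul, fres_self])
  obtain ⟨θ, hθ⟩ := key
  refine ⟨rfl, θ, hθ.trans (pullback_hom_ext fun V s ↦ ?_)⟩
  exact (qsec_pullbackCongr (rfl : g ≫ p = g ≫ p) r le_rfl s).symm

end classifies

/-- The map `f^* F ⟶ M` with given values on a basis. -/
theorem exists_pullbackHom_of_basis (he : IsBasisOn F V e) {f : T ⟶ X} (hf : ⊤ ≤ f ⁻¹ᵁ V)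
    {M : T.Modules} (m : ι → Γ(M, ⊤)) :
    ∃ r : (Scheme.Modules.pullback f).obj F ⟶ M, ∀ i, qsec r hf (e i) = m i := by
  have hle : ∀ U : X.Opens, f ⁻¹ᵁ U ≤ f ⁻¹ᵁ (U ⊓ V) := fun U x hx ↦ ⟨hx, hf trivial⟩
  obtain ⟨r, hr⟩ := exists_pullbackHom_of_relation (f := f) (F := F) (M := M)
    (fun U s b ↦ ∃ c : ι → Γ(X, U ⊓ V),
      mres F inf_le_left s = ∑ j, c j • mres F inf_le_right (e j) ∧
        b = ∑ j, fpull f (hle U) (c j) • mres M le_top (m j))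
    (by
      rintro U U' h a b ⟨c, hc, hb⟩
      refine ⟨fun j ↦ fres (inf_le_inf_right V h) (c j), ?_, ?_⟩
      · have := congrArg (mres F (inf_le_inf_right V h)) hc
        rw [mres_sum_smul] at this
        simpa using this
      · rw [hb, mres_sum_smul]
        simp)
    (by
      rintro U a b a' b' ⟨c, hc, hb⟩ ⟨c', hc', hb'⟩
      refine ⟨c + c', ?_, ?_⟩
      · rw [map_add, hc, hc', ← Finset.sum_add_distrib]
        simp [add_smul]
      · rw [hb, hb', ← Finset.sum_add_distrib]
        simp [add_smul])
    (by
      rintro U d a b ⟨c, hc, hb⟩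
      refine ⟨fun j ↦ fres inf_le_left d * c j, ?_, ?_⟩
      · rw [mres_smul, hc, Finset.smul_sum]
        simp [mul_smul]
      · rw [hb, Finset.smul_sum]
        simp [mul_smul])
    (by
      rintro U b ⟨c, hc, hb⟩
      have h0 := fun i ↦ he.repr_eq_zero inf_le_right (hc.symm.trans (map_zero _)) i
      simpa [h0] using hb)
    (by
      intro U a x hx
      obtain ⟨c, hc⟩ := he.exists_repr (W := U ⊓ V) inf_le_right (mres F inf_le_left a)
      exact ⟨U, le_rfl, hx, _, c, by simpa using hc, rfl⟩)
  refine ⟨r, fun i ↦ ?_⟩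
  classical
  have h1 := hr V (e i) (mres M le_top (m i)) ⟨Pi.single i 1, ?_, ?_⟩
  · have h2 := congrArg (mres M hf) h1
    rw [mres_mres, mres_self, mres_app, mres_spull] at h2
    exact h2
  · rw [Finset.sum_eq_single i (fun k _ hk ↦ by simp [hk]) (by simp)]
    simp
  · rw [Finset.sum_eq_single i (fun k _ hk ↦ by simp [hk]) (by simp)]
    simp

variable (hP : IsProjectiveBundle F p q) (he : IsBasisOn F V e)
include hP he

theorem IsProjectiveBundle.exists_lift {f : T ⟶ X} (hf : ⊤ ≤ f ⁻¹ᵁ V) (a : ι → Γ(T, ⊤))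
    (ha : a j = 1) : ∃ g : T ⟶ P, g ≫ p = f ∧ ∃ hg : ⊤ ≤ g ⁻¹ᵁ chart q e j,
      ∀ i, fpull g hg (coord q e j i) = a i := by
  have := hP.epi
  obtain ⟨r, hr⟩ := exists_pullbackHom_of_basis he hf (M := structureSheaf T)
    (fun i ↦ (unitSec ⊤).symm (a i))
  have hgen : IsGen (structureSheaf T) ⊤ (qsec r hf (e j)) := by
    rw [hr, ha]
    exact isGen_one
  have hr' : ∀ i, qsec r hf (e i) = a i • qsec r hf (e j) := by
    intro i
    rw [hr, hr, ha]
    apply (unitSec ⊤).injective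
    rw [unitSec_smul, AddEquiv.apply_symm_apply, AddEquiv.apply_symm_apply, mul_one]
  have hepi : Epi r := epi_of_isGen r fun x ↦ ⟨V, e j, ⊤, hf, trivial, hgen⟩
  obtain ⟨g, hg, -⟩ := hP.existsUnique T f _ r isInvertible_structureSheaf hepi
  have hc := hg.le_chart j hP.isInvertible he hf hgen
  exact ⟨g, hg.choose, hc, fun i ↦ hg.fpull_coord j hf hgen (hr' i) hc⟩

theorem IsProjectiveBundle.lift_ext {g g' : T ⟶ P} (h : g ≫ p = g' ≫ p)
    (hg : ⊤ ≤ g ⁻¹ᵁ chart q e j) (hg' : ⊤ ≤ g' ⁻¹ᵁ chart q e j)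
    (hc : ∀ i, fpull g hg (coord q e j i) = fpull g' hg' (coord q e j i)) : g = g' := by
  have hf : ⊤ ≤ (g ≫ p) ⁻¹ᵁ V := hg.trans (g.preimage_mono (chart_le q e j))
  obtain ⟨r, hr⟩ := exists_pullbackHom_of_basis he hf (M := structureSheaf T)
    (fun i ↦ (unitSec ⊤).symm (fpull g hg (coord q e j i)))
  have hgen : IsGen (structureSheaf T) ⊤ (qsec r hf (e j)) := by
    rw [hr, coord_self, map_one]
    exact isGen_one
  have hr' : ∀ i, qsec r hf (e i) = fpull g hg (coord q e j i) • qsec r hf (e j) := by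
    intro i
    rw [hr, hr, coord_self]
    apply (unitSec ⊤).injective
    rw [unitSec_smul, AddEquiv.apply_symm_apply, AddEquiv.apply_symm_apply, map_one, mul_one]
  have hepi : Epi r := epi_of_isGen r fun x ↦ ⟨V, e j, ⊤, hf, trivial, hgen⟩
  have h1 : Classifies q g r := classifies_of_coords rfl fun x ↦
    ⟨V, ι, _, e, j, ⊤, hf, hg, trivial, he, hgen, hr'⟩
  have h2 : Classifies q g' r := classifies_of_coords h.symm fun x ↦
    ⟨V, ι, _, e, j, ⊤, hf, hg', trivial, he, hgen, fun i ↦ by rw [hr' i, hc]⟩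
  exact (hP.existsUnique T _ _ r isInvertible_structureSheaf hepi).unique h1 h2

end chart

/-! ### Regular functions -/

section regular

variable {X : Scheme.{u}} {U W : X.Opens}

/-- A function all of whose restrictions are not zero divisors. -/
def IsReg (a : Γ(X, U)) : Prop :=
  ∀ (W : X.Opens) (h : W ≤ U) (c : Γ(X, W)), fres h a * c = 0 → c = 0

theorem IsReg.mono {a : Γ(X, U)} (ha : IsReg a) (h : W ≤ U) : IsReg (fres h a) := by
  intro W' h' c hc
  rw [fres_fres] at hc
  exact ha _ _ _ hc

theorem IsReg.of_cover {a : Γ(X, U)}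
    (H : ∀ x ∈ U, ∃ (W : X.Opens) (h : W ≤ U), x ∈ W ∧ IsReg (fres h a)) : IsReg a := by
  intro W h c hc
  refine fun_ext fun x hx ↦ ?_
  obtain ⟨W', h', hx', ha⟩ := H x (h hx)
  refine ⟨W ⊓ W', inf_le_left, ⟨hx, hx'⟩, ?_⟩
  rw [map_zero]
  refine ha _ inf_le_right _ ?_
  have := congrArg (fres (inf_le_left : W ⊓ W' ≤ W)) hc
  rw [map_mul, map_zero, fres_fres] at this
  simpa using this

theorem IsReg.cancel {a : Γ(X, U)} (ha : IsReg a) {b c : Γ(X, U)} (h : a * b = a * c) : b = c := by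
  have := ha U le_rfl (b - c) (by rw [fres_self, mul_sub, h, sub_self])
  exact sub_eq_zero.mp this

theorem IsReg.mem_nonZeroDivisors {a : Γ(X, U)} (ha : IsReg a) : a ∈ nonZeroDivisors Γ(X, U) :=
  mem_nonZeroDivisors_iff_right.mpr fun c hc ↦ ha U le_rfl c (by rw [fres_self, mul_comm, hc])

theorem isReg_of_mul_right {a b : Γ(X, U)} (h : IsReg (a * b)) : IsReg a := by
  intro W hW c hc
  refine h W hW c ?_
  rw [map_mul, mul_right_comm, hc, zero_mul]

theorem IsReg.of_isUnit {a : Γ(X, U)} (h : IsUnit a) : IsReg a := by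
  intro W hW c hc
  exact (h.map (fres hW)).mul_right_eq_zero.mp hc

theorem isReg_of_isAffineOpen (hU : IsAffineOpen U) {a : Γ(X, U)}
    (ha : a ∈ nonZeroDivisors Γ(X, U)) : IsReg a := by
  intro W h c hc
  refine fun_ext fun x hx ↦ ?_
  obtain ⟨b, hb, hxb⟩ := hU.exists_basicOpen_le ⟨x, hx⟩ (h hx)
  refine ⟨X.basicOpen b, hb, hxb, ?_⟩
  have hloc := hU.isLocalization_basicOpen b
  have h1 : fres (X.basicOpen_le b) a ∈ nonZeroDivisors Γ(X, X.basicOpen b) :=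
    IsLocalization.map_nonZeroDivisors_le (Submonoid.powers b) _ ⟨a, ha, rfl⟩
  have h2 := congrArg (fres hb) hc
  rw [map_mul, map_zero, fres_fres, mul_comm] at h2
  rw [map_zero]
  exact (mem_nonZeroDivisors_iff_right.mp h1) _ h2

theorem fun_eq_zero_of_isReg {t : Γ(X, U)} (ht : IsReg t) (h : W ≤ U) {c : Γ(X, W)}
    {W' : X.Opens} (hW' : W ⊓ X.basicOpen t ≤ W') (hW'' : W' ≤ W) (hc : fres hW'' c = 0) :
    c = 0 := by
  refine fun_ext fun x hx ↦ ?_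
  obtain ⟨A, hA, hxA, hAW⟩ := exists_isAffineOpen_mem_and_subset hx
  refine ⟨A, hAW, hxA, ?_⟩
  have hA' : IsAffineOpen A := hA
  have hloc := hA'.isLocalization_basicOpen (fres (hAW.trans h) t)
  have hle : X.basicOpen (fres (hAW.trans h) t) ≤ W' := by
    have : X.basicOpen (fres (hAW.trans h) t) = A ⊓ X.basicOpen t :=
      X.basicOpen_res t (homOfLE (hAW.trans h)).op
    rw [this]
    exact (inf_le_inf_right _ hAW).trans hW'
  have h1 : algebraMap Γ(X, A) Γ(X, X.basicOpen (fres (hAW.trans h) t)) (fres hAW c) = 0 := by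
    have := congrArg (fres hle) hc
    rw [fres_fres, map_zero] at this
    refine Eq.trans ?_ this
    exact fres_fres hAW (X.basicOpen_le _) c
  obtain ⟨⟨_, n, rfl⟩, hn⟩ := (IsLocalization.map_eq_zero_iff (Submonoid.powers
    (fres (hAW.trans h) t)) _ _).mp h1
  rw [map_zero]
  have h2 : ∀ n : ℕ, fres (hAW.trans h) t ^ n * fres hAW c = 0 → fres hAW c = 0 := by
    intro n
    induction n with
    | zero => simp
    | succ k ih =>
      intro h3
      refine ih (ht _ (hAW.trans h) _ ?_)
      rw [← h3]; ring
  exact h2 n hn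

theorem le_closure_basicOpen {t : Γ(X, U)} (ht : IsReg t) {x : X} (hx : x ∈ U) :
    x ∈ closure (X.basicOpen t : Set X) := by
  rw [mem_closure_iff]
  intro O hO hxO
  by_contra hemp
  rw [Set.not_nonempty_iff_eq_empty] at hemp
  let W : X.Opens := ⟨O, hO⟩ ⊓ U
  have h1 : (1 : Γ(X, W)) = 0 := by
    refine fun_eq_zero_of_isReg ht (inf_le_right : W ≤ U) (W' := ⊥) ?_ bot_le ?_
    · intro y hy
      have : y ∈ O ∩ (X.basicOpen t : Set X) := ⟨hy.1.1, hy.2⟩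
      rw [hemp] at this
      exact this
    · exact Subsingleton.elim _ _
  have : Nonempty W := ⟨⟨x, hxO, hx⟩⟩
  have : Nontrivial Γ(X, W) := inferInstance
  exact one_ne_zero h1

end regular

/-! ### Morphisms to affine schemes -/

section spec

variable {X P T : Scheme.{u}}

/-- Functions on the spectrum of a ring. -/
def specFun (A : Type u) [CommRing A] : A →+* Γ(Spec (CommRingCat.of A), ⊤) :=
  (Scheme.ΓSpecIso (CommRingCat.of A)).inv.hom

theorem specFun_bijective (A : Type u) [CommRing A] : Function.Bijective (specFun A) :=
  ConcreteCategory.bijective_of_isIso (Scheme.ΓSpecIso (CommRingCat.of A)).inv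

/-- The morphism to the spectrum given by a ring homomorphism. -/
def toSpec {A : Type u} [CommRing A] (φ : A →+* Γ(T, ⊤)) : T ⟶ Spec (CommRingCat.of A) :=
  T.toSpecΓ ≫ Spec.map (CommRingCat.ofHom φ)

@[simp] theorem fpull_toSpec {A : Type u} [CommRing A] (φ : A →+* Γ(T, ⊤))
    (e : ⊤ ≤ toSpec φ ⁻¹ᵁ ⊤) (a : A) : fpull (toSpec φ) e (specFun A a) = φ a := by
  have h : (Scheme.ΓSpecIso (CommRingCat.of A)).inv ≫ (toSpec φ).appTop = CommRingCat.ofHom φ := by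
    rw [toSpec, Scheme.Hom.comp_appTop, ← Scheme.ΓSpecIso_inv_naturality_assoc]
    simp
  exact (app_eq_fpull (toSpec φ) _).symm.trans (ConcreteCategory.congr_hom h a)

theorem spec_ext {A : Type u} [CommRing A] {g g' : T ⟶ Spec (CommRingCat.of A)}
    (h : ∀ a : A, fpull g (le_refl ⊤) (specFun A a) = fpull g' (le_refl ⊤) (specFun A a)) :
    g = g' := by
  refine ext_to_Spec (R := A) ?_
  ext a
  exact (app_eq_fpull g _).trans ((h a).trans (app_eq_fpull g' _).symm)

theorem affine_ext {V : X.Opens} (hV : IsAffineOpen V) {g g' : T ⟶ X} (e : ⊤ ≤ g ⁻¹ᵁ V)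
    (e' : ⊤ ≤ g' ⁻¹ᵁ V) (h : ∀ a : Γ(X, V), fpull g e a = fpull g' e' a) : g = g' := by
  have key : ∀ (k : T ⟶ X) (ek : ⊤ ≤ k ⁻¹ᵁ V), k = toSpec (fpull k ek) ≫ hV.fromSpec := by
    intro k ek
    have h1 := Scheme.Opens.toSpecΓ_SpecMap_appLE k V ⊤ ek
    have h2 : k.resLE V ⊤ ek ≫ V.ι = (⊤ : T.Opens).ι ≫ k := by simp
    rw [← hV.toSpecΓ_fromSpec, ← Category.assoc, ← h1] at h2
    have : IsIso (⊤ : T.Opens).ι := T.topIso.isIso_hom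
    have h3 : (⊤ : T.Opens).toSpecΓ = (⊤ : T.Opens).ι ≫ T.toSpecΓ := by simp
    rw [h3, Category.assoc, Category.assoc, cancel_epi] at h2
    refine h2.symm.trans ?_
    rw [toSpec, Category.assoc]
    rfl
  rw [key g e, key g' e', RingHom.ext h]

/-- Functions on an open subset, as functions on the open subscheme. -/
def openTop (U : X.Opens) : Γ(X, U) →+* Γ(U.toScheme, ⊤) :=
  fpull U.ι (by rw [Scheme.Opens.ι_preimage_self])

theorem openTop_bijective (U : X.Opens) : Function.Bijective (openTop U) := by
  have h : openTop U = (U.topIso.inv).hom := by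
    ext a
    simp [openTop, fpull]
    rfl
  rw [h]
  exact ConcreteCategory.bijective_of_isIso U.topIso.inv

theorem fpull_fromSpec {V : X.Opens} (hV : IsAffineOpen V) (e : ⊤ ≤ hV.fromSpec ⁻¹ᵁ V)
    (a : Γ(X, V)) : fpull hV.fromSpec e a = specFun Γ(X, V) a := by
  have := hV.fromSpec_app_self
  rw [fpull, Scheme.Hom.appLE, this]
  simp only [CommRingCat.hom_comp, RingHom.comp_apply, specFun]
  rw [← CommRingCat.comp_apply, ← Functor.map_comp]
  exact ConcreteCategory.congr_hom ((Spec Γ(X, V)).presheaf.map_id _) _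

end spec

/-! ### Rings of functions on charts -/

theorem top_le_preimage_top {X Y : Scheme.{u}} (f : X ⟶ Y) : ⊤ ≤ f ⁻¹ᵁ ⊤ := le_rfl

theorem exists_option_equiv {ι : Type} (j : ι) : ∃ (κ : Type) (w : Option κ ≃ ι), w none = j := by
  classical
  exact ⟨_, Equiv.optionSubtypeNe j, Equiv.optionSubtypeNe_none j⟩

section affineChart

variable {P : Scheme.{u}} {U : P.Opens} {A : Type u} [CommRing A]

theorem isAffineOpen_of_section (φ : A →+* Γ(P, U)) (g : Spec (CommRingCat.of A) ⟶ P)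
    (hg : ⊤ ≤ g ⁻¹ᵁ U) (h₁ : ∀ a, fpull g hg (φ a) = specFun A a)
    (h₂ : toSpec ((openTop U).comp φ) ≫ g = U.ι) :
    IsAffineOpen U ∧ Function.Bijective φ := by
  have hr : Set.range g ⊆ Set.range U.ι := by
    rintro _ ⟨x, rfl⟩
    rw [Scheme.Opens.range_ι]
    exact hg (Set.mem_univ x)
  let g' := IsOpenImmersion.lift U.ι g hr
  have hg' : g' ≫ U.ι = g := IsOpenImmersion.lift_fac _ _ _
  have e1 : toSpec ((openTop U).comp φ) ≫ g' = 𝟙 _ := by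
    rw [← cancel_mono U.ι, Category.assoc, hg', h₂, Category.id_comp]
  have hU : (⊤ : U.toScheme.Opens) ≤ U.ι ⁻¹ᵁ U := by rw [Scheme.Opens.ι_preimage_self]
  have e2 : g' ≫ toSpec ((openTop U).comp φ) = 𝟙 _ := by
    refine spec_ext fun a ↦ ?_
    have h3 := fpull_comp g' (toSpec ((openTop U).comp φ)) (top_le_preimage_top _) (top_le_preimage_top _) (specFun A a)
    rw [fpull_toSpec, RingHom.comp_apply, openTop, fpull_comp g' U.ι hU (top_le_preimage_top _)] at h3
    refine h3.symm.trans ?_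
    rw [fpull_congr hg', h₁]
    have : fpull (𝟙 (Spec (CommRingCat.of A))) (top_le_preimage_top _) (specFun A a) = specFun A a := by
      exact (app_eq_fpull (𝟙 _) _).symm
    exact this.symm
  let i : U.toScheme ≅ Spec (CommRingCat.of A) := ⟨toSpec ((openTop U).comp φ), g', e1, e2⟩
  have hi : IsIso i.hom := i.isIso_hom
  have : IsAffine U.toScheme := IsAffine.of_isIso i.hom
  refine ⟨this, ?_⟩
  have h4 : (openTop U) ∘ φ = (i.hom.appTop).hom ∘ specFun A := by
    funext a
    have := fpull_toSpec ((openTop U).comp φ) (top_le_preimage_top _) a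
    exact this.symm.trans (app_eq_fpull i.hom _).symm
  have h5 : Function.Bijective ((openTop U) ∘ φ) := by
    rw [h4]
    have : IsIso i.hom.appTop := inferInstanceAs (IsIso (Scheme.Γ.map i.hom.op))
    exact (ConcreteCategory.bijective_of_isIso i.hom.appTop).comp (specFun_bijective A)
  exact (Function.Bijective.of_comp_iff' (openTop_bijective U) φ).mp h5

end affineChart

section chartRing

variable {X P : Scheme.{u}} {F : X.Modules} {p : P ⟶ X} {L : P.Modules}
  (q : (Scheme.Modules.pullback p).obj F ⟶ L) {V : X.Opens} {ι κ : Type}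
  (e : ι → Γ(F, V)) (w : Option κ ≃ ι)

/-- The map from the polynomial ring in the coordinates to the functions on a chart. -/
def chartHom : MvPolynomial κ Γ(X, V) →+* Γ(P, chart q e (w none)) :=
  MvPolynomial.eval₂Hom (fpull p (chart_le q e (w none)))
    (fun k ↦ coord q e (w none) (w (some k)))

@[simp] theorem chartHom_C (a : Γ(X, V)) :
    chartHom q e w (MvPolynomial.C a) = fpull p (chart_le q e (w none)) a := by
  simp [chartHom]

@[simp] theorem chartHom_X (k : κ) :
    chartHom q e w (MvPolynomial.X k) = coord q e (w none) (w (some k)) := by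
  simp [chartHom]

variable {q e} [Fintype ι]

theorem chart_isAffineOpen_and_bijective (hP : IsProjectiveBundle F p q) (he : IsBasisOn F V e)
    (hV : IsAffineOpen V) :
    IsAffineOpen (chart q e (w none)) ∧ Function.Bijective (chartHom q e w) := by
  let A := MvPolynomial κ Γ(X, V)
  let φ : Γ(X, V) →+* A := MvPolynomial.C
  let f : Spec (CommRingCat.of A) ⟶ X := Spec.map (CommRingCat.ofHom φ) ≫ hV.fromSpec
  have hf0 : ⊤ ≤ hV.fromSpec ⁻¹ᵁ V := hV.fromSpec_preimage_self.ge
  have hf : ⊤ ≤ f ⁻¹ᵁ V := fun x _ ↦ hf0 (x := Spec.map (CommRingCat.ofHom φ) x) trivial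
  have hfa : ∀ a, fpull f hf a = specFun A (φ a) := by
    intro a
    have h1 := fpull_comp (Spec.map (CommRingCat.ofHom φ)) hV.fromSpec hf0 (top_le_preimage_top _) a
    rw [fpull_fromSpec] at h1
    refine h1.symm.trans ?_
    have h2 := ConcreteCategory.congr_hom
      (Scheme.ΓSpecIso_inv_naturality (CommRingCat.ofHom φ)) a
    exact (app_eq_fpull (Spec.map (CommRingCat.ofHom φ)) _).symm.trans h2.symm
  obtain ⟨g, hgf, hg, hgc⟩ := hP.exists_lift (w none) he hf
    (fun i ↦ Option.elim (w.symm i) 1 fun k ↦ specFun A (MvPolynomial.X k)) (by simp)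
  have hg1 : ∀ a, fpull g hg (chartHom q e w a) = specFun A a := by
    intro a
    have : (fpull g hg).comp (chartHom q e w) = specFun A := by
      refine MvPolynomial.ringHom_ext (fun a ↦ ?_) (fun k ↦ ?_)
      · rw [RingHom.comp_apply, chartHom_C, fpull_comp, fpull_congr hgf, hfa]
      · rw [RingHom.comp_apply, chartHom_X, hgc]
        simp
    exact RingHom.congr_fun this a
  have hU : (⊤ : (chart q e (w none)).toScheme.Opens) ≤
      (chart q e (w none)).ι ⁻¹ᵁ (chart q e (w none)) := by rw [Scheme.Opens.ι_preimage_self]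
  refine isAffineOpen_of_section _ g hg hg1 (hP.lift_ext (w none) he ?_ ?_ hU ?_)
  · refine affine_ext hV (by
      rw [Category.assoc, hgf]
      intro x _
      exact hf (x := toSpec ((openTop _).comp (chartHom q e w)) x) trivial)
      (hU.trans ((chart q e (w none)).ι.preimage_mono (chart_le q e (w none)))) fun a ↦ ?_
    rw [fpull_congr (show (toSpec ((openTop _).comp (chartHom q e w)) ≫ g) ≫ p =
      toSpec ((openTop _).comp (chartHom q e w)) ≫ f by rw [Category.assoc, hgf])]
    have h3 := fpull_comp (toSpec ((openTop _).comp (chartHom q e w))) f hf (top_le_preimage_top _) a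
    refine h3.symm.trans ?_
    rw [hfa, fpull_toSpec, RingHom.comp_apply, chartHom_C, openTop, fpull_comp]
  · intro x _
    exact hg (x := toSpec ((openTop _).comp (chartHom q e w)) x) trivial
  · intro i
    have h3 := fpull_comp (toSpec ((openTop _).comp (chartHom q e w))) g hg (top_le_preimage_top _)
      (coord q e (w none) i)
    refine h3.symm.trans ?_
    obtain ⟨k, rfl⟩ := w.surjective i
    cases k with
    | none => rw [coord_self, map_one, map_one, map_one]
    | some k =>
      rw [hgc, Equiv.symm_apply_apply, Option.elim_some, fpull_toSpec, RingHom.comp_apply,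
        chartHom_X, openTop]

theorem chart_isAffineOpen (hP : IsProjectiveBundle F p q) (he : IsBasisOn F V e)
    (hV : IsAffineOpen V) (j : ι) : IsAffineOpen (chart q e j) := by
  obtain ⟨κ, w, rfl⟩ := exists_option_equiv j
  exact (chart_isAffineOpen_and_bijective w hP he hV).1

theorem chart_ringHom_ext (hP : IsProjectiveBundle F p q) (he : IsBasisOn F V e)
    (hV : IsAffineOpen V) {j : ι} {S : Type*} [CommRing S] {ψ ψ' : Γ(P, chart q e j) →+* S}
    (h : ∀ a, ψ (fpull p (chart_le q e j) a) = ψ' (fpull p (chart_le q e j) a))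
    (h' : ∀ i, ψ (coord q e j i) = ψ' (coord q e j i)) : ψ = ψ' := by
  obtain ⟨κ, w, rfl⟩ := exists_option_equiv j
  have hb := (chart_isAffineOpen_and_bijective w hP he hV).2.surjective
  have : ψ.comp (chartHom q e w) = ψ'.comp (chartHom q e w) :=
    MvPolynomial.ringHom_ext (fun a ↦ by simp [h]) (fun k ↦ by simp [h'])
  ext a
  obtain ⟨b, rfl⟩ := hb a
  exact RingHom.congr_fun this b

/-- Ring homomorphisms out of the functions on a chart. -/
theorem exists_chart_ringHom (hP : IsProjectiveBundle F p q) (he : IsBasisOn F V e)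
    (hV : IsAffineOpen V) {j : ι} {S : Type*} [CommRing S] (φ : Γ(X, V) →+* S) (a : ι → S)
    (ha : a j = 1) : ∃ ψ : Γ(P, chart q e j) →+* S,
      (∀ b, ψ (fpull p (chart_le q e j) b) = φ b) ∧ ∀ i, ψ (coord q e j i) = a i := by
  obtain ⟨κ, w, rfl⟩ := exists_option_equiv j
  have hb := (chart_isAffineOpen_and_bijective w hP he hV).2
  let E := RingEquiv.ofBijective _ hb
  refine ⟨(MvPolynomial.eval₂Hom φ (fun k ↦ a (w (some k)))).comp E.symm.toRingHom, ?_, ?_⟩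
  · intro b
    have : E.symm (fpull p (chart_le q e (w none)) b) = MvPolynomial.C b := by
      rw [RingEquiv.symm_apply_eq]; exact (chartHom_C q e w b).symm
    simp [this]
  · intro i
    obtain ⟨k, rfl⟩ := w.surjective i
    cases k with
    | none => rw [coord_self, map_one, ha]
    | some k =>
      have : E.symm (coord q e (w none) (w (some k))) = MvPolynomial.X k := by
        rw [RingEquiv.symm_apply_eq]; exact (chartHom_X q e w k).symm
      simp [this]

theorem isReg_fpull_chart (hP : IsProjectiveBundle F p q) (he : IsBasisOn F V e)
    (hV : IsAffineOpen V) {t : Γ(X, V)} (ht : t ∈ nonZeroDivisors Γ(X, V)) (j : ι) :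
    IsReg (fpull p (chart_le q e j) t) := by
  obtain ⟨κ, w, rfl⟩ := exists_option_equiv j
  obtain ⟨ha, hb⟩ := chart_isAffineOpen_and_bijective w hP he hV
  refine isReg_of_isAffineOpen ha (mem_nonZeroDivisors_iff_right.mpr fun c hc ↦ ?_)
  obtain ⟨P, rfl⟩ := hb.2 c
  rw [← chartHom_C q e w, ← map_mul] at hc
  have h1 := hb.1 (hc.trans (map_zero _).symm)
  have h2 : P = 0 := by
    ext m
    have := congrArg (MvPolynomial.coeff m) h1
    rw [mul_comm, MvPolynomial.coeff_C_mul, MvPolynomial.coeff_zero, mul_comm] at this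
    rw [MvPolynomial.coeff_zero]
    exact (mem_nonZeroDivisors_iff_right.mp ht) _ this
  rw [h2, map_zero]

end chartRing

/-! ### Sections of associated sheaves -/

section sheafify

variable {X : Scheme.{u}} (P : X.PresheafOfModules) {U W : X.Opens}

/-- The module of sections of a presheaf of modules. -/
def PSec (U : X.Opens) : Type u := P.obj (op U)

instance : AddCommGroup (PSec P U) := inferInstanceAs (AddCommGroup (P.obj (op U)))

instance : Module Γ(X, U) (PSec P U) :=
  inferInstanceAs (Module (X.ringCatSheaf.obj.obj (op U)) (P.obj (op U)))

/-- Restriction of sections of a presheaf of modules. -/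
def pres (h : W ≤ U) : PSec P U →+ PSec P W := (P.presheaf.map (homOfLE h).op).hom

theorem pres_smul (h : W ≤ U) (a : Γ(X, U)) (s : PSec P U) :
    pres P h (a • s) = fres h a • pres P h s :=
  PresheafOfModules.map_smul P (homOfLE h).op a s

theorem pres_pres (h : W ≤ U) {W' : X.Opens} (h' : W' ≤ W) (s : PSec P U) :
    pres P h' (pres P h s) = pres P (h'.trans h) s :=
  (ConcreteCategory.congr_hom (P.presheaf.map_comp (homOfLE h).op (homOfLE h').op) s).symm

/-- The section of the associated sheaf defined by a section of a presheaf. -/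
def shf (U : X.Opens) : PSec P U →+ Γ(sheafify P, U) :=
  (((PresheafOfModules.toPresheaf _).map (toSheafify P)).app (op U)).hom

theorem shf_smul (a : Γ(X, U)) (s : PSec P U) : shf P U (a • s) = a • shf P U s :=
  ((toSheafify P).app (op U)).hom.map_smul a s

theorem mres_shf (h : W ≤ U) (s : PSec P U) :
    mres (sheafify P) h (shf P U s) = shf P W (pres P h s) :=
  (ConcreteCategory.congr_hom (((PresheafOfModules.toPresheaf _).map
    (toSheafify P)).naturality (homOfLE h).op) s).symm

theorem toSheafify_eq : (PresheafOfModules.toPresheaf _).map (toSheafify P) =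
    CategoryTheory.toSheafify (Opens.grothendieckTopology X) P.presheaf := by
  refine (PresheafOfModules.toPresheaf_map_sheafificationHomEquiv_def (𝟙 X.ringCatSheaf.obj)
    (𝟙 ((PresheafOfModules.sheafification (𝟙 X.ringCatSheaf.obj)).obj P))).trans ?_
  exact Category.comp_id _

theorem exists_shf (s : Γ(sheafify P, U)) {x : X} (hx : x ∈ U) :
    ∃ (W : X.Opens) (h : W ≤ U), x ∈ W ∧ ∃ a, shf P W a = mres _ h s := by
  have h1 := Presheaf.imageSieve_mem (Opens.grothendieckTopology X)
    (CategoryTheory.toSheafify (Opens.grothendieckTopology X) P.presheaf) (U := op U) s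
  obtain ⟨W, f, ⟨a, ha⟩, hxW⟩ := h1 x hx
  refine ⟨W, leOfHom f, hxW, a, ?_⟩
  rw [shf, toSheafify_eq]
  exact ha

theorem shf_eq_zero {a : PSec P U} (h : shf P U a = 0) {x : X} (hx : x ∈ U) :
    ∃ (W : X.Opens) (h : W ≤ U), x ∈ W ∧ pres P h a = 0 := by
  rw [shf, toSheafify_eq] at h
  have h1 := Presheaf.equalizerSieve_mem (Opens.grothendieckTopology X)
    (CategoryTheory.toSheafify (Opens.grothendieckTopology X) P.presheaf) (X := op U)
    (x := (a : ToType (P.presheaf.obj (op U)))) (y := (0 : PSec P U)) (by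
      refine h.trans (map_zero _).symm)
  obtain ⟨W, f, hf, hxW⟩ := h1 x hx
  exact ⟨W, leOfHom f, hxW, hf.trans (map_zero (pres P (leOfHom f)))⟩

theorem shf_sum {ι : Type*} [Fintype ι] (c : ι → Γ(X, U)) (s : ι → PSec P U) :
    shf P U (∑ i, c i • s i) = ∑ i, c i • shf P U (s i) := by
  rw [map_sum]
  exact Finset.sum_congr rfl fun i _ ↦ shf_smul P _ _

theorem sheafifyDesc_shf {M : X.Modules} (φ : P ⟶ M.val) (s : PSec P U) :
    (sheafifyDesc φ).app U (shf P U s) = (φ.app (op U)).hom s := by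
  have h1 : toSheafify P ≫ (sheafifyDesc φ).val = φ := by
    have h2 := (PresheafOfModules.sheafificationHomEquiv (𝟙 X.ringCatSheaf.obj) (P := P)
      (F := M)).apply_symm_apply φ
    refine Eq.trans ?_ h2
    apply (PresheafOfModules.toPresheaf _).map_injective
    rw [Functor.map_comp, toSheafify_eq]
    exact (PresheafOfModules.toPresheaf_map_sheafificationHomEquiv_def (𝟙 X.ringCatSheaf.obj) _).symm
  conv_rhs => rw [← h1]
  rfl

end sheafify

/-! ### Bases of the sheaf of differentials -/

section differentials

variable {X : Scheme.{u}} {R : CommRingCat.{u}} (s : X ⟶ Spec R) {U V W : X.Opens}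

/-- The structure of an algebra over the base on functions. -/
abbrev constAlgebra (U : X.Opens) : Algebra R Γ(X, U) := ((constHom s).app (op U)).hom.toAlgebra

/-- Kähler differentials of the ring of functions. -/
abbrev Om (U : X.Opens) : Type u :=
  letI := constAlgebra s U
  KaehlerDifferential R Γ(X, U)

/-- The differential in `Om`. -/
def omD (a : Γ(X, U)) : Om s U :=
  letI := constAlgebra s U
  KaehlerDifferential.D R Γ(X, U) a

/-- The section of the sheaf of differentials given by a Kähler differential. -/
def omSec (U : X.Opens) : Om s U →+ Γ(differentials s, U) := shf (differentialsPresheaf s) U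

theorem omSec_smul (a : Γ(X, U)) (ω : Om s U) : omSec s U (a • ω) = a • omSec s U ω :=
  shf_smul (differentialsPresheaf s) a ω

theorem omSec_omD (a : Γ(X, U)) : omSec s U (omD s a) = dSection s U a := rfl

/-- Restriction of Kähler differentials. -/
def omRes (h : W ≤ U) : Om s U →+ Om s W := pres (differentialsPresheaf s) h

theorem omRes_smul (h : W ≤ U) (a : Γ(X, U)) (ω : Om s U) :
    omRes s h (a • ω) = fres h a • omRes s h ω := pres_smul (differentialsPresheaf s) h a ω

theorem omRes_omD (h : W ≤ U) (a : Γ(X, U)) : omRes s h (omD s a) = omD s (fres h a) :=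
  PresheafOfModules.DifferentialsConstruction.relativeDifferentials'_map_d (constHom s)
    (homOfLE h).op a

theorem mres_omSec (h : W ≤ U) (ω : Om s U) :
    mres _ h (omSec s U ω) = omSec s W (omRes s h ω) := mres_shf (differentialsPresheaf s) h ω

theorem constHom_fres (h : W ≤ U) (a : R) :
    fres h ((constHom s).app (op U) a) = (constHom s).app (op W) a :=
  (ConcreteCategory.congr_hom ((constHom s).naturality (homOfLE h).op) a).symm

theorem omRes_bijective_sum {ι : Type} [Fintype ι] (hV : IsAffineOpen V) (b : Module.Basis ι Γ(X, V) (Om s V))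
    (g : Γ(X, V)) : Function.Bijective (fun c : ι → Γ(X, X.basicOpen g) ↦
      ∑ i, c i • omRes s (X.basicOpen_le g) (b i)) := by
  letI := constAlgebra s V
  letI := constAlgebra s (X.basicOpen g)
  letI : Algebra Γ(X, V) Γ(X, X.basicOpen g) := (fres (X.basicOpen_le g)).toAlgebra
  haveI : IsLocalization.Away g Γ(X, X.basicOpen g) := hV.isLocalization_basicOpen g
  haveI : IsScalarTower R Γ(X, V) Γ(X, X.basicOpen g) :=
    IsScalarTower.of_algebraMap_eq fun a ↦ (constHom_fres s (X.basicOpen_le g) a).symm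
  have key : ∀ ω : Om s V, omRes s (X.basicOpen_le g) ω =
      KaehlerDifferential.map R R Γ(X, V) Γ(X, X.basicOpen g) ω := by
    intro ω
    have h1 : ω ∈ Submodule.span Γ(X, V) (Set.range (KaehlerDifferential.D R Γ(X, V))) := by
      rw [KaehlerDifferential.span_range_derivation]; trivial
    induction h1 using Submodule.span_induction with
    | mem x hx =>
      obtain ⟨a, rfl⟩ := hx
      refine (omRes_omD s (X.basicOpen_le g) a).trans ?_
      rw [KaehlerDifferential.map_D]
      rfl
    | zero => rw [map_zero, map_zero]
    | add x y _ _ hx hy => rw [map_add, map_add, hx, hy]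
    | smul a x _ hx =>
      rw [omRes_smul, hx, map_smul]
      rfl
  let b' := b.ofIsLocalizedModule Γ(X, X.basicOpen g) (Submonoid.powers g)
    (KaehlerDifferential.map R R Γ(X, V) Γ(X, X.basicOpen g))
  have h2 : (fun c : ι → Γ(X, X.basicOpen g) ↦ ∑ i, c i • omRes s (X.basicOpen_le g) (b i)) =
      b'.equivFun.symm := by
    funext c
    rw [Module.Basis.equivFun_symm_apply]
    refine Finset.sum_congr rfl fun i _ ↦ ?_
    rw [key, Module.Basis.ofIsLocalizedModule_apply]
  rw [h2]
  exact b'.equivFun.symm.bijective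

theorem omRes_omRes (h : W ≤ U) {W' : X.Opens} (h' : W' ≤ W) (ω : Om s U) :
    omRes s h' (omRes s h ω) = omRes s (h'.trans h) ω :=
  pres_pres (differentialsPresheaf s) h h' ω

theorem isBasisOn_omSec {ι : Type} [Fintype ι] (hV : IsAffineOpen V)
    (b : Module.Basis ι Γ(X, V) (Om s V)) :
    IsBasisOn (differentials s) V (fun i ↦ omSec s V (b i)) := by
  refine isBasisOn_of_local ?_ ?_
  · intro W h c hc x hx
    simp only [mres_omSec] at hc
    have h0 : shf (differentialsPresheaf s) W (∑ i, c i • omRes s h (b i)) = 0 :=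
      (shf_sum _ _ _).trans hc
    obtain ⟨W', hW', hxW', h1⟩ := shf_eq_zero _ h0 hx
    obtain ⟨g, hg, hxg⟩ := hV.exists_basicOpen_le ⟨x, hxW'⟩ (h hx)
    refine ⟨X.basicOpen g, hg.trans hW', hxg, fun i ↦ ?_⟩
    have h2 := congrArg (omRes s hg) h1
    have h3 : ∀ i, omRes s hg (omRes s hW' (c i • omRes s h (b i))) =
        fres (hg.trans hW') (c i) • omRes s (X.basicOpen_le g) (b i) := by
      intro i
      rw [omRes_smul, omRes_smul, fres_fres, omRes_omRes, omRes_omRes]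
    have h4 : ∑ i, fres (hg.trans hW') (c i) • omRes s (X.basicOpen_le g) (b i) = 0 := by
      refine Eq.trans ?_ (h2.trans (map_zero (omRes s hg)))
      have h5 : pres (differentialsPresheaf s) hW' (∑ i, c i • omRes s h (b i)) =
        omRes s hW' (∑ i, c i • omRes s h (b i)) := rfl
      rw [h5, map_sum, map_sum]
      exact Finset.sum_congr rfl fun i _ ↦ (h3 i).symm
    have h5 := (omRes_bijective_sum s hV b g).injective
      (a₁ := fun i ↦ fres (hg.trans hW') (c i)) (a₂ := 0) (by simpa using h4)
    exact congrFun h5 i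
  · intro W h m x hx
    obtain ⟨W', hW', hxW', a, ha⟩ := exists_shf _ m hx
    obtain ⟨g, hg, hxg⟩ := hV.exists_basicOpen_le ⟨x, hxW'⟩ (h hx)
    obtain ⟨c, hc⟩ := (omRes_bijective_sum s hV b g).surjective (omRes s hg a)
    refine ⟨X.basicOpen g, hg.trans hW', X.basicOpen_le g, hxg, c, ?_⟩
    have h1 : mres (differentials s) hg (omSec s W' a) =
      mres (differentials s) hg (mres (differentials s) hW' m) := congrArg _ ha
    rw [mres_mres] at h1
    refine h1.symm.trans ((mres_omSec s hg a).trans ?_)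
    rw [← hc, map_sum]
    exact Finset.sum_congr rfl fun i _ ↦ by rw [omSec_smul, mres_omSec]

end differentials

/-! ### Zero divisors in smooth algebras over a field -/

section smoothAlgebra

open TensorProduct

theorem exists_notMem_of_mul_eq_zero_of_etale {A S : Type u} [CommRing A] [IsDomain A]
    [IsIntegrallyClosed A] [CommRing S] [Algebra A S] [Algebra.Etale A S] {a b : S}
    (hab : a * b = 0) (p : Ideal S) [p.IsPrime] : ∃ s ∉ p, s * a = 0 ∨ s * b = 0 := by
  let K := FractionRing A
  obtain ⟨I, _, k, _, _, e, -⟩ := (Algebra.Etale.iff_exists_algEquiv_prod K (K ⊗[A] S)).mp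
    inferInstance
  have hvn : ∀ t : S ⊗[A] K, ∃ t', t * t' * t = t := by
    intro t
    let E : S ⊗[A] K ≃+* Π i, k i := (Algebra.TensorProduct.comm A S K).toRingEquiv.trans e.toRingEquiv
    refine ⟨E.symm (fun i ↦ (E t i)⁻¹), E.injective ?_⟩
    rw [map_mul, map_mul, RingEquiv.apply_symm_apply]
    funext i
    by_cases h : E t i = 0
    · simp [h]
    · simp [h]
  have hinj : Function.Injective (algebraMap S (S ⊗[A] K)) := by
    have : Module.Flat A S := inferInstance
    exact Algebra.TensorProduct.includeLeft_injective (R := A) (S := S) (A := S) (B := K)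
      (IsFractionRing.injective A K)
  obtain ⟨t', ht'⟩ := hvn (algebraMap S _ a)
  have hint : IsIntegral S (algebraMap S (S ⊗[A] K) a * t') := by
    refine ⟨Polynomial.X ^ 2 - Polynomial.X, by monicity!, ?_⟩
    rw [← Polynomial.aeval_def]
    simp only [map_sub, map_pow, Polynomial.aeval_X]
    rw [pow_two, ← mul_assoc, ht', sub_self]
  obtain ⟨z, hz⟩ := (TensorProduct.toIntegralClosure_bijective_of_smooth (R := A) (S := S)
    (B := K)).surjective ⟨_, hint⟩
  have hz' : ∃ c : S, algebraMap S (S ⊗[A] K) c =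
      (TensorProduct.toIntegralClosure A S K z : S ⊗[A] K) := by
    clear hz
    induction z with
    | zero => exact ⟨0, by simp⟩
    | add x y hx hy =>
      obtain ⟨c, hc⟩ := hx
      obtain ⟨d, hd⟩ := hy
      exact ⟨c + d, by rw [map_add, map_add, hc, hd]; rfl⟩
    | tmul x y =>
      obtain ⟨c, hc⟩ := IsIntegrallyClosed.isIntegral_iff.mp y.2
      refine ⟨c • x, ?_⟩
      have : ((TensorProduct.toIntegralClosure A S K (x ⊗ₜ y) : _) : S ⊗[A] K) = x ⊗ₜ y.1 := rfl
      rw [this, ← hc, Algebra.TensorProduct.algebraMap_apply, Algebra.algebraMap_eq_smul_one c,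
        ← TensorProduct.smul_tmul]
      rfl
  obtain ⟨c, hc⟩ := hz'
  have hc' : algebraMap S (S ⊗[A] K) c = algebraMap S (S ⊗[A] K) a * t' := by
    rw [hc, hz]
  have h1 : c * a = a := hinj (by rw [map_mul, hc', ht'])
  have h2 : c * b = 0 := hinj (by
    rw [map_mul, hc', mul_right_comm, ← map_mul, hab, map_zero, zero_mul])
  by_cases hcp : c ∈ p
  · refine ⟨1 - c, fun h ↦ (Ideal.IsPrime.ne_top ‹_›) ((Ideal.eq_top_iff_one p).mpr ?_), Or.inl ?_⟩
    · simpa using p.add_mem h hcp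
    · rw [sub_mul, one_mul, h1, sub_self]
  · exact ⟨c, hcp, Or.inr h2⟩

theorem exists_notMem_of_mul_eq_zero_of_smooth {K S : Type u} [Field K] [CommRing S] [Algebra K S]
    [Algebra.Smooth K S] {a b : S} (hab : a * b = 0) (p : Ideal S) [p.IsPrime] :
    ∃ s ∉ p, s * a = 0 ∨ s * b = 0 := by
  obtain ⟨f, hf, hS⟩ := Algebra.IsSmoothAt.exists_notMem_isStandardSmooth K p
  obtain ⟨n, g, -, hg⟩ := RingHom.IsStandardSmooth.exists_etale_mvPolynomial
    (f := algebraMap K (Localization.Away f)) (by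
      rw [RingHom.isStandardSmooth_algebraMap]; exact hS)
  letI := g.toAlgebra
  have : Algebra.Etale (MvPolynomial (Fin n) K) (Localization.Away f) := hg
  have hdisj : Disjoint (Submonoid.powers f : Set S) (p : Set S) := by
    rw [Set.disjoint_left]
    rintro _ ⟨m, rfl⟩ h
    exact hf (Ideal.IsPrime.mem_of_pow_mem ‹_› _ h)
  have hp := IsLocalization.isPrime_of_isPrime_disjoint (Submonoid.powers f)
    (Localization.Away f) p ‹_› hdisj
  obtain ⟨s, hs, h⟩ := exists_notMem_of_mul_eq_zero_of_etale (A := MvPolynomial (Fin n) K)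
    (a := algebraMap S (Localization.Away f) a) (b := algebraMap S (Localization.Away f) b)
    (by rw [← map_mul, hab, map_zero]) (p.map (algebraMap S (Localization.Away f)))
  obtain ⟨⟨s', m⟩, hs'⟩ := IsLocalization.surj (Submonoid.powers f) s
  have hs'p : s' ∉ p := by
    intro h'
    have h3 : s * algebraMap S (Localization.Away f) m ∈ p.map (algebraMap S _) := by
      rw [hs']; exact Ideal.mem_map_of_mem _ h'
    rcases hp.mem_or_mem h3 with h4 | h4
    · exact hs h4
    · refine hp.ne_top (Ideal.eq_top_of_isUnit_mem _ h4 (IsLocalization.map_units _ m))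
  have key : ∀ x : S, s * algebraMap S (Localization.Away f) x = 0 → ∃ s ∉ p, s * x = 0 := by
    intro x hx
    have h3 : algebraMap S (Localization.Away f) (s' * x) = 0 := by
      rw [map_mul, ← hs', mul_right_comm, hx, zero_mul]
    obtain ⟨⟨_, l, rfl⟩, hl⟩ := (IsLocalization.map_eq_zero_iff (Submonoid.powers f) _ _).mp h3
    refine ⟨f ^ l * s', fun h4 ↦ ?_, by rw [mul_assoc]; exact hl⟩
    rcases Ideal.IsPrime.mem_or_mem ‹_› h4 with h5 | h5
    · exact hf (Ideal.IsPrime.mem_of_pow_mem ‹_› _ h5)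
    · exact hs'p h5
  rcases h with h | h
  · obtain ⟨s, hs, h⟩ := key a h
    exact ⟨s, hs, Or.inl h⟩
  · obtain ⟨s, hs, h⟩ := key b h
    exact ⟨s, hs, Or.inr h⟩

/-- The split conormal sequence of a principal ideal, in terms of bases. -/
theorem exists_basis_of_conormal {R A B : Type u} [CommRing R] [CommRing A] [CommRing B]
    [Algebra R A] [Algebra A B] [Algebra R B] [IsScalarTower R A B]
    [Algebra.FormallySmooth R A] [Algebra.FormallySmooth R B]
    (hs : Function.Surjective (algebraMap A B)) {t : A} (ht : t ∈ nonZeroDivisors A)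
    (hk : RingHom.ker (algebraMap A B) = Ideal.span {t}) {κ : Type} [Fintype κ]
    (b : Module.Basis κ B (Ω[B⁄R])) (ω : κ → Ω[A⁄R])
    (hω : ∀ k, KaehlerDifferential.map R R A B (ω k) = b k) :
    ∃ e : Module.Basis (Option κ) B (B ⊗[A] Ω[A⁄R]),
      e none = 1 ⊗ₜ KaehlerDifferential.D R A t ∧ ∀ k, e (some k) = 1 ⊗ₜ ω k := by
  obtain ⟨l, hl⟩ := (Algebra.FormallySmooth.iff_split_injection (R := R) (P := A) hs).mp ‹_›
  have htk : t ∈ RingHom.ker (algebraMap A B) := by rw [hk]; exact Ideal.mem_span_singleton_self t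
  let e : Option κ → B ⊗[A] Ω[A⁄R] :=
    fun o ↦ Option.elim o (1 ⊗ₜ KaehlerDifferential.D R A t) (fun k ↦ 1 ⊗ₜ ω k)
  have hm : ∀ k, KaehlerDifferential.mapBaseChange R A B (1 ⊗ₜ ω k) = b k := by
    intro k
    rw [KaehlerDifferential.mapBaseChange_tmul, hω, one_smul]
  have hm0 : KaehlerDifferential.mapBaseChange R A B (1 ⊗ₜ KaehlerDifferential.D R A t) = 0 := by
    rw [KaehlerDifferential.mapBaseChange_tmul, KaehlerDifferential.map_D, RingHom.mem_ker.mp htk,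
      map_zero, smul_zero]
  have hli : LinearIndependent B e := by
    rw [Fintype.linearIndependent_iff]
    intro c hc
    rw [Fintype.sum_option] at hc
    have h1 := congrArg (KaehlerDifferential.mapBaseChange R A B) hc
    simp only [map_add, map_smul, map_sum, map_zero, e, Option.elim, hm, hm0, smul_zero,
      zero_add] at h1
    have h2 := Fintype.linearIndependent_iff.mp b.linearIndependent (fun k ↦ c (some k)) h1
    simp only [h2, zero_smul, Finset.sum_const_zero, add_zero, e, Option.elim] at hc
    obtain ⟨a, ha⟩ := hs (c none)
    have h3 : a • KaehlerDifferential.kerCotangentToTensor R A B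
        ((RingHom.ker (algebraMap A B)).toCotangent ⟨t, htk⟩) = 0 := by
      rw [KaehlerDifferential.kerCotangentToTensor_toCotangent, ← algebraMap_smul B a, ha]
      exact hc
    have h4 := congrArg l h3
    rw [map_zero, map_smul] at h4
    have h5 := LinearMap.congr_fun hl ((RingHom.ker (algebraMap A B)).toCotangent ⟨t, htk⟩)
    rw [LinearMap.comp_apply, LinearMap.id_apply] at h5
    rw [h5, ← map_smul, Ideal.toCotangent_eq_zero] at h4
    have h6 : a * t ∈ Ideal.span {t} ^ 2 := by rw [← hk]; exact h4
    rw [Ideal.span_singleton_pow, Ideal.mem_span_singleton] at h6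
    obtain ⟨d, hd⟩ := h6
    have h7 : a = t * d := by
      have : (a - t * d) * t = 0 := by rw [sub_mul, hd]; ring
      exact sub_eq_zero.mp ((mem_nonZeroDivisors_iff_right.mp ht) _ this)
    have h8 : c none = 0 := by
      rw [← ha, h7, map_mul, RingHom.mem_ker.mp htk, zero_mul]
    rintro (_ | k)
    · exact h8
    · exact h2 k
  have hsp : ⊤ ≤ Submodule.span B (Set.range e) := by
    intro x _
    obtain ⟨c, hc⟩ : ∃ c : κ → B, ∑ k, c k • b k = KaehlerDifferential.mapBaseChange R A B x :=
      ⟨_, b.sum_repr _⟩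
    have h1 : KaehlerDifferential.mapBaseChange R A B (x - ∑ k, c k • e (some k)) = 0 := by
      simp only [map_sub, map_sum, map_smul, e, Option.elim, hm, hc, sub_self]
    obtain ⟨y, hy⟩ := (KaehlerDifferential.exact_kerCotangentToTensor_mapBaseChange R A B hs _).mp h1
    obtain ⟨⟨z, hz⟩, rfl⟩ := Ideal.toCotangent_surjective _ y
    rw [KaehlerDifferential.kerCotangentToTensor_toCotangent] at hy
    have hz' := hz
    rw [hk, Ideal.mem_span_singleton] at hz'
    obtain ⟨a, ha⟩ := hz'
    have h2 : (1 : B) ⊗ₜ[A] KaehlerDifferential.D R A z = algebraMap A B a • e none := by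
      have : algebraMap A B t = 0 := RingHom.mem_ker.mp htk
      simp only [ha, Derivation.leibniz, TensorProduct.tmul_add, e, Option.elim]
      rw [← TensorProduct.smul_tmul, ← TensorProduct.smul_tmul, TensorProduct.smul_tmul',
        Algebra.smul_def, this, Algebra.smul_def]
      simp
    have h3 : x = algebraMap A B a • e none + ∑ k, c k • e (some k) := by
      rw [← h2]
      exact (sub_eq_iff_eq_add.mp hy.symm)
    rw [h3]
    refine Submodule.add_mem _ (Submodule.smul_mem _ _ (Submodule.subset_span ⟨_, rfl⟩))
      (Submodule.sum_mem _ fun k _ ↦ Submodule.smul_mem _ _ (Submodule.subset_span ⟨_, rfl⟩))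
  exact ⟨Module.Basis.mk hli hsp, by simp [e], fun k ↦ by simp [e]⟩

end smoothAlgebra

/-! ### Local equations of divisors -/

section eqn

variable {X D : Scheme.{u}} {i : D ⟶ X} {V W : X.Opens}

/-- `t` is a regular local equation of the closed subscheme `i : D ⟶ X` on `V`. -/
structure IsEqn (i : D ⟶ X) (V : X.Opens) (t : Γ(X, V)) : Prop where
  isReg : IsReg t
  zero : fpull i (le_refl (i ⁻¹ᵁ V)) t = 0
  exists_mul : ∀ (W : X.Opens) (h : W ≤ V) (f : Γ(X, W)), fpull i (le_refl (i ⁻¹ᵁ W)) f = 0 →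
    ∃ g, f = fres h t * g

theorem IsEqn.mono {t : Γ(X, V)} (ht : IsEqn i V t) (h : W ≤ V) : IsEqn i W (fres h t) := by
  refine ⟨ht.isReg.mono h, ?_, fun W' h' f hf ↦ ?_⟩
  · have := congrArg (fres (i.preimage_mono h)) ht.zero
    rw [fres_fpull, map_zero] at this
    rwa [fpull_fres]
  · obtain ⟨g, hg⟩ := ht.exists_mul W' (h'.trans h) f hf
    exact ⟨g, by rw [fres_fres, hg]⟩

theorem mem_basicOpen_iff {U : X.Opens} (hU : IsAffineOpen U) {x : X} (hx : x ∈ U)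
    (f : Γ(X, U)) : x ∈ X.basicOpen f ↔ f ∉ (hU.primeIdealOf ⟨x, hx⟩).asIdeal := by
  have h1 : hU.fromSpec (hU.primeIdealOf ⟨x, hx⟩) = x := hU.fromSpec_primeIdealOf ⟨x, hx⟩
  have h2 := hU.fromSpec_preimage_basicOpen f
  have h3 : hU.primeIdealOf ⟨x, hx⟩ ∈ hU.fromSpec ⁻¹ᵁ X.basicOpen f ↔
      hU.primeIdealOf ⟨x, hx⟩ ∈ PrimeSpectrum.basicOpen f := by
    rw [h2]; exact Iff.rfl
  have h4 : hU.primeIdealOf ⟨x, hx⟩ ∈ hU.fromSpec ⁻¹ᵁ X.basicOpen f ↔ x ∈ X.basicOpen f := by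
    change hU.fromSpec (hU.primeIdealOf ⟨x, hx⟩) ∈ X.basicOpen f ↔ _
    rw [h1]
  rw [← h4, h3]
  rfl

theorem exists_pow_mul_eq_fres (hU : IsAffineOpen V) (f : Γ(X, V)) (a : Γ(X, X.basicOpen f)) :
    ∃ (n : ℕ) (b : Γ(X, V)), fres (X.basicOpen_le f) f ^ n * a = fres (X.basicOpen_le f) b := by
  have := hU.isLocalization_basicOpen f
  obtain ⟨⟨b, _, n, rfl⟩, h⟩ := IsLocalization.surj (Submonoid.powers f) a
  refine ⟨n, b, ?_⟩
  rw [mul_comm, ← map_pow]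
  exact h

theorem exists_pow_mul_eq_zero (hU : IsAffineOpen V) (f b : Γ(X, V))
    (h : fres (X.basicOpen_le f) b = 0) : ∃ n : ℕ, f ^ n * b = 0 := by
  have := hU.isLocalization_basicOpen f
  obtain ⟨⟨_, n, rfl⟩, h⟩ := (IsLocalization.map_eq_zero_iff (Submonoid.powers f)
    Γ(X, X.basicOpen f) b).mp h
  exact ⟨n, h⟩

/-- The functions `g` on `V` vanish on the closed subscheme and locally generate its ideal. -/
structure IsIdealGen (i : D ⟶ X) (V : X.Opens) {ι : Type*} [Fintype ι] (g : ι → Γ(X, V)) :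
    Prop where
  zero : ∀ k, fpull i (le_refl (i ⁻¹ᵁ V)) (g k) = 0
  exists_sum : ∀ (W : X.Opens) (h : W ≤ V) (f : Γ(X, W)), fpull i (le_refl (i ⁻¹ᵁ W)) f = 0 →
    ∀ x ∈ W, ∃ (W' : X.Opens) (h' : W' ≤ W) (c : ι → Γ(X, W')), x ∈ W' ∧
      fres h' f = ∑ k, c k * fres (h'.trans h) (g k)

theorem isIdealGen_of_ker [IsAffineHom i] (hV : IsAffineOpen V) {ι : Type*} [Fintype ι]
    {g : ι → Γ(X, V)} (hk : ∀ f : Γ(X, V), fpull i (le_refl (i ⁻¹ᵁ V)) f = 0 ↔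
      f ∈ Ideal.span (Set.range g)) : IsIdealGen i V g := by
  refine ⟨fun k ↦ (hk _).mpr (Ideal.subset_span ⟨k, rfl⟩), fun W h f hf x hx ↦ ?_⟩
  obtain ⟨b, hb, hxb⟩ := hV.exists_basicOpen_le ⟨x, hx⟩ (h hx)
  obtain ⟨n, a, ha⟩ := exists_pow_mul_eq_fres hV b (fres hb f)
  have h1 : fpull i (i.preimage_mono (X.basicOpen_le b)) a = 0 := by
    have h2 := congrArg (fpull i (le_refl (i ⁻¹ᵁ X.basicOpen b))) ha
    rw [map_mul, fpull_fres, fpull_fres] at h2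
    rw [← h2]
    have h3 := congrArg (fres (i.preimage_mono hb)) hf
    rw [fres_fpull, map_zero] at h3
    rw [h3, mul_zero]
  have h2 : fres (D.basicOpen_le (fpull i (le_refl (i ⁻¹ᵁ V)) b))
      (fpull i (le_refl (i ⁻¹ᵁ V)) a) = 0 := by
    rw [fres_fpull]
    have hle : D.basicOpen (fpull i (le_refl (i ⁻¹ᵁ V)) b) ≤ i ⁻¹ᵁ X.basicOpen b := by
      rw [basicOpen_fpull]; exact inf_le_right
    have := congrArg (fres hle) h1
    rwa [fres_fpull, map_zero] at this
  have hA : IsAffineOpen (i ⁻¹ᵁ V) := hV.preimage i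
  obtain ⟨m, hm⟩ := exists_pow_mul_eq_zero hA _ _ h2
  rw [← map_pow, ← map_mul, hk] at hm
  obtain ⟨c, hc⟩ := (Ideal.mem_span_range_iff_exists_fun).mp hm
  obtain ⟨v, hv⟩ := (isUnit_fres_basicOpen b).exists_right_inv
  refine ⟨X.basicOpen b, hb, fun k ↦ v ^ (m + n) * fres (X.basicOpen_le b) (c k), hxb, ?_⟩
  have h3 := congrArg (fres (X.basicOpen_le b)) hc
  rw [map_mul, map_pow, ← ha, map_sum] at h3
  have h4 : (fres (X.basicOpen_le b) b * v) ^ (m + n) * fres hb f =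
      v ^ (m + n) * (fres (X.basicOpen_le b) b ^ m *
        (fres (X.basicOpen_le b) b ^ n * fres hb f)) := by ring
  rw [hv, one_pow, one_mul, ← h3, Finset.mul_sum] at h4
  rw [h4]
  exact Finset.sum_congr rfl fun k _ ↦ by rw [map_mul, mul_assoc]

theorem IsIdealGen.isEqn {t : Γ(X, V)} (h : IsIdealGen i V (fun _ : Unit ↦ t)) (hr : IsReg t) :
    IsEqn i V t := by
  refine ⟨hr, h.zero (), fun W hW f hf ↦ ?_⟩
  have hex : ∀ x ∈ W, ∃ W' : X.Opens, W' ≤ W ∧ x ∈ W' ∧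
      ∃ g, ∃ h' : W' ≤ W, fres h' f = fres (h'.trans hW) t * g := by
    intro x hx
    obtain ⟨W', h', c, hx', hc⟩ := h.exists_sum W hW f hf x hx
    exact ⟨W', h', hx', c (), h', by rw [hc, Fintype.sum_unique, mul_comm]⟩
  obtain ⟨g, hg⟩ := fun_glue_pred W (fun W' g ↦ ∃ h' : W' ≤ W, fres h' f = fres (h'.trans hW) t * g)
    hex
    (by
      rintro W₁ W₂ g₁ g₂ hW₁ hW₂ ⟨_, h₁⟩ ⟨_, h₂⟩
      have h3 := congrArg (fres (inf_le_left : W₁ ⊓ W₂ ≤ W₁)) h₁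
      have h4 := congrArg (fres (inf_le_right : W₁ ⊓ W₂ ≤ W₂)) h₂
      rw [map_mul, fres_fres, fres_fres] at h3 h4
      exact (hr.mono (inf_le_left.trans (hW₁.trans hW))).cancel (h3.symm.trans h4))
  refine ⟨g, fun_ext fun x hx ↦ ?_⟩
  obtain ⟨W', hW', hx', g', h', hg'⟩ := hex x hx
  refine ⟨W', hW', hx', ?_⟩
  rw [hg', map_mul, fres_fres, hg W' hW' g' ⟨h', hg'⟩]

theorem isIdealGen_of_ker_ideal [IsAffineHom i] [QuasiCompact i] (hV : IsAffineOpen V)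
    {t : Γ(X, V)} (hk : i.ker.ideal ⟨V, hV⟩ = Ideal.span {t}) :
    IsIdealGen i V (fun _ : Unit ↦ t) := by
  rw [Scheme.Hom.ker_apply] at hk
  refine isIdealGen_of_ker hV fun f ↦ ?_
  rw [Set.range_const, ← hk, RingHom.mem_ker, ← app_eq_fpull]

theorem isEqn_of_ker [IsClosedImmersion i] (hV : IsAffineOpen V) {t : Γ(X, V)}
    (ht : t ∈ nonZeroDivisors Γ(X, V)) (hk : i.ker.ideal ⟨V, hV⟩ = Ideal.span {t}) :
    IsEqn i V t :=
  (isIdealGen_of_ker_ideal hV hk).isEqn (isReg_of_isAffineOpen hV ht)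

theorem IsEffectiveCartier.exists_isEqn (hi : IsEffectiveCartier i) (x : X) :
    ∃ (V : X.Opens) (t : Γ(X, V)), x ∈ V ∧ IsAffineOpen V ∧ IsEqn i V t := by
  obtain ⟨V, hx, t, ht, hk⟩ := hi.exists_equation x
  have := hi.isClosedImmersion
  exact ⟨V.1, t, hx, V.2, isEqn_of_ker V.2 ht hk⟩

theorem mem_complement [IsClosedImmersion i] {x : X} : x ∈ complement i ↔ x ∉ Set.range i := by
  have h1 : closure (Set.range i) = Set.range i := i.isClosedEmbedding.isClosed_range.closure_eq
  change x ∈ (closure (Set.range i))ᶜ ↔ _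
  rw [h1]
  rfl

theorem preimage_complement [IsClosedImmersion i] : i ⁻¹ᵁ complement i = ⊥ := by
  rw [eq_bot_iff]
  intro y hy
  exact (mem_complement.mp hy) ⟨y, rfl⟩

theorem IsEqn.basicOpen_eq [IsClosedImmersion i] {t : Γ(X, V)} (ht : IsEqn i V t) :
    X.basicOpen t = V ⊓ complement i := by
  apply le_antisymm
  · refine le_inf (X.basicOpen_le t) fun x hx ↦ mem_complement.mpr ?_
    rintro ⟨y, rfl⟩
    have h1 : y ∈ D.basicOpen (fpull i (le_refl (i ⁻¹ᵁ V)) t) := by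
      rw [basicOpen_fpull]
      exact ⟨X.basicOpen_le t hx, hx⟩
    rw [ht.zero, Scheme.basicOpen_zero] at h1
    exact h1
  · have h1 : i ⁻¹ᵁ (V ⊓ complement i) = ⊥ := by
      rw [eq_bot_iff, ← preimage_complement (i := i)]
      exact i.preimage_mono inf_le_right
    have h2 : Subsingleton Γ(D, i ⁻¹ᵁ (V ⊓ complement i)) := by
      rw [h1]; infer_instance
    obtain ⟨g, hg⟩ := ht.exists_mul (V ⊓ complement i) inf_le_left 1 (Subsingleton.elim _ _)
    exact le_basicOpen_of_isUnit inf_le_left (IsUnit.of_mul_eq_one g hg.symm)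

/-- Locally at every point, one of the factors of a vanishing product vanishes. -/
def LocallyDomain (D : Scheme.{u}) : Prop :=
  ∀ (U : D.Opens) (a b : Γ(D, U)), a * b = 0 → ∀ x ∈ U, ∃ (W : D.Opens) (h : W ≤ U), x ∈ W ∧
    (fres h a = 0 ∨ fres h b = 0)

/-- A function that is invertible outside of a divisor is locally a unit times a power of the
equation. -/
theorem IsEqn.exists_unit_mul_pow [IsClosedImmersion i] (hD : LocallyDomain D) {t : Γ(X, V)}
    (ht : IsEqn i V t) (hW : W ≤ V) {f : Γ(X, W)}
    (hf : IsUnit (fres (inf_le_left : W ⊓ complement i ≤ W) f)) {x : X} (hx : x ∈ W) :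
    ∃ (W' : X.Opens) (h : W' ≤ W) (k : ℕ) (v : Γ(X, W')), x ∈ W' ∧ IsUnit v ∧
      fres h f = v * fres (h.trans hW) t ^ k := by
  by_cases hxc : x ∈ complement i
  · exact ⟨W ⊓ complement i, inf_le_left, 0, _, ⟨hx, hxc⟩, hf, by simp⟩
  have key : ∀ (n : ℕ) (W : X.Opens) (hW : W ≤ V) (f g : Γ(X, W)), x ∈ W →
      f * g = fres hW t ^ n → ∃ (W' : X.Opens) (h : W' ≤ W) (k : ℕ) (v : Γ(X, W')), x ∈ W' ∧
        IsUnit v ∧ fres h f = v * fres (h.trans hW) t ^ k := by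
    intro n
    induction n with
    | zero =>
      intro W hW f g hx h
      exact ⟨W, le_rfl, 0, f, hx, IsUnit.of_mul_eq_one g (by simpa using h), by simp⟩
    | succ n ih =>
      intro W hW f g hx h
      obtain ⟨y, rfl⟩ : x ∈ Set.range i := by
        by_contra h; exact hxc (mem_complement.mpr h)
      have h1 : fpull i (le_refl (i ⁻¹ᵁ W)) f * fpull i (le_refl (i ⁻¹ᵁ W)) g = 0 := by
        rw [← map_mul, h, map_pow, (ht.mono hW).zero, zero_pow (Nat.succ_ne_zero n)]
      obtain ⟨W', hW', hy, h2⟩ := hD _ _ _ h1 y hx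
      obtain ⟨O, hO⟩ := i.isClosedEmbedding.isInducing.isOpen_iff.mp W'.isOpen
      let W₁ : X.Opens := ⟨O, hO.1⟩ ⊓ W
      have hW₁ : i ⁻¹ᵁ W₁ ≤ W' := by
        intro z hz
        have : z ∈ (W' : Set D) := by rw [← hO.2]; exact hz.1
        exact this
      have hyW₁ : i y ∈ W₁ := ⟨by
        have : y ∈ i ⁻¹' O := by rw [hO.2]; exact hy
        exact this, hx⟩
      have h0 : ∀ a : Γ(X, W), fres hW' (fpull i (le_refl (i ⁻¹ᵁ W)) a) = 0 →
          ∃ b, fres (inf_le_right : W₁ ≤ W) a = fres (inf_le_right.trans hW) t * b := by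
        intro a ha
        refine ht.exists_mul W₁ (inf_le_right.trans hW) _ ?_
        have := congrArg (fres hW₁) ha
        rw [fres_fres, fres_fpull, map_zero] at this
        rw [fpull_fres]
        exact this
      have h4 := congrArg (fres (inf_le_right : W₁ ≤ W)) h
      rw [map_mul, map_pow, fres_fres, pow_succ'] at h4
      rcases h2 with h3 | h3
      · obtain ⟨f', hf'⟩ := h0 f h3
        rw [hf', mul_assoc] at h4
        obtain ⟨W₂, hW₂, k, v, hx₂, hv, h5⟩ := ih W₁ (inf_le_right.trans hW) f'
          (fres inf_le_right g) hyW₁ ((ht.isReg.mono _).cancel h4)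
        refine ⟨W₂, hW₂.trans inf_le_right, k + 1, v, hx₂, hv, ?_⟩
        have h6 := congrArg (fres hW₂) hf'
        rw [fres_fres, map_mul, fres_fres, h5] at h6
        rw [h6]; ring
      · obtain ⟨g', hg'⟩ := h0 g h3
        rw [hg', mul_left_comm] at h4
        obtain ⟨W₂, hW₂, k, v, hx₂, hv, h5⟩ := ih W₁ (inf_le_right.trans hW)
          (fres inf_le_right f) g' hyW₁ ((ht.isReg.mono _).cancel h4)
        refine ⟨W₂, hW₂.trans inf_le_right, k, v, hx₂, hv, ?_⟩
        rw [fres_fres] at h5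
        exact h5
  obtain ⟨A, hA, hxA, hAW⟩ := exists_isAffineOpen_mem_and_subset hx
  have hA' : IsAffineOpen A := hA
  have hAW' : A ≤ W := hAW
  have htA := ht.mono (hAW'.trans hW)
  have hle : X.basicOpen (fres (hAW'.trans hW) t) ≤ W ⊓ complement i := by
    rw [htA.basicOpen_eq]
    exact inf_le_inf_right _ hAW'
  have hu := hf.map (fres hle)
  rw [fres_fres] at hu
  obtain ⟨g, hg⟩ := hu.exists_right_inv
  obtain ⟨n, b, hb⟩ := exists_pow_mul_eq_fres hA' _ g
  have h1 : fres (X.basicOpen_le (fres (hAW'.trans hW) t)) (fres hAW' f * b) =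
      fres (X.basicOpen_le (fres (hAW'.trans hW) t)) (fres (hAW'.trans hW) t ^ n) := by
    rw [map_mul, ← hb, map_pow, fres_fres, mul_left_comm]
    rw [hg, mul_one]
  have h2 : fres hAW' f * b = fres (hAW'.trans hW) t ^ n := by
    refine sub_eq_zero.mp (fun_eq_zero_of_isReg htA.isReg le_rfl inf_le_right
      (X.basicOpen_le _) ?_)
    rw [map_sub, h1, sub_self]
  obtain ⟨W', h, k, v, hx', hv, h3⟩ := key n A (hAW'.trans hW) _ b hxA h2
  exact ⟨W', h.trans hAW', k, v, hx', hv, by rw [fres_fres] at h3; exact h3⟩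

end eqn

/-! ### Differentials of smooth schemes -/

section smooth

variable {X D : Scheme.{u}}

theorem smooth_constHom {R : CommRingCat.{u}} (s : X ⟶ Spec R) [Smooth s] {V : X.Opens}
    (hV : IsAffineOpen V) :
    (RingHom.Smooth (R := R) (S := Γ(X, V)) ((constHom s).app (op V)).hom) := by
  have h1 := Smooth.smooth_appLE (f := s) (isAffineOpen_top (Spec R)) hV le_top
  have h2 : RingHom.Smooth (Scheme.ΓSpecIso R).inv.hom :=
    RingHom.Smooth.of_bijective (ConcreteCategory.bijective_of_isIso (Scheme.ΓSpecIso R).inv)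
  have h3 := RingHom.Smooth.comp h2 h1
  exact h3

section field

variable {K : Type u} [Field K] (s : X ⟶ Spec (CommRingCat.of K)) [Smooth s]

theorem smooth_constAlgebra {V : X.Opens} (hV : IsAffineOpen V) :
    letI : Algebra K Γ(X, V) := constAlgebra s V
    Algebra.Smooth K Γ(X, V) := smooth_constHom s hV

include s in
theorem locallyDomain_of_smooth : LocallyDomain X := by
  intro U a b hab x hx
  obtain ⟨A, hA, hxA, hAU⟩ := exists_isAffineOpen_mem_and_subset hx
  have hA' : IsAffineOpen A := hA
  have hAU' : A ≤ U := hAU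
  letI : Algebra K Γ(X, A) := constAlgebra s A
  have := smooth_constAlgebra s hA'
  obtain ⟨c, hc, h⟩ := exists_notMem_of_mul_eq_zero_of_smooth (K := K) (a := fres hAU' a)
    (b := fres hAU' b) (by rw [← map_mul, hab, map_zero]) (hA'.primeIdealOf ⟨x, hxA⟩).asIdeal
  rw [← mem_basicOpen_iff] at hc
  refine ⟨X.basicOpen c, (X.basicOpen_le c).trans hAU', hc, ?_⟩
  have key : ∀ d : Γ(X, U), c * fres hAU' d = 0 → fres ((X.basicOpen_le c).trans hAU') d = 0 := by
    intro d hd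
    have := congrArg (fres (X.basicOpen_le c)) hd
    rw [map_mul, map_zero, fres_fres] at this
    exact (isUnit_fres_basicOpen c).mul_right_eq_zero.mp this
  exact h.imp (key a) (key b)

theorem exists_basis_om {V : X.Opens} (hV : IsAffineOpen V) {x : X} (hx : x ∈ V) :
    ∃ g : Γ(X, V), x ∈ X.basicOpen g ∧ ∃ n : ℕ,
      Nonempty (Module.Basis (Fin n) Γ(X, X.basicOpen g) (Om s (X.basicOpen g))) := by
  letI : Algebra K Γ(X, V) := constAlgebra s V
  have := smooth_constAlgebra s hV
  obtain ⟨g, hg, hS⟩ := Algebra.IsSmoothAt.exists_notMem_isStandardSmooth K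
    (hV.primeIdealOf ⟨x, hx⟩).asIdeal
  rw [← mem_basicOpen_iff] at hg
  refine ⟨g, hg, ?_⟩
  letI : Algebra K Γ(X, X.basicOpen g) := constAlgebra s (X.basicOpen g)
  letI : Algebra Γ(X, V) Γ(X, X.basicOpen g) := (fres (X.basicOpen_le g)).toAlgebra
  have : IsLocalization.Away g Γ(X, X.basicOpen g) := hV.isLocalization_basicOpen g
  have : IsScalarTower K Γ(X, V) Γ(X, X.basicOpen g) :=
    IsScalarTower.of_algebraMap_eq fun a ↦ (constHom_fres s (X.basicOpen_le g) a).symm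
  have e : Localization.Away g ≃ₐ[K] Γ(X, X.basicOpen g) :=
    (IsLocalization.algEquiv (Submonoid.powers g) (Localization.Away g)
      Γ(X, X.basicOpen g)).restrictScalars K
  have hS' : Algebra.IsStandardSmooth K Γ(X, X.basicOpen g) := .of_algEquiv e
  have : Nonempty (X.basicOpen g) := ⟨⟨x, hg⟩⟩
  have : Nontrivial Γ(X, X.basicOpen g) := inferInstance
  have : Module.Free Γ(X, X.basicOpen g) (KaehlerDifferential K Γ(X, X.basicOpen g)) :=
    Algebra.IsStandardSmooth.free_kaehlerDifferential
  exact ⟨_, ⟨Module.finBasis Γ(X, X.basicOpen g) (KaehlerDifferential K Γ(X, X.basicOpen g))⟩⟩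

end field

variable {R : CommRingCat.{u}} (s : X ⟶ Spec R)

theorem basis_om_basicOpen {V : X.Opens} (hV : IsAffineOpen V) (g : Γ(X, V)) {ι : Type}
    [Fintype ι] (b : Module.Basis ι Γ(X, V) (Om s V)) :
    Nonempty (Module.Basis ι Γ(X, X.basicOpen g) (Om s (X.basicOpen g))) := by
  let f : (ι → Γ(X, X.basicOpen g)) →ₗ[Γ(X, X.basicOpen g)] Om s (X.basicOpen g) :=
    Fintype.linearCombination _ (fun i ↦ omRes s (X.basicOpen_le g) (b i))
  exact ⟨(Module.Basis.ofEquivFun (LinearEquiv.ofBijective f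
    (omRes_bijective_sum s hV b g)).symm)⟩

/-! ### Pullback of differentials -/

section pull

variable {Y : Scheme.{u}} {sX : X ⟶ Spec R} {sY : Y ⟶ Spec R} (f : X ⟶ Y) (hf : f ≫ sY = sX)
  {V : Y.Opens} {W : X.Opens}

theorem qsec_differentialsPull_dSection (e : W ≤ f ⁻¹ᵁ V) (a : Γ(Y, V)) :
    qsec (differentialsPull f hf) e (dSection sY V a) = dSection sX W (fpull f e a) := by
  have h1 := homEquiv_symm_spull (differentialsPush f hf) e (dSection sY V a)
  refine h1.trans ?_
  have h2 : (differentialsPush f hf).app V (dSection sY V a) =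
      dSection sX (f ⁻¹ᵁ V) (f.app V a) := by
    have h3 := sheafifyDesc_shf (differentialsPresheaf sY)
      ((PresheafOfModules.DifferentialsConstruction.isUniversal' (constHom sY)).desc
        (differentialsPushDerivation f hf)) (U := V) (omD sY a)
    refine h3.trans ?_
    have h4 := (PresheafOfModules.DifferentialsConstruction.isUniversal' (constHom sY)).fac
        (differentialsPushDerivation f hf)
    exact PresheafOfModules.Derivation.congr_d h4 a
  rw [h2]
  have h5 := dSection_res sX e (f.app V a)
  refine Eq.trans h5.symm ?_
  congr 1

theorem qsec_differentialsPull_omSec (e : W ≤ f ⁻¹ᵁ V) (ω : Om sY V)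
    (ρ : Om sY V →+ Om sX W)
    (hρ : ∀ a ω, ρ (a • ω) = fpull f e a • ρ ω)
    (hρ' : ∀ a, ρ (omD sY a) = omD sX (fpull f e a)) :
    qsec (differentialsPull f hf) e (omSec sY V ω) = omSec sX W (ρ ω) := by
  letI := constAlgebra sY V
  have h1 : ω ∈ Submodule.span Γ(Y, V) (Set.range (KaehlerDifferential.D R Γ(Y, V))) := by
    rw [KaehlerDifferential.span_range_derivation]; trivial
  induction h1 using Submodule.span_induction with
  | mem x hx =>
    obtain ⟨a, rfl⟩ := hx
    have h2 := hρ' a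
    refine (qsec_differentialsPull_dSection f hf e a).trans ?_
    exact (congrArg (omSec sX W) h2).symm
  | zero => rw [map_zero, map_zero, map_zero, qsec_zero]
  | add x y _ _ hx hy => rw [map_add, qsec_add, hx, hy, map_add, map_add]
  | smul a x _ hx => rw [omSec_smul, qsec_smul, hx, hρ, omSec_smul]

include hf in
theorem fpull_constHom (e : W ≤ f ⁻¹ᵁ V) (a : R) :
    fpull f e ((constHom sY).app (op V) a) = (constHom sX).app (op W) a := by
  subst hf
  have h2 : (Scheme.ΓSpecIso R).inv ≫ sY.appLE ⊤ V le_top ≫ f.appLE V W e =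
      (Scheme.ΓSpecIso R).inv ≫ (f ≫ sY).appLE ⊤ W le_top := by
    exact congrArg ((Scheme.ΓSpecIso R).inv ≫ ·) (Scheme.Hom.appLE_comp_appLE f sY ⊤ V W le_top e)
  exact ConcreteCategory.congr_hom h2 a

end pull

/-! ### Local charts of log pairs -/

/-- A base change of a basis by an invertible matrix is a basis. -/
theorem IsBasisOn.of_isUnit_det {F : X.Modules} {V : X.Opens} {ι : Type} [Fintype ι]
    [DecidableEq ι] {b e : ι → Γ(F, V)} (hb : IsBasisOn F V b) (A : Matrix ι ι Γ(X, V))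
    (hA : IsUnit A.det) (he : ∀ j, e j = ∑ k, A j k • b k) : IsBasisOn F V e := by
  intro W h
  let A' : Matrix ι ι Γ(X, W) := A.map (fres h)
  have hA' : IsUnit A'.det := by
    have := hA.map (fres h)
    rwa [RingHom.map_det] at this
  have h1 : (fun c : ι → Γ(X, W) ↦ ∑ j, c j • mres F h (e j)) =
      (fun c : ι → Γ(X, W) ↦ ∑ k, c k • mres F h (b k)) ∘ (fun c ↦ Matrix.vecMul c A') := by
    funext c
    simp only [Function.comp_apply, he, mres_sum_smul, Finset.smul_sum, smul_smul, Matrix.vecMul,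
      dotProduct, Finset.sum_smul]
    rw [Finset.sum_comm]
    rfl
  rw [h1]
  refine (hb W h).comp ?_
  have hu : IsUnit A' := (Matrix.isUnit_iff_isUnit_det _).mpr hA'
  obtain ⟨u, hu⟩ := hu
  have h2 : (↑u⁻¹ : Matrix ι ι Γ(X, W)) * A' = 1 := by rw [← hu]; exact u.inv_mul
  have h3 : A' * (↑u⁻¹ : Matrix ι ι Γ(X, W)) = 1 := by rw [← hu]; exact u.mul_inv
  refine Function.bijective_iff_has_inverse.mpr ⟨fun c ↦ Matrix.vecMul c ↑u⁻¹, ?_, ?_⟩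
  · intro c
    simp only [Matrix.vecMul_vecMul, h3, Matrix.vecMul_one]
  · intro c
    simp only [Matrix.vecMul_vecMul, h2, Matrix.vecMul_one]

/-- A chart of a log pair: a local equation `t`, and differential forms `ω` that restrict to a
basis on the divisor, such that `dt` and `ω` form a basis. -/
structure LogChart (i : D ⟶ X) (V : X.Opens) {κ : Type} [Fintype κ] (t : Γ(X, V))
    (ω : κ → Γ(differentials s, V)) : Prop where
  isAffineOpen : IsAffineOpen V
  isEqn : IsEqn i V t
  isBasisOn : IsBasisOn (differentials s) V (fun o : Option κ ↦ o.elim (dSection s V t) ω)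
  isBasisOn_restrict : IsBasisOn (differentials (i ≫ s)) (i ⁻¹ᵁ V)
    (fun k ↦ qsec (differentialsPull (sX := i ≫ s) i rfl) le_rfl (ω k))

end smooth

open KaehlerDifferential TensorProduct in
/-- A basis of the conormal sequence, expressed in terms of a basis of the ambient module of
differentials. -/
theorem exists_matrix_of_conormal {R A B : Type u} [CommRing R] [CommRing A] [CommRing B]
    [Algebra R A] [Algebra A B] [Algebra R B] [IsScalarTower R A B]
    [Algebra.FormallySmooth R A] [Algebra.FormallySmooth R B] [Nontrivial B]
    (hs : Function.Surjective (algebraMap A B)) {t : A} (ht : t ∈ nonZeroDivisors A)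
    (hk : RingHom.ker (algebraMap A B) = Ideal.span {t}) {κ : Type} [Fintype κ] [DecidableEq κ]
    (b : Module.Basis κ B (Ω[B⁄R])) {n : ℕ} (β : Module.Basis (Fin n) A (Ω[A⁄R])) :
    ∃ (ω : κ → Ω[A⁄R]) (γ : Module.Basis (Option κ) A (Ω[A⁄R]))
      (M : Matrix (Option κ) (Option κ) A),
      (∀ k, KaehlerDifferential.map R R A B (ω k) = b k) ∧ IsUnit (algebraMap A B M.det) ∧
      ∀ o : Option κ, o.elim (KaehlerDifferential.D R A t) ω = ∑ k, M o k • γ k := by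
  choose ω hω using fun k ↦ KaehlerDifferential.map_surjective_of_surjective R R A B hs (b k)
  obtain ⟨e, he, he'⟩ := exists_basis_of_conormal hs ht hk b ω hω
  let β' : Module.Basis (Fin n) B (B ⊗[A] Ω[A⁄R]) := β.baseChange B
  let w : Option κ ≃ Fin n := e.indexEquiv β'
  let γ := β.reindex w.symm
  let γ' : Module.Basis (Option κ) B (B ⊗[A] Ω[A⁄R]) := γ.baseChange B
  let M : Matrix (Option κ) (Option κ) A :=
    fun o k ↦ γ.repr (o.elim (KaehlerDifferential.D R A t) ω) k
  refine ⟨ω, γ, M, hω, ?_, fun o ↦ (γ.sum_repr _).symm⟩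
  · have h1 : (algebraMap A B).mapMatrix M = (γ'.toMatrix e).transpose := by
      ext o k
      have h2 : e o = 1 ⊗ₜ (o.elim (KaehlerDifferential.D R A t) ω) := by
        cases o with
        | none => exact he
        | some k => exact he' k
      rw [Matrix.transpose_apply, Module.Basis.toMatrix_apply, h2]
      refine Eq.trans ?_ (Module.Basis.baseChange_repr_tmul B γ 1 _ k).symm
      rw [Algebra.smul_def, mul_one]
      rfl
    rw [RingHom.map_det, h1, Matrix.det_transpose]
    have := γ'.invertibleToMatrix e
    exact Matrix.isUnit_det_of_invertible _

section chart

variable {X D : Scheme.{u}} {i : D ⟶ X} {K : Type u} [Field K]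
  (s : X ⟶ Spec (CommRingCat.of K)) [Smooth s] [Smooth (i ≫ s)] [IsClosedImmersion i]

theorem qsec_differentialsPull_map {V : X.Opens} (ω : Om s V) :
    letI := constAlgebra s V
    letI := constAlgebra (i ≫ s) (i ⁻¹ᵁ V)
    letI : Algebra Γ(X, V) Γ(D, i ⁻¹ᵁ V) := (fpull i (le_refl (i ⁻¹ᵁ V))).toAlgebra
    haveI : IsScalarTower K Γ(X, V) Γ(D, i ⁻¹ᵁ V) :=
      IsScalarTower.of_algebraMap_eq fun a ↦ (fpull_constHom (sX := i ≫ s) i rfl le_rfl a).symm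
    qsec (differentialsPull (sX := i ≫ s) i rfl) le_rfl (omSec s V ω) =
        omSec (i ≫ s) _ (KaehlerDifferential.map K K Γ(X, V) Γ(D, i ⁻¹ᵁ V) ω) := by
  letI := constAlgebra s V
  letI := constAlgebra (i ≫ s) (i ⁻¹ᵁ V)
  letI : Algebra Γ(X, V) Γ(D, i ⁻¹ᵁ V) := (fpull i (le_refl (i ⁻¹ᵁ V))).toAlgebra
  have : IsScalarTower K Γ(X, V) Γ(D, i ⁻¹ᵁ V) :=
    IsScalarTower.of_algebraMap_eq fun a ↦ (fpull_constHom (sX := i ≫ s) i rfl le_rfl a).symm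
  let ρ : Om s V →+ Om (i ≫ s) (i ⁻¹ᵁ V) :=
    (KaehlerDifferential.map K K Γ(X, V) Γ(D, i ⁻¹ᵁ V)).toAddMonoidHom
  have h1 : ∀ a ω, ρ (a • ω) = fpull i (le_refl (i ⁻¹ᵁ V)) a • ρ ω := by
    intro a ω
    refine (map_smul (KaehlerDifferential.map K K Γ(X, V) Γ(D, i ⁻¹ᵁ V)) a ω).trans ?_
    exact algebra_compatible_smul Γ(D, i ⁻¹ᵁ V) a (KaehlerDifferential.map K K Γ(X, V) Γ(D, i ⁻¹ᵁ V) ω)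
  have h2 : ∀ a, ρ (omD s a) = omD (i ≫ s) (fpull i (le_refl (i ⁻¹ᵁ V)) a) :=
    fun a ↦ KaehlerDifferential.map_D K K Γ(X, V) Γ(D, i ⁻¹ᵁ V) a
  exact qsec_differentialsPull_omSec i rfl le_rfl ω ρ h1 h2

theorem exists_forms_of_isEqn {V : X.Opens} (hV : IsAffineOpen V) {t : Γ(X, V)}
    (ht : IsEqn i V t) [Nontrivial Γ(D, i ⁻¹ᵁ V)] {κ : Type} [Fintype κ] [DecidableEq κ]
    (b : Module.Basis κ Γ(D, i ⁻¹ᵁ V) (Om (i ≫ s) (i ⁻¹ᵁ V))) {n : ℕ}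
    (β : Module.Basis (Fin n) Γ(X, V) (Om s V)) :
    ∃ (ω : κ → Om s V) (γ : Module.Basis (Option κ) Γ(X, V) (Om s V))
      (M : Matrix (Option κ) (Option κ) Γ(X, V)),
      (∀ k, qsec (differentialsPull (sX := i ≫ s) i rfl) le_rfl (omSec s V (ω k)) =
        omSec (i ≫ s) _ (b k)) ∧
      IsUnit (fpull i le_rfl M.det : Γ(D, i ⁻¹ᵁ V)) ∧
      ∀ o : Option κ, o.elim (omD s t) ω = ∑ k, M o k • γ k := by
  letI := constAlgebra s V
  letI := constAlgebra (i ≫ s) (i ⁻¹ᵁ V)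
  letI : Algebra Γ(X, V) Γ(D, i ⁻¹ᵁ V) := (fpull i (le_refl (i ⁻¹ᵁ V))).toAlgebra
  have : IsScalarTower K Γ(X, V) Γ(D, i ⁻¹ᵁ V) :=
    IsScalarTower.of_algebraMap_eq fun a ↦ (fpull_constHom (sX := i ≫ s) i rfl le_rfl a).symm
  have h1 := smooth_constAlgebra s hV
  have h2 := smooth_constAlgebra (i ≫ s) (hV.preimage i)
  have hs : Function.Surjective (algebraMap Γ(X, V) Γ(D, i ⁻¹ᵁ V)) := by
    have := Scheme.Hom.app_surjective i V hV
    intro a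
    obtain ⟨c, hc⟩ := this a
    exact ⟨c, (app_eq_fpull i c).symm.trans hc⟩
  have hk : RingHom.ker (algebraMap Γ(X, V) Γ(D, i ⁻¹ᵁ V)) = Ideal.span {t} := by
    ext f
    rw [Ideal.mem_span_singleton]
    constructor
    · intro hf
      obtain ⟨g, hg⟩ := ht.exists_mul V le_rfl f hf
      exact ⟨g, by rwa [fres_self] at hg⟩
    · rintro ⟨g, rfl⟩
      refine RingHom.mem_ker.mpr ((map_mul _ _ _).trans ?_)
      have : algebraMap Γ(X, V) Γ(D, i ⁻¹ᵁ V) t = 0 := ht.zero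
      rw [this, zero_mul]
  obtain ⟨ω, γ, M, hω, hM, hM'⟩ := exists_matrix_of_conormal (R := K) hs
    ht.isReg.mem_nonZeroDivisors hk b β
  refine ⟨ω, γ, M, fun k ↦ ?_, hM, hM'⟩
  have h3 := qsec_differentialsPull_map s (i := i) (ω k)
  rw [hω k] at h3
  exact h3

theorem exists_logChart_of_basis {V : X.Opens} (hV : IsAffineOpen V) {t : Γ(X, V)}
    (ht : IsEqn i V t) {κ : Type} [Fintype κ]
    (b : Module.Basis κ Γ(D, i ⁻¹ᵁ V) (Om (i ≫ s) (i ⁻¹ᵁ V))) {n : ℕ}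
    (β : Module.Basis (Fin n) Γ(X, V) (Om s V)) {y : D} (hy : i y ∈ V) :
    ∃ (W : X.Opens) (h : W ≤ V) (ω : κ → Γ(differentials s, W)), i y ∈ W ∧
      LogChart s i W (fres h t) ω := by
  classical
  have : Nonempty (i ⁻¹ᵁ V) := ⟨⟨y, hy⟩⟩
  have : Nontrivial Γ(D, i ⁻¹ᵁ V) := inferInstance
  obtain ⟨ω, γ, M, hω, hM, hM'⟩ := exists_forms_of_isEqn s hV ht b β
  have hδ : i y ∈ X.basicOpen M.det := by
    have h1 : y ∈ D.basicOpen (fpull i (le_refl (i ⁻¹ᵁ V)) M.det) := by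
      rw [Scheme.basicOpen_of_isUnit _ hM]; exact hy
    rw [basicOpen_fpull] at h1
    exact h1.2
  have hle := X.basicOpen_le M.det
  refine ⟨X.basicOpen M.det, hle, fun k ↦ mres _ hle (omSec s V (ω k)), hδ, hV.basicOpen _,
    ht.mono hle, ?_, ?_⟩
  · refine ((isBasisOn_omSec s hV γ).mono hle).of_isUnit_det ((fres hle).mapMatrix M) ?_
      fun o ↦ ?_
    · rw [← RingHom.map_det]
      exact isUnit_fres_basicOpen _
    · have h3 := congrArg (fun x ↦ mres (differentials s) hle (omSec s V x)) (hM' o)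
      simp only [map_sum, omSec_smul, mres_smul] at h3
      refine Eq.trans ?_ h3
      cases o with
      | none =>
        exact (dSection_res s hle t).trans
          (congrArg (mres (differentials s) hle) (omSec_omD s t).symm)
      | some k => rfl
  · have h1 := (isBasisOn_omSec (i ≫ s) (hV.preimage i) b).mono (i.preimage_mono hle)
    convert h1 using 2 with k
    rw [← hω k, mres_qsec]
    rw [qsec, qsec, spull_mres]

theorem exists_logChart (hi : IsEffectiveCartier i) (y : D) :
    ∃ (V : X.Opens) (κ : Type) (_ : Fintype κ) (t : Γ(X, V))
      (ω : κ → Γ(differentials s, V)), i y ∈ V ∧ LogChart s i V t ω := by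
  obtain ⟨V₀, t₀, hy₀, hV₀, ht₀⟩ := hi.exists_isEqn (i y)
  obtain ⟨g, hg, n, ⟨β₀⟩⟩ := exists_basis_om s hV₀ hy₀
  have hV₁ : IsAffineOpen (X.basicOpen g) := hV₀.basicOpen g
  obtain ⟨h', hh', m, ⟨b₀⟩⟩ := exists_basis_om (i ≫ s) (hV₁.preimage i) (x := y) hg
  obtain ⟨h, rfl⟩ := Scheme.Hom.app_surjective i _ hV₁ h'
  have e₂ : D.basicOpen (i.app (X.basicOpen g) h) = i ⁻¹ᵁ X.basicOpen h :=
    (Scheme.preimage_basicOpen i h).symm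
  rw [e₂] at b₀ hh'
  obtain ⟨β⟩ := basis_om_basicOpen s hV₁ h β₀
  obtain ⟨W, _, ω, hW, hc⟩ := exists_logChart_of_basis s (hV₁.basicOpen h)
    (ht₀.mono ((X.basicOpen_le h).trans (X.basicOpen_le g))) b₀ β hh'
  exact ⟨W, _, _, _, ω, hW, hc⟩

end chart

/-! ### Sheaves associated with sub-presheaves of modules -/

section subsheaf

variable {X : Scheme.{u}} {M : X.Modules} (N : M.val.Submodule) {V W : X.Opens}

/-- A section of a sub-presheaf, as a section of the ambient sheaf. -/
def subVal (W : X.Opens) : PSec N.toPresheafOfModules W →+ Γ(M, W) :=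
  (N.obj (op W)).subtype.toAddMonoidHom

theorem subVal_smul (c : Γ(X, W)) (a : PSec N.toPresheafOfModules W) :
    subVal N W (c • a) = c • subVal N W a := rfl

theorem subVal_pres (h : W ≤ V) (a : PSec N.toPresheafOfModules V) :
    subVal N W (pres _ h a) = mres M h (subVal N V a) := rfl

theorem subVal_injective : Function.Injective (subVal N W) := Subtype.val_injective

theorem subVal_mem (a : PSec N.toPresheafOfModules W) : subVal N W a ∈ N.obj (op W) := a.2

/-- A section of the ambient sheaf that lies in the sub-presheaf. -/
def subMk {W : X.Opens} (a : Γ(M, W)) (h : a ∈ N.obj (op W)) : PSec N.toPresheafOfModules W :=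
  (⟨a, h⟩ : N.obj (op W))

@[simp] theorem subVal_subMk (a : Γ(M, W)) (h : a ∈ N.obj (op W)) :
    subVal N W (subMk N a h) = a := rfl

theorem subVal_sum {ι : Type*} [Fintype ι] (c : ι → Γ(X, W))
    (w : ι → PSec N.toPresheafOfModules W) :
    subVal N W (∑ i, c i • w i) = ∑ i, c i • subVal N W (w i) := by
  rw [map_sum]; rfl

theorem isBasisOn_shf_sub {ι : Type*} [Fintype ι] (w : ι → PSec N.toPresheafOfModules V)
    (hinj : ∀ (W : X.Opens) (h : W ≤ V) (c : ι → Γ(X, W)),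
      ∑ i, c i • mres M h (subVal N V (w i)) = 0 → ∀ i, c i = 0)
    (hsurj : ∀ (W : X.Opens) (_ : W ≤ V) (a : Γ(M, W)), a ∈ N.obj (op W) → ∀ x ∈ W,
      ∃ (W' : X.Opens) (h' : W' ≤ W) (h'' : W' ≤ V), x ∈ W' ∧ ∃ c : ι → Γ(X, W'),
        mres M h' a = ∑ i, c i • mres M h'' (subVal N V (w i))) :
    IsBasisOn (sheafify N.toPresheafOfModules) V
      (fun i ↦ shf N.toPresheafOfModules V (w i)) := by
  refine isBasisOn_of_local (fun W h c hc x hx ↦ ?_) (fun W h a x hx ↦ ?_)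
  · simp only [mres_shf] at hc
    rw [← shf_sum] at hc
    obtain ⟨W', h', hx', h0⟩ := shf_eq_zero _ hc hx
    refine ⟨W', h', hx', hinj W' (h'.trans h) _ ?_⟩
    have h1 := congrArg (subVal N W') h0
    rw [subVal_pres, subVal_sum, map_zero, mres_sum_smul] at h1
    simpa only [subVal_pres, mres_mres] using h1
  · obtain ⟨W', h', hx', b, hb⟩ := exists_shf _ a hx
    obtain ⟨W'', h1, h2, hx'', c, hc⟩ := hsurj W' (h'.trans h) _ (subVal_mem N b) x hx'
    refine ⟨W'', h1.trans h', h2, hx'', c, ?_⟩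
    rw [← mres_mres _ h' h1, ← hb, mres_shf]
    simp only [mres_shf]
    rw [← shf_sum]
    congr 1
    apply subVal_injective
    rw [subVal_pres, subVal_sum, hc]
    rfl

end subsheaf

/-! ### Bases of logarithmic differentials -/

section log

variable {X D : Scheme.{u}} {R : CommRingCat.{u}} (s : X ⟶ Spec R) (i : D ⟶ X) {V W : X.Opens}

theorem toLog_app (ω : Γ(differentials s, V)) :
    (toLog s i).app V ω = shf (logSubmodule s (complement i)).toPresheafOfModules V
      (subMk _ ((toAwayFrom (differentials s) (complement i)).app V ω)
        (Submodule.subset_span (Or.inl ⟨ω, rfl⟩))) := rfl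

/-- Sections of `Ω_X(log D)` that locally generate all generators form a basis. -/
theorem isBasisOn_shf_log {ι : Type*} [Fintype ι]
    (w : ι → PSec (logSubmodule s (complement i)).toPresheafOfModules V)
    (hinj : ∀ (W : X.Opens) (h : W ≤ V) (c : ι → Γ(X, W)),
      ∑ k, c k • mres _ h (subVal _ V (w k)) = 0 → ∀ k, c k = 0)
    (hΩ : ∀ (W : X.Opens) (h : W ≤ V) (η : Γ(differentials s, W)), ∃ c : ι → Γ(X, W),
      (toAwayFrom (differentials s) (complement i)).app W η =
        ∑ k, c k • mres _ h (subVal _ V (w k)))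
    (hlog : ∀ (W : X.Opens) (_ : W ≤ V) (f : Γ(X, W)),
      IsUnit (fres (inf_le_left : W ⊓ complement i ≤ W) f) →
      ∀ x ∈ W, ∃ (W' : X.Opens) (h' : W' ≤ W) (h'' : W' ≤ V), x ∈ W' ∧ ∃ c : ι → Γ(X, W'),
        fres h' f • ∑ k, c k • mres _ h'' (subVal _ V (w k)) =
          (toAwayFrom (differentials s) (complement i)).app W' (dSection s W' (fres h' f))) :
    IsBasisOn (logDifferentials s i) V
      (fun k ↦ shf (logSubmodule s (complement i)).toPresheafOfModules V (w k)) := by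
  refine isBasisOn_shf_sub _ w hinj fun W h a ha x hx ↦ ?_
  induction ha using Submodule.span_induction with
  | mem g hg =>
    obtain ⟨η, rfl⟩ | ⟨f, hf, hg⟩ := hg
    · obtain ⟨c, hc⟩ := hΩ W h η
      exact ⟨W, le_rfl, h, hx, c, by rw [mres_self, hc]⟩
    · obtain ⟨W', h', h'', hx', c, hc⟩ := hlog W h f hf x hx
      refine ⟨W', h', h'', hx', c, ?_⟩
      have h1 := congrArg (mres _ h') hg
      rw [mres_smul, mres_app] at h1
      have h2 : mres (differentials s) h' (dSection s W f) = dSection s W' (fres h' f) :=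
        (dSection_res s h' f).symm
      rw [h2, ← hc] at h1
      have h3 := congrArg (awaySec (differentials s) (complement i) W') h1
      rw [awaySec_smul, awaySec_smul] at h3
      have hu : IsUnit (fres (away_le (complement i) W') (fres h' f)) := by
        have h4 : away (complement i) W' ≤ W ⊓ complement i :=
          le_inf ((away_le _ _).trans h') (away_le_left _ _)
        have h5 : IsUnit (fres (inf_le_left : W ⊓ complement i ≤ W) f) := hf
        have := h5.map (fres h4)
        rwa [fres_fres] at this ⊢
      exact (awaySec (differentials s) (complement i) W').injective
        (hu.smul_left_cancel.mp h3)
  | zero => exact ⟨W, le_rfl, h, hx, 0, by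
      simp only [Pi.zero_apply, zero_smul, Finset.sum_const_zero]
      exact map_zero _⟩
  | add a b _ _ ha hb =>
    obtain ⟨W₁, h₁, h₁', hx₁, c₁, hc₁⟩ := ha
    obtain ⟨W₂, h₂, h₂', hx₂, c₂, hc₂⟩ := hb
    refine ⟨W₁ ⊓ W₂, inf_le_left.trans h₁, inf_le_left.trans h₁', ⟨hx₁, hx₂⟩,
      fun k ↦ fres inf_le_left (c₁ k) + fres inf_le_right (c₂ k), ?_⟩
    have e₁ := congrArg (mres _ (inf_le_left : W₁ ⊓ W₂ ≤ W₁)) hc₁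
    have e₂ := congrArg (mres _ (inf_le_right : W₁ ⊓ W₂ ≤ W₂)) hc₂
    rw [mres_sum_smul, mres_mres] at e₁ e₂
    refine (map_add (mres _ _) a b).trans ?_
    rw [e₁, e₂]
    simp only [mres_mres, add_smul, Finset.sum_add_distrib]
  | smul r a _ ha =>
    obtain ⟨W₁, h₁, h₁', hx₁, c₁, hc₁⟩ := ha
    refine ⟨W₁, h₁, h₁', hx₁, fun k ↦ fres h₁ r * c₁ k, ?_⟩
    refine (mres_smul (M := awayFrom (differentials s) (complement i)) (h := h₁)
      (r : Γ(X, W)) a).trans ?_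
    rw [hc₁, Finset.smul_sum]
    simp only [mul_smul]

variable {s i}

theorem isBasisOn_toLog {ι : Type*} [Fintype ι] (hV : V ≤ complement i)
    {e : ι → Γ(differentials s, V)} (he : IsBasisOn (differentials s) V e) :
    IsBasisOn (logDifferentials s i) V (fun k ↦ (toLog s i).app V (e k)) := by
  let w : ι → PSec (logSubmodule s (complement i)).toPresheafOfModules V := fun k ↦
    subMk (logSubmodule s (complement i)) ((toAwayFrom (differentials s) (complement i)).app V (e k))
      (Submodule.subset_span (Or.inl ⟨e k, rfl⟩))
  have key : ∀ (W : X.Opens) (h : W ≤ V) (c : ι → Γ(X, W)),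
      ∑ k, c k • mres _ h (subVal _ V (w k)) =
        (toAwayFrom (differentials s) (complement i)).app W (∑ k, c k • mres _ h (e k)) := by
    intro W h c
    rw [app_sum_smul]
    exact Finset.sum_congr rfl fun k _ ↦ by
      rw [← mres_app (toAwayFrom (differentials s) (complement i)) h (e k)]; rfl
  have hle : ∀ W ≤ V, W ≤ away (complement i) W := fun W h x hx ↦ (mem_away _).mpr ⟨hV (h hx), hx⟩
  refine isBasisOn_shf_log s i w (fun W h c hc k ↦ ?_) (fun W h η ↦ ?_)
    (fun W h f hf x hx ↦ ?_)
  · rw [key] at hc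
    have h1 := congrArg (fun a ↦ mres _ (hle W h) (awaySec _ _ _ a)) hc
    simp only [awaySec_toAwayFrom, mres_mres, mres_self, map_zero] at h1
    exact he.repr_eq_zero h h1 k
  · obtain ⟨c, hc⟩ := he.exists_repr h η
    refine ⟨c, ?_⟩
    rw [key, ← hc]
  · have h1 : IsUnit f := by
      have := hf.map (fres (le_inf le_rfl (h.trans hV)))
      rwa [fres_fres, fres_self] at this
    obtain ⟨v, hv⟩ := h1.exists_right_inv
    obtain ⟨c, hc⟩ := he.exists_repr h (v • dSection s W f)
    refine ⟨W, le_rfl, h, hx, c, ?_⟩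
    rw [fres_self]
    rw [key, ← hc, ← Scheme.Modules.Hom.app_smul, smul_smul, hv, one_smul]

end log

section frame

variable {X D : Scheme.{u}} {R : CommRingCat.{u}} (s : X ⟶ Spec R) (i : D ⟶ X) (V : X.Opens)

/-- Bases of the differentials and of the logarithmic differentials near a point of the
boundary: `ω` and `dt` form a basis of `Ω_X`, the restrictions of `ω` form a basis of `Ω_D`, and
the logarithmic basis consists of `dt / t` and `ω`. -/
structure LogFrame {κ : Type} [Fintype κ] (t : Γ(X, V)) (ω : κ → Γ(differentials s, V))
    (e : Option κ → Γ(logDifferentials s i, V)) : Prop where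
  isEqn : IsEqn i V t
  isBasisOn : IsBasisOn (differentials s) V (fun o : Option κ ↦ o.elim (dSection s V t) ω)
  isBasisOn_restrict : IsBasisOn (differentials (i ≫ s)) (i ⁻¹ᵁ V)
    (fun k ↦ qsec (differentialsPull (sX := i ≫ s) i rfl) le_rfl (ω k))
  isBasisOn_log : IsBasisOn (logDifferentials s i) V e
  smul_none : t • e none = (toLog s i).app V (dSection s V t)
  eq_toLog : ∀ k, e (some k) = (toLog s i).app V (ω k)

variable {s i V} {W : X.Opens} {κ : Type} [Fintype κ] {t : Γ(X, V)}
  {ω : κ → Γ(differentials s, V)}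

theorem dSection_pow_succ (t : Γ(X, V)) (k : ℕ) :
    dSection s V (t ^ (k + 1)) = ((k + 1 : ℕ) * t ^ k) • dSection s V t := by
  induction k with
  | zero => simp
  | succ k ih =>
    rw [pow_succ t (k + 1), dSection_mul, ih, smul_smul, ← add_smul]
    congr 1
    push_cast
    ring

/-- A local chart of a log pair has a logarithmic basis. -/
theorem LogChart.exists_logFrame [IsClosedImmersion i] (hD : LocallyDomain D)
    (hc : LogChart s i V t ω) : ∃ e, LogFrame s i V t ω e := by
  classical
  have ht := hc.isEqn
  let U := complement i
  have hle : away U V ≤ X.basicOpen t := by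
    rw [ht.basicOpen_eq]
    exact le_inf (away_le _ _) (away_le_left _ _)
  have htu : IsUnit (fres (away_le U V) t) := by
    have := (isUnit_fres_basicOpen t).map (fres hle)
    rwa [fres_fres] at this
  obtain ⟨v, hv⟩ := htu.exists_right_inv
  let N := logSubmodule s U
  let τ : differentials s ⟶ awayFrom (differentials s) U := toAwayFrom (differentials s) U
  let a₀ : Γ(awayFrom (differentials s) U, V) :=
    (awaySec (differentials s) U V).symm (v • mres _ (away_le U V) (dSection s V t))
  have ha₀ : t • a₀ = τ.app V (dSection s V t) := by
    apply (awaySec (differentials s) U V).injective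
    rw [awaySec_smul, awaySec_toAwayFrom, AddEquiv.apply_symm_apply, smul_smul, hv, one_smul]
  have hinf : V ⊓ U ≤ away U V := fun x hx ↦ (mem_away U).mpr ⟨hx.2, hx.1⟩
  have htu' : IsUnit (fres (inf_le_left : V ⊓ U ≤ V) t) := by
    have := htu.map (fres hinf)
    rwa [fres_fres] at this
  let a : Option κ → Γ(awayFrom (differentials s) U, V) := fun o ↦ o.elim a₀ fun k ↦ τ.app V (ω k)
  have ha : ∀ o, a o ∈ N.obj (op V) := by
    rintro (_ | k)
    · exact Submodule.subset_span (Or.inr ⟨t, htu', ha₀⟩)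
    · exact Submodule.subset_span (Or.inl ⟨ω k, rfl⟩)
  let w : Option κ → PSec N.toPresheafOfModules V := fun o ↦ subMk N (a o) (ha o)
  have key : ∀ (W : X.Opens) (h : W ≤ V) (c₀ : Γ(X, W)) (c : κ → Γ(X, W)),
      ∑ o : Option κ, (o.elim c₀ c) • mres _ h (subVal N V (w o)) =
        c₀ • mres _ h a₀ + ∑ k, c k • mres _ h (τ.app V (ω k)) := by
    intro W h c₀ c
    rw [Fintype.sum_option]
    rfl
  have hres₀ : ∀ (W : X.Opens) (h : W ≤ V),
      fres h t • mres _ h a₀ = τ.app W (mres _ h (dSection s V t)) := by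
    intro W h
    rw [← mres_smul, ha₀]
    exact mres_app τ h _
  have hresk : ∀ (W : X.Opens) (h : W ≤ V) (k : κ),
      mres _ h (τ.app V (ω k)) = τ.app W (mres _ h (ω k)) := fun W h k ↦ mres_app τ h _
  have hΩ : ∀ (W : X.Opens) (h : W ≤ V) (η : Γ(differentials s, W)), ∃ (c₀ : Γ(X, W))
      (c : κ → Γ(X, W)), τ.app W η =
        c₀ • mres _ h a₀ + ∑ k, c k • mres _ h (τ.app V (ω k)) := by
    intro W h η
    obtain ⟨c, hc'⟩ := hc.isBasisOn.exists_repr h η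
    rw [Fintype.sum_option] at hc'
    refine ⟨c none * fres h t, fun k ↦ c (some k), ?_⟩
    rw [hc', map_add, map_sum, mul_smul, hres₀, Scheme.Modules.Hom.app_smul]
    congr 1
    refine Finset.sum_congr rfl fun k _ ↦ ?_
    rw [hresk, Scheme.Modules.Hom.app_smul]
    rfl
  have hb : IsBasisOn (logDifferentials s i) V (fun o ↦ shf N.toPresheafOfModules V (w o)) := by
    refine isBasisOn_shf_log s i w (fun W h c hc' ↦ ?_) (fun W h η ↦ ?_)
      (fun W h f hf x hx ↦ ?_)
    · have h0 : c = fun o : Option κ ↦ o.elim (c none) fun k ↦ c (some k) := by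
        funext o; cases o <;> rfl
      rw [h0, key] at hc'
      have h1 := congrArg (awaySec (differentials s) U W) hc'
      simp only [map_add, map_sum, awaySec_smul, awaySec_res, map_zero, hresk] at h1
      have h2 : awaySec (differentials s) U V a₀ = v • mres _ (away_le U V) (dSection s V t) :=
        AddEquiv.apply_symm_apply _ _
      rw [h2, mres_smul, mres_mres, smul_smul] at h1
      have h3 := hc.isBasisOn.repr_eq_zero ((away_le U W).trans h) (c := fun o : Option κ ↦
        o.elim (fres (away_le U W) (c none) * fres (away_mono U h) v)
          fun k ↦ fres (away_le U W) (c (some k))) (by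
        rw [Fintype.sum_option]
        refine Eq.trans ?_ h1
        congr 1
        refine Finset.sum_congr rfl fun k _ ↦ ?_
        refine congrArg (fres (away_le U W) (c (some k)) • ·) ?_
        exact ((awaySec_toAwayFrom (U := U) (mres _ h (ω k))).trans (mres_mres _ _ _ _)).symm)
      have hreg : ∀ b : Γ(X, W), fres (away_le U W) b = 0 → b = 0 := fun b hb ↦
        fun_eq_zero_of_isReg ht.isReg h (by
          rw [ht.basicOpen_eq]; exact fun y hy ↦ (mem_away U).mpr ⟨hy.2.2, hy.1⟩) (away_le U W) hb
      rintro (_ | k)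
      · refine hreg _ ?_
        have h4 := h3 none
        have hvu : IsUnit (fres (away_mono U h) v) := (IsUnit.of_mul_eq_one_right _ hv).map _
        exact hvu.mul_left_eq_zero.mp h4
      · exact hreg _ (h3 (some k))
    · obtain ⟨c₀, c, h1⟩ := hΩ W h η
      exact ⟨fun o ↦ o.elim c₀ c, h1.trans (key W h c₀ c).symm⟩
    · obtain ⟨W', h', k, u, hx', hu, hf'⟩ := ht.exists_unit_mul_pow hD h hf hx
      obtain ⟨u', hu'⟩ := hu.exists_right_inv
      have h'' := h'.trans h
      obtain ⟨c₀, c, h1⟩ := hΩ W' h'' (u' • dSection s W' u)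
      refine ⟨W', h', h'', hx', fun o ↦ o.elim ((k : Γ(X, W')) + c₀) c, ?_⟩
      refine (congrArg (fres h' f • ·) (key W' h'' _ c)).trans ?_
      rw [add_smul, add_assoc, ← h1, hf', dSection_mul, smul_add, map_add]
      congr 1
      · rw [Scheme.Modules.Hom.app_smul, mul_smul]
        congr 1
        cases k with
        | zero =>
          rw [pow_zero, Nat.cast_zero, zero_smul, smul_zero]
          have : dSection s W' 1 = 0 := by
            have := dSection_const s W' 1
            rwa [map_one] at this
          rw [this, map_zero]
        | succ k =>
          have h2 : dSection s W' (fres h'' t) = mres _ h'' (dSection s V t) :=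
            dSection_res s h'' t
          rw [dSection_pow_succ, Scheme.Modules.Hom.app_smul, h2]
          refine Eq.trans ?_ (congrArg _ (hres₀ W' h''))
          rw [smul_smul, smul_smul, pow_succ]
          congr 1
          ring
      · rw [Scheme.Modules.Hom.app_smul, Scheme.Modules.Hom.app_smul, smul_smul, mul_right_comm,
          hu', one_mul]
  refine ⟨_, ht, hc.isBasisOn, hc.isBasisOn_restrict, hb, ?_, fun k ↦ rfl⟩
  refine (shf_smul N.toPresheafOfModules t (w none)).symm.trans
    (congrArg (shf N.toPresheafOfModules V) ?_)
  exact subVal_injective N ha₀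

end frame

/-! ### The Poincaré residue -/

section residue

variable {X D : Scheme.{u}} {R : CommRingCat.{u}} {s : X ⟶ Spec R} {i : D ⟶ X} {V W : X.Opens}
  {κ : Type} [Fintype κ] {t : Γ(X, V)} {ω : κ → Γ(differentials s, V)}
  {e : Option κ → Γ(logDifferentials s i, V)}

theorem LogFrame.mono (hF : LogFrame s i V t ω e) (h : W ≤ V) :
    LogFrame s i W (fres h t) (fun k ↦ mres _ h (ω k)) (fun o ↦ mres _ h (e o)) := by
  have hd : dSection s W (fres h t) = mres _ h (dSection s V t) := dSection_res s h t
  refine ⟨hF.isEqn.mono h, ?_, ?_, hF.isBasisOn_log.mono h, ?_, fun k ↦ ?_⟩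
  · convert hF.isBasisOn.mono h using 2 with o
    cases o with
    | none => exact hd
    | some k => rfl
  · convert hF.isBasisOn_restrict.mono (i.preimage_mono h) using 2 with k
    rw [mres_qsec, qsec, qsec, spull_mres]
  · rw [← mres_smul, hF.smul_none, mres_app, hd]
  · rw [hF.eq_toLog, mres_app]

theorem LogFrame.sum_toLog (hF : LogFrame s i V t ω e) (c : Option κ → Γ(X, V)) :
    (toLog s i).app V (∑ o, c o • (Option.elim o (dSection s V t) ω)) =
      (c none * t) • e none + ∑ k, c (some k) • e (some k) := by
  rw [Fintype.sum_option, map_add, map_sum, Scheme.Modules.Hom.app_smul, mul_smul, hF.smul_none]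
  congr 1
  exact Finset.sum_congr rfl fun k _ ↦ by rw [Scheme.Modules.Hom.app_smul, hF.eq_toLog]; rfl

theorem LogFrame.exists_toLog (hF : LogFrame s i V t ω e) (η : Γ(differentials s, V)) :
    ∃ (c₀ : Γ(X, V)) (c : κ → Γ(X, V)), (toLog s i).app V η =
      (c₀ * t) • e none + ∑ k, c k • e (some k) := by
  obtain ⟨c, hc⟩ := hF.isBasisOn.exists_repr le_rfl η
  simp only [mres_self] at hc
  exact ⟨c none, fun k ↦ c (some k), by rw [hc, hF.sum_toLog]⟩

theorem LogFrame.exists_repr (hF : LogFrame s i V t ω e) (a : Γ(logDifferentials s i, V)) :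
    ∃ (c₀ : Γ(X, V)) (c : κ → Γ(X, V)), a = c₀ • e none + ∑ k, c k • e (some k) := by
  obtain ⟨c, hc⟩ := hF.isBasisOn_log.exists_repr le_rfl a
  simp only [mres_self] at hc
  exact ⟨c none, fun k ↦ c (some k), by rw [hc, Fintype.sum_option]⟩

theorem LogFrame.repr_ext (hF : LogFrame s i V t ω e) {c₀ c₀' : Γ(X, V)} {c c' : κ → Γ(X, V)}
    (h : c₀ • e none + ∑ k, c k • e (some k) = c₀' • e none + ∑ k, c' k • e (some k)) :
    c₀ = c₀' ∧ c = c' := by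
  have h1 := hF.isBasisOn_log.repr_ext le_rfl (c := fun o : Option κ ↦ o.elim c₀ c)
    (c' := fun o : Option κ ↦ o.elim c₀' c') (by
      simp only [mres_self, Fintype.sum_option]; exact h)
  exact ⟨congrFun h1 none, funext fun k ↦ congrFun h1 (some k)⟩

theorem LogFrame.smul_cancel (hF : LogFrame s i V t ω e) {a b : Γ(logDifferentials s i, V)}
    (h : t • a = t • b) : a = b := by
  obtain ⟨c₀, c, rfl⟩ := hF.exists_repr a
  obtain ⟨c₀', c', rfl⟩ := hF.exists_repr b
  simp only [smul_add, Finset.smul_sum, smul_smul] at h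
  obtain ⟨h1, h2⟩ := hF.repr_ext h
  rw [hF.isEqn.isReg.cancel h1]
  congr 2
  funext k
  rw [hF.isEqn.isReg.cancel (congrFun h2 k)]

/-- Logarithmic differentials `df / f` of functions `f = v t`. -/
theorem LogFrame.exists_dlog (hF : LogFrame s i V t ω e) {v v' : Γ(X, V)} (hv : v * v' = 1)
    {a : Γ(logDifferentials s i, V)}
    (ha : (v * t) • a = (toLog s i).app V (dSection s V (v * t))) :
    a = e none + (toLog s i).app V (v' • dSection s V v) := by
  have hvu : IsUnit v := IsUnit.of_mul_eq_one _ hv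
  refine hF.smul_cancel (hvu.smul_left_cancel.mp ?_)
  rw [smul_smul, ha, dSection_mul, map_add, Scheme.Modules.Hom.app_smul,
    Scheme.Modules.Hom.app_smul, Scheme.Modules.Hom.app_smul, ← hF.smul_none]
  simp only [smul_add, smul_smul]
  congr 2
  rw [mul_left_comm, hv, mul_one]

/-- The first coordinate of a logarithmic form does not depend on the frame, up to multiples of
the equation. -/
theorem LogFrame.fpull_eq (hF : LogFrame s i V t ω e) {κ' : Type} [Fintype κ'] {t' : Γ(X, V)}
    {ω' : κ' → Γ(differentials s, V)} {e' : Option κ' → Γ(logDifferentials s i, V)}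
    (hF' : LogFrame s i V t' ω' e') {c₀ : Γ(X, V)} {c : κ → Γ(X, V)} {c₀' : Γ(X, V)}
    {c' : κ' → Γ(X, V)}
    (h : c₀ • e none + ∑ k, c k • e (some k) = c₀' • e' none + ∑ k, c' k • e' (some k)) :
    fpull i (le_refl (i ⁻¹ᵁ V)) c₀ = fpull i le_rfl c₀' := by
  obtain ⟨v, hv⟩ := hF.isEqn.exists_mul V le_rfl t' hF'.isEqn.zero
  obtain ⟨v', hv'⟩ := hF'.isEqn.exists_mul V le_rfl t hF.isEqn.zero
  rw [fres_self] at hv hv'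
  have h1 : v * v' = 1 := hF.isEqn.isReg.cancel (by rw [← mul_assoc, ← hv, ← hv', mul_one])
  rw [mul_comm] at hv
  have h2 := hF'.smul_none
  rw [hv] at h2
  have h3 := hF.exists_dlog h1 h2
  have h4 : c₀' • e' none + ∑ k, c' k • e' (some k) = c₀' • e none +
      (toLog s i).app V (c₀' • v' • dSection s V v + ∑ k, c' k • ω' k) := by
    rw [h3, map_add, map_sum, smul_add, add_assoc, Scheme.Modules.Hom.app_smul _ c₀']
    congr 2
    exact Finset.sum_congr rfl fun k _ ↦ by rw [hF'.eq_toLog, Scheme.Modules.Hom.app_smul]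
  obtain ⟨d₀, d, hd⟩ := hF.exists_toLog (c₀' • v' • dSection s V v + ∑ k, c' k • ω' k)
  rw [h4, hd, ← add_assoc, ← add_smul] at h
  have h5 := (hF.repr_ext h).1
  rw [h5, map_add, map_mul, hF.isEqn.zero, mul_zero, add_zero]

/-- Sections of `i_* 𝒪_D`. -/
def resSec (i : D ⟶ X) (V : X.Opens) :
    Γ((Scheme.Modules.pushforward i).obj (structureSheaf D), V) ≃+ Γ(D, i ⁻¹ᵁ V) :=
  (pushSec i (structureSheaf D) V).trans (unitSec _)

theorem resSec_smul (c : Γ(X, V)) (b : Γ((Scheme.Modules.pushforward i).obj (structureSheaf D), V)) :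
    resSec i V (c • b) = fpull i le_rfl c * resSec i V b := by
  rw [resSec, AddEquiv.trans_apply, pushSec_smul, unitSec_smul]; rfl

theorem resSec_res (h : W ≤ V) (b : Γ((Scheme.Modules.pushforward i).obj (structureSheaf D), V)) :
    resSec i W (mres _ h b) = fres (i.preimage_mono h) (resSec i V b) := rfl

theorem subsingleton_of_le_complement [IsClosedImmersion i] (h : W ≤ complement i) :
    Subsingleton Γ(D, i ⁻¹ᵁ W) := by
  have h1 : i ⁻¹ᵁ W = ⊥ := by
    rw [eq_bot_iff, ← preimage_complement (i := i)]
    exact i.preimage_mono h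
  rw [h1]; infer_instance

/-- The residue exists if there are logarithmic frames at all points of the boundary. -/
theorem exists_residue [IsClosedImmersion i]
    (H : ∀ y : D, ∃ (V : X.Opens) (κ : Type) (_ : Fintype κ) (t : Γ(X, V))
      (ω : κ → Γ(differentials s, V)) (e : Option κ → Γ(logDifferentials s i, V)),
      i y ∈ V ∧ LogFrame s i V t ω e) :
    ∃ res : logDifferentials s i ⟶ (Scheme.Modules.pushforward i).obj (structureSheaf D),
      ∀ (V : X.Opens) (κ : Type) (_ : Fintype κ) (t : Γ(X, V))
        (ω : κ → Γ(differentials s, V)) (e : Option κ → Γ(logDifferentials s i, V)),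
        LogFrame s i V t ω e → ∀ (c₀ : Γ(X, V)) (c : κ → Γ(X, V)),
        resSec i V (res.app V (c₀ • e none + ∑ k, c k • e (some k))) = fpull i le_rfl c₀ := by
  refine (exists_hom_of_relation (A := logDifferentials s i)
    (G := (Scheme.Modules.pushforward i).obj (structureSheaf D))
    (fun U a b ↦ ∀ (W : X.Opens) (h : W ≤ U) (κ : Type) (_ : Fintype κ) (t : Γ(X, W))
      (ω : κ → Γ(differentials s, W)) (e : Option κ → Γ(logDifferentials s i, W)),
      LogFrame s i W t ω e → ∀ (c₀ : Γ(X, W)) (c : κ → Γ(X, W)),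
      mres _ h a = c₀ • e none + ∑ k, c k • e (some k) →
      resSec i W (mres _ h b) = fpull i le_rfl c₀) ?_ ?_ ?_ ?_ ?_).imp
      fun φ hφ V κ _ t ω e hF c₀ c ↦ ?_
  · intro U V h a b hab W hW κ _ t ω e hF c₀ c hc
    rw [mres_mres] at hc ⊢
    exact hab W _ κ _ t ω e hF c₀ c hc
  · intro U a b a' b' hab hab' W hW κ _ t ω e hF c₀ c hc
    obtain ⟨d₀, d, hd⟩ := hF.exists_repr (mres _ hW a)
    obtain ⟨d₀', d', hd'⟩ := hF.exists_repr (mres _ hW a')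
    rw [map_add, map_add, hab W hW κ _ t ω e hF _ _ hd, hab' W hW κ _ t ω e hF _ _ hd', ← map_add]
    rw [map_add, hd, hd'] at hc
    have := (hF.repr_ext (c₀ := d₀ + d₀') (c := fun k ↦ d k + d' k) (c₀' := c₀) (c' := c) (by
      rw [← hc]
      simp only [add_smul, Finset.sum_add_distrib]
      abel)).1
    rw [this]
  · intro U r a b hab W hW κ _ t ω e hF c₀ c hc
    obtain ⟨d₀, d, hd⟩ := hF.exists_repr (mres _ hW a)
    rw [mres_smul, resSec_smul, hab W hW κ _ t ω e hF _ _ hd, ← map_mul]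
    rw [mres_smul, hd] at hc
    have := (hF.repr_ext (c₀ := fres hW r * d₀) (c := fun k ↦ fres hW r * d k) (c₀' := c₀)
      (c' := c) (by
      rw [← hc]
      simp only [smul_add, Finset.smul_sum, smul_smul])).1
    rw [this]
  · intro U b hb
    refine (resSec i U).injective ?_
    rw [map_zero]
    refine fun_ext fun y hy ↦ ?_
    obtain ⟨V, κ, _, t, ω, e, hyV, hF⟩ := H y
    refine ⟨i ⁻¹ᵁ (V ⊓ U), i.preimage_mono inf_le_right, ⟨hyV, hy⟩, ?_⟩
    have := hb (V ⊓ U) inf_le_right κ _ _ _ _ (hF.mono inf_le_left) 0 0 (by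
      rw [map_zero]; simp)
    rw [resSec_res, map_zero] at this
    rw [this, map_zero]
  · intro U a x hx
    by_cases hxD : x ∈ complement i
    · refine ⟨U ⊓ complement i, inf_le_left, ⟨hx, hxD⟩, 0, fun W hW κ _ t ω e hF c₀ c hc ↦ ?_⟩
      have := subsingleton_of_le_complement (hW.trans inf_le_right)
      exact Subsingleton.elim _ _
    · rw [mem_complement, not_not] at hxD
      obtain ⟨y, rfl⟩ := hxD
      obtain ⟨V, κ, _, t, ω, e, hyV, hF⟩ := H y
      have hF' := hF.mono (inf_le_right : U ⊓ V ≤ V)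
      obtain ⟨d₀, d, hd⟩ := hF'.exists_repr (mres _ inf_le_left a)
      refine ⟨U ⊓ V, inf_le_left, ⟨hx, hyV⟩, (resSec i _).symm (fpull i le_rfl d₀),
        fun W hW κ' _ t' ω' e' hF'' c₀ c hc ↦ ?_⟩
      rw [resSec_res, AddEquiv.apply_symm_apply, fres_fpull, ← fpull_fres _ hW (le_refl (i ⁻¹ᵁ W))]
      refine (hF'.mono hW).fpull_eq hF'' (c := fun k ↦ fres hW (d k)) (c' := c) ?_
      rw [← hc, hd, map_add, map_sum, mres_smul]
      congr 1
      exact Finset.sum_congr rfl fun k _ ↦ by rw [mres_smul]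
  · rw [hφ V _ ((resSec i V).symm (fpull i le_rfl c₀)), AddEquiv.apply_symm_apply]
    intro W hW κ' _ t' ω' e' hF' c₀' c' hc
    rw [resSec_res, AddEquiv.apply_symm_apply, fres_fpull, ← fpull_fres _ hW (le_refl (i ⁻¹ᵁ W))]
    refine (hF.mono hW).fpull_eq hF' (c := fun k ↦ fres hW (c k)) (c' := c') ?_
    rw [← hc, map_add, map_sum, mres_smul]
    congr 1
    exact Finset.sum_congr rfl fun k _ ↦ by rw [mres_smul]

end residue

/-! ### Local criteria for morphisms -/

section criteria

variable {T Y : Scheme.{u}} (f : T ⟶ Y)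

theorem morphismRestrict_appTop_openTop (U : Y.Opens) (a : Γ(Y, U)) :
    (f ∣_ U).appTop (openTop U a) = openTop (f ⁻¹ᵁ U) (f.app U a) := by
  have h1 : (f ∣_ U).appTop (openTop U a) = fpull (f ∣_ U) (top_le_preimage_top _) (openTop U a) :=
    app_eq_fpull (f ∣_ U) _
  rw [h1, openTop, openTop, fpull_comp, app_eq_fpull, fpull_comp]
  exact fpull_congr (morphismRestrict_ι f U) _ _

theorem isClosedImmersion_of_forall (H : ∀ y : Y, ∃ U : Y.Opens, y ∈ U ∧ IsAffineOpen U ∧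
    IsAffineOpen (f ⁻¹ᵁ U) ∧ Function.Surjective (f.app U)) : IsClosedImmersion f := by
  choose U hy hU hU' hs using H
  have htop : ⨆ y, U y = ⊤ := eq_top_iff.mpr fun y _ ↦ Opens.mem_iSup.mpr ⟨y, hy y⟩
  refine IsZariskiLocalAtTarget.of_iSup_eq_top (P := @IsClosedImmersion.{u}) U htop fun y ↦ ?_
  have : IsAffine (U y) := hU y
  have : IsAffine (f ⁻¹ᵁ U y) := hU' y
  refine IsClosedImmersion.of_surjective_of_isAffine _ fun b ↦ ?_
  obtain ⟨b, rfl⟩ := (openTop_bijective _).2 b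
  obtain ⟨a, rfl⟩ := hs y b
  exact ⟨openTop _ a, morphismRestrict_appTop_openTop f (U y) a⟩

theorem isIso_of_forall (H : ∀ y : Y, ∃ U : Y.Opens, y ∈ U ∧ IsAffineOpen U ∧
    IsAffineOpen (f ⁻¹ᵁ U) ∧ Function.Bijective (f.app U)) : IsIso f := by
  choose U hy hU hU' hs using H
  have htop : ⨆ y, U y = ⊤ := eq_top_iff.mpr fun y _ ↦ Opens.mem_iSup.mpr ⟨y, hy y⟩
  refine IsZariskiLocalAtTarget.of_iSup_eq_top (P := MorphismProperty.isomorphisms Scheme.{u})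
    U htop fun y ↦ ?_
  have : IsAffine (U y) := hU y
  have : IsAffine (f ⁻¹ᵁ U y) := hU' y
  have : IsIso (f ∣_ U y).appTop := by
    refine (ConcreteCategory.isIso_iff_bijective _).mpr ⟨fun a b h ↦ ?_, fun b ↦ ?_⟩
    · obtain ⟨a, rfl⟩ := (openTop_bijective _).2 a
      obtain ⟨b, rfl⟩ := (openTop_bijective _).2 b
      have h' := (morphismRestrict_appTop_openTop f (U y) a).symm.trans
        (h.trans (morphismRestrict_appTop_openTop f (U y) b))
      rw [(hs y).1 ((openTop_bijective _).1 h')]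
    · obtain ⟨b, rfl⟩ := (openTop_bijective _).2 b
      obtain ⟨a, rfl⟩ := (hs y).2 b
      exact ⟨openTop _ a, morphismRestrict_appTop_openTop f (U y) a⟩
  have h : IsIso ((f ∣_ U y) ≫ (U y).toScheme.isoSpec.hom) := by
    rw [← Scheme.isoSpec_hom_naturality]
    infer_instance
  exact IsIso.of_isIso_comp_right _ (U y).toScheme.isoSpec.hom

theorem isOpenImmersion_of_forall (U₀ : Y.Opens) (hf : ∀ x, f x ∈ U₀)
    (H : ∀ y ∈ U₀, ∃ U : Y.Opens, U ≤ U₀ ∧ y ∈ U ∧ IsAffineOpen U ∧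
      IsAffineOpen (f ⁻¹ᵁ U) ∧ Function.Bijective (f.app U)) :
    IsOpenImmersion f ∧ Set.range f = U₀ := by
  have hr : Set.range f ⊆ Set.range U₀.ι := by
    rw [Scheme.Opens.range_ι]
    rintro _ ⟨x, rfl⟩
    exact hf x
  obtain ⟨g, rfl⟩ : ∃ g : T ⟶ U₀, g ≫ U₀.ι = f :=
    ⟨IsOpenImmersion.lift U₀.ι f hr, IsOpenImmersion.lift_fac _ _ _⟩
  have : IsIso g := by
    refine isIso_of_forall g fun y ↦ ?_
    obtain ⟨U, hle, hy, hU, hU', hb⟩ := H y.1 y.2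
    have hle' : U ≤ U₀.ι.opensRange := by rwa [Scheme.Opens.opensRange_ι]
    refine ⟨U₀.ι ⁻¹ᵁ U, hy, hU.preimage_of_isOpenImmersion _ hle', hU', ?_⟩
    have h1 : Function.Bijective (U₀.ι.app U) :=
      have := U₀.ι.isIso_app U hle'
      ConcreteCategory.bijective_of_isIso _
    have h2 : Function.Bijective (g.app (U₀.ι ⁻¹ᵁ U) ∘ U₀.ι.app U) := by
      have h3 := Scheme.Hom.comp_app g U₀.ι U
      rw [h3] at hb
      exact hb
    exact (Function.Bijective.of_comp_iff _ h1).mp h2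
  refine ⟨inferInstance, ?_⟩
  rw [← Scheme.Hom.coe_opensRange, Scheme.Hom.opensRange_comp_of_isIso, Scheme.Opens.opensRange_ι]

end criteria

section chart

variable {X P T : Scheme.{u}} {F : X.Modules} {p : P ⟶ X} {L : P.Modules}
  {q : (Scheme.Modules.pullback p).obj F ⟶ L} {V : X.Opens} {ι : Type} [Fintype ι]
  {e : ι → Γ(F, V)}

/-- The functions on a chart are generated by the functions on the base and the coordinates. -/
theorem chart_induction (hP : IsProjectiveBundle F p q) (he : IsBasisOn F V e)
    (hV : IsAffineOpen V) {j : ι} (S : Subring Γ(P, chart q e j))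
    (h : ∀ a, fpull p (chart_le q e j) a ∈ S) (h' : ∀ i, coord q e j i ∈ S) (c) : c ∈ S := by
  obtain ⟨κ, w, rfl⟩ := exists_option_equiv j
  obtain ⟨c, rfl⟩ := (chart_isAffineOpen_and_bijective w hP he hV).2.surjective c
  induction c using MvPolynomial.induction_on with
  | C a => rw [chartHom_C]; exact h a
  | add a b ha hb => rw [map_add]; exact S.add_mem ha hb
  | mul_X a k ha => rw [map_mul, chartHom_X]; exact S.mul_mem ha (h' _)

variable {g : T ⟶ P} {f : T ⟶ X} {M : T.Modules} {r : (Scheme.Modules.pullback f).obj F ⟶ M}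
  {j : ι}

theorem Classifies.isGen (h : Classifies q g r) {W : T.Opens}
    (hW : W ≤ g ⁻¹ᵁ chart q e j) (hW' : W ≤ f ⁻¹ᵁ V) : IsGen M W (qsec r hW' (e j)) := by
  obtain ⟨θ, hθ⟩ := h.exists_iso
  have h1 := ((isGen_chart q e j).pullback g).mono hW
  rw [mres_spull] at h1
  intro W' h'
  have h2 := h1 W' h'
  have hb : Function.Bijective (θ.hom.app W') := by
    have : IsIso (θ.hom.app W') := inferInstance
    exact ConcreteCategory.bijective_of_isIso _
  convert hb.comp h2 using 1
  funext c
  rw [Function.comp_apply, Scheme.Modules.Hom.app_smul, mres_spull, hθ, mres_qsec]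

theorem Classifies.preimage_chart_le (h : Classifies q g r) : g ⁻¹ᵁ chart q e j ≤ f ⁻¹ᵁ V := by
  obtain ⟨rfl, -⟩ := h
  exact g.preimage_mono (chart_le q e j)

theorem eq_bot_of_isGen_zero {W : T.Opens} (h : IsGen M W 0) : W = ⊥ := by
  have h1 : (1 : Γ(T, W)) = 0 := h.smul_ext le_rfl (by simp)
  have h2 := T.basicOpen_of_isUnit (isUnit_one (M := Γ(T, W)))
  rw [h1, Scheme.basicOpen_zero] at h2
  exact h2.symm

end chart

/-! ### Log pairs with frames -/

section pair

variable {X D : Scheme.{u}} {R : CommRingCat.{u}} (s : X ⟶ Spec R) (i : D ⟶ X)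

/-- Pairs that have logarithmic frames along the boundary, and bases of differentials outside. -/
structure LogPair : Prop where
  isClosedImmersion : IsClosedImmersion i
  exists_frame : ∀ y : D, ∃ (V : X.Opens) (κ : Type) (_ : Fintype κ) (t : Γ(X, V))
    (ω : κ → Γ(differentials s, V)) (e : Option κ → Γ(logDifferentials s i, V)),
    i y ∈ V ∧ IsAffineOpen V ∧ LogFrame s i V t ω e
  exists_basis : ∀ x ∈ complement i, ∃ (V : X.Opens) (κ : Type) (_ : Fintype κ)
    (e : κ → Γ(differentials s, V)), x ∈ V ∧ V ≤ complement i ∧ IsAffineOpen V ∧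
      IsBasisOn (differentials s) V e

/-- A residue map maps a logarithmic form to the restriction of its coefficient at `dt / t`. -/
def IsFrameResidue
    (res : logDifferentials s i ⟶ (Scheme.Modules.pushforward i).obj (structureSheaf D)) : Prop :=
  ∀ (V : X.Opens) (κ : Type) (_ : Fintype κ) (t : Γ(X, V))
    (ω : κ → Γ(differentials s, V)) (e : Option κ → Γ(logDifferentials s i, V)),
    LogFrame s i V t ω e → ∀ (c₀ : Γ(X, V)) (c : κ → Γ(X, V)),
    resSec i V (res.app V (c₀ • e none + ∑ k, c k • e (some k))) = fpull i le_rfl c₀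

end pair

section smoothPair

variable {X D : Scheme.{u}} {i : D ⟶ X} {K : Type u} [Field K]
  (s : X ⟶ Spec (CommRingCat.of K)) [Smooth s] [Smooth (i ≫ s)]

theorem logPair_of_smooth (hi : IsEffectiveCartier i) : LogPair s i := by
  have := hi.isClosedImmersion
  refine ⟨this, fun y ↦ ?_, fun x hx ↦ ?_⟩
  · obtain ⟨V, κ, _, t, ω, hy, hc⟩ := exists_logChart s hi y
    obtain ⟨e, he⟩ := hc.exists_logFrame (locallyDomain_of_smooth (i ≫ s))
    exact ⟨V, κ, _, t, ω, e, hy, hc.isAffineOpen, he⟩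
  · obtain ⟨A, hA, hxA, hAU⟩ := exists_isAffineOpen_mem_and_subset hx
    have hA' : IsAffineOpen A := hA
    obtain ⟨g, hg, n, ⟨b⟩⟩ := exists_basis_om s hA' hxA
    exact ⟨X.basicOpen g, Fin n, inferInstance, _, hg, (X.basicOpen_le g).trans hAU,
      hA'.basicOpen g, isBasisOn_omSec s (hA'.basicOpen g) b⟩

end smoothPair

section residue

variable {X D : Scheme.{u}} {R : CommRingCat.{u}} {s : X ⟶ Spec R} {i : D ⟶ X}
  (hX : LogPair s i)
  {res : logDifferentials s i ⟶ (Scheme.Modules.pushforward i).obj (structureSheaf D)}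
  (hres : IsFrameResidue s i res) {V W : X.Opens} {κ : Type} [Fintype κ] {t : Γ(X, V)}
  {ω : κ → Γ(differentials s, V)} {e : Option κ → Γ(logDifferentials s i, V)}

include hX in
theorem LogPair.exists_residue : ∃ res, IsFrameResidue s i res := by
  have := hX.isClosedImmersion
  refine LogResolution.exists_residue fun y ↦ ?_
  obtain ⟨V, κ, _, t, ω, e, hy, -, hF⟩ := hX.exists_frame y
  exact ⟨V, κ, _, t, ω, e, hy, hF⟩

include hres in
theorem IsFrameResidue.app_none (hF : LogFrame s i V t ω e) :
    resSec i V (res.app V (e none)) = 1 := by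
  have := hres V κ _ t ω e hF 1 0
  simpa using this

include hres in
theorem IsFrameResidue.app_toLog (hF : LogFrame s i V t ω e) (η : Γ(differentials s, V)) :
    resSec i V (res.app V ((toLog s i).app V η)) = 0 := by
  obtain ⟨c₀, c, hc⟩ := hF.exists_toLog η
  rw [hc, hres V κ _ t ω e hF, map_mul, hF.isEqn.zero, mul_zero]

include hX hres in
theorem IsFrameResidue.isPoincareResidue : IsPoincareResidue s i res := by
  have hi := hX.isClosedImmersion
  have key : ∀ (U : X.Opens) (a b : Γ(D, i ⁻¹ᵁ U)),
      (∀ (V : X.Opens) (κ : Type) (_ : Fintype κ) (t : Γ(X, V)) (ω : κ → Γ(differentials s, V))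
        (e : Option κ → Γ(logDifferentials s i, V)), LogFrame s i V t ω e → ∀ h : V ≤ U,
        fres (i.preimage_mono h) a = fres (i.preimage_mono h) b) → a = b := by
    intro U a b h
    refine fun_ext fun y hy ↦ ?_
    obtain ⟨V, κ, _, t, ω, e, hyV, -, hF⟩ := hX.exists_frame y
    exact ⟨i ⁻¹ᵁ (V ⊓ U), i.preimage_mono inf_le_right, ⟨hyV, hy⟩,
      h (V ⊓ U) κ _ _ _ _ (hF.mono inf_le_left) inf_le_right⟩
  constructor
  · refine modHom_ext fun U a ↦ (resSec i U).injective (key _ _ _ fun V κ _ t ω e hF h ↦ ?_)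
    rw [← resSec_res h, ← resSec_res h, mres_app, mres_app]
    exact (hres.app_toLog hF (mres _ h a)).trans (map_zero (resSec i V)).symm
  · intro V f hf w hw
    refine (resSec i V.1).injective (key _ _ _ fun W κ _ t ω e hF h ↦ ?_)
    rw [← resSec_res h, mres_app]
    refine Eq.trans ?_ (map_one _).symm
    have hI := isIdealGen_of_ker_ideal V.2 hf
    refine fun_ext fun y hy ↦ ?_
    obtain ⟨g, hg⟩ := hF.isEqn.exists_mul W le_rfl (fres h f) (by
      have := congrArg (fres (i.preimage_mono h)) (hI.zero ())
      rw [fres_fpull, map_zero] at this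
      rw [fpull_fres, this])
    obtain ⟨W', h', c, hyW', hc⟩ := hI.exists_sum W h t hF.isEqn.zero (i y) hy
    rw [Fintype.sum_unique] at hc
    have hF' := hF.mono h'
    have h1 := congrArg (fres h') hg
    rw [fres_self, map_mul, fres_fres] at h1
    have h2 : fres h' g * c () = 1 := hF'.isEqn.isReg.cancel (by
      rw [← mul_assoc, ← h1, mul_comm, mul_one]; exact hc.symm)
    refine ⟨i ⁻¹ᵁ W', i.preimage_mono h', hyW', ?_⟩
    rw [← resSec_res h', mres_app, mres_mres, map_one]
    have h3 := congrArg (mres _ (h'.trans h)) hw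
    rw [mres_smul, mres_app] at h3
    have h4 : mres (differentials s) (h'.trans h) (dSection s V.1 f) =
      dSection s W' (fres (h'.trans h) f) := (dSection_res s (h'.trans h) f).symm
    rw [h4, h1, mul_comm] at h3
    rw [hF'.exists_dlog h2 h3, map_add, map_add, hres.app_none hF', hres.app_toLog hF', add_zero]

end residue

/-! ### The section given by the residue -/

section sigma

variable {X D Y : Scheme.{u}} {R : CommRingCat.{u}} {s : X ⟶ Spec R} {i : D ⟶ X}
  {res : logDifferentials s i ⟶ (Scheme.Modules.pushforward i).obj (structureSheaf D)}
  {V : X.Opens} {κ : Type} [Fintype κ] {t : Γ(X, V)}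
  {ω : κ → Γ(differentials s, V)} {e : Option κ → Γ(logDifferentials s i, V)}
  {p : Y ⟶ X} {L : Y.Modules} {q : (Scheme.Modules.pullback p).obj (logDifferentials s i) ⟶ L}
  {σ : D ⟶ Y}

theorem qsec_restrictToDivisor {F : X.Modules}
    (φ : F ⟶ (Scheme.Modules.pushforward i).obj (structureSheaf D)) {W : D.Opens}
    (h : W ≤ i ⁻¹ᵁ V) (a : Γ(F, V)) :
    unitSec W (qsec (restrictToDivisor i φ) h a) = fres h (resSec i V (φ.app V a)) :=
  congrArg (unitSec W) (homEquiv_symm_spull φ h a)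

theorem IsFrameResidue.qsec_none (hres : IsFrameResidue s i res) (hF : LogFrame s i V t ω e) :
    qsec (restrictToDivisor i res) le_rfl (e none) = (unitSec (i ⁻¹ᵁ V)).symm 1 := by
  apply (unitSec _).injective
  rw [qsec_restrictToDivisor, hres.app_none hF, map_one, AddEquiv.apply_symm_apply]

theorem IsFrameResidue.qsec_toLog (hres : IsFrameResidue s i res) (hF : LogFrame s i V t ω e)
    (η : Γ(differentials s, V)) :
    qsec (restrictToDivisor i res) (le_refl (i ⁻¹ᵁ V)) ((toLog s i).app V η) = 0 := by
  apply (unitSec _).injective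
  rw [qsec_restrictToDivisor, hres.app_toLog hF, map_zero, map_zero]

theorem IsFrameResidue.isGen (hres : IsFrameResidue s i res) (hF : LogFrame s i V t ω e) :
    IsGen (structureSheaf D) (i ⁻¹ᵁ V) (qsec (restrictToDivisor i res) le_rfl (e none)) := by
  rw [hres.qsec_none hF]
  exact isGen_one

theorem LogPair.exists_sigma (hX : LogPair s i) (hres : IsFrameResidue s i res)
    (hY : IsProjectiveBundle (logDifferentials s i) p q) :
    ∃ σ : D ⟶ Y, Classifies q σ (restrictToDivisor i res) := by
  have : Epi (restrictToDivisor i res) := epi_of_isGen _ fun y ↦ by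
    obtain ⟨V, κ, _, t, ω, e, hy, -, hF⟩ := hX.exists_frame y
    exact ⟨V, e none, i ⁻¹ᵁ V, le_rfl, hy, hres.isGen hF⟩
  obtain ⟨σ, hσ, -⟩ := hY.existsUnique D i (structureSheaf D) (restrictToDivisor i res)
    isInvertible_structureSheaf this
  exact ⟨σ, hσ⟩

variable (hX : LogPair s i) (hres : IsFrameResidue s i res)
  (hY : IsProjectiveBundle (logDifferentials s i) p q)
  (hσ : Classifies q σ (restrictToDivisor i res))

include hres hY hσ

theorem sigma_preimage_none (hF : LogFrame s i V t ω e) :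
    σ ⁻¹ᵁ chart q e none = i ⁻¹ᵁ V := by
  have := hY.epi
  exact le_antisymm (hσ.preimage_chart_le (e := e) (j := none))
    (hσ.le_chart none hY.isInvertible hF.isBasisOn_log le_rfl (hres.isGen hF))

theorem sigma_preimage_some (hF : LogFrame s i V t ω e) (k : κ) :
    σ ⁻¹ᵁ chart q e (some k) = ⊥ := by
  have h1 := hσ.isGen (e := e) (j := some k) le_rfl (hσ.preimage_chart_le (e := e) (j := some k))
  have h2 := congrArg (mres _ (hσ.preimage_chart_le (e := e) (j := some k))) (hres.qsec_toLog hF (ω k))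
  rw [mres_qsec, ← hF.eq_toLog, map_zero] at h2
  rw [h2] at h1
  exact eq_bot_of_isGen_zero h1

theorem sigma_le (hF : LogFrame s i V t ω e) : i ⁻¹ᵁ V ≤ σ ⁻¹ᵁ chart q e none :=
  (sigma_preimage_none hres hY hσ hF).ge

theorem sigma_coord (hF : LogFrame s i V t ω e) (k : κ) :
    fpull σ (sigma_le hres hY hσ hF) (coord q e none (some k)) = 0 := by
  refine hσ.fpull_coord none le_rfl (hres.isGen hF) ?_ _
  rw [hF.eq_toLog, hres.qsec_toLog hF, zero_smul]

theorem sigma_surjective [IsClosedImmersion i] (hF : LogFrame s i V t ω e) (hV : IsAffineOpen V) :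
    Function.Surjective (σ.app (chart q e none)) := by
  intro b
  have hb := sigma_preimage_none hres hY hσ hF
  obtain ⟨a, ha⟩ := Scheme.Hom.app_surjective i V hV (fres hb.ge b)
  refine ⟨fpull p (chart_le q e none) a, ?_⟩
  have h1 : fres hb.ge (σ.app _ (fpull p (chart_le q e none) a)) = fres hb.ge b := by
    rw [← ha, app_eq_fpull, fpull_comp, fres_fpull, app_eq_fpull]
    exact fpull_congr hσ.1 _ _
  have h2 := congrArg (fres hb.le) h1
  rwa [fres_fres, fres_fres, fres_self, fres_self] at h2

include hX

theorem isClosedImmersion_sigma : IsClosedImmersion σ := by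
  have := hX.isClosedImmersion
  have := hY.epi
  refine isClosedImmersion_of_forall σ fun y ↦ ?_
  by_cases hy : p y ∈ complement i
  · obtain ⟨A, hA, hyA, hAU⟩ := exists_isAffineOpen_mem_and_subset (U := p ⁻¹ᵁ complement i) hy
    have h1 : σ ⁻¹ᵁ A = ⊥ := by
      rw [eq_bot_iff, ← preimage_complement (i := i)]
      refine (σ.preimage_mono hAU).trans ?_
      rw [← Scheme.Hom.comp_preimage, hσ.1]
    refine ⟨A, hyA, hA, h1 ▸ isAffineOpen_bot D, ?_⟩
    have : Subsingleton Γ(D, σ ⁻¹ᵁ A) := by rw [h1]; infer_instance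
    exact fun b ↦ ⟨0, Subsingleton.elim _ _⟩
  · rw [mem_complement, not_not] at hy
    obtain ⟨d, hd⟩ := hy
    obtain ⟨V, κ, _, t, ω, e, hdV, hV, hF⟩ := hX.exists_frame d
    obtain ⟨o, ho⟩ := exists_mem_chart (q := q) hY.isInvertible hF.isBasisOn_log (y := y)
      (show p y ∈ V from hd ▸ hdV)
    refine ⟨_, ho, chart_isAffineOpen hY hF.isBasisOn_log hV o, ?_⟩
    cases o with
    | none =>
      refine ⟨?_, sigma_surjective hres hY hσ hF hV⟩
      rw [sigma_preimage_none hres hY hσ hF]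
      exact hV.preimage i
    | some k =>
      have h1 := sigma_preimage_some hres hY hσ hF k
      refine ⟨h1 ▸ isAffineOpen_bot D, ?_⟩
      have : Subsingleton Γ(D, σ ⁻¹ᵁ chart q e (some k)) := by rw [h1]; infer_instance
      exact fun b ↦ ⟨0, Subsingleton.elim _ _⟩

/-- The ideal of the section is generated by the equation and the coordinates. -/
theorem isIdealGen_sigma (hF : LogFrame s i V t ω e) (hV : IsAffineOpen V) :
    IsIdealGen σ (chart q e none) (fun o : Option κ ↦
      o.elim (fpull p (chart_le q e none) t) fun k ↦ coord q e none (some k)) := by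
  have := hX.isClosedImmersion
  have := isClosedImmersion_sigma hX hres hY hσ
  have hb := sigma_preimage_none hres hY hσ hF
  refine isIdealGen_of_ker (chart_isAffineOpen hY hF.isBasisOn_log hV none) ?_
  set g : Option κ → Γ(Y, chart q e none) := fun o ↦
      o.elim (fpull p (chart_le q e none) t) fun k ↦ coord q e none (some k) with hg
  let I := Ideal.span (Set.range g)
  have hpull : ∀ a : Γ(X, V), fpull σ (le_refl (σ ⁻¹ᵁ chart q e none))
      (fpull p (chart_le q e none) a) = fpull i hb.le a := by
    intro a
    rw [fpull_comp]
    exact fpull_congr hσ.1 _ _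
  have hcoord : ∀ k, fpull σ (le_refl (σ ⁻¹ᵁ chart q e none)) (coord q e none (some k)) = 0 := by
    intro k
    have h1 := congrArg (fres hb.le) (sigma_coord hres hY hσ hF k)
    rwa [fres_fpull, map_zero] at h1
  have hsurj : Function.Surjective (fpull i hb.le : Γ(X, V) →+* Γ(D, σ ⁻¹ᵁ chart q e none)) := by
    intro b
    obtain ⟨a, ha⟩ := Scheme.Hom.app_surjective i V hV (fres hb.ge b)
    refine ⟨a, ?_⟩
    rw [app_eq_fpull] at ha
    have := congrArg (fres hb.le) ha
    rwa [fres_fpull, fres_fres, fres_self] at this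
  have hker : ∀ a : Γ(X, V), a ∈ RingHom.ker (fpull i hb.le : Γ(X, V) →+* Γ(D, σ ⁻¹ᵁ chart q e none)) →
      a ∈ RingHom.ker ((Ideal.Quotient.mk I).comp (fpull p (chart_le q e none))) := by
    intro a ha
    rw [RingHom.mem_ker]
    have h1 := congrArg (fres hb.ge) (RingHom.mem_ker.mp ha)
    rw [fres_fpull, map_zero] at h1
    obtain ⟨c, hc⟩ := hF.isEqn.exists_mul V le_rfl a h1
    rw [hc, fres_self, map_mul, RingHom.comp_apply]
    have : Ideal.Quotient.mk I (fpull p (chart_le q e none) t) = 0 :=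
      Ideal.Quotient.eq_zero_iff_mem.mpr (Ideal.subset_span (Set.mem_range_self none))
    rw [this, zero_mul]
  let ψ : Γ(D, σ ⁻¹ᵁ chart q e none) →+* (Γ(Y, chart q e none) ⧸ I) :=
    RingHom.liftOfSurjective (C := Γ(Y, chart q e none) ⧸ I)
      (fpull i hb.le : Γ(X, V) →+* Γ(D, σ ⁻¹ᵁ chart q e none)) hsurj
      ⟨(Ideal.Quotient.mk I).comp (fpull p (chart_le q e none)), hker⟩
  have hψ : ψ.comp (fpull σ le_rfl) = Ideal.Quotient.mk I := by
    refine chart_ringHom_ext hY hF.isBasisOn_log hV (fun a ↦ ?_) (fun o ↦ ?_)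
    · rw [RingHom.comp_apply, hpull]
      exact RingHom.liftOfRightInverse_comp_apply _ _ _ _ a
    · cases o with
      | none => rw [coord_self, map_one, map_one]
      | some k =>
        rw [RingHom.comp_apply, hcoord, map_zero]
        exact (Ideal.Quotient.eq_zero_iff_mem.mpr (Ideal.subset_span (Set.mem_range_self (some k)))).symm
  intro f
  constructor
  · intro hf
    have h1 := RingHom.congr_fun hψ f
    rw [RingHom.comp_apply, hf, map_zero] at h1
    exact Ideal.Quotient.eq_zero_iff_mem.mp h1.symm
  · intro hf
    have h1 : I ≤ RingHom.ker (fpull σ (le_refl (σ ⁻¹ᵁ chart q e none))) := by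
      refine Ideal.span_le.mpr ?_
      rintro _ ⟨o, rfl⟩
      cases o with
      | none =>
        refine RingHom.mem_ker.mpr ((hpull t).trans ?_)
        have := congrArg (fres hb.le) hF.isEqn.zero
        rwa [fres_fpull, map_zero] at this
      | some k => exact RingHom.mem_ker.mpr (hcoord k)
    exact h1 hf

end sigma

/-! ### The inclusion of the projective bundle of the boundary -/

section tau

variable {X D Y₀ P : Scheme.{u}} {R : CommRingCat.{u}} {s : X ⟶ Spec R} {i : D ⟶ X}
  {V : X.Opens} {κ : Type} [Fintype κ] {t : Γ(X, V)}
  {ω : κ → Γ(differentials s, V)} {e : Option κ → Γ(logDifferentials s i, V)}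
  {p₀ : Y₀ ⟶ X} {L₀ : Y₀.Modules} {q₀ : (Scheme.Modules.pullback p₀).obj (differentials s) ⟶ L₀}
  {pD : P ⟶ D} {LD : P.Modules}
  {qD : (Scheme.Modules.pullback pD).obj (differentials (i ≫ s)) ⟶ LD} {τ : P ⟶ Y₀}

/-- The basis of `Ω_X` given by a logarithmic frame. -/
abbrev frameBasis (s : X ⟶ Spec R) (t : Γ(X, V)) (ω : κ → Γ(differentials s, V)) :
    Option κ → Γ(differentials s, V) := fun o ↦ o.elim (dSection s V t) ω

/-- The restriction of forms to the boundary. -/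
abbrev restrictForms (i : D ⟶ X) (ω : κ → Γ(differentials s, V)) :
    κ → Γ(differentials (i ≫ s), i ⁻¹ᵁ V) :=
  fun k ↦ qsec (differentialsPull (sX := i ≫ s) i rfl) le_rfl (ω k)

variable (i qD) in
/-- The quotient of `Ω_X` on the projective bundle of the boundary. -/
abbrev tauQuotient : (Scheme.Modules.pullback (pD ≫ i)).obj (differentials s) ⟶ LD :=
  pullbackQuotient (differentialsPull (sX := i ≫ s) i rfl) pD ≫ qD

theorem qsec_tauQuotient {U : P.Opens} (h : U ≤ pD ⁻¹ᵁ i ⁻¹ᵁ V) (h' : U ≤ (pD ≫ i) ⁻¹ᵁ V)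
    (η : Γ(differentials s, V)) : qsec (tauQuotient i qD) h' η =
      qsec qD h (qsec (differentialsPull (sX := i ≫ s) i rfl) le_rfl η) := by
  rw [qsec_comp]
  have := qsec_pullbackQuotient (differentialsPull (sX := i ≫ s) i rfl) pD
    (le_refl (i ⁻¹ᵁ V)) h η
  exact congrArg (qD.app U) this

theorem qsec_tauQuotient_dSection (ht : IsEqn i V t) {U : P.Opens} (h : U ≤ (pD ≫ i) ⁻¹ᵁ V) :
    qsec (tauQuotient i qD) h (dSection s V t) = 0 := by
  rw [qsec_tauQuotient (U := U) h h, qsec_differentialsPull_dSection, ht.zero, map_zero]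
  exact qsec_zero qD h

theorem isGen_tauQuotient (j : κ) {U : P.Opens} (hU : U ≤ chart qD (restrictForms i ω) j)
    (h : U ≤ (pD ≫ i) ⁻¹ᵁ V) : IsGen LD U (qsec (tauQuotient i qD) h (ω j)) := by
  have h1 := (isGen_chart qD (restrictForms i ω) j).mono hU
  rw [mres_qsec] at h1
  rwa [qsec_tauQuotient (hU.trans (chart_le qD _ j)) h]

theorem LogPair.exists_tau (hX : LogPair s i) (hY₀ : IsProjectiveBundle (differentials s) p₀ q₀)
    (hP : IsProjectiveBundle (differentials (i ≫ s)) pD qD) :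
    ∃ τ : P ⟶ Y₀, Classifies q₀ τ (tauQuotient i qD) := by
  have := hP.epi
  have : Epi (tauQuotient (s := s) i qD) := epi_of_isGen _ fun y ↦ by
    obtain ⟨V, κ, _, t, ω, e, hy, -, hF⟩ := hX.exists_frame (pD y)
    obtain ⟨j, hj⟩ := exists_mem_chart (q := qD) hP.isInvertible hF.isBasisOn_restrict hy
    exact ⟨V, ω j, _, chart_le qD (restrictForms i ω) j, hj, isGen_tauQuotient j le_rfl _⟩
  obtain ⟨τ, hτ, -⟩ := hY₀.existsUnique P (pD ≫ i) LD (tauQuotient i qD) hP.isInvertible this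
  exact ⟨τ, hτ⟩

theorem isGen_tauQuotient_frameBasis (j : κ) {U : P.Opens}
    (hU : U ≤ chart qD (restrictForms i ω) j) (h : U ≤ (pD ≫ i) ⁻¹ᵁ V) :
    IsGen LD U (qsec (tauQuotient i qD) h (frameBasis s t ω (some j))) :=
  isGen_tauQuotient j hU h

variable (hX : LogPair s i) (hY₀ : IsProjectiveBundle (differentials s) p₀ q₀)
  (hP : IsProjectiveBundle (differentials (i ≫ s)) pD qD) (hτ : Classifies q₀ τ (tauQuotient i qD))

include hτ

theorem tau_preimage_none (ht : IsEqn i V t) : τ ⁻¹ᵁ chart q₀ (frameBasis s t ω) none = ⊥ := by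
  have h1 := hτ.isGen (e := frameBasis s t ω) (j := none) le_rfl
    (hτ.preimage_chart_le (e := frameBasis s t ω) (j := none))
  change IsGen _ _ (qsec _ _ (dSection s V t)) at h1
  rw [qsec_tauQuotient_dSection ht] at h1
  exact eq_bot_of_isGen_zero h1

include hY₀ hP

theorem tau_preimage_some (hF : LogFrame s i V t ω e) (j : κ) :
    τ ⁻¹ᵁ chart q₀ (frameBasis s t ω) (some j) = chart qD (restrictForms i ω) j := by
  have := hY₀.epi
  have := hP.epi
  have hle := hτ.preimage_chart_le (e := frameBasis s t ω) (j := some j)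
  apply le_antisymm
  · refine le_chart (j := j) (hW := ?_) hle
    have h1 := hτ.isGen (e := frameBasis s t ω) (j := some j) le_rfl hle
    change IsGen _ _ (qsec _ _ (ω j)) at h1
    rwa [qsec_tauQuotient (U := τ ⁻¹ᵁ chart q₀ (frameBasis s t ω) (some j)) hle] at h1
  · exact hτ.le_chart (some j) hY₀.isInvertible hF.isBasisOn
      (chart_le qD (restrictForms i ω) j) (isGen_tauQuotient j le_rfl _)

theorem tau_le (hF : LogFrame s i V t ω e) (j : κ) :
    chart qD (restrictForms i ω) j ≤ τ ⁻¹ᵁ chart q₀ (frameBasis s t ω) (some j) :=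
  (tau_preimage_some hY₀ hP hτ hF j).ge

theorem tau_coord_none (hF : LogFrame s i V t ω e) (j : κ) :
    fpull τ (tau_le hY₀ hP hτ hF j) (coord q₀ (frameBasis s t ω) (some j) none) = 0 := by
  refine hτ.fpull_coord (e := frameBasis s t ω) (some j) (chart_le qD (restrictForms i ω) j)
    (isGen_tauQuotient_frameBasis j le_rfl _) ?_ _
  rw [zero_smul]
  exact qsec_tauQuotient_dSection hF.isEqn _

theorem tau_coord_some (hF : LogFrame s i V t ω e) (j k : κ) :
    fpull τ (tau_le hY₀ hP hτ hF j) (coord q₀ (frameBasis s t ω) (some j) (some k)) =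
      coord qD (restrictForms i ω) j k := by
  refine hτ.fpull_coord (e := frameBasis s t ω) (some j) (chart_le qD (restrictForms i ω) j)
    (isGen_tauQuotient_frameBasis j le_rfl _) ?_ _
  have h1 : ∀ k, qsec (tauQuotient i qD) (chart_le qD (restrictForms i ω) j) (ω k) =
      qsec qD (chart_le qD (restrictForms i ω) j) (restrictForms i ω k) :=
    fun k ↦ qsec_tauQuotient (chart_le qD (restrictForms i ω) j) _ (ω k)
  have h2 := coord_smul qD (restrictForms i ω) j k le_rfl
  rw [fres_self] at h2
  exact (h1 k).trans (h2.trans (congrArg _ (h1 j).symm))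

theorem tau_fpull {j : κ} (h : chart qD (restrictForms i ω) j ≤
      τ ⁻¹ᵁ chart q₀ (frameBasis s t ω) (some j)) (a : Γ(X, V)) :
    fpull τ h (fpull p₀ (chart_le q₀ (frameBasis s t ω) (some j)) a) =
      fpull pD (chart_le qD (restrictForms i ω) j) (fpull i le_rfl a) := by
  rw [fpull_comp, fpull_comp]
  exact fpull_congr hτ.1 _ _

theorem tau_surjective [IsClosedImmersion i] (hF : LogFrame s i V t ω e) (hV : IsAffineOpen V)
    (j : κ) : Function.Surjective (τ.app (chart q₀ (frameBasis s t ω) (some j))) := by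
  have h1 : ∀ c, c ∈ (fpull τ (tau_le hY₀ hP hτ hF j)).range := by
    refine chart_induction hP hF.isBasisOn_restrict (hV.preimage i) _ (fun a ↦ ?_) (fun k ↦ ?_)
    · obtain ⟨a, rfl⟩ := Scheme.Hom.app_surjective i V hV a
      exact ⟨_, (tau_fpull hY₀ hP hτ _ a).trans (by rw [app_eq_fpull])⟩
    · exact ⟨_, tau_coord_some hY₀ hP hτ hF j k⟩
  intro b
  have hb := tau_preimage_some hY₀ hP hτ hF j
  obtain ⟨a, ha⟩ := h1 (fres hb.ge b)
  refine ⟨a, ?_⟩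
  have h2 := congrArg (fres hb.le) ha
  rw [fres_fpull, fres_fres, fres_self] at h2
  rw [app_eq_fpull, h2]

include hX

theorem isClosedImmersion_tau : IsClosedImmersion τ := by
  have := hX.isClosedImmersion
  have := hY₀.epi
  refine isClosedImmersion_of_forall τ fun y ↦ ?_
  by_cases hy : p₀ y ∈ complement i
  · obtain ⟨A, hA, hyA, hAU⟩ := exists_isAffineOpen_mem_and_subset (U := p₀ ⁻¹ᵁ complement i) hy
    have h1 : τ ⁻¹ᵁ A = ⊥ := by
      rw [eq_bot_iff]
      refine (τ.preimage_mono hAU).trans ?_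
      rw [← Scheme.Hom.comp_preimage, hτ.1, Scheme.Hom.comp_preimage, preimage_complement]
      rfl
    refine ⟨A, hyA, hA, h1 ▸ isAffineOpen_bot P, ?_⟩
    have : Subsingleton Γ(P, τ ⁻¹ᵁ A) := by rw [h1]; infer_instance
    exact fun b ↦ ⟨0, Subsingleton.elim _ _⟩
  · rw [mem_complement, not_not] at hy
    obtain ⟨d, hd⟩ := hy
    obtain ⟨V, κ, _, t, ω, e, hdV, hV, hF⟩ := hX.exists_frame d
    obtain ⟨o, ho⟩ := exists_mem_chart (q := q₀) hY₀.isInvertible hF.isBasisOn (y := y)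
      (show p₀ y ∈ V from hd ▸ hdV)
    refine ⟨_, ho, chart_isAffineOpen hY₀ hF.isBasisOn hV o, ?_⟩
    cases o with
    | none =>
      have h1 := tau_preimage_none (ω := ω) hτ hF.isEqn
      refine ⟨h1 ▸ isAffineOpen_bot P, ?_⟩
      have : Subsingleton Γ(P, τ ⁻¹ᵁ chart q₀ (frameBasis s t ω) none) := by
        rw [h1]; infer_instance
      exact fun b ↦ ⟨0, Subsingleton.elim _ _⟩
    | some j =>
      refine ⟨?_, tau_surjective hY₀ hP hτ hF hV j⟩
      rw [tau_preimage_some hY₀ hP hτ hF]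
      exact chart_isAffineOpen hP hF.isBasisOn_restrict (hV.preimage i) j

/-- The ideal of the projective bundle of the boundary is generated by the equation and the first
coordinate. -/
theorem isIdealGen_tau (hF : LogFrame s i V t ω e) (hV : IsAffineOpen V) (j : κ) :
    IsIdealGen τ (chart q₀ (frameBasis s t ω) (some j)) (fun o : Option Unit ↦
      o.elim (fpull p₀ (chart_le q₀ (frameBasis s t ω) (some j)) t)
        fun _ ↦ coord q₀ (frameBasis s t ω) (some j) none) := by
  have := hX.isClosedImmersion
  have := isClosedImmersion_tau hX hY₀ hP hτ
  have hb := tau_preimage_some hY₀ hP hτ hF j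
  refine isIdealGen_of_ker (chart_isAffineOpen hY₀ hF.isBasisOn hV (some j)) ?_
  set g : Option Unit → Γ(Y₀, chart q₀ (frameBasis s t ω) (some j)) := fun o ↦
      o.elim (fpull p₀ (chart_le q₀ (frameBasis s t ω) (some j)) t)
        fun _ ↦ coord q₀ (frameBasis s t ω) (some j) none with hg
  let I := Ideal.span (Set.range g)
  have hpull := tau_fpull hY₀ hP hτ (tau_le hY₀ hP hτ hF j)
  have hsurj : Function.Surjective (fpull i (le_refl (i ⁻¹ᵁ V))) := by
    intro b
    obtain ⟨a, ha⟩ := Scheme.Hom.app_surjective i V hV b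
    exact ⟨a, by rwa [app_eq_fpull] at ha⟩
  have hker : ∀ a : Γ(X, V), a ∈ RingHom.ker (fpull i (le_refl (i ⁻¹ᵁ V))) →
      a ∈ RingHom.ker ((Ideal.Quotient.mk I).comp
        (fpull p₀ (chart_le q₀ (frameBasis s t ω) (some j)))) := by
    intro a ha
    rw [RingHom.mem_ker]
    obtain ⟨c, hc⟩ := hF.isEqn.exists_mul V le_rfl a ha
    rw [hc, fres_self, map_mul, RingHom.comp_apply]
    have : Ideal.Quotient.mk I (fpull p₀ (chart_le q₀ (frameBasis s t ω) (some j)) t) = 0 :=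
      Ideal.Quotient.eq_zero_iff_mem.mpr (Ideal.subset_span (Set.mem_range_self none))
    rw [this, zero_mul]
  let φ : Γ(D, i ⁻¹ᵁ V) →+* (Γ(Y₀, chart q₀ (frameBasis s t ω) (some j)) ⧸ I) :=
    RingHom.liftOfSurjective (C := Γ(Y₀, chart q₀ (frameBasis s t ω) (some j)) ⧸ I)
      (fpull i (le_refl (i ⁻¹ᵁ V))) hsurj
      ⟨(Ideal.Quotient.mk I).comp (fpull p₀ (chart_le q₀ (frameBasis s t ω) (some j))), hker⟩
  obtain ⟨ψ, hψ₁, hψ₂⟩ := exists_chart_ringHom hP hF.isBasisOn_restrict (hV.preimage i) φ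
    (fun k ↦ Ideal.Quotient.mk I (coord q₀ (frameBasis s t ω) (some j) (some k)))
    (j := j) (by rw [coord_self, map_one])
  have hψ : ψ.comp (fpull τ (tau_le hY₀ hP hτ hF j)) = Ideal.Quotient.mk I := by
    refine chart_ringHom_ext hY₀ hF.isBasisOn hV (fun a ↦ ?_) (fun o ↦ ?_)
    · rw [RingHom.comp_apply, hpull, hψ₁]
      exact RingHom.liftOfRightInverse_comp_apply _ _ _ _ a
    · cases o with
      | none =>
        rw [RingHom.comp_apply, tau_coord_none hY₀ hP hτ hF, map_zero]
        exact (Ideal.Quotient.eq_zero_iff_mem.mpr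
          (Ideal.subset_span (Set.mem_range_self (some ())))).symm
      | some k => rw [RingHom.comp_apply, tau_coord_some hY₀ hP hτ hF, hψ₂]
  have hzero : ∀ o, fpull τ (le_refl _) (g o) = 0 := by
    intro o
    have h1 : fpull τ (tau_le hY₀ hP hτ hF j) (g o) = 0 := by
      cases o with
      | none => exact (hpull t).trans (by rw [hF.isEqn.zero, map_zero])
      | some _ => exact tau_coord_none hY₀ hP hτ hF j
    have h2 := congrArg (fres hb.le) h1
    rwa [fres_fpull, map_zero] at h2
  intro f
  constructor
  · intro hf
    have h0 := congrArg (fres hb.ge) hf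
    rw [fres_fpull, map_zero] at h0
    have h1 := RingHom.congr_fun hψ f
    rw [RingHom.comp_apply, h0, map_zero] at h1
    exact Ideal.Quotient.eq_zero_iff_mem.mp h1.symm
  · intro hf
    have h1 : I ≤ RingHom.ker (fpull τ (le_refl _)) := by
      refine Ideal.span_le.mpr ?_
      rintro _ ⟨o, rfl⟩
      exact RingHom.mem_ker.mpr (hzero o)
    exact h1 hf

end tau

/-! ### The birational map -/

section chart

variable {X P T : Scheme.{u}} {F F' : X.Modules} {p : P ⟶ X} {L : P.Modules}
  {q : (Scheme.Modules.pullback p).obj F ⟶ L} {V : X.Opens} {ι : Type} [Fintype ι]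
  {e : ι → Γ(F, V)} {g : T ⟶ P} {f : T ⟶ X} {M : T.Modules}
  {r : (Scheme.Modules.pullback f).obj F ⟶ M}

theorem Classifies.preimage_chart (h : Classifies q g r) (hL : IsInvertible L) [Epi q]
    (he : IsBasisOn F V e) (j : ι) :
    g ⁻¹ᵁ chart q e j = genLocus M (qsec r (le_refl (f ⁻¹ᵁ V)) (e j)) := by
  have hle := h.preimage_chart_le (e := e) (j := j)
  apply le_antisymm
  · refine le_genLocus hle ?_
    rw [mres_qsec]
    exact h.isGen le_rfl hle
  · refine h.le_chart j hL he genLocus_le ?_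
    have := isGen_genLocus (M := M) (s := qsec r (le_refl (f ⁻¹ᵁ V)) (e j))
    rwa [mres_qsec] at this

theorem classifies_pullbackQuotient (q : (Scheme.Modules.pullback p).obj F ⟶ L) (g : T ⟶ P) :
    Classifies q g (pullbackQuotient q g) := by
  refine ⟨rfl, Iso.refl _, ?_⟩
  rw [Iso.refl_hom, Category.comp_id]
  refine pullback_hom_ext fun V s ↦ ?_
  have h1 := qsec_pullbackCongr (rfl : g ≫ p = g ≫ p) (pullbackQuotient q g)
    (le_refl ((g ≫ p) ⁻¹ᵁ V)) s
  exact h1.symm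

theorem qsec_map (φ : F' ⟶ F) {W : T.Opens} (h : W ≤ f ⁻¹ᵁ V) (a : Γ(F', V)) :
    qsec ((Scheme.Modules.pullback f).map φ ≫ r) h a = qsec r h (φ.app V a) := by
  rw [qsec_comp]
  exact congrArg (r.app W) (pullback_map_spull φ h a)

theorem dense_preimage_complement {D : Scheme.{u}} {i : D ⟶ X} [IsClosedImmersion i]
    (hP : IsProjectiveBundle F p q)
    (H : ∀ y : D, ∃ (V : X.Opens) (ι : Type) (_ : Fintype ι) (e : ι → Γ(F, V)) (t : Γ(X, V)),
      i y ∈ V ∧ IsAffineOpen V ∧ IsBasisOn F V e ∧ IsEqn i V t) :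
    Dense ((p ⁻¹ᵁ complement i : P.Opens) : Set P) := by
  have := hP.epi
  intro y
  by_cases hy : p y ∈ complement i
  · exact subset_closure hy
  · rw [mem_complement, not_not] at hy
    obtain ⟨d, hd⟩ := hy
    obtain ⟨V, ι, _, e, t, hdV, hV, he, ht⟩ := H d
    obtain ⟨o, ho⟩ := exists_mem_chart (q := q) hP.isInvertible he (y := y)
      (show p y ∈ V from hd ▸ hdV)
    have h1 := le_closure_basicOpen
      (isReg_fpull_chart hP he hV ht.isReg.mem_nonZeroDivisors o) ho
    refine closure_mono ?_ h1
    intro z hz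
    have h2 : z ∈ P.basicOpen (fpull p (chart_le q e o) t) := hz
    rw [basicOpen_fpull, ht.basicOpen_eq] at h2
    exact h2.2.2

end chart

section birational

variable {X D Y Y₀ : Scheme.{u}} {R : CommRingCat.{u}} {s : X ⟶ Spec R} {i : D ⟶ X}
  {p : Y ⟶ X} {L : Y.Modules} {q : (Scheme.Modules.pullback p).obj (logDifferentials s i) ⟶ L}
  {p₀ : Y₀ ⟶ X} {L₀ : Y₀.Modules} {q₀ : (Scheme.Modules.pullback p₀).obj (differentials s) ⟶ L₀}
  (hX : LogPair s i) (hY : IsProjectiveBundle (logDifferentials s i) p q)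
  (hY₀ : IsProjectiveBundle (differentials s) p₀ q₀)

include hX

theorem LogPair.dense_log (hY : IsProjectiveBundle (logDifferentials s i) p q) :
    Dense ((p ⁻¹ᵁ complement i : Y.Opens) : Set Y) := by
  have := hX.isClosedImmersion
  refine dense_preimage_complement hY fun y ↦ ?_
  obtain ⟨V, κ, _, t, ω, e, hy, hV, hF⟩ := hX.exists_frame y
  exact ⟨V, _, _, e, t, hy, hV, hF.isBasisOn_log, hF.isEqn⟩

theorem LogPair.dense (hY₀ : IsProjectiveBundle (differentials s) p₀ q₀) :
    Dense ((p₀ ⁻¹ᵁ complement i : Y₀.Opens) : Set Y₀) := by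
  have := hX.isClosedImmersion
  refine dense_preimage_complement hY₀ fun y ↦ ?_
  obtain ⟨V, κ, _, t, ω, e, hy, hV, hF⟩ := hX.exists_frame y
  exact ⟨V, _, _, _, t, hy, hV, hF.isBasisOn, hF.isEqn⟩

variable (s i q) in
/-- The quotient of `Ω_X` on the complement of the boundary. -/
abbrev birQuotient : (Scheme.Modules.pullback ((p ⁻¹ᵁ complement i).ι ≫ p)).obj (differentials s) ⟶
    (Scheme.Modules.pullback (p ⁻¹ᵁ complement i).ι).obj L :=
  (Scheme.Modules.pullback ((p ⁻¹ᵁ complement i).ι ≫ p)).map (toLog s i) ≫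
    pullbackQuotient q (p ⁻¹ᵁ complement i).ι

include hY hY₀

theorem LogPair.exists_birational : ∃ u : (p ⁻¹ᵁ complement i).toScheme ⟶ Y₀,
    Classifies q₀ u (birQuotient s i q) := by
  have := hY.epi
  have hinv : IsInvertible ((Scheme.Modules.pullback (p ⁻¹ᵁ complement i).ι).obj L) :=
    hY.isInvertible.pullback _
  have : Epi (birQuotient s i q) := epi_of_isGen _ fun y ↦ by
    obtain ⟨V, κ, _, e, hyV, hVc, hV, he⟩ := hX.exists_basis _ y.2
    have he' := isBasisOn_toLog hVc he
    obtain ⟨k, hk⟩ := exists_mem_chart (q := q) hY.isInvertible he' (y := y.1) hyV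
    have hc := classifies_pullbackQuotient q (p ⁻¹ᵁ complement i).ι
    have hle := hc.preimage_chart_le (e := fun k ↦ (toLog s i).app V (e k)) (j := k)
    refine ⟨V, e k, _, hle, hk, ?_⟩
    have h1 := hc.isGen (e := fun k ↦ (toLog s i).app V (e k)) (j := k) le_rfl hle
    rwa [← qsec_map] at h1
  obtain ⟨u, hu, -⟩ := hY₀.existsUnique _ _ _ (birQuotient s i q) hinv this
  exact ⟨u, hu⟩

variable {u : (p ⁻¹ᵁ complement i).toScheme ⟶ Y₀} (hu : Classifies q₀ u (birQuotient s i q))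

include hu

omit hX in
theorem bir_preimage {V : X.Opens} {κ : Type} [Fintype κ] {e : κ → Γ(differentials s, V)}
    (hVc : V ≤ complement i) (he : IsBasisOn (differentials s) V e) (k : κ) :
    u ⁻¹ᵁ chart q₀ e k = (p ⁻¹ᵁ complement i).ι ⁻¹ᵁ chart q (fun k ↦ (toLog s i).app V (e k)) k := by
  have := hY.epi
  have := hY₀.epi
  rw [hu.preimage_chart hY₀.isInvertible he, (classifies_pullbackQuotient q _).preimage_chart
    hY.isInvertible (isBasisOn_toLog hVc he), qsec_map]

omit hX in
theorem bir_bijective {V : X.Opens} {κ : Type} [Fintype κ] {e : κ → Γ(differentials s, V)}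
    (hVc : V ≤ complement i) (he : IsBasisOn (differentials s) V e) (hV : IsAffineOpen V) (k : κ) :
    Function.Bijective (u.app (chart q₀ e k)) := by
  set j := (p ⁻¹ᵁ complement i).ι with hj
  have hb := bir_preimage hY hY₀ hu hVc he k
  let e' : κ → Γ(logDifferentials s i, V) := fun k ↦ (toLog s i).app V (e k)
  have he' : IsBasisOn (logDifferentials s i) V e' := isBasisOn_toLog hVc he
  obtain ⟨κ', w, rfl⟩ := exists_option_equiv k
  have h0 := (chart_isAffineOpen_and_bijective w hY₀ he hV).2
  have h1 := (chart_isAffineOpen_and_bijective w hY he' hV).2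
  have h2 : Function.Bijective (fpull j hb.le : Γ(Y, chart q e' (w none)) →+* _) := by
    have hle : chart q e' (w none) ≤ j.opensRange := by
      have : j.opensRange = p ⁻¹ᵁ complement i := Scheme.Opens.opensRange_ι _
      rw [this]
      exact (chart_le q e' (w none)).trans (p.preimage_mono hVc)
    have h3 : Function.Bijective (j.app (chart q e' (w none))) :=
      have := j.isIso_app _ hle
      ConcreteCategory.bijective_of_isIso _
    have h4 : ∀ a, fpull j hb.le a = fres hb.le (j.app (chart q e' (w none)) a) := by
      intro a
      rw [app_eq_fpull, fres_fpull]
    have h5 : Function.Bijective (fres hb.le) :=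
      ⟨fun a b h ↦ by
        have := congrArg (fres hb.ge) h
        rwa [fres_fres, fres_fres, fres_self, fres_self] at this,
        fun b ↦ ⟨fres hb.ge b, by rw [fres_fres, fres_self]⟩⟩
    rw [show ⇑(fpull j hb.le) = fres hb.le ∘ j.app (chart q e' (w none)) from funext h4]
    exact h5.comp h3
  have hle := hu.preimage_chart_le (e := e) (j := w none)
  have h3 : (fpull u le_rfl).comp (chartHom q₀ e w) = (fpull j hb.le).comp (chartHom q e' w) := by
    refine MvPolynomial.ringHom_ext (fun a ↦ ?_) (fun l ↦ ?_)
    · rw [RingHom.comp_apply, RingHom.comp_apply, chartHom_C, chartHom_C, fpull_comp, fpull_comp]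
      exact fpull_congr hu.1 _ _
    · rw [RingHom.comp_apply, RingHom.comp_apply, chartHom_X, chartHom_X]
      refine hu.fpull_coord (w none) hle (hu.isGen le_rfl hle) ?_ le_rfl
      rw [qsec_map, qsec_map]
      have h4 := qsec_pullbackQuotient q j (chart_le q e' (w none)) hb.le (e' (w (some l)))
      have h5 := qsec_pullbackQuotient q j (chart_le q e' (w none)) hb.le (e' (w none))
      refine h4.trans (Eq.trans ?_ (congrArg _ h5.symm))
      have h6 := coord_smul q e' (w none) (w (some l)) le_rfl
      rw [h6, spull_smul, fres_self]
  have h4 : Function.Bijective ((fpull u (le_refl (u ⁻¹ᵁ chart q₀ e (w none)))) ∘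
      chartHom q₀ e w) := by
    have := congrArg DFunLike.coe h3
    rw [RingHom.coe_comp, RingHom.coe_comp] at this
    rw [this]
    exact h2.comp h1
  have h5 := (Function.Bijective.of_comp_iff _ h0).mp h4
  convert h5 using 1
  funext a
  exact app_eq_fpull u a

theorem isOpenImmersion_bir : IsOpenImmersion u ∧ Set.range u = (p₀ ⁻¹ᵁ complement i : Y₀.Opens) := by
  have := hY₀.epi
  refine isOpenImmersion_of_forall u _ (fun x ↦ ?_) fun y hy ↦ ?_
  · have h1 : (u ≫ p₀) x = p x.1 := by rw [hu.1]; rfl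
    change (u ≫ p₀) x ∈ complement i
    rw [h1]
    exact x.2
  · obtain ⟨V, κ, _, e, hyV, hVc, hV, he⟩ := hX.exists_basis _ hy
    obtain ⟨k, hk⟩ := exists_mem_chart (q := q₀) hY₀.isInvertible he (y := y) hyV
    refine ⟨_, (chart_le q₀ e k).trans (p₀.preimage_mono hVc), hk,
      chart_isAffineOpen hY₀ he hV k, ?_, bir_bijective hY hY₀ hu hVc he hV k⟩
    rw [bir_preimage hY hY₀ hu hVc he]
    refine (chart_isAffineOpen hY (isBasisOn_toLog hVc he) hV k).preimage_of_isOpenImmersion _ ?_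
    rw [Scheme.Opens.opensRange_ι]
    exact (chart_le q _ k).trans (p.preimage_mono hVc)

end birational

/-! ### Sections of ideal sheaves -/

section idealSections

variable {Y Z : Scheme.{u}} {z : Z ⟶ Y}

/-- The function that corresponds to a section of the ideal sheaf. -/
def idealVal (z : Z ⟶ Y) (U : Y.Opens) : Γ(idealModule z, U) →+ Γ(Y, U) :=
  (unitSec U).toAddMonoidHom.comp ((kernel.ι (structureMap z)).app U).hom

@[simp] theorem idealVal_smul {U : Y.Opens} (c : Γ(Y, U)) (a : Γ(idealModule z, U)) :
    idealVal z U (c • a) = c * idealVal z U a :=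
  (congrArg (unitSec U) (Scheme.Modules.Hom.app_smul (kernel.ι (structureMap z)) c a)).trans
    (unitSec_smul _ _)

@[simp] theorem idealVal_res {U W : Y.Opens} (h : W ≤ U) (a : Γ(idealModule z, U)) :
    idealVal z W (mres _ h a) = fres h (idealVal z U a) :=
  congrArg (unitSec W) (mres_app (kernel.ι (structureMap z)) h a).symm

theorem fpull_idealVal {U : Y.Opens} (a : Γ(idealModule z, U)) :
    fpull z (le_refl (z ⁻¹ᵁ U)) (idealVal z U a) = 0 := by
  rw [← app_eq_fpull]
  exact ConcreteCategory.congr_hom (congrArg (fun t ↦ Scheme.Modules.Hom.app t U)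
    (kernel.condition (structureMap z))) a

theorem sections_exact {X : Scheme.{u}} {M N : X.Modules} (φ : M ⟶ N) (U : X.Opens) :
    Function.Injective ((kernel.ι φ).app U) ∧
      ∀ a, φ.app U a = 0 → ∃ b, (kernel.ι φ).app U b = a := by
  let G : X.Modules ⥤ Ab := Scheme.Modules.toPresheaf X ⋙ (evaluation _ _).obj (op U)
  have : PreservesLimits ((evaluation X.Opensᵒᵖ Ab.{u}).obj (op U)) :=
    ⟨fun {_} _ ↦ ⟨fun {_} ↦ evaluation_preservesLimit _ _⟩⟩
  have : PreservesLimits G := comp_preservesLimits _ _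
  have : G.PreservesZeroMorphisms := ⟨fun _ _ ↦ rfl⟩
  constructor
  · have h : Mono (G.map (kernel.ι φ)) := inferInstance
    exact (AddCommGrpCat.mono_iff_injective _).mp h
  · have h := (ShortComplex.exact_kernel φ).map_of_mono_of_preservesKernel G
      inferInstance inferInstance
    rw [ShortComplex.ab_exact_iff] at h
    exact fun a ha ↦ h a ha

theorem idealVal_injective (z : Z ⟶ Y) (U : Y.Opens) : Function.Injective (idealVal z U) :=
  (unitSec U).injective.comp (sections_exact (structureMap z) U).1

theorem exists_idealVal {U : Y.Opens} (a : Γ(Y, U)) (h : fpull z (le_refl (z ⁻¹ᵁ U)) a = 0) :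
    ∃ b, idealVal z U b = a := by
  rw [← app_eq_fpull] at h
  exact (sections_exact (structureMap z) U).2 ((unitSec U).symm a) h

end idealSections

/-! ### Bases of conormal sheaves -/

section conormal

variable {Y Z : Scheme.{u}} {z : Z ⟶ Y} {A : Y.Opens} {ι : Type*} [Fintype ι]
  {g : ι → Γ(Y, A)}

/-- The generators `g` of the ideal of `Z` are independent modulo this ideal. -/
def IsConormalIndep (z : Z ⟶ Y) (A : Y.Opens) (g : ι → Γ(Y, A)) : Prop :=
  ∀ (W : Y.Opens) (h : W ≤ A) (c : ι → Γ(Y, W)), ∑ o, c o * fres h (g o) = 0 →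
    ∀ o, fpull z (le_refl (z ⁻¹ᵁ W)) (c o) = 0

theorem IsConormalIndep.eq (hg : IsConormalIndep z A g) {W W' : Y.Opens} (h : W ≤ A) (h' : W' ≤ A)
    {U : Z.Opens} (hU : U ≤ z ⁻¹ᵁ W) (hU' : U ≤ z ⁻¹ᵁ W') {V V' : Y.Opens} (hV : W ≤ V)
    (hV' : W' ≤ V') {f : Γ(Y, V)} {f' : Γ(Y, V')}
    (hf : fres (inf_le_left : V ⊓ V' ≤ V) f = fres (inf_le_right : V ⊓ V' ≤ V') f')
    {c : ι → Γ(Y, W)} {c' : ι → Γ(Y, W')} (hc : fres hV f = ∑ o, c o * fres h (g o))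
    (hc' : fres hV' f' = ∑ o, c' o * fres h' (g o)) (o : ι) :
    fpull z hU (c o) = fpull z hU' (c' o) := by
  have h1 := congrArg (fres (inf_le_left : W ⊓ W' ≤ W)) hc
  have h2 := congrArg (fres (inf_le_right : W ⊓ W' ≤ W')) hc'
  have h3 := congrArg (fres (inf_le_inf hV hV')) hf
  simp only [map_sum, map_mul, fres_fres] at h1 h2 h3
  have h4 := hg (W ⊓ W') (inf_le_left.trans h)
    (fun o ↦ fres inf_le_left (c o) - fres inf_le_right (c' o))
    (by simp only [sub_mul, Finset.sum_sub_distrib]; rw [← h1, ← h2, h3, sub_self]) o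
  have h5 := congrArg (fres (show U ≤ z ⁻¹ᵁ (W ⊓ W') from le_inf hU hU')) h4
  simp only [map_sub, fpull_fres, fres_fpull, map_zero] at h5
  exact sub_eq_zero.mp h5

/-- The function `b` is the coefficient of `g o` in `f`, modulo the ideal. -/
def IsConormalCoeff (z : Z ⟶ Y) (g : ι → Γ(Y, A)) (o : ι) {U : Y.Opens} (f : Γ(Y, U))
    {T₀ : Z.Opens} (b : Γ(Z, T₀)) : Prop :=
  ∀ (W : Y.Opens) (hW : W ≤ U) (hA : W ≤ A) (c : ι → Γ(Y, W)),
    fres hW f = ∑ j, c j * fres hA (g j) →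
      ∀ (T : Z.Opens) (hT : T ≤ z ⁻¹ᵁ W) (hT' : T ≤ T₀), fres hT' b = fpull z hT (c o)

theorem exists_conormalCoeff (hg : IsIdealGen z A g) (hi : IsConormalIndep z A g) (o : ι)
    {U : Y.Opens} (f : Γ(Y, U)) (hf : fpull z (le_refl (z ⁻¹ᵁ U)) f = 0) {T₀ : Z.Opens}
    (hU : T₀ ≤ z ⁻¹ᵁ (U ⊓ A)) : ∃ b : Γ(Z, T₀), IsConormalCoeff z g o f b := by
  have hf' : fpull z (le_refl (z ⁻¹ᵁ (U ⊓ A))) (fres inf_le_left f) = 0 := by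
    have := congrArg (fres (z.preimage_mono (inf_le_left : U ⊓ A ≤ U))) hf
    rwa [fres_fpull, map_zero, ← fpull_fres (h := (inf_le_left : U ⊓ A ≤ U)) (e := le_rfl)] at this
  obtain ⟨b, hb⟩ := fun_glue_pred T₀ (fun T b ↦ ∃ (W : Y.Opens) (hW : W ≤ U) (hA : W ≤ A)
      (c : ι → Γ(Y, W)) (hT : T ≤ z ⁻¹ᵁ W), fres hW f = ∑ j, c j * fres hA (g j) ∧
        b = fpull z hT (c o))
    (by
      intro x hx
      obtain ⟨W, hW, c, hxW, hc⟩ := hg.exists_sum (U ⊓ A) inf_le_right _ hf' (z x) (hU hx)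
      rw [fres_fres] at hc
      exact ⟨T₀ ⊓ z ⁻¹ᵁ W, inf_le_left, ⟨hx, hxW⟩, fpull z inf_le_right (c o), W,
        hW.trans inf_le_left, hW.trans inf_le_right, c, inf_le_right, hc, rfl⟩)
    (by
      rintro T T' b b' hT₀ hT₀' ⟨W, hW, hA, c, hT, hc, rfl⟩ ⟨W', hW', hA', c', hT', hc', rfl⟩
      rw [fres_fpull, fres_fpull]
      exact hi.eq hA hA' _ _ hW hW' rfl hc hc' o)
  exact ⟨b, fun W hW hA c hc T hT hT' ↦ hb T hT' _ ⟨W, hW, hA, c, hT, hc, rfl⟩⟩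

theorem exists_conormal_coord (hg : IsIdealGen z A g) (hi : IsConormalIndep z A g) (o : ι) :
    ∃ lam : (Scheme.Modules.pullback z).obj (idealModule z) ⟶
      awayFrom (structureSheaf Z) (z ⁻¹ᵁ A),
      ∀ (U : Y.Opens) (a : Γ(idealModule z, U)), IsConormalCoeff z g o (idealVal z U a)
        (unitSec _ (awaySec _ _ _ (lam.app (z ⁻¹ᵁ U) (spull z _ le_rfl a)))) := by
  have hle : ∀ U : Y.Opens, away (z ⁻¹ᵁ A) (z ⁻¹ᵁ U) ≤ z ⁻¹ᵁ (U ⊓ A) :=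
    fun U ↦ away_preimage_le z U A
  have hex : ∀ (U : Y.Opens) (a : Γ(idealModule z, U)) (x : Z), x ∈ away (z ⁻¹ᵁ A) (z ⁻¹ᵁ U) →
      ∃ (W : Y.Opens) (hW : W ≤ U) (hA : W ≤ A) (c : ι → Γ(Y, W)), z x ∈ W ∧
        fres hW (idealVal z U a) = ∑ j, c j * fres hA (g j) := by
    intro U a x hx
    obtain ⟨W, hW, c, hxW, hc⟩ := hg.exists_sum (U ⊓ A) inf_le_right
      (idealVal z _ (mres _ inf_le_left a)) (fpull_idealVal _) (z x) (hle U hx)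
    rw [idealVal_res, fres_fres] at hc
    exact ⟨W, _, _, c, hxW, hc⟩
  refine (exists_pullbackHom_of_relation (f := z) (F := idealModule z)
    (M := awayFrom (structureSheaf Z) (z ⁻¹ᵁ A))
    (fun U a b ↦ IsConormalCoeff z g o (idealVal z U a) (unitSec _ (awaySec _ _ _ b)))
    ?_ ?_ ?_ ?_ ?_).imp fun φ hφ U a ↦ ?_
  · intro U V h a b hb W hW hA c hc T hT hT'
    rw [idealVal_res, fres_fres] at hc
    rw [awaySec_res, unitSec_res, fres_fres]
    exact hb W _ hA c hc T hT _
  · intro U a b a' b' hb hb' W hW hA c hc T hT hT'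
    refine fun_ext fun x hx ↦ ?_
    obtain ⟨W₁, hW₁, hA₁, c₁, hx₁, hc₁⟩ := hex U a x (hT' hx)
    obtain ⟨W₂, hW₂, hA₂, c₂, hx₂, hc₂⟩ := hex U a' x (hT' hx)
    refine ⟨T ⊓ z ⁻¹ᵁ (W₁ ⊓ W₂), inf_le_left, ⟨hx, hx₁, hx₂⟩, ?_⟩
    have h1 := hb W₁ hW₁ hA₁ c₁ hc₁ (T ⊓ z ⁻¹ᵁ (W₁ ⊓ W₂))
      (inf_le_right.trans (z.preimage_mono inf_le_left)) (inf_le_left.trans hT')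
    have h2 := hb' W₂ hW₂ hA₂ c₂ hc₂ (T ⊓ z ⁻¹ᵁ (W₁ ⊓ W₂))
      (inf_le_right.trans (z.preimage_mono inf_le_right)) (inf_le_left.trans hT')
    have h3 : fres (inf_le_left.trans hW₁) (idealVal z U (a + a')) =
        ∑ j, (fres (inf_le_left : W₁ ⊓ W₂ ≤ W₁) (c₁ j) + fres inf_le_right (c₂ j)) *
          fres (inf_le_left.trans hA₁) (g j) := by
      have h4 := congrArg (fres (inf_le_left : W₁ ⊓ W₂ ≤ W₁)) hc₁
      have h5 := congrArg (fres (inf_le_right : W₁ ⊓ W₂ ≤ W₂)) hc₂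
      simp only [map_sum, map_mul, fres_fres] at h4 h5
      simp only [map_add, h4, h5, add_mul, Finset.sum_add_distrib]
    rw [map_add, map_add, map_add, map_add, fres_fres, fres_fres, h1, h2, fres_fpull,
      hi.eq hA (inf_le_left.trans hA₁) (inf_le_left.trans hT) inf_le_right hW
        (inf_le_left.trans hW₁) rfl hc h3 o]
    simp
  · intro U d a b hb W hW hA c hc T hT hT'
    refine fun_ext fun x hx ↦ ?_
    obtain ⟨W₁, hW₁, hA₁, c₁, hx₁, hc₁⟩ := hex U a x (hT' hx)
    refine ⟨T ⊓ z ⁻¹ᵁ W₁, inf_le_left, ⟨hx, hx₁⟩, ?_⟩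
    have h1 := hb W₁ hW₁ hA₁ c₁ hc₁ (T ⊓ z ⁻¹ᵁ W₁) inf_le_right (inf_le_left.trans hT')
    have h3 : fres hW₁ (idealVal z U (d • a)) =
        ∑ j, (fres hW₁ d * c₁ j) * fres hA₁ (g j) := by
      rw [idealVal_smul, map_mul, hc₁, Finset.mul_sum]
      exact Finset.sum_congr rfl fun j _ ↦ by ring
    rw [awaySec_smul, unitSec_smul, map_mul, map_mul, fres_fres, fres_fres, fres_fres, h1, fres_fpull,
      fres_fpull, hi.eq hA hA₁ (inf_le_left.trans hT) inf_le_right hW hW₁ rfl hc h3 o, map_mul,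
      fpull_fres]
  · intro U b hb
    have h1 := hb (U ⊓ A) inf_le_left inf_le_right 0 (by simp) _ (hle U) le_rfl
    rw [fres_self] at h1
    simpa using h1
  · intro U a x hx
    obtain ⟨b, hb⟩ := exists_conormalCoeff hg hi o (idealVal z U a) (fpull_idealVal a) (hle U)
    exact ⟨U, le_rfl, hx, (awaySec _ _ _).symm ((unitSec _).symm b), by simpa using hb⟩
  · obtain ⟨b, hb⟩ := exists_conormalCoeff hg hi o (idealVal z U a) (fpull_idealVal a) (hle U)
    rw [hφ U a ((awaySec _ _ _).symm ((unitSec _).symm b)) (by simpa using hb)]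
    simpa using hb

/-- Independent generators of the ideal give a basis of the conormal sheaf. -/
theorem isBasisOn_conormal (hg : IsIdealGen z A g) (hi : IsConormalIndep z A g)
    {a : ι → Γ(idealModule z, A)} (ha : ∀ o, idealVal z A (a o) = g o) :
    IsBasisOn ((Scheme.Modules.pullback z).obj (idealModule z)) (z ⁻¹ᵁ A)
       (fun o ↦ spull z _ le_rfl (a o)) := by
  classical
  choose lam hlam using exists_conormal_coord hg hi
  have h1 : ∀ i j, unitSec _ (awaySec _ _ _ ((lam i).app (z ⁻¹ᵁ A) (spull z _ le_rfl (a j)))) =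
      if i = j then 1 else 0 := by
    intro i j
    have h2 := hlam i A (a j) A le_rfl le_rfl (fun k ↦ if k = j then 1 else 0)
      (by simp [ha]) _ (away_le _ _) le_rfl
    rw [fres_self] at h2
    rw [h2]
    split_ifs <;> simp
  refine isBasisOn_of_dual lam (fun i ↦ by simp [h1]) (fun i j hj ↦ by simp [h1, hj.symm])
    fun U s ↦ ?_
  refine section_ext fun x hx ↦ ?_
  have hx' := away_preimage_le z U A hx
  obtain ⟨W, hW, c, hxW, hc⟩ := hg.exists_sum (U ⊓ A) inf_le_right
    (idealVal z _ (mres _ inf_le_left s)) (fpull_idealVal _) (z x) hx'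
  rw [idealVal_res, fres_fres] at hc
  refine ⟨away (z ⁻¹ᵁ A) (z ⁻¹ᵁ U) ⊓ z ⁻¹ᵁ W, inf_le_left, ⟨hx, hxW⟩, ?_⟩
  have h3 : mres _ (hW.trans inf_le_left) s = ∑ j, c j • mres _ (hW.trans inf_le_right) (a j) := by
    apply idealVal_injective
    rw [idealVal_res, hc, map_sum]
    exact Finset.sum_congr rfl fun j _ ↦ by rw [idealVal_smul, idealVal_res, ha]
  have h4 : spull z (idealModule z) (inf_le_left.trans (away_le (z ⁻¹ᵁ A) (z ⁻¹ᵁ U))) s =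
      ∑ j, fpull z (inf_le_right : away (z ⁻¹ᵁ A) (z ⁻¹ᵁ U) ⊓ z ⁻¹ᵁ W ≤ z ⁻¹ᵁ W) (c j) •
        spull z (idealModule z)
          ((inf_le_left : away (z ⁻¹ᵁ A) (z ⁻¹ᵁ U) ⊓ z ⁻¹ᵁ W ≤ _).trans
            (away_le_left (z ⁻¹ᵁ A) (z ⁻¹ᵁ U))) (a j) := by
    rw [← spull_mres (h := hW.trans inf_le_left) (e := inf_le_right), h3, spull_sum]
    exact Finset.sum_congr rfl fun j _ ↦ by rw [spull_mres]
  rw [mres_mres, mres_spull, mres_sum_smul]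
  refine h4.trans (Finset.sum_congr rfl fun j _ ↦ ?_)
  rw [hlam j U s W _ _ c hc _ inf_le_right inf_le_left, mres_mres, mres_spull]

end conormal

/-! ### Independence of the generators -/

section indep

variable {Y Z : Scheme.{u}} {z : Z ⟶ Y} {A : Y.Opens} {ι : Type*} [Fintype ι]
  {g : ι → Γ(Y, A)}

theorem isConormalIndep_of_isReg {t : Γ(Y, A)} (ht : IsReg t) :
    IsConormalIndep z A (fun _ : Unit ↦ t) := by
  intro W h c hc o
  rw [Fintype.sum_unique] at hc
  have h1 : fres h t * c default = fres h t * 0 := by rw [mul_comm, hc, mul_zero]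
  rw [show c o = 0 from (ht.mono h).cancel h1, map_zero]

theorem isConormalIndep_of_isAffineOpen (hA : IsAffineOpen A)
    (h : ∀ c : ι → Γ(Y, A), ∑ o, c o * g o = 0 → ∀ o, fpull z (le_refl (z ⁻¹ᵁ A)) (c o) = 0) :
    IsConormalIndep z A g := by
  intro W hW c hc o
  refine fun_ext fun x hx ↦ ?_
  obtain ⟨b, hb, hxb⟩ := hA.exists_basicOpen_le ⟨z x, hx⟩ (hW hx)
  choose n C hC using fun o ↦ exists_pow_mul_eq_fres hA b (fres hb (c o))
  have h1 : fres (Y.basicOpen_le b) (∑ o, b ^ (∑ j, n j - n o) * C o * g o) = 0 := by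
    have h2 := congrArg (fun f ↦ fres (Y.basicOpen_le b) b ^ (∑ j, n j) * fres hb f) hc
    simp only [map_zero, mul_zero, map_sum, map_mul, fres_fres, Finset.mul_sum] at h2
    rw [map_sum, ← h2]
    refine Finset.sum_congr rfl fun o _ ↦ ?_
    have h3 : n o ≤ ∑ j, n j := Finset.single_le_sum (fun _ _ ↦ Nat.zero_le _) (Finset.mem_univ o)
    rw [map_mul, map_mul, map_pow, ← hC, ← mul_assoc, ← mul_assoc, ← pow_add,
      Nat.sub_add_cancel h3]
  obtain ⟨m, hm⟩ := exists_pow_mul_eq_zero hA _ _ h1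
  have h2 := h (fun o ↦ b ^ m * (b ^ (∑ j, n j - n o) * C o)) (by
    rw [← hm, Finset.mul_sum]
    exact Finset.sum_congr rfl fun o _ ↦ by ring) o
  have hu : IsUnit (fpull z (le_refl (z ⁻¹ᵁ Y.basicOpen b)) (fres (Y.basicOpen_le b) b)) :=
    (isUnit_fres_basicOpen b).map _
  refine ⟨z ⁻¹ᵁ Y.basicOpen b, z.preimage_mono hb, hxb, ?_⟩
  have h3 := congrArg (fres (z.preimage_mono (Y.basicOpen_le b))) h2
  simp only [map_mul, map_pow, fres_fpull, map_zero] at h3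
  have h4 := congrArg (fpull z (le_refl (z ⁻¹ᵁ Y.basicOpen b))) (hC o)
  simp only [map_mul, map_pow, fpull_fres] at h4
  rw [fpull_fres] at hu
  rw [← h4] at h3
  rw [fres_fpull, map_zero]
  exact ((hu.pow _).mul_right_eq_zero.mp ((hu.pow _).mul_right_eq_zero.mp
    ((hu.pow _).mul_right_eq_zero.mp h3)))

end indep

section sigma

variable {X D Y : Scheme.{u}} {R : CommRingCat.{u}} {s : X ⟶ Spec R} {i : D ⟶ X}
  {res : logDifferentials s i ⟶ (Scheme.Modules.pushforward i).obj (structureSheaf D)}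
  {V : X.Opens} {κ : Type} [Fintype κ] {t : Γ(X, V)}
  {ω : κ → Γ(differentials s, V)} {e : Option κ → Γ(logDifferentials s i, V)}
  {p : Y ⟶ X} {L : Y.Modules} {q : (Scheme.Modules.pullback p).obj (logDifferentials s i) ⟶ L}
  {σ : D ⟶ Y}

/-- The generators of the ideal of the section given by the residue. -/
abbrev sigmaGen (q : (Scheme.Modules.pullback p).obj (logDifferentials s i) ⟶ L) (t : Γ(X, V))
    (e : Option κ → Γ(logDifferentials s i, V)) (o : Option κ) : Γ(Y, chart q e none) :=
  o.elim (fpull p (chart_le q e none) t) fun k ↦ coord q e none (some k)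

variable (hX : LogPair s i) (hres : IsFrameResidue s i res)
  (hY : IsProjectiveBundle (logDifferentials s i) p q)
  (hσ : Classifies q σ (restrictToDivisor i res))

include hres hY hσ

theorem isConormalIndep_sigma (hF : LogFrame s i V t ω e) (hV : IsAffineOpen V) :
    IsConormalIndep σ (chart q e none) (sigmaGen q t e) := by
  classical
  have hb := sigma_preimage_none hres hY hσ hF
  refine isConormalIndep_of_isAffineOpen (chart_isAffineOpen hY hF.isBasisOn_log hV none)
    fun c hc o ↦ ?_
  rw [Fintype.sum_option] at hc
  have hpull : ∀ a : Γ(X, V), fpull σ (le_refl (σ ⁻¹ᵁ chart q e none))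
      (fpull p (chart_le q e none) a) = fpull i hb.le a := by
    intro a
    rw [fpull_comp]
    exact fpull_congr hσ.1 _ _
  have hcoord : ∀ k, fpull σ (le_refl (σ ⁻¹ᵁ chart q e none)) (coord q e none (some k)) = 0 := by
    intro k
    have h1 := congrArg (fres hb.le) (sigma_coord hres hY hσ hF k)
    rwa [fres_fpull, map_zero] at h1
  cases o with
  | none =>
    obtain ⟨φ, hφ, hφ'⟩ := exists_chart_ringHom (j := none) hY hF.isBasisOn_log hV (RingHom.id Γ(X, V))
      (fun o ↦ o.elim 1 fun _ ↦ 0) rfl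
    have h1 : (fpull i hb.le).comp φ = fpull σ le_rfl :=
      chart_ringHom_ext hY hF.isBasisOn_log hV (fun a ↦ by
        rw [RingHom.comp_apply, hφ, hpull]; rfl) (fun o ↦ by
        cases o with
        | none => rw [coord_self, map_one, map_one]
        | some k => rw [RingHom.comp_apply, hφ', hcoord]; exact map_zero _)
    have h2 := congrArg φ hc
    simp only [map_add, map_mul, map_sum, map_zero, Option.elim, hφ, hφ', mul_zero,
      Finset.sum_const_zero, add_zero, RingHom.id_apply] at h2
    have h3 : φ (c none) = 0 := hF.isEqn.isReg.cancel (b := φ (c none)) (c := 0) (by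
      rw [mul_zero, mul_comm, h2])
    rw [← h1, RingHom.comp_apply, h3, map_zero]
  | some k =>
    obtain ⟨φ, hφ, hφ'⟩ := exists_chart_ringHom (j := none) hY hF.isBasisOn_log hV
      ((algebraMap Γ(D, σ ⁻¹ᵁ chart q e none) (DualNumber Γ(D, σ ⁻¹ᵁ chart q e none))).comp
        (fpull i hb.le))
      (fun o ↦ o.elim 1 fun j ↦ if j = k then DualNumber.eps else 0) rfl
    have h1 : (TrivSqZeroExt.fstHom Γ(D, σ ⁻¹ᵁ chart q e none) Γ(D, σ ⁻¹ᵁ chart q e none)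
        Γ(D, σ ⁻¹ᵁ chart q e none)).toRingHom.comp φ = fpull σ le_rfl :=
      chart_ringHom_ext hY hF.isBasisOn_log hV (fun a ↦ by
        rw [RingHom.comp_apply, hφ, hpull]; rfl) (fun o ↦ by
        cases o with
        | none => rw [coord_self, map_one, map_one]
        | some j =>
          rw [RingHom.comp_apply, hφ', hcoord]
          by_cases hj : j = k
          · simp [hj]
          · simp [hj])
    have h2 := congrArg φ hc
    have ht : fpull i hb.le t = 0 := by
      have := congrArg (fres hb.le) hF.isEqn.zero
      rwa [fres_fpull, map_zero] at this
    simp only [map_add, map_mul, map_sum, map_zero, Option.elim, hφ, hφ', RingHom.comp_apply, ht,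
      mul_zero, zero_add, mul_ite, Finset.sum_ite_eq', Finset.mem_univ, if_true] at h2
    have h3 := congrArg TrivSqZeroExt.snd h2
    rw [← h1]
    simpa using h3

end sigma

/-! ### The conormal sheaf of the section given by the residue -/

section conormalSigma

variable {X D Y : Scheme.{u}} {R : CommRingCat.{u}} {s : X ⟶ Spec R} {i : D ⟶ X}
  {res : logDifferentials s i ⟶ (Scheme.Modules.pushforward i).obj (structureSheaf D)}
  {V : X.Opens} {κ : Type} [Fintype κ] {t : Γ(X, V)}
  {ω : κ → Γ(differentials s, V)} {e : Option κ → Γ(logDifferentials s i, V)}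
  {p : Y ⟶ X} {L : Y.Modules} {q : (Scheme.Modules.pullback p).obj (logDifferentials s i) ⟶ L}
  {σ : D ⟶ Y}

/-- The class `b` in the conormal sheaf is the function `α` in the ideal for which the image of
`a` in the tautological quotient is `α ℓ`, where `ℓ` is a local generator that restricts to `1`
under `θ`. -/
def IsConormalClass (s : X ⟶ Spec R) (i : D ⟶ X)
    (q : (Scheme.Modules.pullback p).obj (logDifferentials s i) ⟶ L) (σ : D ⟶ Y)
    (θ : (Scheme.Modules.pullback σ).obj L ⟶ structureSheaf D) (U : X.Opens)
    (a : Γ(differentials s, U)) (b : Γ((Scheme.Modules.pullback σ).obj (idealModule σ), i ⁻¹ᵁ U)) :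
    Prop :=
  ∀ d ∈ i ⁻¹ᵁ U, ∃ (W : Y.Opens) (h : W ≤ p ⁻¹ᵁ U) (ℓ : Γ(L, W)) (α : Γ(idealModule σ, W)),
    σ d ∈ W ∧ IsGen L W ℓ ∧
      θ.app (σ ⁻¹ᵁ W) (spull σ L le_rfl ℓ) = (unitSec (σ ⁻¹ᵁ W)).symm 1 ∧
      qsec q h ((toLog s i).app U a) = idealVal σ W α • ℓ ∧
      ∀ (T : D.Opens) (hT : T ≤ i ⁻¹ᵁ U) (hT' : T ≤ σ ⁻¹ᵁ W),
        mres _ hT b = spull σ (idealModule σ) hT' α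

variable {θ : (Scheme.Modules.pullback σ).obj L ⟶ structureSheaf D}

theorem fpull_eq_one_of_smul {W : Y.Opens} {ℓ ℓ' : Γ(L, W)} {c : Γ(Y, W)}
    (h : θ.app (σ ⁻¹ᵁ W) (spull σ L le_rfl ℓ) = (unitSec (σ ⁻¹ᵁ W)).symm 1)
    (h' : θ.app (σ ⁻¹ᵁ W) (spull σ L le_rfl ℓ') = (unitSec (σ ⁻¹ᵁ W)).symm 1)
    (hc : ℓ' = c • ℓ) : fpull σ (le_refl (σ ⁻¹ᵁ W)) c = 1 := by
  rw [hc, spull_smul, Scheme.Modules.Hom.app_smul, h] at h'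
  have := congrArg (unitSec _) h'
  rw [unitSec_smul] at this
  simpa using this

theorem theta_res {W W' : Y.Opens} (hW : W' ≤ W) {ℓ : Γ(L, W)}
    (h : θ.app (σ ⁻¹ᵁ W) (spull σ L le_rfl ℓ) = (unitSec (σ ⁻¹ᵁ W)).symm 1) :
    θ.app (σ ⁻¹ᵁ W') (spull σ L le_rfl (mres L hW ℓ)) = (unitSec (σ ⁻¹ᵁ W')).symm 1 := by
  have h1 := congrArg (mres _ (σ.preimage_mono hW)) h
  rw [mres_app, mres_spull] at h1
  rw [spull_mres]
  refine h1.trans ?_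
  apply (unitSec _).injective
  rw [unitSec_res]
  simp

namespace IsConormalClass

variable {U : X.Opens} {a a' : Γ(differentials s, U)}
  {b b' : Γ((Scheme.Modules.pullback σ).obj (idealModule σ), i ⁻¹ᵁ U)}

theorem restrict (hσ : σ ≫ p = i) (h : IsConormalClass s i q σ θ U a b) {U' : X.Opens} (hU : U' ≤ U) :
    IsConormalClass s i q σ θ U' (mres _ hU a) (mres _ (i.preimage_mono hU) b) := by
  intro d hd
  obtain ⟨W, hW, ℓ, α, hdW, hℓ, hθ, hα, hb⟩ := h d (hU hd)
  refine ⟨W ⊓ p ⁻¹ᵁ U', inf_le_right, mres _ inf_le_left ℓ, mres _ inf_le_left α, ⟨hdW, ?_⟩,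
    hℓ.mono _, theta_res _ hθ, ?_, fun T hT hT' ↦ ?_⟩
  · change p (σ d) ∈ U'
    rw [← Scheme.Hom.comp_apply, hσ]
    exact hd
  · have h1 := congrArg (mres L (inf_le_left : W ⊓ p ⁻¹ᵁ U' ≤ W)) hα
    rw [mres_qsec, mres_smul] at h1
    rw [← mres_app, qsec_mres, h1, idealVal_res]
  · rw [mres_mres, spull_mres]
    exact hb T _ _

theorem add (h : IsConormalClass s i q σ θ U a b) (h' : IsConormalClass s i q σ θ U a' b') :
    IsConormalClass s i q σ θ U (a + a') (b + b') := by
  intro d hd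
  obtain ⟨W, hW, ℓ, α, hdW, hℓ, hθ, hα, hb⟩ := h d hd
  obtain ⟨W', hW', ℓ', α', hdW', hℓ', hθ', hα', hb'⟩ := h' d hd
  obtain ⟨c, hc⟩ := hℓ.exists_smul (W := W ⊓ W') inf_le_left (mres L inf_le_right ℓ')
  have hc1 := fpull_eq_one_of_smul (theta_res inf_le_left hθ) (theta_res inf_le_right hθ') hc
  refine ⟨W ⊓ W', inf_le_left.trans hW, mres _ inf_le_left ℓ,
    mres _ inf_le_left α + c • mres _ inf_le_right α', ⟨hdW, hdW'⟩, hℓ.mono _,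
    theta_res _ hθ, ?_, fun T hT hT' ↦ ?_⟩
  · have h1 := congrArg (mres L (inf_le_left : W ⊓ W' ≤ W)) hα
    have h2 := congrArg (mres L (inf_le_right : W ⊓ W' ≤ W')) hα'
    rw [mres_qsec, mres_smul] at h1 h2
    rw [map_add, qsec_add, h1, h2, hc, map_add, idealVal_smul, idealVal_res, idealVal_res, add_smul,
      smul_smul, mul_comm c]
  · have h1 : fpull σ hT' c = 1 := by
      have := congrArg (fres hT') hc1
      rwa [fres_fpull, map_one] at this
    rw [map_add, hb T hT (hT'.trans (σ.preimage_mono inf_le_left)),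
      hb' T hT (hT'.trans (σ.preimage_mono inf_le_right)), spull_add, spull_smul, h1, one_smul,
      spull_mres, spull_mres]

theorem smul (hσ : σ ≫ p = i) (h : IsConormalClass s i q σ θ U a b) (c : Γ(X, U)) :
    IsConormalClass s i q σ θ U (c • a) (fpull i le_rfl c • b) := by
  intro d hd
  obtain ⟨W, hW, ℓ, α, hdW, hℓ, hθ, hα, hb⟩ := h d hd
  refine ⟨W, hW, ℓ, fpull p hW c • α, hdW, hℓ, hθ, ?_, fun T hT hT' ↦ ?_⟩
  · rw [Scheme.Modules.Hom.app_smul, qsec_smul, hα, idealVal_smul, mul_smul]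
  · rw [mres_smul, hb T hT hT', spull_smul, fpull_comp, fres_fpull]
    congr 1
    exact (fpull_congr hσ _ _).symm

theorem zero (h : IsConormalClass s i q σ θ U 0 b) : b = 0 := by
  refine section_ext fun d hd ↦ ?_
  obtain ⟨W, hW, ℓ, α, hdW, hℓ, hθ, hα, hb⟩ := h d hd
  have h1 : idealVal σ W α = 0 := hℓ.eq_zero_of_smul le_rfl (by
    rw [mres_self, ← hα, map_zero, qsec_zero])
  have h2 : α = 0 := idealVal_injective σ W (h1.trans (map_zero _).symm)
  refine ⟨i ⁻¹ᵁ U ⊓ σ ⁻¹ᵁ W, inf_le_left, ⟨hd, hdW⟩, ?_⟩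
  rw [hb _ inf_le_left inf_le_right, h2, spull_zero, map_zero]

end IsConormalClass

variable (hX : LogPair s i) (hres : IsFrameResidue s i res)
  (hY : IsProjectiveBundle (logDifferentials s i) p q)
  (hσ : Classifies q σ (restrictToDivisor i res))

include hres hY hσ hX

theorem exists_conormalHom : ∃ ψ : (Scheme.Modules.pullback i).obj (differentials s) ⟶
      (Scheme.Modules.pullback σ).obj (idealModule σ),
    ∀ {V : X.Opens} {κ : Type} [Fintype κ] {t : Γ(X, V)} {ω : κ → Γ(differentials s, V)}
      {e : Option κ → Γ(logDifferentials s i, V)} (hF : LogFrame s i V t ω e) (o : Option κ)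
      (α : Γ(idealModule σ, chart q e none)), idealVal σ _ α = sigmaGen q t e o →
        ψ.app _ (spull i _ (le_refl (i ⁻¹ᵁ V)) (frameBasis s t ω o)) =
          spull σ _ (sigma_le hres hY hσ hF) α := by
  have := hX.isClosedImmersion
  obtain ⟨θ, hθ⟩ := hσ.exists_iso
  have hθ' : ∀ {V : X.Opens} {κ : Type} [Fintype κ] {t : Γ(X, V)} {ω : κ → Γ(differentials s, V)}
      {e : Option κ → Γ(logDifferentials s i, V)} (hF : LogFrame s i V t ω e),
      θ.hom.app (σ ⁻¹ᵁ chart q e none)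
        (spull σ L le_rfl (qsec q (chart_le q e none) (e none))) = (unitSec _).symm 1 := by
    intro V κ _ t ω e hF
    have h1 := congrArg (mres _ (sigma_preimage_none hres hY hσ hF).le) (hres.qsec_none hF)
    rw [mres_qsec] at h1
    rw [hθ _ _ _ (sigma_preimage_none hres hY hσ hF).le, h1]
    apply (unitSec _).injective
    rw [unitSec_res]
    simp
  refine (exists_pullbackHom_of_relation (f := i) (F := differentials s)
    (M := (Scheme.Modules.pullback σ).obj (idealModule σ)) (IsConormalClass s i q σ θ.hom)
    (fun U U' h a b hb ↦ hb.restrict hσ.1 h) (fun U a b a' b' h h' ↦ h.add h')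
    (fun U c a b h ↦ h.smul hσ.1 c) (fun U b h ↦ h.zero) ?_).imp ?_
  · intro U a x hx
    by_cases hxD : x ∈ complement i
    · have h0 : i ⁻¹ᵁ (U ⊓ complement i) = ⊥ := by
        rw [eq_bot_iff, ← preimage_complement (i := i)]
        exact i.preimage_mono inf_le_right
      exact ⟨U ⊓ complement i, inf_le_left, ⟨hx, hxD⟩, 0, fun d hd ↦ by
        rw [h0] at hd; exact hd.elim⟩
    · rw [mem_complement, not_not] at hxD
      obtain ⟨d, rfl⟩ := hxD
      obtain ⟨V, κ, _, t, ω, e, hdV, hV, hF⟩ := hX.exists_frame d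
      have hle : i ⁻¹ᵁ (U ⊓ V) ≤ σ ⁻¹ᵁ (chart q e none ⊓ p ⁻¹ᵁ U) := by
        refine fun y hy ↦ ⟨sigma_le hres hY hσ hF hy.2, ?_⟩
        change p (σ y) ∈ U
        rw [← Scheme.Hom.comp_apply, hσ.1]
        exact hy.1
      obtain ⟨A, hA⟩ := (isGen_chart q e none).exists_smul (W := chart q e none ⊓ p ⁻¹ᵁ U)
        inf_le_left (qsec q inf_le_right ((toLog s i).app U a))
      have hA0 : fpull σ (le_refl (σ ⁻¹ᵁ (chart q e none ⊓ p ⁻¹ᵁ U))) A = 0 := by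
        have h1 := congrArg (fun m ↦ θ.hom.app _ (spull σ L (le_refl (σ ⁻¹ᵁ (chart q e none ⊓ p ⁻¹ᵁ U))) m)) hA
        simp only [spull_smul, Scheme.Modules.Hom.app_smul] at h1
        rw [theta_res inf_le_left (hθ' hF), hθ _ _ _ (by
          have := σ.preimage_mono (inf_le_right : chart q e none ⊓ p ⁻¹ᵁ U ≤ p ⁻¹ᵁ U)
          rwa [← Scheme.Hom.comp_preimage, hσ.1] at this)] at h1
        have h2 := congrArg (unitSec _) h1
        have h3 : res.app U ((toLog s i).app U a) = 0 := ConcreteCategory.congr_hom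
          (congrArg (fun f ↦ Scheme.Modules.Hom.app f U) (hres.isPoincareResidue hX).zero) a
        rw [qsec_restrictToDivisor, h3, map_zero, unitSec_smul] at h2
        simpa using h2.symm
      obtain ⟨α, hα⟩ := exists_idealVal A hA0
      refine ⟨U ⊓ V, inf_le_left, ⟨hx, hdV⟩, spull σ _ hle α, fun y hy ↦ ?_⟩
      refine ⟨chart q e none ⊓ p ⁻¹ᵁ (U ⊓ V), inf_le_right, mres L inf_le_left
        (qsec q (chart_le q e none) (e none)), mres _ (inf_le_inf_left _ (p.preimage_mono inf_le_left)) α, ⟨?_, ?_⟩,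
        (isGen_chart q e none).mono _, theta_res _ (hθ' hF), ?_, fun T hT hT' ↦ ?_⟩
      · exact sigma_le hres hY hσ hF hy.2
      · change p (σ y) ∈ U ⊓ V
        rw [← Scheme.Hom.comp_apply, hσ.1]
        exact hy
      · have h1 := congrArg (mres L (inf_le_inf_left (chart q e none)
          (p.preimage_mono (inf_le_left : U ⊓ V ≤ U)))) hA
        rw [mres_smul, mres_mres, mres_qsec] at h1
        rw [idealVal_res, hα, ← h1, ← mres_app, qsec_mres]
      · rw [mres_spull, spull_mres]
  · intro ψ hψ V κ _ t ω e hF o α hα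
    refine hψ V _ _ fun d hd ↦ ⟨chart q e none, chart_le q e none,
      qsec q (chart_le q e none) (e none), α, sigma_le hres hY hσ hF hd, isGen_chart q e none,
      hθ' hF, ?_, fun T hT hT' ↦ ?_⟩
    · rw [hα]
      cases o with
      | none =>
        change qsec q _ ((toLog s i).app V (dSection s V t)) = _
        rw [← hF.smul_none, qsec_smul]
        rfl
      | some k =>
        change qsec q _ ((toLog s i).app V (ω k)) = _
        rw [← hF.eq_toLog]
        have := coord_smul q e none (some k) (le_refl _)
        rwa [fres_self] at this
    · rw [mres_spull]

/-- The isomorphism of the conormal sheaf of the section with the restriction of `Ω_X`. -/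
theorem exists_conormalIso : ∃ ν : conormal σ ≅ (Scheme.Modules.pullback i).obj (differentials s),
    ∀ {V : X.Opens} {κ : Type} [Fintype κ] {t : Γ(X, V)} {ω : κ → Γ(differentials s, V)}
      {e : Option κ → Γ(logDifferentials s i, V)} (hF : LogFrame s i V t ω e) (o : Option κ)
      (α : Γ(idealModule σ, chart q e none)), idealVal σ _ α = sigmaGen q t e o →
        ν.inv.app _ (spull i _ (le_refl (i ⁻¹ᵁ V)) (frameBasis s t ω o)) =
          spull σ (idealModule σ) (sigma_le hres hY hσ hF) α := by
  obtain ⟨ψ, hψ⟩ := exists_conormalHom hX hres hY hσ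
  have : IsIso ψ := isIso_of_isBasisOn ψ fun d ↦ by
    obtain ⟨V, κ, _, t, ω, e, hdV, hV, hF⟩ := hX.exists_frame d
    have hg : IsIdealGen σ (chart q e none) (sigmaGen q t e) :=
      isIdealGen_sigma hX hres hY hσ hF hV
    choose α hα using fun o ↦ exists_idealVal (sigmaGen q t e o) (hg.zero o)
    have hb := (isBasisOn_conormal hg (isConormalIndep_sigma hres hY hσ hF hV) hα).mono
      (sigma_le hres hY hσ hF)
    simp only [mres_spull] at hb
    refine ⟨i ⁻¹ᵁ V, Option κ, inferInstance, fun o ↦ spull i _ le_rfl (frameBasis s t ω o), hdV,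
      hF.isBasisOn.pullback i, ?_⟩
    simp only [hψ hF _ _ (hα _)]
    exact hb
  exact ⟨(asIso ψ).symm, fun hF o α hα ↦ hψ hF o α hα⟩

end conormalSigma

/-! ### Inverse images of closed subschemes -/

section idealGen

variable {T Y Z : Scheme.{u}} {z : Z ⟶ Y} {U W : Y.Opens} {ι : Type*} [Fintype ι]
  {g : ι → Γ(Y, U)}

/-- A morphism along which local generators of the ideal of a closed subscheme become zero factors
through this closed subscheme. -/
theorem exists_lift_of_isIdealGen [IsClosedImmersion z] (h : T ⟶ Y)
    (H : ∀ x : T, ∃ (U : Y.Opens) (ι : Type) (_ : Fintype ι) (g : ι → Γ(Y, U)), h x ∈ U ∧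
      IsIdealGen z U g ∧ ∀ o, fpull h (le_refl (h ⁻¹ᵁ U)) (g o) = 0) : ∃ l : T ⟶ Z, l ≫ z = h := by
  have hker : z.ker ≤ h.ker := by
    refine Scheme.IdealSheafData.le_ofIdeals_iff.mpr fun V a ha ↦ ?_
    have ha' := z.ideal_ker_le V ha
    rw [RingHom.mem_ker] at ha' ⊢
    have ha0 : fpull z (le_refl (z ⁻¹ᵁ V.1)) a = 0 := (app_eq_fpull z a).symm.trans ha'
    refine (app_eq_fpull h a).trans (fun_ext fun x hx ↦ ?_)
    obtain ⟨U, ι, _, g, hxU, hg, h0⟩ := H x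
    have ha1 : fpull z (le_refl (z ⁻¹ᵁ (V.1 ⊓ U))) (fres inf_le_left a) = 0 := by
      have := congrArg (fres (z.preimage_mono (inf_le_left : V.1 ⊓ U ≤ V.1))) ha0
      rwa [fres_fpull, map_zero, ← fpull_fres (h := (inf_le_left : V.1 ⊓ U ≤ V.1)) (e := le_rfl)]
        at this
    obtain ⟨W, hW, c, hxW, hc⟩ := hg.exists_sum _ inf_le_right _ ha1 (h x) ⟨hx, hxU⟩
    refine ⟨h ⁻¹ᵁ W, h.preimage_mono (hW.trans inf_le_left), hxW, ?_⟩
    have h1 := congrArg (fpull h (le_refl (h ⁻¹ᵁ W))) hc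
    rw [fpull_fres, fpull_fres] at h1
    rw [fres_fpull, map_zero]
    refine h1.trans ?_
    rw [map_sum]
    refine Finset.sum_eq_zero fun o _ ↦ ?_
    have h2 := congrArg (fres (h.preimage_mono (hW.trans inf_le_right))) (h0 o)
    rw [fres_fpull, map_zero] at h2
    rw [map_mul, fpull_fres, h2, mul_zero]
  exact ⟨IsClosedImmersion.lift z h hker, IsClosedImmersion.lift_fac z h hker⟩

theorem IsIdealGen.mono (hg : IsIdealGen z U g) (h : W ≤ U) :
    IsIdealGen z W (fun o ↦ fres h (g o)) := by
  refine ⟨fun o ↦ ?_, fun W' h' f hf x hx ↦ ?_⟩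
  · have := congrArg (fres (z.preimage_mono h)) (hg.zero o)
    rw [fres_fpull, map_zero] at this
    rwa [fpull_fres]
  · obtain ⟨W'', h'', c, hx', hc⟩ := hg.exists_sum W' (h'.trans h) f hf x hx
    exact ⟨W'', h'', c, hx', by simpa using hc⟩

theorem IsIdealGen.single {ι : Type} [Fintype ι] {g : ι → Γ(Y, U)} (hg : IsIdealGen z U g)
    {ε : Γ(Y, U)} {c d : ι → Γ(Y, U)} (h : ∀ o, g o = c o * ε) (h' : ∑ o, d o * g o = ε) :
    IsIdealGen z U (fun _ : Unit ↦ ε) := by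
  refine ⟨fun _ ↦ ?_, fun W hW f hf x hx ↦ ?_⟩
  · rw [← h', map_sum]
    exact Finset.sum_eq_zero fun o _ ↦ by rw [map_mul, hg.zero, mul_zero]
  · obtain ⟨W', hW', b, hx', hb⟩ := hg.exists_sum W hW f hf x hx
    refine ⟨W', hW', fun _ ↦ ∑ o, b o * fres (hW'.trans hW) (c o), hx', ?_⟩
    rw [hb, Fintype.sum_unique (ι := Unit), Finset.sum_mul]
    exact Finset.sum_congr rfl fun o _ ↦ by rw [h o, map_mul, mul_assoc]

/-- Generators of the ideal of a closed subscheme give generators of the ideal of its inverse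
image. -/
theorem IsIdealGen.pullback {ι : Type} [Fintype ι] {g : ι → Γ(Y, U)} [IsClosedImmersion z]
    (hg : IsIdealGen z U g) (f : T ⟶ Y) :
    IsIdealGen (pullback.fst f z) (f ⁻¹ᵁ U) (fun o ↦ fpull f le_rfl (g o)) := by
  refine ⟨fun o ↦ ?_, fun W hW a ha x hx ↦ ?_⟩
  · have h1 := congrArg (fpull (pullback.snd f z) (W := pullback.fst f z ⁻¹ᵁ f ⁻¹ᵁ U) (by
      rw [← Scheme.Hom.comp_preimage, ← Scheme.Hom.comp_preimage, pullback.condition])) (hg.zero o)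
    rw [fpull_comp, map_zero] at h1
    rw [fpull_comp, ← h1]
    exact fpull_congr pullback.condition _ _
  · obtain ⟨A, hA, hxA, hAW⟩ := exists_isAffineOpen_mem_and_subset hx
    have hA' : IsAffineOpen A := hA
    let I : Ideal Γ(T, A) := Ideal.span (Set.range fun o ↦ fpull f (hAW.trans hW) (g o))
    let k : Spec (CommRingCat.of (Γ(T, A) ⧸ I)) ⟶ T :=
      Spec.map (CommRingCat.ofHom (Ideal.Quotient.mk I)) ≫ hA'.fromSpec
    have hk : ⊤ ≤ k ⁻¹ᵁ A := by
      rw [Scheme.Hom.comp_preimage, hA'.fromSpec_preimage_self]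
      exact le_rfl
    have hka : ∀ b, fpull k hk b = specFun _ (Ideal.Quotient.mk I b) := by
      intro b
      refine (fpull_comp (Spec.map (CommRingCat.ofHom (Ideal.Quotient.mk I))) hA'.fromSpec
        hA'.fromSpec_preimage_self.ge (top_le_preimage_top _) b).symm.trans ?_
      rw [fpull_fromSpec]
      exact (app_eq_fpull _ _).symm.trans
        (ConcreteCategory.congr_hom (Scheme.ΓSpecIso_inv_naturality
          (CommRingCat.ofHom (Ideal.Quotient.mk I))) b).symm
    have hkU : ⊤ ≤ (k ≫ f) ⁻¹ᵁ U := hk.trans (k.preimage_mono (hAW.trans hW))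
    obtain ⟨l, hl⟩ := exists_lift_of_isIdealGen (z := z) (k ≫ f) fun y ↦
      ⟨U, ι, inferInstance, g, hkU trivial, hg, fun o ↦ by
        have h1 : fpull (k ≫ f) hkU (g o) = 0 := by
          rw [← fpull_comp k f (hAW.trans hW) hk, hka, Ideal.Quotient.eq_zero_iff_mem.mpr
            (Ideal.subset_span (Set.mem_range_self o)), map_zero]
        have h2 := congrArg (fres (le_top : (k ≫ f) ⁻¹ᵁ U ≤ ⊤)) h1
        rwa [fres_fpull, map_zero] at h2⟩
    have h3 : pullback.lift k l hl.symm ≫ pullback.fst f z = k := pullback.lift_fst _ _ _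
    have h4 : fpull k hk (fres hAW a) = 0 := by
      have h5 := congrArg (fpull (pullback.lift k l hl.symm) (W := ⊤) (by
        rw [← Scheme.Hom.comp_preimage, h3]; exact hk.trans (k.preimage_mono hAW))) ha
      rw [fpull_comp, map_zero] at h5
      refine (fpull_fres k hAW hk a).trans (Eq.trans ?_ h5)
      exact fpull_congr h3.symm _ _
    rw [hka] at h4
    have h5 := Ideal.Quotient.eq_zero_iff_mem.mp
      ((specFun_bijective _).1 (h4.trans (map_zero _).symm))
    obtain ⟨c, hc⟩ := Ideal.mem_span_range_iff_exists_fun.mp h5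
    exact ⟨A, hAW, c, hxA, by simp only [← hc, fres_fpull]⟩

theorem isEffectiveCartier_of_isEqn [IsClosedImmersion z]
    (H : ∀ x : Y, ∃ (V : Y.Opens) (t : Γ(Y, V)), x ∈ V ∧ IsEqn z V t) : IsEffectiveCartier z := by
  refine ⟨inferInstance, fun x ↦ ?_⟩
  obtain ⟨V, t, hx, ht⟩ := H x
  obtain ⟨A, hA, hxA, hAV⟩ := exists_isAffineOpen_mem_and_subset hx
  have hA' : IsAffineOpen A := hA
  refine ⟨⟨A, hA'⟩, hxA, fres hAV t, (ht.mono hAV).isReg.mem_nonZeroDivisors, ?_⟩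
  ext a
  rw [Scheme.Hom.ker_apply, RingHom.mem_ker, Ideal.mem_span_singleton]
  constructor
  · intro ha
    exact (ht.mono hAV).exists_mul A le_rfl a ((app_eq_fpull z a).symm.trans ha) |>.imp
      fun b hb ↦ by simpa using hb
  · rintro ⟨b, rfl⟩
    refine (app_eq_fpull z _).trans ?_
    rw [map_mul, (ht.mono hAV).zero, zero_mul]

/-- Locally, one of the generators of the ideal of an effective Cartier divisor is an equation. -/
theorem IsIdealGen.exists_isEqn {ι : Type} [Fintype ι] {g : ι → Γ(Y, U)} (hg : IsIdealGen z U g)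
    (hz : IsEffectiveCartier z) {x : Y} (hx : x ∈ U) : ∃ (W : Y.Opens) (h : W ≤ U) (j : ι)
      (c : ι → Γ(Y, W)), x ∈ W ∧ IsEqn z W (fres h (g j)) ∧ c j = 1 ∧
        ∀ o, fres h (g o) = c o * fres h (g j) := by
  classical
  obtain ⟨V, ε, hxV, -, hε⟩ := hz.exists_isEqn x
  obtain ⟨W, hW, d, hxW, hd⟩ := hg.exists_sum (V ⊓ U) inf_le_right (fres inf_le_left ε)
    (by
      have := congrArg (fres (z.preimage_mono (inf_le_left : V ⊓ U ≤ V))) hε.zero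
      rw [fres_fpull, map_zero] at this
      rwa [fpull_fres]) x ⟨hxV, hx⟩
  rw [fres_fres] at hd
  choose c hc using fun o ↦ hε.exists_mul W (hW.trans inf_le_left) (fres (hW.trans inf_le_right) (g o))
    ((hg.mono (hW.trans inf_le_right)).zero o)
  have hε' := hε.mono (hW.trans inf_le_left)
  have h1 : ∑ o, d o * c o = 1 := by
    refine hε'.isReg.cancel ?_
    rw [Finset.mul_sum, mul_one]
    conv_rhs => rw [hd]
    exact Finset.sum_congr rfl fun o _ ↦ by rw [hc]; ring
  obtain ⟨j, hj⟩ := exists_mem_basicOpen_of_sum hxW (h1 ▸ isUnit_one)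
  obtain ⟨v, hv⟩ := (isUnit_fres_basicOpen (c j)).exists_right_inv
  have hle := Y.basicOpen_le (c j)
  have hc' : ∀ o, fres (hle.trans (hW.trans inf_le_right)) (g o) =
      fres hle (c o) * v * fres (hle.trans (hW.trans inf_le_right)) (g j) := by
    intro o
    have h2 := congrArg (fres hle) (hc o)
    have h3 := congrArg (fres hle) (hc j)
    rw [fres_fres, map_mul] at h2 h3
    rw [h2, h3, ← one_mul (_ * fres hle (c o)), ← hv]
    ring
  refine ⟨Y.basicOpen (c j), hle.trans (hW.trans inf_le_right), j, fun o ↦ fres hle (c o) * v, hj,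
    ?_, hv, hc'⟩
  refine ((hg.mono (hle.trans (hW.trans inf_le_right))).single hc'
    (d := fun o ↦ if o = j then 1 else 0) (by simp)).isEqn ?_
  have h3 := congrArg (fres hle) (hc j)
  rw [fres_fres, map_mul] at h3
  rw [h3]
  intro W' hW' b hb
  rw [map_mul, mul_assoc] at hb
  exact IsReg.of_isUnit (isUnit_fres_basicOpen (c j)) W' hW' b
    ((hε'.isReg.mono hle) W' hW' _ hb)

end idealGen

/-! ### Regular functions on a blowing-up -/

section open_

variable {X : Scheme.{u}} {C U : X.Opens}

theorem openSec_fpull (a : Γ(X, U)) {W : C.toScheme.Opens} (e : W ≤ C.ι ⁻¹ᵁ U) :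
    openSec C W (fpull C.ι e a) = fres ((C.ι.image_mono e).trans (C.ι.image_preimage_le U)) a := by
  rw [fpull, Scheme.Hom.appLE, Scheme.Opens.ι_app]
  exact (ConcreteCategory.congr_hom (X.presheaf.map_comp _ _) a).symm

theorem IsReg.fpull_ι {a : Γ(X, U)} (ha : IsReg a) :
    IsReg (fpull C.ι (le_refl (C.ι ⁻¹ᵁ U)) a) := by
  intro W hW c hc
  apply (openSec C W).injective
  have h1 := congrArg (openSec C W) hc
  rw [map_mul, fres_fpull, openSec_fpull, map_zero] at h1
  rw [map_zero]
  exact ha _ _ _ h1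

end open_

section blowup

variable {Y Z B T : Scheme.{u}} {z : Z ⟶ Y} {π : B ⟶ Y} [IsClosedImmersion z]

theorem isEqn_one {i : Z ⟶ Y} {V : Y.Opens} (h : i ⁻¹ᵁ V = ⊥) : IsEqn i V 1 := by
  have h' : Subsingleton Γ(Z, i ⁻¹ᵁ V) := by rw [h]; infer_instance
  exact ⟨IsReg.of_isUnit isUnit_one, Subsingleton.elim _ _, fun W hW f _ ↦ ⟨f, by simp⟩⟩

theorem preimage_fst_complement (f : T ⟶ Y) :
    pullback.fst f z ⁻¹ᵁ f ⁻¹ᵁ complement z = ⊥ := by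
  rw [← Scheme.Hom.comp_preimage, pullback.condition, Scheme.Hom.comp_preimage,
    preimage_complement]
  rfl

theorem complement_fst (f : T ⟶ Y) : complement (pullback.fst f z) = f ⁻¹ᵁ complement z := by
  ext x
  change x ∈ complement (pullback.fst f z) ↔ f x ∈ complement z
  rw [mem_complement, mem_complement, Scheme.Pullback.range_fst]
  rfl

theorem isEffectiveCartier_of_le (f : T ⟶ Y) (h : ⊤ ≤ f ⁻¹ᵁ complement z) :
    IsEffectiveCartier (pullback.fst f z) :=
  isEffectiveCartier_of_isEqn fun x ↦ ⟨⊤, 1, trivial, isEqn_one (by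
    rw [eq_bot_iff, ← preimage_fst_complement f]
    exact (pullback.fst f z).preimage_mono h)⟩

namespace IsBlowup

variable (hπ : IsBlowup z π)
include hπ

omit [IsClosedImmersion z] in
theorem hom_ext {g g' : T ⟶ B} (h : g ≫ π = g' ≫ π)
    (hg : IsEffectiveCartier (pullback.fst (g ≫ π) z)) : g = g' :=
  (hπ.existsUnique T _ hg).unique rfl h.symm

/-- A blowing-up is an isomorphism outside of its center. -/
theorem exists_section : ∃ k : (complement z).toScheme ⟶ B, k ≫ π = (complement z).ι ∧
    (π ∣_ complement z) ≫ k = (π ⁻¹ᵁ complement z).ι := by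
  obtain ⟨k, hk, -⟩ := hπ.existsUnique _ (complement z).ι
    (isEffectiveCartier_of_le _ (Scheme.Opens.ι_preimage_self _).ge)
  refine ⟨k, hk, hπ.hom_ext ?_ (isEffectiveCartier_of_le _ ?_)⟩
  · rw [Category.assoc, hk, morphismRestrict_ι]
  · rw [Category.assoc, hk, Scheme.Hom.comp_preimage, Scheme.Opens.ι_preimage_self]
    exact le_rfl

theorem isReg_fpull {U : Y.Opens} {a : Γ(Y, U)} (ha : IsReg a) :
    IsReg (fpull π (le_refl (π ⁻¹ᵁ U)) a) := by
  intro W hW c hc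
  refine fun_ext fun x hx ↦ ?_
  obtain ⟨V, ε, hxV, -, hε⟩ := hπ.isEffectiveCartier.exists_isEqn x
  refine ⟨V ⊓ W, inf_le_right, ⟨hxV, hx⟩, ?_⟩
  rw [map_zero]
  refine fun_eq_zero_of_isReg (W' := V ⊓ W ⊓ π ⁻¹ᵁ complement z) hε.isReg inf_le_left ?_
    inf_le_left ?_
  · rw [hε.basicOpen_eq, complement_fst]
    exact inf_le_inf_left _ inf_le_right
  obtain ⟨k, hk, hk'⟩ := hπ.exists_section
  have h1 : fpull k (le_refl (k ⁻¹ᵁ W)) c = 0 := by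
    refine (ha.fpull_ι (C := complement z)) (k ⁻¹ᵁ W) ?_ _ ?_
    · rw [← hk]
      exact k.preimage_mono hW
    · have h2 := congrArg (fpull k (le_refl (k ⁻¹ᵁ W))) hc
      rw [map_mul, map_zero, fpull_fres, fpull_comp] at h2
      rw [← h2, fres_fpull]
      congr 1
      exact fpull_congr hk.symm _ _
  have h3 : fpull (π ⁻¹ᵁ complement z).ι (le_refl ((π ⁻¹ᵁ complement z).ι ⁻¹ᵁ W)) c = 0 := by
    have hle : (π ⁻¹ᵁ complement z).ι ⁻¹ᵁ W ≤ (π ∣_ complement z) ⁻¹ᵁ k ⁻¹ᵁ W := by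
      rw [← Scheme.Hom.comp_preimage, hk']
    have h4 := congrArg (fpull (π ∣_ complement z) hle) h1
    rw [fpull_comp, map_zero] at h4
    rw [← h4]
    exact fpull_congr hk'.symm _ _
  have h5 := congrArg (fres (show V ⊓ W ⊓ π ⁻¹ᵁ complement z ≤ away (π ⁻¹ᵁ complement z) W from
    fun y hy ↦ (mem_away _).mpr ⟨hy.2, hy.1.2⟩)) (congrArg (openSec (π ⁻¹ᵁ complement z) _) h3)
  rw [openSec_fpull, map_zero, map_zero, fres_fres] at h5
  rwa [fres_fres]

end IsBlowup

end blowup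

/-! ### Images that are line bundles -/

section image

variable {T X : Scheme.{u}} {f : T ⟶ X} {F : X.Modules} {G : T.Modules}

/-- The image presheaf of a map of modules. -/
def rangeSubmodule {A G : T.Modules} (ψ : A ⟶ G) : G.val.Submodule where
  obj V := LinearMap.range (ψ.val.app V).hom
  map {V W} g := by
    rintro _ ⟨a, rfl⟩
    exact ⟨A.val.map g a, PresheafOfModules.naturality_apply ψ.val g a⟩

/-- The map to the image sheaf. -/
def toRange {A G : T.Modules} (ψ : A ⟶ G) : A ⟶ sheafify (rangeSubmodule ψ).toPresheafOfModules :=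
  ⟨submoduleLift (rangeSubmodule ψ) ψ.val (fun _ x ↦ ⟨x, rfl⟩) ≫ toSheafify _⟩

/-- The inclusion of the image sheaf. -/
def rangeι {A G : T.Modules} (ψ : A ⟶ G) : sheafify (rangeSubmodule ψ).toPresheafOfModules ⟶ G :=
  sheafifyDesc (rangeSubmodule ψ).ι

theorem toRange_app {A G : T.Modules} (ψ : A ⟶ G) {V : T.Opens} (a : Γ(A, V)) :
    (toRange ψ).app V a = shf (rangeSubmodule ψ).toPresheafOfModules V
      (subMk (rangeSubmodule ψ) (ψ.app V a) ⟨a, rfl⟩) := rfl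

theorem toRange_rangeι {A G : T.Modules} (ψ : A ⟶ G) : toRange ψ ≫ rangeι ψ = ψ := by
  refine modHom_ext fun V a ↦ ?_
  exact sheafifyDesc_shf _ (rangeSubmodule ψ).ι _

/-- The value of `ψ` at `e j` is without torsion, and generates the image of `ψ`; the coordinates
of the other values are `a`. -/
structure IsPrincipal (ψ : (Scheme.Modules.pullback f).obj F ⟶ G) {V : X.Opens} {ι : Type}
    [Fintype ι] (e : ι → Γ(F, V)) (j : ι) {W : T.Opens} (hW : W ≤ f ⁻¹ᵁ V) (a : ι → Γ(T, W)) :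
    Prop where
  isBasisOn : IsBasisOn F V e
  eq_zero : ∀ (W' : T.Opens) (h : W' ≤ W) (c : Γ(T, W')),
    c • qsec ψ (h.trans hW) (e j) = 0 → c = 0
  eq_smul : ∀ i, qsec ψ hW (e i) = a i • qsec ψ hW (e j)

variable {ψ : (Scheme.Modules.pullback f).obj F ⟶ G} {V : X.Opens} {ι : Type}
  [Fintype ι] {e : ι → Γ(F, V)} {j : ι} {W : T.Opens} {hW : W ≤ f ⁻¹ᵁ V} {a : ι → Γ(T, W)}

theorem IsPrincipal.isGen (h : IsPrincipal ψ e j hW a) :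
    IsGen _ W (qsec (toRange ψ) hW (e j)) := by
  refine isGen_iff_isBasisOn.mpr (isBasisOn_shf_sub (rangeSubmodule ψ)
    (fun _ : Unit ↦ subMk (rangeSubmodule ψ) (qsec ψ hW (e j)) ⟨_, rfl⟩) (fun W' hW' c hc _ ↦ ?_) ?_)
  · rw [Fintype.sum_unique] at hc
    refine h.eq_zero W' hW' _ ?_
    rw [← mres_qsec (h := hW')]
    exact hc
  · rintro W' hW' _ ⟨b, rfl⟩ x hx
    have hb := h.isBasisOn.pullback f
    obtain ⟨c, hc⟩ := hb.exists_repr (W := W') (hW'.trans hW) b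
    refine ⟨W', le_rfl, hW', hx, fun _ ↦ ∑ i, c i * fres hW' (a i), ?_⟩
    rw [Fintype.sum_unique]
    refine (mres_self G le_rfl (ψ.app W' b)).trans (Eq.trans ?_ (congrArg _ (mres_qsec ψ hW hW' (e j)).symm))
    have h1 : ψ.app W' b = ∑ i, c i • qsec ψ (hW'.trans hW) (e i) := by
      rw [hc, app_sum_smul]
      refine Finset.sum_congr rfl fun i _ ↦ ?_
      rw [mres_spull, qsec]
    rw [h1, Finset.sum_smul]
    refine Finset.sum_congr rfl fun i _ ↦ ?_
    have h2 := congrArg (mres G hW') (h.eq_smul i)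
    rw [mres_qsec, mres_smul, mres_qsec] at h2
    rw [h2, mul_smul]

theorem IsPrincipal.qsec_toRange (h : IsPrincipal ψ e j hW a) (i : ι) :
    qsec (toRange ψ) hW (e i) = a i • qsec (toRange ψ) hW (e j) := by
  rw [qsec, qsec, toRange_app, toRange_app, ← shf_smul]
  congr 1
  apply subVal_injective
  exact h.eq_smul i

theorem isInvertible_range (H : ∀ x : T, ∃ (V : X.Opens) (ι : Type) (_ : Fintype ι)
    (e : ι → Γ(F, V)) (j : ι) (W : T.Opens) (hW : W ≤ f ⁻¹ᵁ V) (a : ι → Γ(T, W)), x ∈ W ∧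
      IsPrincipal ψ e j hW a) :
    IsInvertible (sheafify (rangeSubmodule ψ).toPresheafOfModules) ∧ Epi (toRange ψ) := by
  constructor
  · refine isInvertible_iff.mpr fun x ↦ ?_
    obtain ⟨V, ι, _, e, j, W, hW, a, hx, h⟩ := H x
    exact ⟨W, _, hx, h.isGen⟩
  · refine epi_of_isGen _ fun x ↦ ?_
    obtain ⟨V, ι, _, e, j, W, hW, a, hx, h⟩ := H x
    exact ⟨V, e j, W, hW, hx, h.isGen⟩

end image

/-! ### Uniqueness of morphisms to projective bundles -/

section unique

variable {X P T : Scheme.{u}} {F : X.Modules} {p : P ⟶ X} {L : P.Modules}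
  {q : (Scheme.Modules.pullback p).obj F ⟶ L} {V : X.Opens} {ι : Type} {e : ι → Γ(F, V)}
  {j : ι} {g g' : T ⟶ P} {f : T ⟶ X} {M : T.Modules}
  {r : (Scheme.Modules.pullback f).obj F ⟶ M}

theorem Classifies.qsec_eq (h : Classifies q g r) {W : T.Opens} (hW : W ≤ f ⁻¹ᵁ V)
    (hg : W ≤ g ⁻¹ᵁ chart q e j) (k : ι) :
    qsec r hW (e k) = fpull g hg (coord q e j k) • qsec r hW (e j) := by
  obtain ⟨θ, hθ⟩ := h.exists_iso
  have h1 := congrArg (fun m ↦ θ.hom.app W (spull g L hg m)) (coord_smul q e j k (le_refl _))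
  simp only [spull_smul, Scheme.Modules.Hom.app_smul, fres_self] at h1
  rwa [hθ _ _ _ hW, hθ _ _ _ hW] at h1

/-- Morphisms to a projective bundle with the same local coordinates are equal. -/
theorem IsProjectiveBundle.hom_ext_local (hP : IsProjectiveBundle F p q) (h : g ≫ p = g' ≫ p)
    (H : ∀ x : T, ∃ (V : X.Opens) (ι : Type) (_ : Fintype ι) (e : ι → Γ(F, V)) (j : ι)
      (W : T.Opens) (hg : W ≤ g ⁻¹ᵁ chart q e j) (hg' : W ≤ g' ⁻¹ᵁ chart q e j), x ∈ W ∧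
        IsBasisOn F V e ∧ ∀ i, fpull g hg (coord q e j i) = fpull g' hg' (coord q e j i)) :
    g = g' := by
  have hc := classifies_pullbackQuotient q g
  have hle : ∀ {V : X.Opens} {ι : Type} {e : ι → Γ(F, V)} {j : ι} {W : T.Opens},
      W ≤ g ⁻¹ᵁ chart q e j → W ≤ (g ≫ p) ⁻¹ᵁ V :=
    fun hg ↦ hg.trans (g.preimage_mono (chart_le q _ _))
  have hepi : Epi (pullbackQuotient q g) := epi_of_isGen _ fun x ↦ by
    obtain ⟨V, ι, _, e, j, W, hg, hg', hx, he, -⟩ := H x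
    exact ⟨V, e j, W, hle hg, hx, hc.isGen (e := e) (j := j) hg (hle hg)⟩
  refine (hP.existsUnique T _ _ (pullbackQuotient q g) (hP.isInvertible.pullback g) hepi).unique hc
    (classifies_of_coords h.symm fun x ↦ ?_)
  obtain ⟨V, ι, _, e, j, W, hg, hg', hx, he, hi⟩ := H x
  exact ⟨V, ι, _, e, j, W, hle hg, hg', hx, he, hc.isGen (e := e) (j := j) hg (hle hg),
    fun k ↦ by rw [← hi, hc.qsec_eq]⟩

theorem fpull_ι_injective {U W : T.Opens} (h : W ≤ U) {a b : Γ(T, W)}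
    (hab : fpull U.ι (le_refl (U.ι ⁻¹ᵁ W)) a = fpull U.ι (le_refl (U.ι ⁻¹ᵁ W)) b) : a = b := by
  have h1 := congrArg (fres (show W ≤ away U W from fun y hy ↦ (mem_away _).mpr ⟨h hy, hy⟩))
    (congrArg (openSec U _) hab)
  rwa [openSec_fpull, openSec_fpull, fres_fres, fres_fres, fres_self, fres_self] at h1

theorem fpull_eq_of_restrict {U W : T.Opens} (h : U.ι ≫ g = U.ι ≫ g') (hW : W ≤ U) {V : P.Opens}
    (hg : W ≤ g ⁻¹ᵁ V) (hg' : W ≤ g' ⁻¹ᵁ V) (a : Γ(P, V)) : fpull g hg a = fpull g' hg' a := by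
  refine fpull_ι_injective hW ?_
  rw [fpull_comp, fpull_comp]
  exact fpull_congr h _ _

theorem basicOpen_coord_le (k : ι) : P.basicOpen (coord q e k j) ≤ chart q e j := by
  refine le_chart ((P.basicOpen_le _).trans (chart_le q e k)) ?_
  have h7 := coord_smul q e k j (le_refl _)
  rw [fres_self] at h7
  have := isGen_of_smul_unit (isGen_chart q e k) h7
  rwa [mres_qsec] at this

theorem coord_mul (j k l : ι) : fres (inf_le_right : chart q e j ⊓ chart q e k ≤ _) (coord q e k l) =
    fres inf_le_left (coord q e j l) * fres inf_le_right (coord q e k j) := by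
  refine coord_eq q e k inf_le_right ?_
  rw [mul_smul, ← coord_smul, ← coord_smul]

/-- Morphisms to a projective bundle that agree where a regular function is invertible are
equal. -/
theorem IsProjectiveBundle.hom_ext_of_isReg (hP : IsProjectiveBundle F p q) (h : g ≫ p = g' ≫ p)
    (H : ∀ x : T, ∃ (V : X.Opens) (ι : Type) (_ : Fintype ι) (e : ι → Γ(F, V))
      (τ : Γ(T, (g ≫ p) ⁻¹ᵁ V)), x ∈ (g ≫ p) ⁻¹ᵁ V ∧ IsBasisOn F V e ∧ IsReg τ ∧
        (T.basicOpen τ).ι ≫ g = (T.basicOpen τ).ι ≫ g') : g = g' := by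
  have := hP.epi
  refine hP.hom_ext_local h fun x ↦ ?_
  obtain ⟨V, ι, _, e, τ, hx, he, hτ, hgg⟩ := H x
  have hx' : p (g' x) ∈ V := by
    rw [h] at hx
    exact hx
  obtain ⟨j, hj⟩ := exists_mem_chart (q := q) hP.isInvertible he (y := g x) hx
  obtain ⟨k, hk⟩ := exists_mem_chart (q := q) hP.isInvertible he (y := g' x) hx'
  set W := g ⁻¹ᵁ chart q e j ⊓ g' ⁻¹ᵁ chart q e k with hWdef
  have hWV : W ≤ (g ≫ p) ⁻¹ᵁ V := inf_le_left.trans (g.preimage_mono (chart_le q e j))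
  have key : ∀ l, fpull g' (inf_le_right : W ≤ _) (coord q e k l) =
      fpull g (inf_le_left : W ≤ _) (coord q e j l) *
        fpull g' (inf_le_right : W ≤ _) (coord q e k j) := by
    intro l
    rw [← sub_eq_zero]
    refine fun_eq_zero_of_isReg (W' := W ⊓ T.basicOpen τ) hτ hWV le_rfl inf_le_left ?_
    have hle : W ⊓ T.basicOpen τ ≤ g' ⁻¹ᵁ chart q e j := by
      intro y hy
      have h1 : (T.basicOpen τ).ι ⁻¹ᵁ g ⁻¹ᵁ chart q e j ≤ (T.basicOpen τ).ι ⁻¹ᵁ g' ⁻¹ᵁ chart q e j :=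
        (congrArg (· ⁻¹ᵁ chart q e j) hgg).le
      exact h1 (show ⟨y, hy.2⟩ ∈ _ from hy.1.1)
    have hle2 : W ⊓ T.basicOpen τ ≤ g' ⁻¹ᵁ (chart q e j ⊓ chart q e k) :=
      le_inf hle (inf_le_left.trans inf_le_right)
    have h2 := congrArg (fpull g' hle2) (coord_mul (q := q) (e := e) j k l)
    rw [map_mul, fpull_fres, fpull_fres, fpull_fres] at h2
    rw [map_sub, map_mul, fres_fpull, fres_fpull, fres_fpull, h2,
      fpull_eq_of_restrict hgg inf_le_right _ hle, sub_self]
  have h1 := key k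
  rw [coord_self, map_one] at h1
  have hW' : W ≤ g' ⁻¹ᵁ chart q e j := by
    have h2 := le_basicOpen_of_isUnit (le_refl W)
      (a := fpull g' (inf_le_right : W ≤ _) (coord q e k j))
      (by rw [fres_self]; exact IsUnit.of_mul_eq_one_right _ h1.symm)
    rw [basicOpen_fpull] at h2
    exact h2.trans (inf_le_right.trans (g'.preimage_mono (basicOpen_coord_le k)))
  refine ⟨V, ι, _, e, j, W, inf_le_left, hW', ⟨hj, hk⟩, he, fun l ↦ ?_⟩
  have hle2 : W ≤ g' ⁻¹ᵁ (chart q e j ⊓ chart q e k) := le_inf hW' inf_le_right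
  have h2 := congrArg (fpull g' hle2) (coord_mul (q := q) (e := e) j k l)
  rw [map_mul, fpull_fres, fpull_fres, fpull_fres, key l] at h2
  have h3 := congrArg (· * fpull g (inf_le_left : W ≤ _) (coord q e j k)) h2
  simp only [mul_assoc] at h3
  rw [mul_comm (fpull g' _ (coord q e k j)), ← h1, mul_one, mul_one] at h3
  exact h3

end unique

/-! ### Morphisms related by the birational map -/

section agree

variable {X D Y Y₀ T S : Scheme.{u}} {R : CommRingCat.{u}} {s : X ⟶ Spec R} {i : D ⟶ X}
  {p : Y ⟶ X} {L : Y.Modules} {q : (Scheme.Modules.pullback p).obj (logDifferentials s i) ⟶ L}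
  {p₀ : Y₀ ⟶ X} {L₀ : Y₀.Modules} {q₀ : (Scheme.Modules.pullback p₀).obj (differentials s) ⟶ L₀}
  {u : (p ⁻¹ᵁ complement i).toScheme ⟶ Y₀} {f f' : T ⟶ Y} {f₀ f₀' : T ⟶ Y₀}

theorem fpull_bir {V : X.Opens} {κ : Type} [Fintype κ] {e : κ → Γ(differentials s, V)} {k : κ}
    (hu : Classifies q₀ u (birQuotient s i q)) {W : (p ⁻¹ᵁ complement i).toScheme.Opens}
    (h : W ≤ u ⁻¹ᵁ chart q₀ e k)
    (h' : W ≤ (p ⁻¹ᵁ complement i).ι ⁻¹ᵁ chart q (fun k ↦ (toLog s i).app V (e k)) k) (l : κ) :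
    fpull u h (coord q₀ e k l) =
      fpull (p ⁻¹ᵁ complement i).ι h' (coord q (fun k ↦ (toLog s i).app V (e k)) k l) := by
  have hW : W ≤ ((p ⁻¹ᵁ complement i).ι ≫ p) ⁻¹ᵁ V := h.trans hu.preimage_chart_le
  refine hu.fpull_coord k hW (hu.isGen h hW) ?_ h
  rw [qsec_map, qsec_map]
  exact (classifies_pullbackQuotient q _).qsec_eq hW h' l

/-- The morphisms `f` and `f₀` over `X` correspond to each other under the birational map `u`. -/
structure Agree (i : D ⟶ X) (p : Y ⟶ X) (p₀ : Y₀ ⟶ X)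
    (u : (p ⁻¹ᵁ complement i).toScheme ⟶ Y₀) (f : T ⟶ Y) (f₀ : T ⟶ Y₀) : Prop where
  comm : f ≫ p = f₀ ≫ p₀
  bir : ∀ {S : Scheme.{u}} (g : S ⟶ T) (v : S ⟶ (p ⁻¹ᵁ complement i).toScheme),
    v ≫ (p ⁻¹ᵁ complement i).ι = g ≫ f → v ≫ u = g ≫ f₀

theorem Agree.precomp (h : Agree i p p₀ u f f₀) (a : S ⟶ T) :
    Agree i p p₀ u (a ≫ f) (a ≫ f₀) :=
  ⟨by rw [Category.assoc, h.comm, Category.assoc], fun g v hv ↦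
    (h.bir (g ≫ a) v (hv.trans (Category.assoc _ _ _).symm)).trans (Category.assoc _ _ _)⟩

variable (hY : IsProjectiveBundle (logDifferentials s i) p q)
  (hY₀ : IsProjectiveBundle (differentials s) p₀ q₀) (hu : Classifies q₀ u (birQuotient s i q))

include hY hY₀ hu

theorem agree_of_coord (h : f ≫ p = f₀ ≫ p₀)
    (H : ∀ x : T, p (f x) ∈ complement i → ∃ (V : X.Opens) (κ : Type) (_ : Fintype κ)
      (e : κ → Γ(differentials s, V)) (k : κ) (W : T.Opens)
      (hW : W ≤ f ⁻¹ᵁ chart q (fun k ↦ (toLog s i).app V (e k)) k)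
      (hW₀ : W ≤ f₀ ⁻¹ᵁ chart q₀ e k), V ≤ complement i ∧ IsBasisOn (differentials s) V e ∧ x ∈ W ∧
        ∀ l, fpull f₀ hW₀ (coord q₀ e k l) =
          fpull f hW (coord q (fun k ↦ (toLog s i).app V (e k)) k l)) :
    Agree i p p₀ u f f₀ := by
  refine ⟨h, fun g v hv ↦ ?_⟩
  refine hY₀.hom_ext_local ?_ fun x ↦ ?_
  · rw [Category.assoc, Category.assoc, ← h, hu.1, reassoc_of% hv]
  · have hx : p (f (g x)) ∈ complement i := by
      have h1 : f (g x) = (v x).1 := congrArg (fun m ↦ m x) hv.symm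
      rw [h1]
      exact (v x).2
    obtain ⟨V, κ, _, e, k, W, hW, hW₀, hV, he, hxW, hl⟩ := H _ hx
    have h0 : (g ≫ f) ⁻¹ᵁ chart q (fun k ↦ (toLog s i).app V (e k)) k =
        (v ≫ (p ⁻¹ᵁ complement i).ι) ⁻¹ᵁ chart q (fun k ↦ (toLog s i).app V (e k)) k := by rw [hv]
    have h1 : g ⁻¹ᵁ W ≤ v ⁻¹ᵁ (p ⁻¹ᵁ complement i).ι ⁻¹ᵁ
        chart q (fun k ↦ (toLog s i).app V (e k)) k := (g.preimage_mono hW).trans h0.le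
    have h2 : g ⁻¹ᵁ W ≤ v ⁻¹ᵁ u ⁻¹ᵁ chart q₀ e k := by
      rw [bir_preimage hY hY₀ hu hV he]
      exact h1
    refine ⟨V, κ, _, e, k, g ⁻¹ᵁ W, h2, g.preimage_mono hW₀, hxW, he, fun l ↦ ?_⟩
    have h6 := (bir_preimage hY hY₀ hu hV he k).le
    have h3 := fpull_bir (e := e) (k := k) (W := u ⁻¹ᵁ chart q₀ e k) hu le_rfl h6 l
    have h4 := congrArg (fpull g (le_refl (g ⁻¹ᵁ W))) (hl l)
    have h5 := congrArg (fpull v h2) h3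
    rw [fpull_comp, fpull_comp] at h4 h5
    exact h5.trans ((fpull_congr hv _ _).trans h4.symm)

variable (i) in
/-- The inverse image of the boundary under `c` is a Cartier divisor. -/
def IsRegOver (c : T ⟶ X) : Prop :=
  ∀ (V : X.Opens) (t : Γ(X, V)), IsEqn i V t → IsReg (fpull c (le_refl (c ⁻¹ᵁ V)) t)

variable (hX : LogPair s i)

include hX

omit hY hY₀ hu in
theorem LogPair.exists_regular {c : T ⟶ X} (hc : IsRegOver i c) (x : T) : ∃ (V : X.Opens)
    (τ : Γ(T, c ⁻¹ᵁ V)) (κ κ' : Type) (_ : Fintype κ) (_ : Fintype κ')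
    (e : κ → Γ(differentials s, V)) (e' : κ' → Γ(logDifferentials s i, V)), c x ∈ V ∧
      IsBasisOn (differentials s) V e ∧ IsBasisOn (logDifferentials s i) V e' ∧ IsReg τ ∧
        T.basicOpen τ ≤ c ⁻¹ᵁ complement i := by
  have := hX.isClosedImmersion
  by_cases hx : c x ∈ complement i
  · obtain ⟨V, κ, _, e, hxV, hVc, -, he⟩ := hX.exists_basis _ hx
    exact ⟨V, 1, κ, κ, _, _, e, _, hxV, he, isBasisOn_toLog hVc he, IsReg.of_isUnit isUnit_one,
      (T.basicOpen_le _).trans (c.preimage_mono hVc)⟩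
  · rw [mem_complement, not_not] at hx
    obtain ⟨y, hy⟩ := hx
    obtain ⟨V, κ, _, t, ω, e, hyV, -, hF⟩ := hX.exists_frame y
    refine ⟨V, fpull c le_rfl t, _, _, _, _, _, e, hy ▸ hyV, hF.isBasisOn, hF.isBasisOn_log,
      hc V t hF.isEqn, ?_⟩
    rw [basicOpen_fpull, hF.isEqn.basicOpen_eq]
    exact inf_le_right.trans (c.preimage_mono inf_le_right)

omit hY hY₀ hu hX in
theorem exists_lift_complement {c : T ⟶ Y} {U : T.Opens} (h : U ≤ c ⁻¹ᵁ p ⁻¹ᵁ complement i) :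
    ∃ v : U.toScheme ⟶ (p ⁻¹ᵁ complement i).toScheme,
      v ≫ (p ⁻¹ᵁ complement i).ι = U.ι ≫ c := by
  refine ⟨IsOpenImmersion.lift (p ⁻¹ᵁ complement i).ι (U.ι ≫ c) ?_, IsOpenImmersion.lift_fac _ _ _⟩
  rw [Scheme.Opens.range_ι]
  rintro _ ⟨x, rfl⟩
  exact h x.2

theorem Agree.left_unique (h : Agree i p p₀ u f f₀) (h' : Agree i p p₀ u f' f₀)
    (hf : IsRegOver i (f ≫ p)) : f = f' := by
  have hu' := (isOpenImmersion_bir hX hY hY₀ hu).1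
  refine hY.hom_ext_of_isReg (h.comm.trans h'.comm.symm) fun x ↦ ?_
  obtain ⟨V, τ, κ, κ', _, _, e, e', hx, he, he', hτ, hb⟩ := hX.exists_regular hf x
  refine ⟨V, κ', _, e', τ, hx, he', hτ, ?_⟩
  obtain ⟨v, hv⟩ := exists_lift_complement (p := p) (c := f) hb
  obtain ⟨v', hv'⟩ := exists_lift_complement (p := p) (c := f') (U := T.basicOpen τ)
    (hb.trans (congrArg (· ⁻¹ᵁ complement i) (h.comm.trans h'.comm.symm)).le)
  have := (h.bir _ v hv).trans (h'.bir _ v' hv').symm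
  rw [cancel_mono] at this
  rw [← hv, ← hv', this]

omit hY hu in
theorem Agree.right_unique (h : Agree i p p₀ u f f₀) (h' : Agree i p p₀ u f f₀')
    (hf : IsRegOver i (f₀ ≫ p₀)) : f₀ = f₀' := by
  refine hY₀.hom_ext_of_isReg (h.comm.symm.trans h'.comm) fun x ↦ ?_
  obtain ⟨V, τ, κ, κ', _, _, e, e', hx, he, he', hτ, hb⟩ := hX.exists_regular hf x
  refine ⟨V, κ, _, e, τ, hx, he, hτ, ?_⟩
  obtain ⟨v, hv⟩ := exists_lift_complement (p := p) (c := f) (U := T.basicOpen τ)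
    (hb.trans (congrArg (· ⁻¹ᵁ complement i) h.comm).ge)
  exact (h.bir _ v hv).symm.trans (h'.bir _ v hv)

end agree

/-! ### Quotients of differentials given by quotients of logarithmic differentials -/

section forms

variable {X D Y Y₀ T : Scheme.{u}} {R : CommRingCat.{u}} {s : X ⟶ Spec R} {i : D ⟶ X}
  {V : X.Opens} {κ : Type} [Fintype κ] {t : Γ(X, V)}
  {ω : κ → Γ(differentials s, V)} {e : Option κ → Γ(logDifferentials s i, V)}
  {p : Y ⟶ X} {L : Y.Modules} {q : (Scheme.Modules.pullback p).obj (logDifferentials s i) ⟶ L}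
  {p₀ : Y₀ ⟶ X} {L₀ : Y₀.Modules} {q₀ : (Scheme.Modules.pullback p₀).obj (differentials s) ⟶ L₀}
  {f : T ⟶ Y} {f₀ : T ⟶ Y₀} {W : T.Opens}

/-- The coefficients of the quotients of the differentials `dt` and `ω`. -/
def logCoord (q : (Scheme.Modules.pullback p).obj (logDifferentials s i) ⟶ L) (t : Γ(X, V))
    (e : Option κ → Γ(logDifferentials s i, V)) (j o : Option κ) : Γ(Y, chart q e j) :=
  o.elim (fpull p (chart_le q e j) t * coord q e j none) fun k ↦ coord q e j (some k)

omit [Fintype κ] in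
theorem logCoord_none (o : Option κ) : logCoord q t e none o = sigmaGen q t e o := by
  cases o
  · simp [logCoord, coord_self, sigmaGen]
  · rfl

theorem LogFrame.qsec_toLog (hF : LogFrame s i V t ω e) (j o : Option κ) (h : W ≤ (f ≫ p) ⁻¹ᵁ V)
    (hW : W ≤ f ⁻¹ᵁ chart q e j) :
    qsec (pullbackQuotient q f) h ((toLog s i).app V (frameBasis s t ω o)) =
      fpull f hW (logCoord q t e j o) • qsec (pullbackQuotient q f) h (e j) := by
  have hc := classifies_pullbackQuotient q f
  cases o with
  | none =>
    have h1 : (toLog s i).app V (frameBasis s t ω none) = t • e none := hF.smul_none.symm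
    rw [h1, qsec_smul, hc.qsec_eq h hW none, smul_smul]
    congr 1
    rw [logCoord, Option.elim_none, map_mul, fpull_comp]
  | some k =>
    have h1 : (toLog s i).app V (frameBasis s t ω (some k)) = e (some k) := (hF.eq_toLog k).symm
    rw [h1, hc.qsec_eq h hW (some k)]
    rfl

variable (s i q) in
/-- The quotient of `Ω_X` given by a morphism to the projective bundle of `Ω_X(log D)`. -/
abbrev formsQuotient (f : T ⟶ Y) : (Scheme.Modules.pullback (f ≫ p)).obj (differentials s) ⟶
    (Scheme.Modules.pullback f).obj L :=
  (Scheme.Modules.pullback (f ≫ p)).map (toLog s i) ≫ pullbackQuotient q f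

variable (s i q q₀) in
/-- A map from the pullback of `L₀` to the pullback of `L` that is compatible with the map from
differentials to logarithmic differentials. -/
structure IsFormsMap (f : T ⟶ Y) (f₀ : T ⟶ Y₀)
    (θ : (Scheme.Modules.pullback f₀).obj L₀ ⟶ (Scheme.Modules.pullback f).obj L) : Prop where
  comm : f ≫ p = f₀ ≫ p₀
  app : ∀ {V : X.Opens} {W : T.Opens} (h : W ≤ (f ≫ p) ⁻¹ᵁ V) (h₀ : W ≤ (f₀ ≫ p₀) ⁻¹ᵁ V)
    (η : Γ(differentials s, V)), θ.app W (qsec (pullbackQuotient q₀ f₀) h₀ η) =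
      qsec (pullbackQuotient q f) h ((toLog s i).app V η)

variable {res : logDifferentials s i ⟶ (Scheme.Modules.pushforward i).obj (structureSheaf D)}
  {σ : D ⟶ Y} (hX : LogPair s i) (hres : IsFrameResidue s i res)
  (hY : IsProjectiveBundle (logDifferentials s i) p q)
  (hσ : Classifies q σ (restrictToDivisor i res))
  (hY₀ : IsProjectiveBundle (differentials s) p₀ q₀)

include hX hY in
/-- The points of the projective bundle of logarithmic differentials, over the complement and over
the boundary. -/
theorem LogPair.chart_cases (y : Y) :
    (∃ (V : X.Opens) (κ : Type) (_ : Fintype κ) (e : κ → Γ(differentials s, V)) (k : κ),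
      V ≤ complement i ∧ IsAffineOpen V ∧ IsBasisOn (differentials s) V e ∧
        y ∈ chart q (fun k ↦ (toLog s i).app V (e k)) k) ∨
    ∃ (V : X.Opens) (κ : Type) (_ : Fintype κ) (t : Γ(X, V)) (ω : κ → Γ(differentials s, V))
      (e : Option κ → Γ(logDifferentials s i, V)) (j : Option κ), IsAffineOpen V ∧
        LogFrame s i V t ω e ∧ y ∈ chart q e j := by
  have := hX.isClosedImmersion
  have := hY.epi
  by_cases hx : p y ∈ complement i
  · obtain ⟨V, κ, _, e, hxV, hVc, hV, he⟩ := hX.exists_basis _ hx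
    obtain ⟨k, hk⟩ := exists_mem_chart (q := q) hY.isInvertible (isBasisOn_toLog hVc he) (y := y) hxV
    exact Or.inl ⟨V, κ, _, e, k, hVc, hV, he, hk⟩
  · rw [mem_complement, not_not] at hx
    obtain ⟨z, hz⟩ := hx
    obtain ⟨V, κ, _, t, ω, e, hzV, hV, hF⟩ := hX.exists_frame z
    obtain ⟨j, hj⟩ := exists_mem_chart (q := q) hY.isInvertible hF.isBasisOn_log (y := y) 
      (show p y ∈ V from hz ▸ hzV)
    exact Or.inr ⟨V, κ, _, t, ω, e, j, hV, hF, hj⟩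

include hX hres hY hσ hY₀

theorem LogPair.exists_formsMap (hf : IsEffectiveCartier (pullback.fst f σ)) :
    ∃ (f₀ : T ⟶ Y₀) (θ : (Scheme.Modules.pullback f₀).obj L₀ ⟶ (Scheme.Modules.pullback f).obj L),
      IsFormsMap s i q q₀ f f₀ θ := by
  have hσ' := isClosedImmersion_sigma hX hres hY hσ
  have hc := classifies_pullbackQuotient q f
  set ψ := formsQuotient s i q f with hψ
  have hq : ∀ {V : X.Opens} {W : T.Opens} (h : W ≤ (f ≫ p) ⁻¹ᵁ V) (η : Γ(differentials s, V)),
      qsec ψ h η = qsec (pullbackQuotient q f) h ((toLog s i).app V η) := fun h η ↦ qsec_map _ h η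
  obtain ⟨hinv, hepi⟩ := isInvertible_range (ψ := ψ) fun x ↦ by
    rcases hX.chart_cases hY (f x) with ⟨V, κ, _, e, k, hVc, hV, he, hk⟩ |
      ⟨V, κ, _, t, ω, e, j, hV, hF, hj⟩
    · have hle := hc.preimage_chart_le (e := fun k ↦ (toLog s i).app V (e k)) (j := k)
      refine ⟨V, κ, _, e, k, _, hle, fun l ↦ fpull f le_rfl (coord q _ k l), hk, he,
        fun W' h c h0 ↦ ?_, fun l ↦ ?_⟩
      · rw [hq] at h0
        have h1 := (hc.isGen (e := fun k ↦ (toLog s i).app V (e k)) (j := k) h (h.trans hle))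
        exact h1.eq_zero_of_smul le_rfl (by rwa [mres_self])
      · rw [hq, hq]
        exact hc.qsec_eq hle le_rfl l
    · have hle := hc.preimage_chart_le (e := e) (j := j)
      cases j with
      | none =>
        obtain ⟨W, h, k, c, hxW, hW, hk, hc'⟩ :=
          ((isIdealGen_sigma hX hres hY hσ hF hV).pullback f).exists_isEqn hf hj
        have key : ∀ {W' : T.Opens} (h' : W' ≤ f ⁻¹ᵁ chart q e none) (o : Option κ),
            qsec ψ (h'.trans hle) (frameBasis s t ω o) = fres h' (fpull f le_rfl (sigmaGen q t e o)) •
              qsec (pullbackQuotient q f) (h'.trans hle) (e none) := fun h' o ↦ by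
          rw [hq, hF.qsec_toLog none o (h'.trans hle) h', logCoord_none, fres_fpull]
        refine ⟨V, _, _, frameBasis s t ω, k, W, h.trans hle, c, hxW, hF.isBasisOn,
          fun W' h' b h0 ↦ ?_, fun o ↦ ?_⟩
        · rw [key (h'.trans h), smul_smul] at h0
          have h1 := hc.isGen (e := e) (j := none) (h'.trans h) ((h'.trans h).trans hle)
          have h2 := h1.eq_zero_of_smul le_rfl (by rwa [mres_self])
          rw [mul_comm, ← fres_fres h h'] at h2
          exact (hW.isReg.mono h').cancel (h2.trans (mul_zero _).symm)
        · rw [key h, key h, smul_smul]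
          exact congrArg (· • _) (hc' o)
      | some k =>
        refine ⟨V, _, _, frameBasis s t ω, some k, _, hle,
          fun o ↦ fpull f le_rfl (logCoord q t e (some k) o), hj, hF.isBasisOn,
          fun W' h b h0 ↦ ?_, fun o ↦ ?_⟩
        · rw [hq, hF.qsec_toLog (some k) (some k) _ h] at h0
          simp only [logCoord, Option.elim_some, coord_self, map_one, one_smul] at h0
          have h1 := (hc.isGen (e := e) (j := some k) h (h.trans hle))
          exact h1.eq_zero_of_smul le_rfl (by rwa [mres_self])
        · rw [hq, hq, hF.qsec_toLog (some k) o hle le_rfl, hF.qsec_toLog (some k) (some k) hle le_rfl]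
          simp [logCoord, coord_self]
  obtain ⟨f₀, ⟨h, θ, hθ⟩, -⟩ := hY₀.existsUnique T (f ≫ p) _ (toRange ψ) hinv hepi
  refine ⟨f₀, θ.hom ≫ rangeι ψ, h.symm, fun {V W} hW h₀ η ↦ ?_⟩
  have h1 : pullbackQuotient q₀ f₀ ≫ θ.hom ≫ rangeι ψ =
      (Scheme.Modules.pullbackCongr h).hom.app (differentials s) ≫ ψ := by
    rw [reassoc_of% hθ, toRange_rangeι]
  rw [← qsec_comp, h1, qsec_pullbackCongr, hq]

end forms

/-! ### Local equations of the inverse images of the two centres -/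

section bot

variable {T Y Z X D : Scheme.{u}} {z : Z ⟶ Y} {U : Y.Opens}

theorem fst_preimage_eq_bot (hU : z ⁻¹ᵁ U = ⊥) (f : T ⟶ Y) {W : T.Opens} (hW : W ≤ f ⁻¹ᵁ U) :
    pullback.fst f z ⁻¹ᵁ W = ⊥ := by
  refine le_bot_iff.mp ?_
  have h1 : pullback.fst f z ⁻¹ᵁ W ≤ (pullback.fst f z ≫ f) ⁻¹ᵁ U := Scheme.Hom.preimage_mono _ hW
  rw [pullback.condition, Scheme.Hom.comp_preimage, hU] at h1
  exact h1

theorem preimage_preimage_complement {p : Y ⟶ X} {i : D ⟶ X} [IsClosedImmersion i] {g : Z ⟶ D}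
    (h : z ≫ p = g ≫ i) : z ⁻¹ᵁ p ⁻¹ᵁ complement i = ⊥ := by
  rw [← Scheme.Hom.comp_preimage, h, Scheme.Hom.comp_preimage, preimage_complement]
  rfl

end bot

section eqns

variable {X D Y Y₀ T P : Scheme.{u}} {R : CommRingCat.{u}} {s : X ⟶ Spec R} {i : D ⟶ X}
  {V : X.Opens} {κ : Type} [Fintype κ] {t : Γ(X, V)}
  {ω : κ → Γ(differentials s, V)} {e : Option κ → Γ(logDifferentials s i, V)}
  {p : Y ⟶ X} {L : Y.Modules} {q : (Scheme.Modules.pullback p).obj (logDifferentials s i) ⟶ L}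
  {p₀ : Y₀ ⟶ X} {L₀ : Y₀.Modules} {q₀ : (Scheme.Modules.pullback p₀).obj (differentials s) ⟶ L₀}
  {f : T ⟶ Y} {f₀ : T ⟶ Y₀} {W : T.Opens}
  {θ : (Scheme.Modules.pullback f₀).obj L₀ ⟶ (Scheme.Modules.pullback f).obj L}
  (hθ : IsFormsMap s i q q₀ f f₀ θ)

include hθ

theorem IsFormsMap.qsec_toLog {ι : Type} {b : ι → Γ(differentials s, V)} (k o : ι)
    (h : W ≤ (f ≫ p) ⁻¹ᵁ V) (hW₀ : W ≤ f₀ ⁻¹ᵁ chart q₀ b k) :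
    qsec (pullbackQuotient q f) h ((toLog s i).app V (b o)) =
      fpull f₀ hW₀ (coord q₀ b k o) •
        qsec (pullbackQuotient q f) h ((toLog s i).app V (b k)) := by
  have h₀ : W ≤ (f₀ ≫ p₀) ⁻¹ᵁ V := hW₀.trans (f₀.preimage_mono (chart_le q₀ b k))
  rw [← hθ.app h h₀, ← hθ.app h h₀, ← Scheme.Modules.Hom.app_smul]
  exact congrArg _ ((classifies_pullbackQuotient q₀ f₀).qsec_eq h₀ hW₀ o)

theorem IsFormsMap.logCoord_eq (hF : LogFrame s i V t ω e) {j k : Option κ}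
    (hW : W ≤ f ⁻¹ᵁ chart q e j) (hW₀ : W ≤ f₀ ⁻¹ᵁ chart q₀ (frameBasis s t ω) k) (o : Option κ) :
    fpull f hW (logCoord q t e j o) =
      fpull f₀ hW₀ (coord q₀ (frameBasis s t ω) k o) * fpull f hW (logCoord q t e j k) := by
  have hc := classifies_pullbackQuotient q f
  have h : W ≤ (f ≫ p) ⁻¹ᵁ V := hW.trans hc.preimage_chart_le
  have h1 := hθ.qsec_toLog k o h hW₀
  rw [hF.qsec_toLog j o h hW, hF.qsec_toLog j k h hW, smul_smul] at h1
  exact (hc.isGen (e := e) (j := j) hW h).smul_ext le_rfl (by rwa [mres_self])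

theorem IsFormsMap.agree {u : (p ⁻¹ᵁ complement i).toScheme ⟶ Y₀} (hX : LogPair s i)
    (hY : IsProjectiveBundle (logDifferentials s i) p q)
    (hY₀ : IsProjectiveBundle (differentials s) p₀ q₀)
    (hu : Classifies q₀ u (birQuotient s i q)) : Agree i p p₀ u f f₀ := by
  have := hY.epi
  have := hY₀.epi
  have hc := classifies_pullbackQuotient q f
  refine agree_of_coord hY hY₀ hu hθ.comm fun x hx ↦ ?_
  obtain ⟨V, κ, _, b, hxV, hVc, -, hb⟩ := hX.exists_basis _ hx
  have hxV₀ : p₀ (f₀ x) ∈ V := by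
    have h1 := congrArg (fun m ↦ m x) hθ.comm
    exact (show p (f x) = p₀ (f₀ x) from h1) ▸ hxV
  obtain ⟨k, hk⟩ := exists_mem_chart (q := q) hY.isInvertible (isBasisOn_toLog hVc hb)
    (y := f x) hxV
  obtain ⟨k', hk'⟩ := exists_mem_chart (q := q₀) hY₀.isInvertible hb (y := f₀ x) hxV₀
  let W := f ⁻¹ᵁ chart q (fun k ↦ (toLog s i).app V (b k)) k ⊓ f₀ ⁻¹ᵁ chart q₀ b k'
  have h : W ≤ (f ≫ p) ⁻¹ᵁ V := inf_le_left.trans hc.preimage_chart_le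
  have hgen := hc.isGen (e := fun k ↦ (toLog s i).app V (b k)) (j := k) (W := W) inf_le_left h
  have hl := fun l ↦ hc.qsec_eq (e := fun k ↦ (toLog s i).app V (b k)) (j := k) (W := W) h
    inf_le_left l
  have h1 := hθ.qsec_toLog k' k h inf_le_right
  rw [hl k', smul_smul] at h1
  have h3 := hgen.smul_ext (c := 1) (c' := fpull f₀ (inf_le_right : W ≤ _) (coord q₀ b k' k) *
    fpull f (inf_le_left : W ≤ _) (coord q (fun k ↦ (toLog s i).app V (b k)) k k')) le_rfl
    (by rw [mres_self, one_smul]; exact h1)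
  have hW₀ : W ≤ f₀ ⁻¹ᵁ chart q₀ b k := by
    have h4 := le_basicOpen_of_isUnit (le_refl W)
      (a := fpull f₀ (inf_le_right : W ≤ _) (coord q₀ b k' k))
      (by rw [fres_self]; exact IsUnit.of_mul_eq_one _ h3.symm)
    rw [basicOpen_fpull] at h4
    exact h4.trans (inf_le_right.trans (f₀.preimage_mono (basicOpen_coord_le k')))
  refine ⟨V, κ, _, b, k, W, inf_le_left, hW₀, hVc, hb, ⟨hk, hk'⟩, fun l ↦ ?_⟩
  have h5 := (hθ.qsec_toLog k l h hW₀).symm.trans (hl l)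
  exact hgen.smul_ext le_rfl (by rwa [mres_self])

variable {res : logDifferentials s i ⟶ (Scheme.Modules.pushforward i).obj (structureSheaf D)}
  {σ : D ⟶ Y} (hX : LogPair s i) (hres : IsFrameResidue s i res)
  (hY : IsProjectiveBundle (logDifferentials s i) p q)
  (hσ : Classifies q σ (restrictToDivisor i res))
  (hY₀ : IsProjectiveBundle (differentials s) p₀ q₀) {pD : P ⟶ D} {LD : P.Modules}
  {qD : (Scheme.Modules.pullback pD).obj (differentials (i ≫ s)) ⟶ LD} {τ : P ⟶ Y₀}
  (hP : IsProjectiveBundle (differentials (i ≫ s)) pD qD) (hτ : Classifies q₀ τ (tauQuotient i qD))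
  (hreg : IsRegOver i (f ≫ p)) (hF : LogFrame s i V t ω e) (hV : IsAffineOpen V)

include hX hY₀ hP hτ hF hV in
omit hθ in
/-- The ideal of the inverse image of `ℙ(T_D)` is generated by `t` and the coordinate of `dt`. -/
theorem isIdealGen_fst_tau {k : Option κ} (hW₀ : W ≤ f₀ ⁻¹ᵁ chart q₀ (frameBasis s t ω) k)
    (hW : W ≤ (f₀ ≫ p₀) ⁻¹ᵁ V) : IsIdealGen (pullback.fst f₀ τ) W (fun o : Option Unit ↦
      o.elim (fpull (f₀ ≫ p₀) hW t) fun _ ↦ fpull f₀ hW₀ (coord q₀ (frameBasis s t ω) k none)) := by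
  have := isClosedImmersion_tau hX hY₀ hP hτ
  cases k with
  | none =>
    have h1 := (isEqn_one (fst_preimage_eq_bot (tau_preimage_none hτ hF.isEqn) f₀ hW₀)).zero
    rw [map_one] at h1
    exact ⟨fun o ↦ eq_zero_of_zero_eq_one h1.symm _, fun W' h b hb x hx ↦
      ⟨W', le_rfl, fun o ↦ o.elim 0 fun _ ↦ b, hx, by simp [coord_self]⟩⟩
  | some k =>
    have h1 := ((isIdealGen_tau hX hY₀ hP hτ hF hV k).pullback f₀).mono hW₀
    convert h1 using 1
    funext o
    cases o
    · simp [fpull_comp]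
    · simp

include hX hres hY hσ hY₀ hP hτ hreg hF

theorem IsFormsMap.isEqn_fst_none (hV : IsAffineOpen V) {k : Option κ}
    (hW : W ≤ f ⁻¹ᵁ chart q e none) (hW₀ : W ≤ f₀ ⁻¹ᵁ chart q₀ (frameBasis s t ω) k) :
    IsEqn (pullback.fst f σ) W (fpull f hW (sigmaGen q t e k)) ∧
      IsEqn (pullback.fst f₀ τ) W (fpull f₀ hW₀ (coord q₀ (frameBasis s t ω) k none)) := by
  classical
  have := isClosedImmersion_sigma hX hres hY hσ
  have hc := classifies_pullbackQuotient q f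
  have h : W ≤ (f ≫ p) ⁻¹ᵁ V := hW.trans hc.preimage_chart_le
  have h₀ : W ≤ (f₀ ≫ p₀) ⁻¹ᵁ V := hW₀.trans (f₀.preimage_mono (chart_le q₀ _ k))
  have h1 : ∀ o, fpull f hW (sigmaGen q t e o) =
      fpull f₀ hW₀ (coord q₀ (frameBasis s t ω) k o) * fpull f hW (sigmaGen q t e k) := fun o ↦ by
    rw [← logCoord_none, ← logCoord_none]
    exact hθ.logCoord_eq hF hW hW₀ o
  have h2 : fpull (f ≫ p) h t = fpull f₀ hW₀ (coord q₀ (frameBasis s t ω) k none) *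
      fpull f hW (sigmaGen q t e k) := by
    rw [← h1 none]
    exact (fpull_comp f p _ hW t).symm
  have h3 : IsReg (fpull (f ≫ p) h t) := by
    have := (hreg V t hF.isEqn).mono h
    rwa [fres_fpull] at this
  constructor
  · refine IsIdealGen.isEqn (IsIdealGen.single
      (((isIdealGen_sigma hX hres hY hσ hF hV).pullback f).mono hW) (d := Pi.single k 1)
      (c := fun o ↦ fpull f₀ hW₀ (coord q₀ (frameBasis s t ω) k o)) (fun o ↦ ?_) ?_) ?_
    · rw [fres_fpull]
      exact h1 o
    · simp [Pi.single_apply]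
    · rw [h2, mul_comm] at h3
      exact isReg_of_mul_right h3
  · refine IsIdealGen.isEqn (IsIdealGen.single
      (isIdealGen_fst_tau hX hY₀ hP hτ hF hV hW₀ h₀) (d := fun o ↦ o.elim 0 fun _ ↦ 1)
      (c := fun o ↦ o.elim (fpull f hW (sigmaGen q t e k)) fun _ ↦ 1) (fun o ↦ ?_) ?_) ?_
    · cases o
      · rw [Option.elim_none, Option.elim_none, mul_comm, ← h2]
        exact (fpull_congr hθ.comm _ _).symm
      · simp
    · simp
    · rw [h2] at h3
      exact isReg_of_mul_right h3

theorem IsFormsMap.isEqn_fst_some (hV : IsAffineOpen V) {k : Option κ} {l : κ}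
    (hW : W ≤ f ⁻¹ᵁ chart q e (some l)) (hW₀ : W ≤ f₀ ⁻¹ᵁ chart q₀ (frameBasis s t ω) k)
    (h : W ≤ (f ≫ p) ⁻¹ᵁ V) :
    IsEqn (pullback.fst f σ) W 1 ∧ IsEqn (pullback.fst f₀ τ) W (fpull (f ≫ p) h t) := by
  have h₀ : W ≤ (f₀ ≫ p₀) ⁻¹ᵁ V := hW₀.trans (f₀.preimage_mono (chart_le q₀ _ k))
  refine ⟨isEqn_one (fst_preimage_eq_bot (sigma_preimage_some hres hY hσ hF l) f hW), ?_⟩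
  have h1 := fun o ↦ hθ.logCoord_eq hF hW hW₀ o
  have h2 : 1 = fpull f₀ hW₀ (coord q₀ (frameBasis s t ω) k (some l)) *
      fpull f hW (logCoord q t e (some l) k) := by
    rw [← h1 (some l), logCoord, Option.elim_some, coord_self, map_one]
  have h3 : fpull f hW (logCoord q t e (some l) none) =
      fpull (f ≫ p) h t * fpull f hW (coord q e (some l) none) := by
    rw [logCoord, Option.elim_none, map_mul, fpull_comp]
  refine IsIdealGen.isEqn (IsIdealGen.single (isIdealGen_fst_tau hX hY₀ hP hτ hF hV hW₀ h₀)
    (d := fun o ↦ o.elim 1 fun _ ↦ 0) (c := fun o ↦ o.elim 1 fun _ ↦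
      fpull f hW (coord q e (some l) none) *
        fpull f₀ hW₀ (coord q₀ (frameBasis s t ω) k (some l))) (fun o ↦ ?_) ?_) ?_
  · cases o with
    | none => exact (fpull_congr hθ.comm.symm _ _).trans (one_mul _).symm
    | some _ =>
      have h4 := h1 none
      rw [h3] at h4
      simp only [Option.elim_some]
      linear_combination (-fpull f₀ hW₀ (coord q₀ (frameBasis s t ω) k (some l))) * h4 +
        fpull f₀ hW₀ (coord q₀ (frameBasis s t ω) k none) * h2
  · simp only [Fintype.sum_option, Option.elim_none, Option.elim_some, one_mul, zero_mul,
      Finset.sum_const_zero, add_zero]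
    exact fpull_congr hθ.comm.symm _ _
  · have := (hreg V t hF.isEqn).mono h
    rwa [fres_fpull] at this

end eqns

/-! ### Extension of quotients of differentials to logarithmic differentials -/

section bijective

variable {X : Scheme.{u}} {M N : X.Modules} {U : X.Opens}

theorem bijective_app_of_isBasisOn (φ : M ⟶ N) (H : ∀ x ∈ U, ∃ (V : X.Opens) (κ : Type)
    (_ : Fintype κ) (b : κ → Γ(M, V)), x ∈ V ∧ IsBasisOn M V b ∧
      IsBasisOn N V (fun k ↦ φ.app V (b k))) : Function.Bijective (φ.app U) := by
  have hsum : ∀ {V W : X.Opens} {κ : Type} [Fintype κ] (b : κ → Γ(M, V)) (h : W ≤ V)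
      (c : κ → Γ(X, W)), φ.app W (∑ k, c k • mres M h (b k)) =
        ∑ k, c k • mres N h (φ.app V (b k)) := fun b h c ↦ by
    rw [app_sum_smul]
    exact Finset.sum_congr rfl fun k _ ↦ by rw [mres_app]
  have hinj : ∀ (W : X.Opens), W ≤ U → Function.Injective (φ.app W) := fun W hW ↦ by
    refine (injective_iff_map_eq_zero _).mpr fun a ha ↦ section_ext fun x hx ↦ ?_
    obtain ⟨V, κ, _, b, hxV, hb, hb'⟩ := H x (hW hx)
    obtain ⟨c, hc⟩ := hb.exists_repr (W := W ⊓ V) inf_le_right (mres M inf_le_left a)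
    have h1 := mres_app φ (inf_le_left : W ⊓ V ≤ W) a
    rw [ha, map_zero, hc, hsum] at h1
    refine ⟨W ⊓ V, inf_le_left, ⟨hx, hxV⟩, ?_⟩
    rw [map_zero, hc]
    exact Finset.sum_eq_zero fun k _ ↦ by rw [hb'.repr_eq_zero _ h1.symm k, zero_smul]
  refine ⟨hinj U le_rfl, fun b ↦ ?_⟩
  have hex : ∀ x ∈ U, ∃ W : X.Opens, W ≤ U ∧ x ∈ W ∧ ∃ a, ∃ h : W ≤ U, φ.app W a = mres N h b :=
    fun x hx ↦ by
      obtain ⟨V, κ, _, b', hxV, hb, hb'⟩ := H x hx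
      obtain ⟨c, hc⟩ := hb'.exists_repr (W := U ⊓ V) inf_le_right (mres N inf_le_left b)
      rw [← hsum] at hc
      exact ⟨U ⊓ V, inf_le_left, ⟨hx, hxV⟩, _, inf_le_left, hc.symm⟩
  obtain ⟨a, ha⟩ := section_glue_pred (M := M) U
    (fun W a ↦ ∃ h : W ≤ U, φ.app W a = mres N h b) hex
    fun W W' a a' hW hW' ⟨_, ha⟩ ⟨_, ha'⟩ ↦ hinj _ (inf_le_left.trans hW) (by
      rw [← mres_app, ← mres_app, ha, ha', mres_mres, mres_mres])
  refine ⟨a, section_ext fun x hx ↦ ?_⟩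
  obtain ⟨W, hW, hxW, a', h, ha'⟩ := hex x hx
  exact ⟨W, h, hxW, by rw [mres_app, ha _ h _ ⟨h, ha'⟩, ha']⟩

end bijective

section extend

variable {X D T : Scheme.{u}} {R : CommRingCat.{u}} {s : X ⟶ Spec R} {i : D ⟶ X}
  {c : T ⟶ X} {M : T.Modules} (r : (Scheme.Modules.pullback c).obj (differentials s) ⟶ M)
  (hX : LogPair s i)

include hX

theorem LogPair.bijective_toLog {U : X.Opens} (hU : U ≤ complement i) :
    Function.Bijective ((toLog s i).app U) :=
  bijective_app_of_isBasisOn _ fun x hx ↦ by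
    obtain ⟨V, κ, _, e, hxV, hVc, -, he⟩ := hX.exists_basis x (hU hx)
    exact ⟨V, κ, _, e, hxV, he, isBasisOn_toLog hVc he⟩

theorem LogPair.exists_extension :
    ∃ ψ : (Scheme.Modules.pullback c).obj (logDifferentials s i) ⟶
        awayFrom M (c ⁻¹ᵁ complement i),
      ∀ {V : X.Opens} {W : T.Opens} (h : W ≤ c ⁻¹ᵁ V) (η : Γ(differentials s, V)),
        qsec ψ h ((toLog s i).app V η) =
          (toAwayFrom M (c ⁻¹ᵁ complement i)).app W (qsec r h η) := by
  have hle : ∀ V : X.Opens, away (c ⁻¹ᵁ complement i) (c ⁻¹ᵁ V) ≤ c ⁻¹ᵁ (V ⊓ complement i) :=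
    fun V ↦ away_preimage_le c V (complement i)
  have hb : ∀ V : X.Opens, Function.Bijective ((toLog s i).app (V ⊓ complement i)) :=
    fun V ↦ hX.bijective_toLog inf_le_right
  refine (exists_pullbackHom_of_relation (f := c) (F := logDifferentials s i)
    (M := awayFrom M (c ⁻¹ᵁ complement i)) (fun V a b ↦
      ∃ η : Γ(differentials s, V ⊓ complement i), mres _ inf_le_left a = (toLog s i).app _ η ∧
        awaySec M _ _ b = qsec r (hle V) η) ?_ ?_ ?_ ?_ ?_).imp fun ψ hψ V W h η ↦ ?_
  · rintro U V h a b ⟨η, h1, h2⟩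
    refine ⟨mres _ (inf_le_inf_right _ h) η, ?_, ?_⟩
    · rw [← mres_app, ← h1, mres_mres, mres_mres]
    · rw [awaySec_res, h2, mres_qsec, qsec_mres]
  · rintro U a b a' b' ⟨η, h1, h2⟩ ⟨η', h1', h2'⟩
    exact ⟨η + η', by rw [map_add, map_add, h1, h1'], by rw [map_add, qsec_add, h2, h2']⟩
  · rintro U d a b ⟨η, h1, h2⟩
    refine ⟨fres (inf_le_left : U ⊓ complement i ≤ U) d • η, ?_, ?_⟩
    · rw [mres_smul, h1, Scheme.Modules.Hom.app_smul]
    · rw [awaySec_smul, h2, qsec_smul, fres_fpull, fpull_fres]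
  · rintro U b ⟨η, h1, h2⟩
    rw [map_zero] at h1
    have h3 : η = 0 := (hb U).1 (h1.symm.trans (map_zero _).symm)
    rw [h3, qsec_zero] at h2
    exact (AddEquiv.map_eq_zero_iff _).mp h2
  · intro U a x hx
    obtain ⟨η, hη⟩ := (hb U).2 (mres _ inf_le_left a)
    exact ⟨U, le_rfl, hx, (awaySec M _ _).symm (qsec r (hle U) η), η,
      by rw [mres_self, hη], by rw [AddEquiv.apply_symm_apply]⟩
  · have h1 := hψ V ((toLog s i).app V η) ((toAwayFrom M _).app _ (qsec r le_rfl η))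
      ⟨mres _ inf_le_left η, mres_app _ _ _, by
        rw [awaySec_toAwayFrom, mres_qsec, qsec_mres]⟩
    have h2 := congrArg (mres _ h) h1
    rw [mres_app, mres_spull, mres_app, mres_qsec] at h2
    exact h2

variable {r} {ψ : (Scheme.Modules.pullback c).obj (logDifferentials s i) ⟶
  awayFrom M (c ⁻¹ᵁ complement i)} {V : X.Opens} {W : T.Opens} {t : Γ(X, V)}

theorem LogPair.smul_cancel (ht : IsEqn i V t) (h : W ≤ c ⁻¹ᵁ V)
    {a b : Γ(awayFrom M (c ⁻¹ᵁ complement i), W)} (hab : fpull c h t • a = fpull c h t • b) :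
    a = b := by
  have := hX.isClosedImmersion
  apply (awaySec _ _ _).injective
  have h1 := congrArg (awaySec _ _ _) hab
  rw [awaySec_smul, awaySec_smul, fres_fpull] at h1
  have h2 : away (c ⁻¹ᵁ complement i) W ≤ c ⁻¹ᵁ X.basicOpen t := by
    rw [ht.basicOpen_eq]
    exact fun x hx ↦ ⟨h ((mem_away _).mp hx).2, ((mem_away _).mp hx).1⟩
  have h3 := (isUnit_fres_basicOpen t).map (fpull c h2)
  rw [fpull_fres] at h3
  obtain ⟨v, hv⟩ := h3.exists_left_inv
  have h4 := congrArg (v • ·) h1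
  simpa only [smul_smul, hv, one_smul] using h4

theorem LogPair.smul_toAway (hc : IsRegOver i c) (ht : IsEqn i V t) (h : W ≤ c ⁻¹ᵁ V)
    {m : Γ(M, W)} (hm : IsGen M W m) {b : Γ(T, W)}
    (hb : b • (toAwayFrom M (c ⁻¹ᵁ complement i)).app W m = 0) : b = 0 := by
  have := hX.isClosedImmersion
  have h1 := congrArg (awaySec _ _ _) hb
  rw [awaySec_smul, awaySec_toAwayFrom, map_zero] at h1
  refine fun_eq_zero_of_isReg (hc V t ht) h (fun x hx ↦ ?_) (away_le _ W)
    (hm.eq_zero_of_smul _ h1)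
  have h2 : x ∈ T.basicOpen (fpull c (le_refl (c ⁻¹ᵁ V)) t) := hx.2
  rw [basicOpen_fpull, ht.basicOpen_eq] at h2
  exact (mem_away _).mpr ⟨h2.2.2, hx.1⟩

end extend

/-! ### Morphisms to the two projective bundles -/

section lift

variable {X D Y Y₀ T P : Scheme.{u}} {R : CommRingCat.{u}} {s : X ⟶ Spec R} {i : D ⟶ X}
  {V : X.Opens} {κ : Type} [Fintype κ] {t : Γ(X, V)}
  {ω : κ → Γ(differentials s, V)} {e : Option κ → Γ(logDifferentials s i, V)}
  {p : Y ⟶ X} {L : Y.Modules} {q : (Scheme.Modules.pullback p).obj (logDifferentials s i) ⟶ L}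
  {p₀ : Y₀ ⟶ X} {L₀ : Y₀.Modules} {q₀ : (Scheme.Modules.pullback p₀).obj (differentials s) ⟶ L₀}
  {f : T ⟶ Y} {f₀ : T ⟶ Y₀} {W : T.Opens}
  {θ : (Scheme.Modules.pullback f₀).obj L₀ ⟶ (Scheme.Modules.pullback f).obj L}
  {ψ : (Scheme.Modules.pullback (f₀ ≫ p₀)).obj (logDifferentials s i) ⟶
    awayFrom ((Scheme.Modules.pullback f₀).obj L₀) ((f₀ ≫ p₀) ⁻¹ᵁ complement i)}
  {res : logDifferentials s i ⟶ (Scheme.Modules.pushforward i).obj (structureSheaf D)}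
  {σ : D ⟶ Y} {pD : P ⟶ D} {LD : P.Modules}
  {qD : (Scheme.Modules.pullback pD).obj (differentials (i ≫ s)) ⟶ LD} {τ : P ⟶ Y₀}
  {u : (p ⁻¹ᵁ complement i).toScheme ⟶ Y₀}
  (hX : LogPair s i) (hres : IsFrameResidue s i res)
  (hY : IsProjectiveBundle (logDifferentials s i) p q)
  (hσ : Classifies q σ (restrictToDivisor i res))
  (hY₀ : IsProjectiveBundle (differentials s) p₀ q₀)
  (hP : IsProjectiveBundle (differentials (i ≫ s)) pD qD) (hτ : Classifies q₀ τ (tauQuotient i qD))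
  (hu : Classifies q₀ u (birQuotient s i q))

include hX

theorem LogPair.exists_charts (hY : IsProjectiveBundle (logDifferentials s i) p q)
    (hY₀ : IsProjectiveBundle (differentials s) p₀ q₀) (h : f ≫ p = f₀ ≫ p₀) (x : T) :
    p (f x) ∈ complement i ∨ ∃ (V : X.Opens) (κ : Type) (_ : Fintype κ) (t : Γ(X, V))
      (ω : κ → Γ(differentials s, V)) (e : Option κ → Γ(logDifferentials s i, V))
      (j k : Option κ), IsAffineOpen V ∧ LogFrame s i V t ω e ∧
        x ∈ f ⁻¹ᵁ chart q e j ⊓ f₀ ⁻¹ᵁ chart q₀ (frameBasis s t ω) k := by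
  have := hY₀.epi
  rcases hX.chart_cases hY (f x) with ⟨V, κ, _, e, k, hVc, hV, he, hk⟩ |
    ⟨V, κ, _, t, ω, e, j, hV, hF, hj⟩
  · exact Or.inl (hVc (chart_le q _ k hk))
  · have hx : f₀ x ∈ p₀ ⁻¹ᵁ V := by
      have h1 : p (f x) = p₀ (f₀ x) := congrArg (fun m ↦ m x) h
      exact (show p₀ (f₀ x) ∈ V from h1 ▸ chart_le q _ j hj)
    obtain ⟨k, hk⟩ := exists_mem_chart (q := q₀) hY₀.isInvertible hF.isBasisOn hx
    exact Or.inr ⟨V, κ, _, t, ω, e, j, k, hV, hF, hj, hk⟩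

include hres hY hσ hY₀ hP hτ in
theorem IsFormsMap.exists_isEqn (hθ : IsFormsMap s i q q₀ f f₀ θ) (hreg : IsRegOver i (f ≫ p))
    (x : T) : ∃ (W : T.Opens) (ε ε₀ : Γ(T, W)), x ∈ W ∧ IsEqn (pullback.fst f σ) W ε ∧
      IsEqn (pullback.fst f₀ τ) W ε₀ := by
  have := hX.isClosedImmersion
  rcases hX.exists_charts hY hY₀ hθ.comm x with hx | ⟨V, κ, _, t, ω, e, j, k, hV, hF, hx⟩
  · refine ⟨(f ≫ p) ⁻¹ᵁ complement i, 1, 1, hx, isEqn_one ?_, isEqn_one ?_⟩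
    · exact fst_preimage_eq_bot
        (preimage_preimage_complement (hσ.1.trans (Category.id_comp i).symm)) f le_rfl
    · refine fst_preimage_eq_bot (preimage_preimage_complement hτ.1) f₀ ?_
      rw [hθ.comm]
      rfl
  · cases j with
    | none =>
      have h1 := hθ.isEqn_fst_none hX hres hY hσ hY₀ hP hτ hreg hF hV (k := k) (W := _ ⊓ _)
        inf_le_left inf_le_right
      exact ⟨_, _, _, hx, h1.1, h1.2⟩
    | some l =>
      have h1 := hθ.isEqn_fst_some hX hres hY hσ hY₀ hP hτ hreg hF hV (k := k) (l := l) (W := _ ⊓ _)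
        inf_le_left inf_le_right (inf_le_left.trans (f.preimage_mono (chart_le q e _)))
      exact ⟨_, _, _, hx, h1.1, h1.2⟩

variable (hψ : ∀ {V : X.Opens} {W : T.Opens} (h : W ≤ (f₀ ≫ p₀) ⁻¹ᵁ V) (η : Γ(differentials s, V)),
    qsec ψ h ((toLog s i).app V η) =
      (toAwayFrom _ ((f₀ ≫ p₀) ⁻¹ᵁ complement i)).app W (qsec (pullbackQuotient q₀ f₀) h η))
  (hreg : IsRegOver i (f₀ ≫ p₀)) (hF : LogFrame s i V t ω e)

include hψ hreg hF

theorem LogPair.isPrincipal_extension {k : Option κ} (h : W ≤ (f₀ ≫ p₀) ⁻¹ᵁ V)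
    (hW₀ : W ≤ f₀ ⁻¹ᵁ chart q₀ (frameBasis s t ω) k) (a : Γ(T, W)) :
    (∀ l, k = some l → fpull f₀ hW₀ (coord q₀ (frameBasis s t ω) k none) = a * fpull _ h t →
      IsPrincipal ψ e k h (fun o ↦ o.elim a fun l ↦
        fpull f₀ hW₀ (coord q₀ (frameBasis s t ω) k (some l)))) ∧
    (fpull _ h t = a * fpull f₀ hW₀ (coord q₀ (frameBasis s t ω) k none) →
      IsPrincipal ψ e none h (fun o ↦ o.elim 1 fun l ↦
        fpull f₀ hW₀ (coord q₀ (frameBasis s t ω) k (some l)) * a)) := by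
  have hc := classifies_pullbackQuotient q₀ f₀
  have hz : ∀ (W' : T.Opens) (h' : W' ≤ W) (o : Option κ),
      qsec ψ (h'.trans h) ((toLog s i).app V (frameBasis s t ω o)) =
        fpull f₀ (h'.trans hW₀) (coord q₀ (frameBasis s t ω) k o) •
          qsec ψ (h'.trans h) ((toLog s i).app V (frameBasis s t ω k)) := fun W' h' o ↦ by
    rw [hψ, hψ, ← Scheme.Modules.Hom.app_smul]
    exact congrArg _ (hc.qsec_eq (h'.trans h) (h'.trans hW₀) o)
  have ht : ∀ (W' : T.Opens) (h' : W' ≤ W), fpull _ (h'.trans h) t • qsec ψ (h'.trans h) (e none) =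
      fpull f₀ (h'.trans hW₀) (coord q₀ (frameBasis s t ω) k none) •
        qsec ψ (h'.trans h) ((toLog s i).app V (frameBasis s t ω k)) := fun W' h' ↦ by
    rw [← hz W' h' none, ← qsec_smul]
    exact congrArg _ hF.smul_none
  have hl : ∀ (l : κ), qsec ψ h (e (some l)) =
      fpull f₀ hW₀ (coord q₀ (frameBasis s t ω) k (some l)) •
        qsec ψ h ((toLog s i).app V (frameBasis s t ω k)) := fun l ↦ by
    rw [← hz W le_rfl (some l)]
    exact congrArg _ (hF.eq_toLog l)
  have h0 : ∀ (W' : T.Opens) (h' : W' ≤ W) (b : Γ(T, W')),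
      b • qsec ψ (h'.trans h) ((toLog s i).app V (frameBasis s t ω k)) = 0 → b = 0 :=
    fun W' h' b hb ↦ by
      rw [hψ] at hb
      exact hX.smul_toAway hreg hF.isEqn (h'.trans h)
        (hc.isGen (e := frameBasis s t ω) (j := k) (h'.trans hW₀) (h'.trans h)) hb
  constructor
  · rintro l rfl ha
    have he : e (some l) = (toLog s i).app V (frameBasis s t ω (some l)) := hF.eq_toLog l
    refine ⟨hF.isBasisOn_log, fun W' h' b hb ↦ h0 W' h' b (by rwa [he] at hb), fun o ↦ ?_⟩
    cases o with
    | none =>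
      refine hX.smul_cancel hF.isEqn h ?_
      rw [ht W le_rfl, ha, he, smul_smul, mul_comm]
      rfl
    | some l' => rw [hl, he]; rfl
  · intro ha
    refine ⟨hF.isBasisOn_log, fun W' h' b hb ↦ ?_, fun o ↦ ?_⟩
    · have h1 := congrArg (fpull _ (h'.trans h) t • ·) hb
      simp only [smul_zero] at h1
      rw [smul_comm, ht W' h', smul_smul] at h1
      have h2 := h0 W' h' _ h1
      have h3 : IsReg (fpull (f₀ ≫ p₀) (h'.trans h) t) := by
        have := (hreg V t hF.isEqn).mono (h'.trans h)
        rwa [fres_fpull] at this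
      refine h3.cancel (Eq.trans ?_ (mul_zero _).symm)
      have h4 := congrArg (fres h') ha
      rw [map_mul, fres_fpull, fres_fpull] at h4
      rw [h4, mul_assoc, mul_comm _ b, h2, mul_zero]
    · cases o with
      | none => exact (one_smul _ _).symm
      | some l =>
        refine hX.smul_cancel hF.isEqn h ?_
        rw [hl, Option.elim_some, smul_comm _ (_ * a), ht W le_rfl, ha, smul_smul, smul_smul]
        congr 1
        ring

end lift

section principal

variable {X P T : Scheme.{u}} {F : X.Modules} {p : P ⟶ X} {L : P.Modules}
  {q : (Scheme.Modules.pullback p).obj F ⟶ L} {g : T ⟶ P} {c : T ⟶ X} {G : T.Modules}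
  {ψ : (Scheme.Modules.pullback c).obj F ⟶ G} {V : X.Opens} {ι : Type} [Fintype ι]
  {e : ι → Γ(F, V)} {j : ι} {W : T.Opens} {hW : W ≤ c ⁻¹ᵁ V} {a : ι → Γ(T, W)}

theorem IsPrincipal.exists_coord [Epi q] (h : IsPrincipal ψ e j hW a) (hL : IsInvertible L)
    (hg : Classifies q g (toRange ψ)) :
    ∃ hle : W ≤ g ⁻¹ᵁ chart q e j, ∀ l, fpull g hle (coord q e j l) = a l :=
  ⟨hg.le_chart j hL h.isBasisOn _ h.isGen, fun l ↦
    hg.fpull_coord j _ h.isGen (h.qsec_toRange l) _⟩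

end principal

section lift

variable {X D Y Y₀ T P : Scheme.{u}} {R : CommRingCat.{u}} {s : X ⟶ Spec R} {i : D ⟶ X}
  {V : X.Opens} {κ : Type} [Fintype κ] {t : Γ(X, V)}
  {ω : κ → Γ(differentials s, V)} {e : Option κ → Γ(logDifferentials s i, V)}
  {p : Y ⟶ X} {L : Y.Modules} {q : (Scheme.Modules.pullback p).obj (logDifferentials s i) ⟶ L}
  {p₀ : Y₀ ⟶ X} {L₀ : Y₀.Modules} {q₀ : (Scheme.Modules.pullback p₀).obj (differentials s) ⟶ L₀}
  {f : T ⟶ Y} {f₀ : T ⟶ Y₀} {W : T.Opens}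
  {θ : (Scheme.Modules.pullback f₀).obj L₀ ⟶ (Scheme.Modules.pullback f).obj L}
  {ψ : (Scheme.Modules.pullback (f₀ ≫ p₀)).obj (logDifferentials s i) ⟶
    awayFrom ((Scheme.Modules.pullback f₀).obj L₀) ((f₀ ≫ p₀) ⁻¹ᵁ complement i)}
  {res : logDifferentials s i ⟶ (Scheme.Modules.pushforward i).obj (structureSheaf D)}
  {σ : D ⟶ Y} {pD : P ⟶ D} {LD : P.Modules}
  {qD : (Scheme.Modules.pullback pD).obj (differentials (i ≫ s)) ⟶ LD} {τ : P ⟶ Y₀}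
  {u : (p ⁻¹ᵁ complement i).toScheme ⟶ Y₀}
  (hX : LogPair s i) (hres : IsFrameResidue s i res)
  (hY : IsProjectiveBundle (logDifferentials s i) p q)
  (hσ : Classifies q σ (restrictToDivisor i res))
  (hY₀ : IsProjectiveBundle (differentials s) p₀ q₀)
  (hP : IsProjectiveBundle (differentials (i ≫ s)) pD qD) (hτ : Classifies q₀ τ (tauQuotient i qD))
  (hu : Classifies q₀ u (birQuotient s i q))

variable (hψ : ∀ {V : X.Opens} {W : T.Opens} (h : W ≤ (f₀ ≫ p₀) ⁻¹ᵁ V) (η : Γ(differentials s, V)),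
    qsec ψ h ((toLog s i).app V η) =
      (toAwayFrom _ ((f₀ ≫ p₀) ⁻¹ᵁ complement i)).app W (qsec (pullbackQuotient q₀ f₀) h η))

include hψ in
theorem isPrincipal_complement {κ : Type} [Fintype κ] {e : κ → Γ(differentials s, V)}
    (hVc : V ≤ complement i) (he : IsBasisOn (differentials s) V e) (k : κ) :
    IsPrincipal ψ (fun k ↦ (toLog s i).app V (e k)) k
      ((classifies_pullbackQuotient q₀ f₀).preimage_chart_le (e := e) (j := k))
      fun l ↦ fpull f₀ le_rfl (coord q₀ e k l) := by
  have hc := classifies_pullbackQuotient q₀ f₀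
  refine ⟨isBasisOn_toLog hVc he, fun W' h' b hb ↦ ?_, fun l ↦ ?_⟩
  · have h := h'.trans (hc.preimage_chart_le (e := e) (j := k))
    rw [hψ] at hb
    have h1 := congrArg (awaySec _ _ _) hb
    rw [awaySec_smul, awaySec_toAwayFrom, map_zero] at h1
    have h2 := (hc.isGen (e := e) (j := k) h' h).eq_zero_of_smul _ h1
    have h3 : W' ≤ away ((f₀ ≫ p₀) ⁻¹ᵁ complement i) W' :=
      fun x hx ↦ (mem_away _).mpr ⟨hVc (h hx), hx⟩
    have h4 := congrArg (fres h3) h2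
    rwa [fres_fres, fres_self, map_zero] at h4
  · rw [hψ, hψ, ← Scheme.Modules.Hom.app_smul]
    exact congrArg _ (hc.qsec_eq _ le_rfl l)

variable (hreg : IsRegOver i (f₀ ≫ p₀))

include hX hY₀ hP hτ hψ hreg in
theorem LogPair.exists_isPrincipal (hf₀ : IsEffectiveCartier (pullback.fst f₀ τ))
    (hV : IsAffineOpen V) (hF : LogFrame s i V t ω e) {k : Option κ} {x : T}
    (hk : x ∈ f₀ ⁻¹ᵁ chart q₀ (frameBasis s t ω) k) :
    ∃ (W : T.Opens) (h : W ≤ (f₀ ≫ p₀) ⁻¹ᵁ V)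
      (j : Option κ) (a : Option κ → Γ(T, W)), x ∈ W ∧ IsPrincipal ψ e j h a ∧
        (j = none → ∃ (ε : Γ(T, W)) (d d' : Option κ → Γ(T, W)), IsReg ε ∧
          (∀ o : Option κ, o.elim (fpull _ h t) (fun l ↦ a (some l)) = d o * ε) ∧
          ∑ o, d' o * o.elim (fpull _ h t) (fun l ↦ a (some l)) = ε) := by
  classical
  have hc := classifies_pullbackQuotient q₀ f₀
  have hle := hc.preimage_chart_le (e := frameBasis s t ω) (j := k)
  have hB : ∀ {W : T.Opens} (hW₀ : W ≤ f₀ ⁻¹ᵁ chart q₀ (frameBasis s t ω) k) (a : Γ(T, W)),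
      fpull _ (hW₀.trans hle) t = a * fpull f₀ hW₀ (coord q₀ (frameBasis s t ω) k none) →
      ∃ (ε : Γ(T, W)) (d d' : Option κ → Γ(T, W)), IsReg ε ∧
        (∀ o : Option κ, o.elim (fpull _ (hW₀.trans hle) t)
          (fun l ↦ fpull f₀ hW₀ (coord q₀ (frameBasis s t ω) k (some l)) * a) = d o * ε) ∧
        ∑ o, d' o * o.elim (fpull _ (hW₀.trans hle) t)
          (fun l ↦ fpull f₀ hW₀ (coord q₀ (frameBasis s t ω) k (some l)) * a) = ε := by
    intro W hW₀ a ha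
    have h1 : ∀ o : Option κ, o.elim (fpull _ (hW₀.trans hle) t)
          (fun l ↦ fpull f₀ hW₀ (coord q₀ (frameBasis s t ω) k (some l)) * a) =
        fpull f₀ hW₀ (coord q₀ (frameBasis s t ω) k o) * a := by
      rintro (_ | l)
      · rw [Option.elim_none, ha, mul_comm]
      · rfl
    refine ⟨a, fun o ↦ fpull f₀ hW₀ (coord q₀ (frameBasis s t ω) k o), Pi.single k 1, ?_, h1, ?_⟩
    · have h2 := (hreg V t hF.isEqn).mono (hW₀.trans hle)
      rw [fres_fpull, ha] at h2
      exact isReg_of_mul_right h2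
    · simp only [h1]
      simp [Pi.single_apply, coord_self]
  cases k with
  | none =>
    have h1 : fpull _ hle t = fpull _ hle t *
        fpull f₀ le_rfl (coord q₀ (frameBasis s t ω) none none) := by
      rw [coord_self, map_one, mul_one]
    exact ⟨_, hle, none, _, hk, (hX.isPrincipal_extension hψ hreg hF hle le_rfl _).2 h1,
      fun _ ↦ hB le_rfl _ h1⟩
  | some k =>
    obtain ⟨W, h, j, c, hx, -, -, hc'⟩ := (isIdealGen_fst_tau hX hY₀ hP hτ hF hV (k := some k)
      (f₀ := f₀) le_rfl hle).exists_isEqn hf₀ hk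
    cases j with
    | none =>
      have h1 := hc' (some ())
      simp only [Option.elim_none, Option.elim_some, fres_fpull] at h1
      exact ⟨W, h.trans hle, some k, _, hx,
        (hX.isPrincipal_extension hψ hreg hF (h.trans hle) h _).1 k rfl h1, nofun⟩
    | some _ =>
      have h1 := hc' none
      simp only [Option.elim_none, Option.elim_some, fres_fpull] at h1
      exact ⟨W, h.trans hle, none, _, hx,
        (hX.isPrincipal_extension hψ hreg hF (h.trans hle) h _).2 h1, fun _ ↦ hB h _ h1⟩

include hX hres hY hσ hY₀ hP hτ hu hreg

theorem LogPair.exists_logMap (hf₀ : IsEffectiveCartier (pullback.fst f₀ τ)) : ∃ f : T ⟶ Y, Agree i p p₀ u f f₀ ∧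
      IsEffectiveCartier (pullback.fst f σ) := by
  have := hX.isClosedImmersion
  have := isClosedImmersion_sigma hX hres hY hσ
  have := hY₀.epi
  have := hY.epi
  obtain ⟨ψ, hψ⟩ := hX.exists_extension (pullbackQuotient q₀ f₀)
  have hcases : ∀ x : T, (∃ (V : X.Opens) (κ : Type) (_ : Fintype κ)
      (e : κ → Γ(differentials s, V)) (k : κ), V ≤ complement i ∧
        IsBasisOn (differentials s) V e ∧ x ∈ f₀ ⁻¹ᵁ chart q₀ e k) ∨
      ∃ (V : X.Opens) (κ : Type) (_ : Fintype κ) (t : Γ(X, V)) (ω : κ → Γ(differentials s, V))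
        (e : Option κ → Γ(logDifferentials s i, V)) (k : Option κ), IsAffineOpen V ∧
          LogFrame s i V t ω e ∧ x ∈ f₀ ⁻¹ᵁ chart q₀ (frameBasis s t ω) k := by
    intro x
    by_cases hx : p₀ (f₀ x) ∈ complement i
    · obtain ⟨V, κ, _, e, hxV, hVc, hV, he⟩ := hX.exists_basis _ hx
      obtain ⟨k, hk⟩ := exists_mem_chart (q := q₀) hY₀.isInvertible he (y := f₀ x) hxV
      exact Or.inl ⟨V, κ, _, e, k, hVc, he, hk⟩
    · rw [mem_complement, not_not] at hx
      obtain ⟨z, hz⟩ := hx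
      obtain ⟨V, κ, _, t, ω, e, hzV, hV, hF⟩ := hX.exists_frame z
      obtain ⟨k, hk⟩ := exists_mem_chart (q := q₀) hY₀.isInvertible hF.isBasisOn (y := f₀ x)
        (show p₀ (f₀ x) ∈ V from hz ▸ hzV)
      exact Or.inr ⟨V, κ, _, t, ω, e, k, hV, hF, hk⟩
  obtain ⟨hinv, hepi⟩ := isInvertible_range (ψ := ψ) fun x ↦ by
    rcases hcases x with ⟨V, κ, _, e, k, hVc, he, hk⟩ | ⟨V, κ, _, t, ω, e, k, hV, hF, hk⟩
    · exact ⟨V, κ, _, _, k, _, _, _, hk, isPrincipal_complement hψ hVc he k⟩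
    · obtain ⟨W, h, j, a, hxW, hp, -⟩ := hX.exists_isPrincipal hY₀ hP hτ hψ hreg hf₀ hV hF hk
      exact ⟨V, _, _, e, j, W, h, a, hxW, hp⟩
  obtain ⟨f, hf, -⟩ := hY.existsUnique T _ _ (toRange ψ) hinv hepi
  refine ⟨f, agree_of_coord hY hY₀ hu hf.1 fun x hx ↦ ?_, isEffectiveCartier_of_isEqn ?_⟩
  · have hx' : p₀ (f₀ x) ∈ complement i := by
      have h1 : p (f x) = p₀ (f₀ x) := congrArg (fun m ↦ m x) hf.1
      exact h1 ▸ hx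
    obtain ⟨V, κ, _, e, hxV, hVc, hV, he⟩ := hX.exists_basis _ hx'
    obtain ⟨k, hk⟩ := exists_mem_chart (q := q₀) hY₀.isInvertible he (y := f₀ x) hxV
    have hp := isPrincipal_complement hψ hVc he k
    obtain ⟨hle, hl⟩ := hp.exists_coord hY.isInvertible hf
    exact ⟨V, κ, _, e, k, f₀ ⁻¹ᵁ chart q₀ e k, hle, le_rfl, hVc, he, hk, fun l ↦ (hl l).symm⟩
  · intro x
    rcases hcases x with ⟨V, κ, _, e, k, hVc, he, hk⟩ | ⟨V, κ, _, t, ω, e, k, hV, hF, hk⟩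
    · refine ⟨f ⁻¹ᵁ p ⁻¹ᵁ complement i, 1, ?_, isEqn_one (fst_preimage_eq_bot
        (preimage_preimage_complement (hσ.1.trans (Category.id_comp i).symm)) f le_rfl)⟩
      have h1 : p (f x) = p₀ (f₀ x) := congrArg (fun m ↦ m x) hf.1
      exact (show p (f x) ∈ complement i from h1 ▸ hVc (chart_le q₀ e k hk))
    · obtain ⟨W, h, j, a, hxW, hp, hj⟩ := hX.exists_isPrincipal hY₀ hP hτ hψ hreg hf₀ hV hF hk
      obtain ⟨hle, hcoord⟩ := hp.exists_coord hY.isInvertible hf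
      cases j with
      | some l =>
        exact ⟨W, 1, hxW, isEqn_one (fst_preimage_eq_bot
          (sigma_preimage_some hres hY hσ hF l) f hle)⟩
      | none =>
        obtain ⟨ε, d, d', hε, hd, hd'⟩ := hj rfl
        have h1 : ∀ o, fpull f hle (sigmaGen q t e o) =
            o.elim (fpull _ h t) (fun l ↦ a (some l)) := by
          rintro (_ | l)
          · exact (fpull_comp _ _ _ _ _).trans (fpull_congr hf.1 _ _)
          · exact hcoord (some l)
        refine ⟨W, ε, hxW, IsIdealGen.isEqn (IsIdealGen.single
          (((isIdealGen_sigma hX hres hY hσ hF hV).pullback f).mono hle) (c := d) (d := d')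
          (fun o ↦ ?_) ?_) hε⟩
        · rw [fres_fpull]
          exact (h1 o).trans (hd o)
        · simp only [fres_fpull]
          exact (Finset.sum_congr rfl fun o _ ↦ congrArg _ (h1 o)).trans hd'

end lift

/-! ### The isomorphism of the two blowings-up -/

section lift

variable {X D Y Y₀ T P : Scheme.{u}} {R : CommRingCat.{u}} {s : X ⟶ Spec R} {i : D ⟶ X}
  {V : X.Opens} {κ : Type} [Fintype κ] {t : Γ(X, V)}
  {ω : κ → Γ(differentials s, V)} {e : Option κ → Γ(logDifferentials s i, V)}
  {p : Y ⟶ X} {L : Y.Modules} {q : (Scheme.Modules.pullback p).obj (logDifferentials s i) ⟶ L}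
  {p₀ : Y₀ ⟶ X} {L₀ : Y₀.Modules} {q₀ : (Scheme.Modules.pullback p₀).obj (differentials s) ⟶ L₀}
  {f : T ⟶ Y} {f₀ : T ⟶ Y₀} {W : T.Opens}
  {θ : (Scheme.Modules.pullback f₀).obj L₀ ⟶ (Scheme.Modules.pullback f).obj L}
  {ψ : (Scheme.Modules.pullback (f₀ ≫ p₀)).obj (logDifferentials s i) ⟶
    awayFrom ((Scheme.Modules.pullback f₀).obj L₀) ((f₀ ≫ p₀) ⁻¹ᵁ complement i)}
  {res : logDifferentials s i ⟶ (Scheme.Modules.pushforward i).obj (structureSheaf D)}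
  {σ : D ⟶ Y} {pD : P ⟶ D} {LD : P.Modules}
  {qD : (Scheme.Modules.pullback pD).obj (differentials (i ≫ s)) ⟶ LD} {τ : P ⟶ Y₀}
  {u : (p ⁻¹ᵁ complement i).toScheme ⟶ Y₀}
  (hX : LogPair s i) (hres : IsFrameResidue s i res)
  (hY : IsProjectiveBundle (logDifferentials s i) p q)
  (hσ : Classifies q σ (restrictToDivisor i res))
  (hY₀ : IsProjectiveBundle (differentials s) p₀ q₀)
  (hP : IsProjectiveBundle (differentials (i ≫ s)) pD qD) (hτ : Classifies q₀ τ (tauQuotient i qD))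
  (hu : Classifies q₀ u (birQuotient s i q))

theorem isRegOver_bundle {F : X.Modules} {Q : Scheme.{u}} {c : Q ⟶ X} {M : Q.Modules}
    {r : (Scheme.Modules.pullback c).obj F ⟶ M} (hQ : IsProjectiveBundle F c r)
    (H : ∀ x : X, ∃ (V : X.Opens) (κ : Type) (_ : Fintype κ) (e : κ → Γ(F, V)), x ∈ V ∧
      IsBasisOn F V e) : IsRegOver i c := by
  have := hQ.epi
  refine fun V t ht ↦ IsReg.of_cover fun y hy ↦ ?_
  obtain ⟨V', κ, _, e, hyV', he⟩ := H (c y)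
  obtain ⟨A, hA, hyA, hAV⟩ := exists_isAffineOpen_mem_and_subset (U := V ⊓ V') ⟨hy, hyV'⟩
  have hA' : IsAffineOpen A := hA
  have he' := he.mono (show A ≤ V' from hAV.trans inf_le_right)
  obtain ⟨k, hk⟩ := exists_mem_chart (q := r) hQ.isInvertible he' (y := y) hyA
  have h1 := isReg_fpull_chart hQ he' hA'
    (ht.mono (show A ≤ V from hAV.trans inf_le_left)).isReg.mem_nonZeroDivisors k
  rw [fpull_fres] at h1
  exact ⟨_, (chart_le r _ k).trans (c.preimage_mono (hAV.trans inf_le_left)), hk, by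
    rw [fres_fpull]; exact h1⟩

theorem IsRegOver.blowup {B Q Z : Scheme.{u}} {c : Q ⟶ X} {z : Z ⟶ Q} {π : B ⟶ Q}
    [IsClosedImmersion z] (hc : IsRegOver i c) (hπ : IsBlowup z π) : IsRegOver i (π ≫ c) :=
  fun V t ht ↦ by
    have h1 := hπ.isReg_fpull (hc V t ht)
    rwa [fpull_comp] at h1

include hX

theorem LogPair.exists_bases (x : X) : ∃ (V : X.Opens) (κ κ' : Type) (_ : Fintype κ)
    (_ : Fintype κ') (e : κ → Γ(differentials s, V)) (e' : κ' → Γ(logDifferentials s i, V)),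
      x ∈ V ∧ IsBasisOn (differentials s) V e ∧ IsBasisOn (logDifferentials s i) V e' := by
  obtain ⟨V, -, κ, κ', _, _, e, e', hx, he, he', -⟩ := hX.exists_regular (c := 𝟙 X)
    (fun V t ht ↦ by
      have h1 : fpull (𝟙 X) (le_refl (𝟙 X ⁻¹ᵁ V)) t = t := by
        rw [← app_eq_fpull, Scheme.Hom.id_app]
        rfl
      rw [h1]
      exact ht.isReg) x
  exact ⟨V, κ, κ', _, _, e, e', hx, he, he'⟩

include hY in
theorem LogPair.isRegOver_log : IsRegOver i p := isRegOver_bundle hY fun x ↦ by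
  obtain ⟨V, -, κ', -, _, -, e', hx, -, he'⟩ := hX.exists_bases x
  exact ⟨V, κ', _, e', hx, he'⟩

include hY₀ in
theorem LogPair.isRegOver : IsRegOver i p₀ := isRegOver_bundle hY₀ fun x ↦ by
  obtain ⟨V, κ, -, _, -, e, -, hx, he, -⟩ := hX.exists_bases x
  exact ⟨V, κ, _, e, hx, he⟩

include hres hY hσ hY₀ hP hτ hu

theorem LogPair.exists_blowup_iso {B B₀ : Scheme.{u}} {π : B ⟶ Y} {π₀ : B₀ ⟶ Y₀}
    (hπ : IsBlowup σ π) (hπ₀ : IsBlowup τ π₀) : ∃ (Φ : B ≅ B₀)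
      (θ : (Scheme.Modules.pullback (Φ.hom ≫ π₀)).obj L₀ ⟶ (Scheme.Modules.pullback π).obj L)
      (θ' : (Scheme.Modules.pullback π₀).obj L₀ ⟶ (Scheme.Modules.pullback (Φ.inv ≫ π)).obj L),
      IsFormsMap s i q q₀ π (Φ.hom ≫ π₀) θ ∧ IsFormsMap s i q q₀ (Φ.inv ≫ π) π₀ θ' ∧
        IsBlowup σ (Φ.inv ≫ π) := by
  have := isClosedImmersion_sigma hX hres hY hσ
  have := isClosedImmersion_tau hX hY₀ hP hτ
  have hreg := (hX.isRegOver_log hY).blowup hπ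
  have hreg₀ := (hX.isRegOver hY₀).blowup hπ₀
  obtain ⟨f₀, θ, hθ⟩ := hX.exists_formsMap hres hY hσ hY₀ hπ.isEffectiveCartier
  have hC : IsEffectiveCartier (pullback.fst f₀ τ) := isEffectiveCartier_of_isEqn fun x ↦ by
    obtain ⟨W, -, ε₀, hx, -, h⟩ := hθ.exists_isEqn hX hres hY hσ hY₀ hP hτ hreg x
    exact ⟨W, ε₀, hx, h⟩
  have hag := hθ.agree hX hY hY₀ hu
  obtain ⟨a, rfl, -⟩ := hπ₀.existsUnique B f₀ hC
  obtain ⟨f, hag', hfC⟩ := hX.exists_logMap hres hY hσ hY₀ hP hτ hu hreg₀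
    hπ₀.isEffectiveCartier
  obtain ⟨b, rfl, -⟩ := hπ.existsUnique B₀ f hfC
  have h1 : π = a ≫ b ≫ π := hag.left_unique hY hY₀ hu hX (hag'.precomp a) hreg
  have h2 : π₀ = b ≫ a ≫ π₀ := hag'.right_unique hY₀ hX (hag.precomp b) hreg₀
  obtain ⟨f₀', θ', hθ'⟩ := hX.exists_formsMap hres hY hσ hY₀ hfC
  obtain rfl : π₀ = f₀' := hag'.right_unique hY₀ hX (hθ'.agree hX hY hY₀ hu) hreg₀
  have hab : a ≫ b = 𝟙 B := hπ.hom_ext (by rw [Category.assoc, ← h1, Category.id_comp])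
    (by rw [Category.assoc, ← h1]; exact hπ.isEffectiveCartier)
  have hba : b ≫ a = 𝟙 B₀ := hπ₀.hom_ext (by rw [Category.assoc, ← h2, Category.id_comp])
    (by rw [Category.assoc, ← h2]; exact hπ₀.isEffectiveCartier)
  refine ⟨⟨a, b, hab, hba⟩, θ, θ', hθ, hθ', hfC, fun T f hf ↦ ?_⟩
  obtain ⟨g, rfl, hg⟩ := hπ.existsUnique T f hf
  refine ⟨g ≫ a, ?_, fun g' h ↦ ?_⟩
  · change (g ≫ a) ≫ b ≫ π = g ≫ π
    rw [Category.assoc, reassoc_of% hab]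
  · rw [← hg (g' ≫ b) ((Category.assoc _ _ _).trans h), Category.assoc, hba, Category.comp_id]

end lift

/-! ### The coordinate rings of the blowing-up -/

section model

open Polynomial

variable {S : Type u} [CommRing S] (b t : S)

/-- The ring `S[ε] / (b ε - t)`. -/
abbrev BlowupRing : Type u := AdjoinRoot (C b * X - C t : S[X])

variable {b t}

theorem BlowupRing.mk_eq_zero {P : S[X]} :
    AdjoinRoot.mk (C b * X - C t) P = 0 ↔ ∃ Q, P = (C b * X - C t) * Q := AdjoinRoot.mk_eq_zero

theorem BlowupRing.relation :
    AdjoinRoot.of (C b * X - C t) b * AdjoinRoot.root _ = AdjoinRoot.of _ t := by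
  rw [← sub_eq_zero, ← AdjoinRoot.mk_X, ← AdjoinRoot.mk_C, ← AdjoinRoot.mk_C, ← map_mul, ← map_sub]
  exact AdjoinRoot.mk_self

theorem eq_of_X_mul {P Q : S[X]} (h : X * P = X * Q) : P = Q := isRegular_X.left h

theorem BlowupRing.root_mem_nonZeroDivisors (ht : t ∈ nonZeroDivisors S) :
    AdjoinRoot.root (C b * X - C t) ∈ nonZeroDivisors (BlowupRing b t) := by
  refine mem_nonZeroDivisors_iff_right.mpr fun a ha ↦ ?_
  obtain ⟨P, rfl⟩ := AdjoinRoot.mk_surjective a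
  rw [← AdjoinRoot.mk_X, ← map_mul, BlowupRing.mk_eq_zero] at ha
  obtain ⟨Q, hQ⟩ := ha
  have h0 := congrArg (coeff · 0) hQ
  simp only [mul_coeff_zero, coeff_X_zero, mul_zero, coeff_sub, coeff_C_zero, zero_sub, neg_mul,
    zero_eq_neg] at h0
  have h1 : Q.coeff 0 = 0 := mem_nonZeroDivisors_iff_right.mp ht _ (by rwa [mul_comm])
  rw [← divX_mul_X_add Q, h1] at hQ
  exact BlowupRing.mk_eq_zero.mpr ⟨Q.divX, eq_of_X_mul (by linear_combination hQ + (C b * X - C t) * (C_0 (R := S)))⟩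

theorem BlowupRing.of_eq_root_mul {x : S} {a : BlowupRing b t}
    (h : AdjoinRoot.of _ x = AdjoinRoot.root _ * a) : ∃ y, x = t * y := by
  obtain ⟨P, rfl⟩ := AdjoinRoot.mk_surjective a
  rw [← sub_eq_zero, ← AdjoinRoot.mk_X, ← AdjoinRoot.mk_C, ← map_mul, ← map_sub,
    BlowupRing.mk_eq_zero] at h
  obtain ⟨Q, hQ⟩ := h
  have h0 := congrArg (coeff · 0) hQ
  simp only [mul_coeff_zero, coeff_X_zero, mul_zero, coeff_sub, coeff_C_zero, zero_sub, zero_mul,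
    sub_zero] at h0
  exact ⟨-Q.coeff 0, by rw [h0]; ring⟩

theorem BlowupRing.exists_of_add (a : BlowupRing b t) :
    ∃ x a', a = AdjoinRoot.of _ x + AdjoinRoot.root _ * a' := by
  obtain ⟨P, rfl⟩ := AdjoinRoot.mk_surjective a
  refine ⟨P.coeff 0, AdjoinRoot.mk _ P.divX, ?_⟩
  rw [← AdjoinRoot.mk_X, ← AdjoinRoot.mk_C, ← map_mul, ← map_add]
  congr 1
  linear_combination -(divX_mul_X_add P)

theorem BlowupRing.exists_of_root_mul {a a' : BlowupRing b t}
    (h : AdjoinRoot.root _ * a = AdjoinRoot.of _ b * a') : ∃ c, a = AdjoinRoot.of _ b * c := by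
  obtain ⟨P, rfl⟩ := AdjoinRoot.mk_surjective a
  obtain ⟨P', rfl⟩ := AdjoinRoot.mk_surjective a'
  rw [← sub_eq_zero, ← AdjoinRoot.mk_X, ← AdjoinRoot.mk_C, ← map_mul, ← map_mul, ← map_sub,
    BlowupRing.mk_eq_zero] at h
  obtain ⟨Q, hQ⟩ := h
  have h0 := congrArg (coeff · 0) hQ
  simp only [mul_coeff_zero, coeff_X_zero, mul_zero, coeff_sub, coeff_C_zero, zero_sub, zero_mul]
    at h0
  have h1 : (C b * C (P'.coeff 0) : S[X]) = C t * C (Q.coeff 0) := by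
    rw [← C_mul, ← C_mul]
    exact congrArg C (by linear_combination -h0)
  refine ⟨AdjoinRoot.mk _ (P'.divX + C (Q.coeff 0)), ?_⟩
  rw [← sub_eq_zero, ← AdjoinRoot.mk_C, ← map_mul, ← map_sub, BlowupRing.mk_eq_zero]
  refine ⟨Q.divX, eq_of_X_mul ?_⟩
  rw [← divX_mul_X_add Q, ← divX_mul_X_add P'] at hQ
  simp only [divX_mul_X_add] at hQ h1
  have h2 := divX_mul_X_add P'
  have h3 := divX_mul_X_add Q
  linear_combination hQ + h1 - C b * h2 - (C b * X - C t) * h3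

end model

/-! ### Charts of the blowing-up -/

section blowupChart

variable {X D Y Y₀ T P : Scheme.{u}} {R : CommRingCat.{u}} {s : X ⟶ Spec R} {i : D ⟶ X}
  {V : X.Opens} {κ : Type} [Fintype κ] {t : Γ(X, V)}
  {ω : κ → Γ(differentials s, V)} {e : Option κ → Γ(logDifferentials s i, V)}
  {p : Y ⟶ X} {L : Y.Modules} {q : (Scheme.Modules.pullback p).obj (logDifferentials s i) ⟶ L}
  {p₀ : Y₀ ⟶ X} {L₀ : Y₀.Modules} {q₀ : (Scheme.Modules.pullback p₀).obj (differentials s) ⟶ L₀}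
  {f : T ⟶ Y} {f₀ : T ⟶ Y₀} {W : T.Opens}
  {θ : (Scheme.Modules.pullback f₀).obj L₀ ⟶ (Scheme.Modules.pullback f).obj L}
  {res : logDifferentials s i ⟶ (Scheme.Modules.pushforward i).obj (structureSheaf D)}
  {σ : D ⟶ Y} {pD : P ⟶ D} {LD : P.Modules}
  {qD : (Scheme.Modules.pullback pD).obj (differentials (i ≫ s)) ⟶ LD} {τ : P ⟶ Y₀}
  {u : (p ⁻¹ᵁ complement i).toScheme ⟶ Y₀}
  (hX : LogPair s i) (hres : IsFrameResidue s i res)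
  (hY : IsProjectiveBundle (logDifferentials s i) p q)
  (hσ : Classifies q σ (restrictToDivisor i res))
  (hY₀ : IsProjectiveBundle (differentials s) p₀ q₀)
  (hP : IsProjectiveBundle (differentials (i ≫ s)) pD qD) (hτ : Classifies q₀ τ (tauQuotient i qD))
  (hu : Classifies q₀ u (birQuotient s i q))


theorem isEffectiveCartier_of_coords (hX : LogPair s i) (hres : IsFrameResidue s i res)
    (hY : IsProjectiveBundle (logDifferentials s i) p q)
    (hσ : Classifies q σ (restrictToDivisor i res)) (hF : LogFrame s i V t ω e)
    (hV : IsAffineOpen V) (hf : ⊤ ≤ f ⁻¹ᵁ chart q e none) {k : Option κ} {ε : Γ(T, ⊤)}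
    {z : Option κ → Γ(T, ⊤)} (hε : IsReg ε) (hk : z k = 1)
    (hz : ∀ o, fpull f hf (sigmaGen q t e o) = z o * ε) :
    IsEffectiveCartier (pullback.fst f σ) := by
  classical
  have := isClosedImmersion_sigma hX hres hY hσ
  refine isEffectiveCartier_of_isEqn fun x ↦ ⟨⊤, ε, trivial, IsIdealGen.isEqn (IsIdealGen.single
    (((isIdealGen_sigma hX hres hY hσ hF hV).pullback f).mono hf) (c := z) (d := Pi.single k 1)
    (fun o ↦ ?_) ?_) hε⟩
  · rw [fres_fpull]
    exact hz o
  · simp only [fres_fpull]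
    rw [Finset.sum_eq_single k (fun o _ ho ↦ by rw [Pi.single_eq_of_ne ho, zero_mul]) (by simp),
      Pi.single_eq_same, one_mul]
    exact (hz k).trans (by rw [hk, one_mul])

variable (hθ : IsFormsMap s i q q₀ f f₀ θ)

include hθ

theorem IsFormsMap.preimage_chart (hY₀ : IsProjectiveBundle (differentials s) p₀ q₀)
    (hF : LogFrame s i V t ω e) {S : Scheme.{u}} {g : S ⟶ T}
    (hg : ⊤ ≤ (g ≫ f) ⁻¹ᵁ chart q e none) {k : Option κ} {ε : Γ(S, ⊤)}
    {z : Option κ → Γ(S, ⊤)} (hε : IsReg ε) (hk : z k = 1)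
    (hz : ∀ o, fpull (g ≫ f) hg (sigmaGen q t e o) = z o * ε) :
    ∃ h : ⊤ ≤ (g ≫ f₀) ⁻¹ᵁ chart q₀ (frameBasis s t ω) k,
      ∀ o, fpull (g ≫ f₀) h (coord q₀ (frameBasis s t ω) k o) = z o := by
  have := hY₀.epi
  have key : ∀ (k' : Option κ) (W : S.Opens)
      (h : W ≤ (g ≫ f₀) ⁻¹ᵁ chart q₀ (frameBasis s t ω) k') (o : Option κ),
      fres le_top (z o) * fres le_top ε = fpull (g ≫ f₀) h (coord q₀ (frameBasis s t ω) k' o) *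
        (fres le_top (z k') * fres le_top ε) := fun k' W h o ↦ by
    have hle : W ≤ g ⁻¹ᵁ (f ⁻¹ᵁ chart q e none ⊓ f₀ ⁻¹ᵁ chart q₀ (frameBasis s t ω) k') :=
      le_inf (le_top.trans hg) h
    have h1 := congrArg (fpull g hle) (hθ.logCoord_eq hF inf_le_left inf_le_right o)
    rw [logCoord_none, logCoord_none, map_mul, fpull_comp, fpull_comp, fpull_comp] at h1
    have h2 := fun o ↦ congrArg (fres (le_top : W ≤ ⊤)) (hz o)
    simp only [fres_fpull, map_mul] at h2
    rw [← h2, ← h2]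
    exact h1
  have hle : ⊤ ≤ (g ≫ f₀) ⁻¹ᵁ chart q₀ (frameBasis s t ω) k := fun x _ ↦ by
    have hx : f₀ (g x) ∈ p₀ ⁻¹ᵁ V := by
      have h1 : p (f (g x)) = p₀ (f₀ (g x)) := congrArg (fun m ↦ m (g x)) hθ.comm
      exact (show p₀ (f₀ (g x)) ∈ V from h1 ▸ chart_le q e none (hg trivial))
    obtain ⟨k', hk'⟩ := exists_mem_chart (q := q₀) hY₀.isInvertible hF.isBasisOn hx
    have h1 := key k' ((g ≫ f₀) ⁻¹ᵁ chart q₀ (frameBasis s t ω) k') le_rfl k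
    rw [hk, map_one, one_mul, ← mul_assoc] at h1
    have h2 := (hε.mono le_top).cancel ((mul_one _).trans (h1.trans (mul_comm _ _)))
    have h3 := le_basicOpen_of_isUnit (le_refl ((g ≫ f₀) ⁻¹ᵁ chart q₀ (frameBasis s t ω) k'))
      (a := fpull (g ≫ f₀) le_rfl (coord q₀ (frameBasis s t ω) k' k))
      (by rw [fres_self]; exact IsUnit.of_mul_eq_one _ h2.symm)
    rw [basicOpen_fpull] at h3
    exact basicOpen_coord_le k' (h3 hk').2
  refine ⟨hle, fun o ↦ ?_⟩
  have h1 := key k ⊤ hle o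
  rw [fres_self, fres_self, fres_self, hk, one_mul, mul_comm, mul_comm _ ε] at h1
  exact (hε.cancel h1).symm

variable (hX : LogPair s i) (hres : IsFrameResidue s i res)
  (hY : IsProjectiveBundle (logDifferentials s i) p q)
  (hσ : Classifies q σ (restrictToDivisor i res))
  (hY₀ : IsProjectiveBundle (differentials s) p₀ q₀)
  (hreg : IsRegOver i (f ≫ p)) (hF : LogFrame s i V t ω e) (hV : IsAffineOpen V)

variable (q q₀ f f₀ e) in
/-- The chart of the blowing-up over a chart of the projective bundle of differentials. -/
abbrev blowupChart (t : Γ(X, V)) (ω : κ → Γ(differentials s, V)) (k : Option κ) : T.Opens :=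
  f ⁻¹ᵁ chart q e none ⊓ f₀ ⁻¹ᵁ chart q₀ (frameBasis s t ω) k

include hF

theorem IsFormsMap.sigmaGen_eq (k o : Option κ) :
    fpull f (inf_le_left : blowupChart e q q₀ f f₀ t ω k ≤ _) (sigmaGen q t e o) =
      fpull f₀ inf_le_right (coord q₀ (frameBasis s t ω) k o) *
        fpull f inf_le_left (sigmaGen q t e k) := by
  rw [← logCoord_none, ← logCoord_none]
  exact hθ.logCoord_eq hF inf_le_left inf_le_right o

theorem IsFormsMap.fpull_chart (k : Option κ) :
    fpull f₀ (inf_le_right : blowupChart e q q₀ f f₀ t ω k ≤ _)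
      (fpull p₀ (chart_le q₀ (frameBasis s t ω) k) t) =
      fpull f₀ inf_le_right (coord q₀ (frameBasis s t ω) k none) *
        fpull f inf_le_left (sigmaGen q t e k) := by
  rw [← hθ.sigmaGen_eq hF k none]
  refine (fpull_comp _ _ _ _ _).trans ((fpull_congr hθ.comm.symm _ _).trans ?_)
  exact (fpull_comp f p _ _ t).symm

/-- The map from the coordinate ring of the model to the functions on the blowing-up. -/
def IsFormsMap.chartHom (k : Option κ) :
    BlowupRing (coord q₀ (frameBasis s t ω) k none)
      (fpull p₀ (chart_le q₀ (frameBasis s t ω) k) t) →+* Γ(T, blowupChart e q q₀ f f₀ t ω k) :=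
  AdjoinRoot.lift (fpull f₀ inf_le_right) (fpull f inf_le_left (sigmaGen q t e k)) (by
    rw [Polynomial.eval₂_sub, Polynomial.eval₂_mul, Polynomial.eval₂_C, Polynomial.eval₂_C,
      Polynomial.eval₂_X, sub_eq_zero]
    exact (hθ.fpull_chart hF k).symm)

theorem IsFormsMap.chartHom_of (k : Option κ) (a) :
    hθ.chartHom hF k (AdjoinRoot.of _ a) = fpull f₀ inf_le_right a := AdjoinRoot.lift_of _

theorem IsFormsMap.chartHom_root (k : Option κ) :
    hθ.chartHom hF k (AdjoinRoot.root _) = fpull f inf_le_left (sigmaGen q t e k) :=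
  AdjoinRoot.lift_root _

end blowupChart

theorem isReg_specFun {A : Type u} [CommRing A] {a : A} (ha : a ∈ nonZeroDivisors A) :
    IsReg (specFun A a) := by
  refine isReg_of_isAffineOpen (isAffineOpen_top _)
    (mem_nonZeroDivisors_iff_right.mpr fun c hc ↦ ?_)
  obtain ⟨b, rfl⟩ := (specFun_bijective A).2 c
  rw [← map_mul, ← map_zero (specFun A)] at hc
  rw [mem_nonZeroDivisors_iff_right.mp ha b ((specFun_bijective A).1 hc), map_zero]

theorem _root_.AlgebraicGeometry.IsAffineOpen.exists_hom {X T : Scheme.{u}} {U : X.Opens}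
    (hU : IsAffineOpen U) (φ : Γ(X, U) →+* Γ(T, ⊤)) :
    ∃ (h : T ⟶ X) (hh : ⊤ ≤ h ⁻¹ᵁ U), ∀ a, fpull h hh a = φ a := by
  have h0 : ⊤ ≤ hU.fromSpec ⁻¹ᵁ U := hU.fromSpec_preimage_self.ge
  refine ⟨toSpec φ ≫ hU.fromSpec, fun x _ ↦ h0 (x := toSpec φ x) trivial, fun a ↦ ?_⟩
  refine (fpull_comp (toSpec φ) hU.fromSpec h0 (top_le_preimage_top _) a).symm.trans ?_
  rw [fpull_fromSpec, fpull_toSpec]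

section blowupChart

variable {X D Y Y₀ T P : Scheme.{u}} {R : CommRingCat.{u}} {s : X ⟶ Spec R} {i : D ⟶ X}
  {V : X.Opens} {κ : Type} [Fintype κ] {t : Γ(X, V)}
  {ω : κ → Γ(differentials s, V)} {e : Option κ → Γ(logDifferentials s i, V)}
  {p : Y ⟶ X} {L : Y.Modules} {q : (Scheme.Modules.pullback p).obj (logDifferentials s i) ⟶ L}
  {p₀ : Y₀ ⟶ X} {L₀ : Y₀.Modules} {q₀ : (Scheme.Modules.pullback p₀).obj (differentials s) ⟶ L₀}
  {f : T ⟶ Y} {f₀ : T ⟶ Y₀} {W : T.Opens}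
  {θ : (Scheme.Modules.pullback f₀).obj L₀ ⟶ (Scheme.Modules.pullback f).obj L}
  {res : logDifferentials s i ⟶ (Scheme.Modules.pushforward i).obj (structureSheaf D)}
  {σ : D ⟶ Y} {pD : P ⟶ D} {LD : P.Modules}
  {qD : (Scheme.Modules.pullback pD).obj (differentials (i ≫ s)) ⟶ LD} {τ : P ⟶ Y₀}
  {u : (p ⁻¹ᵁ complement i).toScheme ⟶ Y₀}
  (hX : LogPair s i) (hres : IsFrameResidue s i res)
  (hY : IsProjectiveBundle (logDifferentials s i) p q)
  (hσ : Classifies q σ (restrictToDivisor i res))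
  (hY₀ : IsProjectiveBundle (differentials s) p₀ q₀)
  (hP : IsProjectiveBundle (differentials (i ≫ s)) pD qD) (hτ : Classifies q₀ τ (tauQuotient i qD))
  (hu : Classifies q₀ u (birQuotient s i q))

variable (hθ : IsFormsMap s i q q₀ f f₀ θ) (hX : LogPair s i) (hres : IsFrameResidue s i res)
  (hY : IsProjectiveBundle (logDifferentials s i) p q)
  (hσ : Classifies q σ (restrictToDivisor i res))
  (hY₀ : IsProjectiveBundle (differentials s) p₀ q₀)
  (hF : LogFrame s i V t ω e) (hV : IsAffineOpen V)

variable {A : Type u} [CommRing A] {k : Option κ}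
  {of' : Γ(Y₀, chart q₀ (frameBasis s t ω) k) →+* A} {ε : A}
  {φ : A →+* Γ(T, blowupChart e q q₀ f f₀ t ω k)}

include hθ hX hres hY hσ hY₀ hF hV

theorem IsFormsMap.isAffineOpen_of_model (hf : IsBlowup σ f) (hε' : ε ∈ nonZeroDivisors A)
    (hrel : of' (coord q₀ (frameBasis s t ω) k none) * ε = of' (fpull p₀ (chart_le q₀ _ k) t))
    (hof : ∀ a, φ (of' a) = fpull f₀ inf_le_right a)
    (hroot : φ ε = fpull f inf_le_left (sigmaGen q t e k))
    (hext : ∀ {S : Type u} [CommRing S] (ψ ψ' : A →+* S), (∀ a, ψ (of' a) = ψ' (of' a)) →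
      ψ ε = ψ' ε → ψ = ψ') :
    IsAffineOpen (blowupChart e q q₀ f f₀ t ω k) ∧ Function.Bijective φ := by
  have := isClosedImmersion_sigma hX hres hY hσ
  have hU := chart_isAffineOpen hY₀ hF.isBasisOn hV k
  let U := blowupChart e q q₀ f f₀ t ω k
  let z : Option κ → A := fun o ↦ of' (coord q₀ (frameBasis s t ω) k o)
  have hzk : z k = 1 := by simp only [z, coord_self, map_one]
  have hzn : z none * ε = of' (fpull p₀ (chart_le q₀ (frameBasis s t ω) k) t) := hrel
  obtain ⟨h₀, hh₀, hfun⟩ := hU.exists_hom ((specFun A).comp of')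
  have hbase : ⊤ ≤ (h₀ ≫ p₀) ⁻¹ᵁ V := hh₀.trans (h₀.preimage_mono (chart_le q₀ _ k))
  obtain ⟨h, hhp, hh, hcoord⟩ := hY.exists_lift (j := none) hF.isBasisOn_log hbase
    (fun o ↦ o.elim 1 fun l ↦ specFun A (z (some l) * ε)) rfl
  have hgen : ∀ o, fpull h hh (sigmaGen q t e o) = specFun A (z o) * specFun A ε := by
    rintro (_ | l)
    · rw [← map_mul, hzn]
      refine (fpull_comp h p _ _ t).trans ((fpull_congr hhp _ t).trans ?_)
      exact (fpull_comp h₀ p₀ _ hh₀ t).symm.trans (hfun _)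
    · exact (hcoord (some l)).trans (map_mul _ _ _)
  have hε : IsReg (specFun A ε) := isReg_specFun hε'
  obtain ⟨g, hg, -⟩ := hf.existsUnique _ h (isEffectiveCartier_of_coords hX hres hY hσ hF hV hh hε
    (k := k) (z := fun o ↦ specFun A (z o)) (by rw [hzk, map_one]) hgen)
  subst hg
  obtain ⟨hgf₀, hgc⟩ := hθ.preimage_chart hY₀ hF hh hε (k := k) (z := fun o ↦ specFun A (z o))
    (by rw [hzk, map_one]) hgen
  have hgh : g ≫ f₀ = h₀ := hY₀.lift_ext (j := k) hF.isBasisOn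
    (by rw [Category.assoc, ← hθ.comm, ← Category.assoc, hhp]) hgf₀ hh₀ fun o ↦ by
      rw [hgc, hfun]
      rfl
  have hgU : ⊤ ≤ g ⁻¹ᵁ U := le_inf hh hgf₀
  have hUU : (⊤ : U.toScheme.Opens) ≤ U.ι ⁻¹ᵁ U := by rw [Scheme.Opens.ι_preimage_self]
  have h1 : ∀ a, fpull g hgU (φ a) = specFun A a := fun a ↦ by
    have : (fpull g hgU).comp φ = specFun A := by
      refine hext _ _ (fun a ↦ ?_) ?_
      · refine (congrArg (fpull g hgU) (hof a)).trans ?_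
        exact (fpull_comp g f₀ _ _ a).trans ((fpull_congr hgh _ a).trans (hfun a))
      · refine (congrArg (fpull g hgU) hroot).trans ?_
        refine (fpull_comp g f _ _ _).trans ((hgen k).trans ?_)
        rw [hzk, map_one, one_mul]
    exact RingHom.congr_fun this a
  refine isAffineOpen_of_section φ g hgU h1 (hf.hom_ext ?_ ?_)
  · have e₀ : ⊤ ≤ (U.ι ≫ f₀) ⁻¹ᵁ chart q₀ (frameBasis s t ω) k :=
      hUU.trans (U.ι.preimage_mono inf_le_right)
    have e₁ : ⊤ ≤ (U.ι ≫ f) ⁻¹ᵁ chart q e none := hUU.trans (U.ι.preimage_mono inf_le_left)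
    have e₂ : ⊤ ≤ (toSpec ((openTop U).comp φ) ≫ g ≫ f) ⁻¹ᵁ chart q e none :=
      fun x _ ↦ hh (x := toSpec ((openTop U).comp φ) x) trivial
    have hop : ∀ {X' : Scheme.{u}} (c : T ⟶ X') {V' : X'.Opens} (h' : U ≤ c ⁻¹ᵁ V')
        (e' : ⊤ ≤ (U.ι ≫ c) ⁻¹ᵁ V') (a : Γ(X', V')),
        fpull (U.ι ≫ c) e' a = openTop U (fpull c h' a) := fun c V' h' e' a ↦
      (fpull_comp U.ι c h' hUU a).symm
    have h2 : toSpec ((openTop U).comp φ) ≫ g ≫ f₀ = U.ι ≫ f₀ := by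
      refine affine_ext hU (fun x _ ↦ hgf₀ (x := toSpec ((openTop U).comp φ) x) trivial) e₀
        fun a ↦ ?_
      refine (fpull_comp _ (g ≫ f₀) hgf₀ (top_le_preimage_top _) a).symm.trans ?_
      rw [hop f₀ inf_le_right e₀ a, fpull_congr hgh, hfun]
      refine (fpull_toSpec _ _ _).trans (congrArg (openTop U) (hof a))
    rw [Category.assoc]
    refine hY.lift_ext (j := none) hF.isBasisOn_log ?_ e₂ e₁ fun o ↦ ?_
    · rw [Category.assoc, Category.assoc, Category.assoc, hθ.comm, reassoc_of% h2]
    · rw [hop f inf_le_left e₁]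
      refine (fpull_comp _ (g ≫ f) hh (top_le_preimage_top _) _).symm.trans ?_
      cases o with
      | none => simp only [coord_self, map_one]
      | some l =>
        have h3 := hgen (some l)
        rw [← map_mul] at h3
        refine (congrArg _ h3).trans ((fpull_toSpec _ _ _).trans (congrArg (openTop U) ?_))
        refine Eq.trans ?_ (hθ.sigmaGen_eq hF k (some l)).symm
        refine (map_mul φ _ _).trans (congrArg₂ _ (hof _) hroot)
  · rw [Category.assoc]
    refine isEffectiveCartier_of_coords hX hres hY hσ hF hV (k := k)
      (fun x _ ↦ hh (x := toSpec ((openTop U).comp φ) x) trivial) (ε := openTop U (φ ε))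
      (z := fun o ↦ openTop U (φ (z o))) ?_ (by rw [hzk, map_one, map_one]) fun o ↦ ?_
    · have hreg := ((hX.isRegOver_log hY).blowup hf V t hF.isEqn).mono
        (show U ≤ (f ≫ p) ⁻¹ᵁ V from inf_le_left.trans (f.preimage_mono (chart_le q e none)))
      have h3 : fpull (f ≫ p) (inf_le_left.trans (f.preimage_mono (chart_le q e none))) t =
          fpull f₀ (inf_le_right : U ≤ _) (coord q₀ (frameBasis s t ω) k none) * φ ε := by
        rw [hroot, ← hθ.fpull_chart hF k]
        exact (fpull_congr hθ.comm _ _).trans (fpull_comp _ _ _ _ _).symm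
      rw [fres_fpull, h3, mul_comm] at hreg
      have h4 := ((isReg_of_mul_right hreg).fpull_ι (C := U)).mono hUU
      rwa [fres_fpull] at h4
    · refine (fpull_comp _ (g ≫ f) hh (top_le_preimage_top _) _).symm.trans ?_
      rw [hgen, map_mul]
      exact congrArg₂ _ (fpull_toSpec _ _ _) (fpull_toSpec _ _ _)

omit hθ in
theorem IsFormsMap.isAffineOpen_blowupChart (hθ : IsFormsMap s i q q₀ f f₀ θ)
    (hf : IsBlowup σ f) (k : Option κ) : IsAffineOpen (blowupChart e q q₀ f f₀ t ω k) ∧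
      Function.Bijective (hθ.chartHom hF k) :=
  hθ.isAffineOpen_of_model hX hres hY hσ hY₀ hF hV hf
    (BlowupRing.root_mem_nonZeroDivisors (isReg_fpull_chart hY₀ hF.isBasisOn hV
      hF.isEqn.isReg.mem_nonZeroDivisors k).mem_nonZeroDivisors) BlowupRing.relation
    (hθ.chartHom_of hF k) (hθ.chartHom_root hF k)
    fun ψ ψ' h h' ↦ AdjoinRoot.ringHom_ext (RingHom.ext h) h'

end blowupChart

/-! ### Strict transforms -/

section ker

variable {X D Y T E E₀ F : Scheme.{u}} {z : E ⟶ T} {z₀ : E₀ ⟶ T} {w : F ⟶ T} {W : T.Opens}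
  {ε ε₀ : Γ(T, W)}

theorem isReg_fpull_of_isEqn [IsClosedImmersion z₀] (hW : IsAffineOpen W) (h₀ : IsEqn z₀ W ε₀)
    (h : ∀ a a', ε * a = ε₀ * a' → ∃ c, a = ε₀ * c) :
    IsReg (fpull z₀ (le_refl (z₀ ⁻¹ᵁ W)) ε) := by
  refine isReg_of_isAffineOpen (hW.preimage z₀) (mem_nonZeroDivisors_iff_right.mpr fun c hc ↦ ?_)
  obtain ⟨a, rfl⟩ := Scheme.Hom.app_surjective z₀ W hW c
  rw [app_eq_fpull, mul_comm, ← map_mul] at hc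
  obtain ⟨a', ha'⟩ := h₀.exists_mul W le_rfl _ hc
  rw [fres_self] at ha'
  obtain ⟨c, rfl⟩ := h a a' ha'
  rw [app_eq_fpull, map_mul, h₀.zero, zero_mul]

theorem ker_le_ker (h : ∀ (U : T.Opens) (a : Γ(T, U)), fpull z (le_refl (z ⁻¹ᵁ U)) a = 0 →
    fpull z₀ (le_refl (z₀ ⁻¹ᵁ U)) a = 0) : z.ker ≤ z₀.ker :=
  Scheme.IdealSheafData.le_ofIdeals_iff.mpr fun U a ha ↦ RingHom.mem_ker.mpr
    ((app_eq_fpull z₀ a).trans (h U.1 a ((app_eq_fpull z a).symm.trans (z.ideal_ker_le U ha))))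

theorem ker_strict [IsClosedImmersion z] (H : ∀ x : T, ∃ (W : T.Opens) (ε ε₀ : Γ(T, W)),
    x ∈ W ∧ IsEqn z W ε ∧ IsEqn z₀ W ε₀ ∧ IsIdealGen w W (fun _ : Unit ↦ ε * ε₀) ∧
      IsReg (fpull z₀ (le_refl (z₀ ⁻¹ᵁ W)) ε)) :
    ((w ⁻¹ᵁ complement z).ι ≫ w).ker = z₀.ker := by
  refine le_antisymm (ker_le_ker fun U a ha ↦ fun_ext fun y hy ↦ ?_)
    (ker_le_ker fun U a ha ↦ ?_)
  · obtain ⟨W, ε, ε₀, hx, hε, hε₀, hw, hr⟩ := H (z₀ y)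
    refine ⟨z₀ ⁻¹ᵁ (U ⊓ W), z₀.preimage_mono inf_le_left, ⟨hy, hx⟩, ?_⟩
    rw [map_zero, fres_fpull]
    have h1 : fpull w (le_refl (w ⁻¹ᵁ (U ⊓ W ⊓ complement z)))
        (fres (inf_le_left.trans inf_le_left) a) = 0 := by
      refine fpull_ι_injective (U := w ⁻¹ᵁ complement z) (w.preimage_mono inf_le_right) ?_
      have h2 := congrArg (fres (Scheme.Hom.preimage_mono ((w ⁻¹ᵁ complement z).ι ≫ w)
        (inf_le_left.trans inf_le_left : U ⊓ W ⊓ complement z ≤ U))) ha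
      rw [map_zero, fres_fpull] at h2
      rw [fpull_fres, fpull_comp, map_zero]
      exact h2
    refine fun_eq_zero_of_isReg hr (z₀.preimage_mono inf_le_right)
      (W' := z₀ ⁻¹ᵁ (U ⊓ W ⊓ complement z)) ?_ (z₀.preimage_mono inf_le_left) ?_
    · rw [basicOpen_fpull, hε.basicOpen_eq]
      exact fun y hy ↦ ⟨hy.1, hy.2.2.2⟩
    · refine fun_ext fun y hy ↦ ?_
      obtain ⟨W', h', c, hy', hc⟩ := hw.exists_sum _ (inf_le_left.trans inf_le_right) _ h1 _ hy
      refine ⟨z₀ ⁻¹ᵁ W', z₀.preimage_mono h', hy', ?_⟩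
      have h3 := congrArg (fpull z₀ (le_refl (z₀ ⁻¹ᵁ W'))) hc
      have h4 := congrArg (fres (z₀.preimage_mono (h'.trans (inf_le_left.trans inf_le_right))))
        hε₀.zero
      rw [map_zero, fres_fpull] at h4
      rw [Fintype.sum_unique (ι := Unit), map_mul, map_mul, map_mul, fpull_fres _ _ _ ε₀, h4,
        mul_zero, mul_zero, fpull_fres, fpull_fres] at h3
      rw [fres_fpull, fres_fpull, map_zero]
      exact h3
  · have h1 : fpull w (le_refl (w ⁻¹ᵁ (U ⊓ complement z))) (fres inf_le_left a) = 0 := by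
      refine fun_ext fun y hy ↦ ?_
      obtain ⟨W, ε, ε₀, hx, hε, hε₀, hw, -⟩ := H (w y)
      have hle : U ⊓ complement z ⊓ W ≤ U := inf_le_left.trans inf_le_left
      refine ⟨w ⁻¹ᵁ (U ⊓ complement z ⊓ W), w.preimage_mono inf_le_left, ⟨hy, hx⟩, ?_⟩
      have h2 := congrArg (fres (z₀.preimage_mono hle)) ha
      rw [map_zero, fres_fpull, ← fpull_fres z₀ hle le_rfl] at h2
      obtain ⟨g, hg⟩ := hε₀.exists_mul _ inf_le_right _ h2
      have hb : U ⊓ complement z ⊓ W ≤ T.basicOpen ε :=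
        (le_inf inf_le_right (inf_le_left.trans inf_le_right)).trans hε.basicOpen_eq.ge
      obtain ⟨v, hv⟩ := ((isUnit_fres_basicOpen ε).map (fres hb)).exists_left_inv
      rw [fres_fres] at hv
      have h3 : fres hle a = fres inf_le_right (ε * ε₀) * (v * g) := by
        rw [hg, map_mul]
        linear_combination (-fres (inf_le_right : U ⊓ complement z ⊓ W ≤ W) ε₀ * g) * hv
      have h4 := congrArg (fres (w.preimage_mono (inf_le_right : U ⊓ complement z ⊓ W ≤ W)))
        (hw.zero ())
      rw [map_zero, fres_fpull] at h4
      rw [fpull_fres, fres_fpull, map_zero,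
        ← fpull_fres w hle (le_refl (w ⁻¹ᵁ (U ⊓ complement z ⊓ W))), h3, map_mul, fpull_fres, h4,
        zero_mul]
    have hle : ((w ⁻¹ᵁ complement z).ι ≫ w) ⁻¹ᵁ U ≤
        (w ⁻¹ᵁ complement z).ι ⁻¹ᵁ w ⁻¹ᵁ (U ⊓ complement z) := fun y hy ↦ ⟨hy, y.2⟩
    have h2 := congrArg (fpull _ hle) h1
    rw [fpull_fres, fpull_comp, map_zero] at h2
    exact h2

theorem IsEqn.isIdealGen {i : D ⟶ X} {V : X.Opens} {t : Γ(X, V)} (ht : IsEqn i V t) :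
    IsIdealGen i V (fun _ : Unit ↦ t) :=
  ⟨fun _ ↦ ht.zero, fun W h f hf x hx ↦ by
    obtain ⟨g, hg⟩ := ht.exists_mul W h f hf
    exact ⟨W, le_rfl, fun _ ↦ g, hx, by
      rw [Fintype.sum_unique (ι := Unit), fres_self, hg, mul_comm]⟩⟩

theorem isIdealGen_fst_fst {i : D ⟶ X} [IsClosedImmersion i] {V : X.Opens} {t : Γ(X, V)}
    (ht : IsEqn i V t) (f : T ⟶ Y) (p : Y ⟶ X) (h : W ≤ (f ≫ p) ⁻¹ᵁ V) :
    IsIdealGen (pullback.fst f (pullback.fst p i)) W (fun _ : Unit ↦ fpull (f ≫ p) h t) := by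
  have h2 : fres h (fpull f le_rfl (fpull p (le_refl (p ⁻¹ᵁ V)) t)) = fpull (f ≫ p) h t :=
    (congrArg (fres h) (fpull_comp f p le_rfl le_rfl t)).trans (fres_fpull _ _ _ _)
  exact h2 ▸ ((ht.isIdealGen.pullback p).pullback f).mono (W := W) h

end ker

section blowupChart

variable {X D Y Y₀ T P : Scheme.{u}} {R : CommRingCat.{u}} {s : X ⟶ Spec R} {i : D ⟶ X}
  {V : X.Opens} {κ : Type} [Fintype κ] {t : Γ(X, V)}
  {ω : κ → Γ(differentials s, V)} {e : Option κ → Γ(logDifferentials s i, V)}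
  {p : Y ⟶ X} {L : Y.Modules} {q : (Scheme.Modules.pullback p).obj (logDifferentials s i) ⟶ L}
  {p₀ : Y₀ ⟶ X} {L₀ : Y₀.Modules} {q₀ : (Scheme.Modules.pullback p₀).obj (differentials s) ⟶ L₀}
  {f : T ⟶ Y} {f₀ : T ⟶ Y₀} {W : T.Opens}
  {θ : (Scheme.Modules.pullback f₀).obj L₀ ⟶ (Scheme.Modules.pullback f).obj L}
  {res : logDifferentials s i ⟶ (Scheme.Modules.pushforward i).obj (structureSheaf D)}
  {σ : D ⟶ Y} {pD : P ⟶ D} {LD : P.Modules}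
  {qD : (Scheme.Modules.pullback pD).obj (differentials (i ≫ s)) ⟶ LD} {τ : P ⟶ Y₀}
  (hX : LogPair s i) (hres : IsFrameResidue s i res)
  (hY : IsProjectiveBundle (logDifferentials s i) p q)
  (hσ : Classifies q σ (restrictToDivisor i res))
  (hY₀ : IsProjectiveBundle (differentials s) p₀ q₀)
  (hP : IsProjectiveBundle (differentials (i ≫ s)) pD qD) (hτ : Classifies q₀ τ (tauQuotient i qD))

  (hF : LogFrame s i V t ω e) (hV : IsAffineOpen V) (hθ : IsFormsMap s i q q₀ f f₀ θ)
  (hf : IsBlowup σ f)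

include hX hres hY hσ hY₀ hf hθ

include hF hV in
theorem IsFormsMap.exists_of_sigmaGen_mul (k : Option κ)
    {a a' : Γ(T, blowupChart e q q₀ f f₀ t ω k)}
    (h : fpull f inf_le_left (sigmaGen q t e k) * a =
      fpull f₀ inf_le_right (coord q₀ (frameBasis s t ω) k none) * a') :
    ∃ c, a = fpull f₀ inf_le_right (coord q₀ (frameBasis s t ω) k none) * c := by
  have hb := (hθ.isAffineOpen_blowupChart hX hres hY hσ hY₀ hF hV hf k).2
  obtain ⟨a, rfl⟩ := hb.2 a
  obtain ⟨a', rfl⟩ := hb.2 a'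
  rw [← hθ.chartHom_of hF, ← hθ.chartHom_root hF, ← map_mul, ← map_mul] at h
  obtain ⟨c, rfl⟩ := BlowupRing.exists_of_root_mul (hb.1 h)
  exact ⟨hθ.chartHom hF k c, by rw [← hθ.chartHom_of hF, ← map_mul]⟩

include hP hτ

theorem IsFormsMap.exists_divisors (x : T) : ∃ (W : T.Opens) (ε ε₀ : Γ(T, W)), x ∈ W ∧
    IsEqn (pullback.fst f σ) W ε ∧ IsEqn (pullback.fst f₀ τ) W ε₀ ∧
      (IsIdealGen (pullback.fst f (pullback.fst p i)) W (fun _ : Unit ↦ ε * ε₀) ∧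
        IsReg (fpull (pullback.fst f₀ τ) (le_refl (pullback.fst f₀ τ ⁻¹ᵁ W)) ε)) ∧
      IsIdealGen (pullback.fst f₀ (pullback.fst p₀ i)) W (fun _ : Unit ↦ ε₀ * ε) ∧
        IsReg (fpull (pullback.fst f σ) (le_refl (pullback.fst f σ ⁻¹ᵁ W)) ε₀) := by
  have := hX.isClosedImmersion
  have := isClosedImmersion_sigma hX hres hY hσ
  have := isClosedImmersion_tau hX hY₀ hP hτ
  have hreg := (hX.isRegOver_log hY).blowup hf
  have hgen : ∀ {V : X.Opens} {t : Γ(X, V)} {W : T.Opens} (ht : IsEqn i V t)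
      (h : W ≤ (f ≫ p) ⁻¹ᵁ V) {a : Γ(T, W)} (ha : fpull (f ≫ p) h t = a),
      IsIdealGen (pullback.fst f (pullback.fst p i)) W (fun _ : Unit ↦ a) ∧
        IsIdealGen (pullback.fst f₀ (pullback.fst p₀ i)) W (fun _ : Unit ↦ a) := by
    rintro V t W ht h _ rfl
    refine ⟨isIdealGen_fst_fst ht f p h, ?_⟩
    rw [fpull_congr hθ.comm h t]
    exact isIdealGen_fst_fst ht f₀ p₀ _
  rcases hX.exists_charts hY hY₀ hθ.comm x with hx | ⟨V, κ, _, t, ω, e, j, k, hV, hF, hx⟩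
  · have h1 := hgen (isEqn_one preimage_complement) (le_refl ((f ≫ p) ⁻¹ᵁ complement i))
      (a := 1 * 1) (by rw [map_one, one_mul])
    refine ⟨(f ≫ p) ⁻¹ᵁ complement i, 1, 1, hx, isEqn_one ?_, isEqn_one ?_, ⟨h1.1, ?_⟩, h1.2, ?_⟩
    · exact fst_preimage_eq_bot
        (preimage_preimage_complement (hσ.1.trans (Category.id_comp i).symm)) f le_rfl
    · refine fst_preimage_eq_bot (preimage_preimage_complement hτ.1) f₀ ?_
      rw [hθ.comm]
      rfl
    · exact .of_isUnit (by rw [map_one]; exact isUnit_one)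
    · exact .of_isUnit (by rw [map_one]; exact isUnit_one)
  · cases j with
    | none =>
      have h1 := hθ.isEqn_fst_none hX hres hY hσ hY₀ hP hτ hreg hF hV (k := k) (W := _ ⊓ _)
        inf_le_left inf_le_right
      have hW := (hθ.isAffineOpen_blowupChart hX hres hY hσ hY₀ hF hV hf k).1
      have h2 := hgen hF.isEqn (W := blowupChart e q q₀ f f₀ t ω k)
        (inf_le_left.trans (f.preimage_mono (chart_le q e _)))
        ((fpull_congr hθ.comm _ _).trans
          ((fpull_comp f₀ p₀ _ inf_le_right t).symm.trans (hθ.fpull_chart hF k)))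
      have h3 := fun a a' ↦ hθ.exists_of_sigmaGen_mul hX hres hY hσ hY₀ hF hV hf k
        (a := a) (a' := a')
      refine ⟨_, _, _, hx, h1.1, h1.2, ⟨?_, isReg_fpull_of_isEqn hW h1.2 h3⟩, h2.2,
        isReg_fpull_of_isEqn hW h1.1 fun a a' h ↦ ?_⟩
      · rw [mul_comm]
        exact h2.1
      · obtain ⟨c, rfl⟩ := h3 a' a h.symm
        exact ⟨c, h1.2.isReg.cancel (by rw [h]; ring)⟩
    | some l =>
      have hle : f ⁻¹ᵁ chart q e (some l) ⊓ f₀ ⁻¹ᵁ chart q₀ (frameBasis s t ω) k ≤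
        (f ≫ p) ⁻¹ᵁ V := inf_le_left.trans (f.preimage_mono (chart_le q e _))
      have h1 := hθ.isEqn_fst_some hX hres hY hσ hY₀ hP hτ hreg hF hV (k := k) (l := l) (W := _ ⊓ _)
        inf_le_left inf_le_right hle
      have h2 := hgen hF.isEqn hle rfl
      refine ⟨_, _, _, hx, h1.1, h1.2, ⟨?_, ?_⟩, ?_, fun W h c _ ↦ ?_⟩
      · rw [one_mul]
        exact h2.1
      · exact .of_isUnit (by rw [map_one]; exact isUnit_one)
      · rw [mul_one]
        exact h2.2
      · have h3 := congrArg (fres h) h1.1.zero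
        rw [map_one, map_one, map_zero] at h3
        exact (mul_one c).symm.trans (by rw [h3, mul_zero])

theorem IsFormsMap.strictTransform_eq :
    strictTransform σ f (pullback.fst p i) = (exceptional τ f₀).ker ∧
      strictTransform τ f₀ (pullback.fst p₀ i) = (exceptional σ f).ker := by
  have := isClosedImmersion_sigma hX hres hY hσ
  have := isClosedImmersion_tau hX hY₀ hP hτ
  exact ⟨ker_strict fun x ↦ by
      obtain ⟨W, ε, ε₀, hx, h, h₀, h1, -⟩ := hθ.exists_divisors hX hres hY hσ hY₀ hP hτ hf x
      exact ⟨W, ε, ε₀, hx, h, h₀, h1⟩,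
    ker_strict fun x ↦ by
      obtain ⟨W, ε, ε₀, hx, h, h₀, -, h1⟩ := hθ.exists_divisors hX hres hY hσ hY₀ hP hτ hf x
      exact ⟨W, ε₀, ε, hx, h₀, h, h1⟩⟩

end blowupChart

/-! ### Base change of projective bundles -/

section baseChange

variable {X D P E T : Scheme.{u}} {F : X.Modules} {p : P ⟶ X} {L : P.Modules}
  {q : (Scheme.Modules.pullback p).obj F ⟶ L} {i : D ⟶ X} {g : E ⟶ P} {p' : E ⟶ D} {M : E.Modules}
  {r : (Scheme.Modules.pullback p').obj ((Scheme.Modules.pullback i).obj F) ⟶ M} {h : T ⟶ E}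
  {f : T ⟶ D} {N : T.Modules}
  {r' : (Scheme.Modules.pullback f).obj ((Scheme.Modules.pullback i).obj F) ⟶ N}

theorem qsec_pullbackComp {V : X.Opens} {W : T.Opens} (e : W ≤ (f ≫ i) ⁻¹ᵁ V) (a : Γ(F, V)) :
    qsec ((Scheme.Modules.pullbackComp f i).inv.app F ≫ r') e a =
      qsec r' (V := i ⁻¹ᵁ V) e (spull i F le_rfl a) :=
  (qsec_comp _ _ e a).trans (congrArg (r'.app _) (pullbackComp_inv_spull i e a))

theorem pullback_pullback_hom_ext
    {φ ψ : (Scheme.Modules.pullback f).obj ((Scheme.Modules.pullback i).obj F) ⟶ N}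
    (H : ∀ (V : X.Opens) (a : Γ(F, V)), qsec φ (le_refl (f ⁻¹ᵁ i ⁻¹ᵁ V)) (spull i F le_rfl a) =
      qsec ψ le_rfl (spull i F le_rfl a)) : φ = ψ := by
  rw [← cancel_epi ((Scheme.Modules.pullbackComp f i).inv.app F)]
  exact pullback_hom_ext fun V a ↦ (qsec_pullbackComp (le_refl ((f ≫ i) ⁻¹ᵁ V)) a).trans
    ((H V a).trans (qsec_pullbackComp (le_refl ((f ≫ i) ⁻¹ᵁ V)) a).symm)

theorem classifies_iff_of_baseChange
    (hr : Classifies q g ((Scheme.Modules.pullbackComp p' i).inv.app F ≫ r)) (hf : h ≫ p' = f) :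
    Classifies r h r' ↔
      Classifies q (h ≫ g) ((Scheme.Modules.pullbackComp f i).inv.app F ≫ r') := by
  subst hf
  obtain ⟨θ, hθ⟩ := hr.exists_iso
  have hgp : (h ≫ g) ≫ p = (h ≫ p') ≫ i := by rw [Category.assoc, hr.1, Category.assoc]
  have hle : ∀ V : X.Opens, g ⁻¹ᵁ p ⁻¹ᵁ V ≤ (p' ≫ i) ⁻¹ᵁ V := fun V ↦ by
    rw [← hr.1]
    rfl
  have h1 : ∀ {V : X.Opens} {W : E.Opens} (e : W ≤ g ⁻¹ᵁ p ⁻¹ᵁ V) (e' : W ≤ p' ⁻¹ᵁ i ⁻¹ᵁ V)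
      (a : Γ(F, V)), θ.hom.app W (spull g L e (qsec q le_rfl a)) =
        qsec r e' (spull i F le_rfl a) := fun e e' a ↦
    (hθ a le_rfl e e').trans (qsec_pullbackComp _ a)
  constructor
  · intro hc
    obtain ⟨η, hη⟩ := hc.exists_iso
    let Θ := (Scheme.Modules.pullbackComp h g).symm.app L ≪≫
      (Scheme.Modules.pullback h).mapIso θ ≪≫ η
    refine ⟨hgp, Θ, pullback_hom_ext fun V a ↦ ?_⟩
    have e : (h ≫ g) ⁻¹ᵁ p ⁻¹ᵁ V ≤ ((h ≫ p') ≫ i) ⁻¹ᵁ V := by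
      rw [← hgp]
      rfl
    have h2 := congrArg (((Scheme.Modules.pullback h).map θ.hom).app _)
      (pullbackComp_inv_spull (f := h) g (le_refl ((h ≫ g) ⁻¹ᵁ p ⁻¹ᵁ V))
        (qsec q (le_refl (p ⁻¹ᵁ V)) a))
    refine (congrArg (Θ.hom.app _) (qsec_pullbackQuotient q (h ≫ g) le_rfl le_rfl a)).trans
      ((congrArg (η.hom.app _) (h2.trans ((pullback_map_spull _ _ _).trans
        (congrArg _ (h1 le_rfl (hle V) a))))).trans ((hη _ _ _ e).trans
          ((qsec_pullbackComp e a).symm.trans (qsec_pullbackCongr hgp _ _ a).symm)))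
  · intro hc
    obtain ⟨η, hη⟩ := hc.exists_iso
    let Θ := (Scheme.Modules.pullback h).mapIso θ.symm ≪≫
      (Scheme.Modules.pullbackComp h g).app L ≪≫ η
    refine ⟨rfl, Θ, pullback_pullback_hom_ext fun V a ↦ ?_⟩
    have e : (h ≫ p') ⁻¹ᵁ i ⁻¹ᵁ V ≤ h ⁻¹ᵁ g ⁻¹ᵁ p ⁻¹ᵁ V := by
      have h0 : ((h ≫ p') ≫ i) ⁻¹ᵁ V = ((h ≫ g) ≫ p) ⁻¹ᵁ V := by rw [hgp]
      exact h0.le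
    have h2 : θ.inv.app (g ⁻¹ᵁ p ⁻¹ᵁ V) (qsec r (V := i ⁻¹ᵁ V) (hle V) (spull i F le_rfl a)) =
        spull g L le_rfl (qsec q le_rfl a) := by
      rw [← h1 le_rfl (hle V) a]
      exact ConcreteCategory.congr_hom (congrArg (fun t ↦ Scheme.Modules.Hom.app t _)
        θ.hom_inv_id) _
    refine (congrArg (Θ.hom.app _) (qsec_pullbackQuotient r h (hle V) e (spull i F le_rfl a))).trans
      ((congrArg (η.hom.app _) ((congrArg (((Scheme.Modules.pullbackComp h g).hom.app L).app _)
        ((pullback_map_spull _ _ _).trans (congrArg _ h2))).trans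
          (pullbackComp_hom_spull g le_rfl e _))).trans ((hη _ _ _ le_rfl).trans
            ((qsec_pullbackComp _ a).trans (qsec_pullbackCongr rfl _ _ _).symm)))

theorem IsProjectiveBundle.of_isPullback (hP : IsProjectiveBundle F p q)
    (hE : IsPullback g p' p i)
    (hr : Classifies q g ((Scheme.Modules.pullbackComp p' i).inv.app F ≫ r)) :
    IsProjectiveBundle ((Scheme.Modules.pullback i).obj F) p' r := by
  have := hP.epi
  have ⟨_, θ, hθ⟩ := hr
  refine ⟨?_, ?_, fun T f N r' hN hr' ↦ ?_⟩
  · intro x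
    obtain ⟨U, hx, ⟨φ⟩⟩ := hP.isInvertible.pullback g x
    exact ⟨U, hx, ⟨(Scheme.Modules.restrictFunctor U.ι).mapIso θ.symm ≪≫ φ⟩⟩
  · have h1 : Epi (pullbackQuotient q g ≫ θ.hom) := by
      unfold pullbackQuotient
      infer_instance
    rw [hθ, ← Category.assoc] at h1
    exact @epi_of_epi _ _ _ _ _ _ r h1
  · obtain ⟨k, hk, huniq⟩ := hP.existsUnique T (f ≫ i) N
      ((Scheme.Modules.pullbackComp f i).inv.app F ≫ r') hN inferInstance
    refine ⟨hE.lift k f hk.1, ?_, fun k' hk' ↦ ?_⟩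
    · refine (classifies_iff_of_baseChange hr (hE.lift_snd k f hk.1)).mpr ?_
      rwa [hE.lift_fst]
    · refine hE.hom_ext ?_ ?_
      · rw [hE.lift_fst]
        exact huniq _ ((classifies_iff_of_baseChange hr hk'.1).mp hk')
      · rw [hE.lift_snd]
        exact hk'.1

end baseChange

/-! ### The exceptional divisor -/

section conormal

variable {B Y E Z X : Scheme.{u}} {e : E ⟶ B} {g : E ⟶ Z} {π : B ⟶ Y} {z : Z ⟶ Y}
  (h : e ≫ π = g ≫ z) {V : Y.Opens}

theorem idealVal_pullbackIdeal (α : Γ(idealModule z, V)) :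
    idealVal e (π ⁻¹ᵁ V) ((pullbackIdeal h).app _ (spull π _ le_rfl α)) =
      fpull π le_rfl (idealVal z V α) := by
  have h1 : pullbackIdeal h ≫ kernel.ι (structureMap e) = _ := kernel.lift_ι _ _ _
  have h2 := homEquiv_symm_spull (kernel.ι (structureMap z) ≫ structureMap π)
    (le_refl (π ⁻¹ᵁ V)) α
  have h3 := mres_self (M := structureSheaf B) (le_refl (π ⁻¹ᵁ V))
    (pushSec π _ V ((kernel.ι (structureMap z) ≫ structureMap π).app V α))
  refine (ConcreteCategory.congr_hom (congrArg (fun t ↦ Scheme.Modules.Hom.app t (π ⁻¹ᵁ V)) h1)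
    (spull π _ le_rfl α)).trans (h2.trans (h3.trans (app_eq_fpull π _)))

theorem conormalMap_spull {U : Z.Opens} {W : E.Opens} (hU : U ≤ z ⁻¹ᵁ V) (hW : W ≤ g ⁻¹ᵁ U)
    (hW' : W ≤ e ⁻¹ᵁ π ⁻¹ᵁ V) (α : Γ(idealModule z, V)) :
    (conormalMap h).app W (spull g _ hW (spull z _ hU α)) =
      spull e _ hW' ((pullbackIdeal h).app _ (spull π _ (le_refl (π ⁻¹ᵁ V)) α)) := by
  have h1 := (congrArg (((Scheme.Modules.pullbackCongr h.symm).hom.app (idealModule z)).app W)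
    (pullbackComp_hom_spull (f := g) z hU hW α)).trans (pullbackCongr_hom_spull h.symm _ α)
  have h2 := (congrArg (((Scheme.Modules.pullbackComp e π).inv.app (idealModule z)).app W) h1).trans
    (pullbackComp_inv_spull π hW' α)
  exact (congrArg (((Scheme.Modules.pullback e).map (pullbackIdeal h)).app W) h2).trans
    (pullback_map_spull _ _ _)

theorem qsec_conormalMap {F : X.Modules} {i : Z ⟶ X} {V' : X.Opens} {W : E.Opens}
    (ν : (Scheme.Modules.pullback i).obj F ⟶ conormal z) (a : Γ(F, V')) (α : Γ(idealModule z, V))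
    (hU : i ⁻¹ᵁ V' ≤ z ⁻¹ᵁ V) (hα : ν.app _ (spull i F le_rfl a) = spull z _ hU α)
    (hW : W ≤ (g ≫ i) ⁻¹ᵁ V') (hW' : W ≤ e ⁻¹ᵁ π ⁻¹ᵁ V) :
    qsec ((Scheme.Modules.pullbackComp g i).inv.app F ≫
      (Scheme.Modules.pullback g).map ν ≫ conormalMap h) hW a =
        spull e _ hW' ((pullbackIdeal h).app _ (spull π _ (le_refl (π ⁻¹ᵁ V)) α)) := by
  refine (qsec_pullbackComp hW a).trans ((qsec_map ν _ _).trans ?_)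
  refine (congrArg (qsec (conormalMap h) hW) hα).trans ?_
  exact conormalMap_spull h hU hW hW' α

end conormal

section blowupChart

variable {X D Y Y₀ T P : Scheme.{u}} {R : CommRingCat.{u}} {s : X ⟶ Spec R} {i : D ⟶ X}
  {V : X.Opens} {κ : Type} [Fintype κ] {t : Γ(X, V)}
  {ω : κ → Γ(differentials s, V)} {e : Option κ → Γ(logDifferentials s i, V)}
  {p : Y ⟶ X} {L : Y.Modules} {q : (Scheme.Modules.pullback p).obj (logDifferentials s i) ⟶ L}
  {p₀ : Y₀ ⟶ X} {L₀ : Y₀.Modules} {q₀ : (Scheme.Modules.pullback p₀).obj (differentials s) ⟶ L₀}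
  {f : T ⟶ Y} {f₀ : T ⟶ Y₀} {W : T.Opens}
  {θ : (Scheme.Modules.pullback f₀).obj L₀ ⟶ (Scheme.Modules.pullback f).obj L}
  {res : logDifferentials s i ⟶ (Scheme.Modules.pushforward i).obj (structureSheaf D)}
  {σ : D ⟶ Y} {pD : P ⟶ D} {LD : P.Modules}
  {qD : (Scheme.Modules.pullback pD).obj (differentials (i ≫ s)) ⟶ LD} {τ : P ⟶ Y₀}
  (hX : LogPair s i) (hres : IsFrameResidue s i res)
  (hY : IsProjectiveBundle (logDifferentials s i) p q)
  (hσ : Classifies q σ (restrictToDivisor i res))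
  (hY₀ : IsProjectiveBundle (differentials s) p₀ q₀)
  (hP : IsProjectiveBundle (differentials (i ≫ s)) pD qD) (hτ : Classifies q₀ τ (tauQuotient i qD))

  (hθ : IsFormsMap s i q q₀ f f₀ θ) (hf : IsBlowup σ f)

include hres hY hσ hθ in
theorem IsFormsMap.fst_preimage_blowupChart (hF : LogFrame s i V t ω e) (k : Option κ) :
    (pullback.fst f σ ≫ f₀) ⁻¹ᵁ chart q₀ (frameBasis s t ω) k =
      pullback.fst f σ ⁻¹ᵁ blowupChart e q q₀ f f₀ t ω k := by
  refine le_antisymm (fun x hx ↦ ⟨?_, hx⟩) fun x hx ↦ hx.2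
  have h1 : (pullback.fst f σ ≫ f₀) ≫ p₀ = pullback.snd f σ ≫ i := by
    rw [Category.assoc, ← hθ.comm, pullback.condition_assoc, hσ.1]
  have h2 : x ∈ ((pullback.fst f σ ≫ f₀) ≫ p₀) ⁻¹ᵁ V := chart_le q₀ _ k hx
  rw [h1] at h2
  have h3 : x ∈ (pullback.snd f σ ≫ σ) ⁻¹ᵁ chart q e none := sigma_le hres hY hσ hF h2
  rwa [← pullback.condition] at h3

include hX hres hY hσ hY₀ hP hτ hf hθ

theorem IsFormsMap.isPullback : IsPullback (pullback.fst f σ ≫ f₀) (pullback.snd f σ) p₀ i := by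
  have := hX.isClosedImmersion
  have := isClosedImmersion_sigma hX hres hY hσ
  have := hY₀.epi
  have h1 : (pullback.fst f σ ≫ f₀) ≫ p₀ = pullback.snd f σ ≫ i := by
    rw [Category.assoc, ← hθ.comm, pullback.condition_assoc, hσ.1]
  have h2 : IsIso (pullback.lift _ _ h1) := isIso_of_forall _ fun y ↦ by
    obtain ⟨V, κ, _, t, ω, e, hd, hV, hF⟩ := hX.exists_frame (pullback.snd p₀ i y)
    obtain ⟨k, hk⟩ := exists_mem_chart (q := q₀) hY₀.isInvertible hF.isBasisOn
      (y := pullback.fst p₀ i y) (by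
        have h2 : y ∈ (pullback.snd p₀ i ≫ i) ⁻¹ᵁ V := hd
        rwa [← pullback.condition] at h2)
    have hC := chart_isAffineOpen hY₀ hF.isBasisOn hV k
    obtain ⟨hW, hb⟩ := hθ.isAffineOpen_blowupChart hX hres hY hσ hY₀ hF hV hf k
    have hpre : pullback.lift _ _ h1 ⁻¹ᵁ pullback.fst p₀ i ⁻¹ᵁ chart q₀ (frameBasis s t ω) k =
        pullback.fst f σ ⁻¹ᵁ blowupChart e q q₀ f f₀ t ω k := by
      rw [← Scheme.Hom.comp_preimage, pullback.lift_fst]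
      exact hθ.fst_preimage_blowupChart hres hY hσ hF k
    have hQ : IsEqn (pullback.fst p₀ i) (chart q₀ (frameBasis s t ω) k)
        (fpull p₀ (chart_le q₀ _ k) t) := by
      have h3 := (hF.isEqn.isIdealGen.pullback p₀).mono (chart_le q₀ (frameBasis s t ω) k)
      simp only [fres_fpull] at h3
      exact h3.isEqn (isReg_fpull_chart hY₀ hF.isBasisOn hV hF.isEqn.isReg.mem_nonZeroDivisors k)
    have hE := (hθ.isEqn_fst_none hX hres hY hσ hY₀ hP hτ ((hX.isRegOver_log hY).blowup hf) hF hV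
      (k := k) (W := blowupChart e q q₀ f f₀ t ω k) inf_le_left inf_le_right).1
    have h3 : ∀ a, (pullback.lift _ _ h1).app _ ((pullback.fst p₀ i).app _ a) =
        fpull (pullback.fst f σ) hpre.le (fpull f₀ inf_le_right a) := fun a ↦ by
      rw [app_eq_fpull, app_eq_fpull, fpull_comp, fpull_comp]
      exact fpull_congr (pullback.lift_fst _ _ h1) _ a
    refine ⟨_, hk, hC.preimage _, hpre ▸ hW.preimage _, ?_, fun b ↦ ?_⟩
    · refine (injective_iff_map_eq_zero (Scheme.Hom.app _ _).hom).mpr fun b hb' ↦ ?_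
      obtain ⟨a, rfl⟩ := Scheme.Hom.app_surjective (pullback.fst p₀ i) _ hC b
      have h4 := congrArg (fres hpre.ge) ((h3 a).symm.trans hb')
      rw [fres_fpull, map_zero] at h4
      obtain ⟨g, hg⟩ := hE.exists_mul _ le_rfl _ h4
      obtain ⟨g, rfl⟩ := hb.2 g
      rw [fres_self, ← hθ.chartHom_of hF, ← hθ.chartHom_root hF, ← map_mul] at hg
      obtain ⟨y, rfl⟩ := BlowupRing.of_eq_root_mul (hb.1 hg)
      rw [app_eq_fpull, map_mul, hQ.zero, zero_mul]
    · obtain ⟨a, ha⟩ := Scheme.Hom.app_surjective (pullback.fst f σ) _ hW (fres hpre.ge b)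
      obtain ⟨a, rfl⟩ := hb.2 a
      obtain ⟨x, a', rfl⟩ := BlowupRing.exists_of_add a
      refine ⟨(pullback.fst p₀ i).app _ x, (h3 x).trans ?_⟩
      have h4 := congrArg (fres hpre.le) ha
      rw [app_eq_fpull, map_add, map_mul, hθ.chartHom_of, hθ.chartHom_root, map_add, map_mul,
        hE.zero, zero_mul, add_zero, fres_fpull, fres_fres, fres_self] at h4
      exact h4
  exact .of_iso_pullback ⟨h1⟩ (asIso (pullback.lift _ _ h1)) (pullback.lift_fst _ _ h1)
    (pullback.lift_snd _ _ h1)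

theorem IsFormsMap.classifies_conormal
    {ν : conormal σ ≅ (Scheme.Modules.pullback i).obj (differentials s)}
    (hν : ∀ {V : X.Opens} {κ : Type} [Fintype κ] {t : Γ(X, V)} {ω : κ → Γ(differentials s, V)}
      {e : Option κ → Γ(logDifferentials s i, V)} (hF : LogFrame s i V t ω e) (o : Option κ)
      (α : Γ(idealModule σ, chart q e none)), idealVal σ _ α = sigmaGen q t e o →
        ν.inv.app _ (spull i _ (le_refl (i ⁻¹ᵁ V)) (frameBasis s t ω o)) =
          spull σ (idealModule σ) (sigma_le hres hY hσ hF) α) :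
    Classifies q₀ (pullback.fst f σ ≫ f₀)
      ((Scheme.Modules.pullbackComp (pullback.snd f σ) i).inv.app (differentials s) ≫
        (Scheme.Modules.pullback (pullback.snd f σ)).map ν.inv ≫
          conormalMap (pullback.condition (f := f) (g := σ))) := by
  have := hX.isClosedImmersion
  have := isClosedImmersion_sigma hX hres hY hσ
  have := hY₀.epi
  have hp : (pullback.fst f σ ≫ f₀) ≫ p₀ = pullback.snd f σ ≫ i := by
    rw [Category.assoc, ← hθ.comm, pullback.condition_assoc, hσ.1]
  refine classifies_of_coords hp fun x ↦ ?_
  obtain ⟨V, κ, _, t, ω, e, hd, hV, hF⟩ := hX.exists_frame (pullback.snd f σ x)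
  have hx : x ∈ ((pullback.fst f σ ≫ f₀) ≫ p₀) ⁻¹ᵁ V := by
    rw [hp]
    exact hd
  obtain ⟨k, hk⟩ := exists_mem_chart (q := q₀) hY₀.isInvertible hF.isBasisOn
    (y := (pullback.fst f σ ≫ f₀) x) hx
  let U := blowupChart e q q₀ f f₀ t ω k
  have hpre := hθ.fst_preimage_blowupChart hres hY hσ hF k
  have hE := (hθ.isEqn_fst_none hX hres hY hσ hY₀ hP hτ ((hX.isRegOver_log hY).blowup hf) hF hV
    (k := k) (W := U) inf_le_left inf_le_right).1
  have hU : pullback.fst f σ ⁻¹ᵁ U ≤ (pullback.snd f σ ≫ i) ⁻¹ᵁ V := by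
    rw [← hp, ← hpre]
    exact Scheme.Hom.preimage_mono _ (chart_le q₀ _ k)
  obtain ⟨β, hβ⟩ := exists_idealVal _ hE.zero
  choose α hα using fun o ↦ exists_idealVal (sigmaGen q t e o)
    ((isIdealGen_sigma hX hres hY hσ hF hV).zero o)
  have key : ∀ o, qsec ((Scheme.Modules.pullbackComp (pullback.snd f σ) i).inv.app
      (differentials s) ≫ (Scheme.Modules.pullback (pullback.snd f σ)).map ν.inv ≫
        conormalMap (pullback.condition (f := f) (g := σ))) hU (frameBasis s t ω o) =
      fpull (pullback.fst f σ ≫ f₀) hpre.ge (coord q₀ (frameBasis s t ω) k o) •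
        spull (pullback.fst f σ) _ le_rfl β := fun o ↦ by
    have h1 : (pullbackIdeal (pullback.condition (f := f) (g := σ))).app U
        (spull f _ (inf_le_left : U ≤ f ⁻¹ᵁ chart q e none) (α o)) =
        fpull f₀ (inf_le_right : U ≤ _) (coord q₀ (frameBasis s t ω) k o) • β := by
      apply idealVal_injective
      rw [idealVal_smul, hβ, ← hθ.sigmaGen_eq hF k o, ← hα o]
      have h2 := congrArg (fres (inf_le_left : U ≤ f ⁻¹ᵁ chart q e none))
        (idealVal_pullbackIdeal (pullback.condition (f := f) (g := σ)) (α o))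
      rw [← idealVal_res, mres_app, mres_spull, fres_fpull] at h2
      exact h2
    have h4 := congrArg (spull (pullback.fst f σ) _ (le_refl (pullback.fst f σ ⁻¹ᵁ U))) h1
    rw [spull_smul, fpull_comp, ← mres_spull (f := f) le_rfl inf_le_left, ← mres_app,
      spull_mres] at h4
    exact (qsec_conormalMap _ ν.inv _ (α o) (sigma_le hres hY hσ hF) (hν hF o (α o) (hα o)) hU
      (Scheme.Hom.preimage_mono _ inf_le_left)).trans h4
  refine ⟨V, _, _, frameBasis s t ω, k, pullback.fst f σ ⁻¹ᵁ U, hU, hpre.ge, hpre.le hk,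
    hF.isBasisOn, ?_, fun o ↦ ?_⟩
  · rw [key, coord_self, map_one, one_smul]
    exact isGen_iff_isBasisOn.mpr (isBasisOn_conormal hE.isIdealGen
      (isConormalIndep_of_isReg hE.isReg) fun _ ↦ hβ)
  · rw [key, key, coord_self, map_one, one_smul]
    rfl

end blowupChart

/-! ### Tensor products with the line bundle of a divisor -/

section tensor

variable {X D : Scheme.{u}} {U V W : X.Opens}

theorem isGen_shf {P : X.PresheafOfModules} {a : PSec P V}
    (hinj : ∀ (W : X.Opens) (h : W ≤ V) (c : Γ(X, W)), c • pres P h a = 0 → c = 0)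
    (hsurj : ∀ (W : X.Opens) (h : W ≤ V) (b : PSec P W), ∃ c : Γ(X, W), b = c • pres P h a) :
    IsGen (sheafify P) V (shf P V a) := by
  refine isGen_iff_isBasisOn.mpr (isBasisOn_of_local (fun W h c hc x hx ↦ ?_) fun W h b x hx ↦ ?_)
  · rw [Fintype.sum_unique (ι := Unit), mres_shf, ← shf_smul] at hc
    obtain ⟨W', h', hx', h0⟩ := shf_eq_zero _ hc hx
    rw [pres_smul, pres_pres] at h0
    exact ⟨W', h', hx', fun _ ↦ hinj _ _ _ h0⟩
  · obtain ⟨W', h', hx', b', hb⟩ := exists_shf _ b hx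
    obtain ⟨c, rfl⟩ := hsurj W' (h'.trans h) b'
    refine ⟨W', h', h'.trans h, hx', fun _ ↦ c, ?_⟩
    rw [Fintype.sum_unique (ι := Unit), ← hb, shf_smul, mres_shf]

variable {M N : X.Modules}

/-- The presheaf `U ↦ M(U) ⊗ N(U)`. -/
abbrev tensorPresheaf (M N : X.Modules) : X.PresheafOfModules :=
  PresheafOfModules.Monoidal.tensorObj (R := X.presheaf) M.val N.val

open TensorProduct in
/-- Tensors as sections of the presheaf `U ↦ M(U) ⊗ N(U)`. -/
def tensorSec (M N : X.Modules) (U : X.Opens) :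
    Γ(M, U) ⊗[Γ(X, U)] Γ(N, U) ≃ₗ[Γ(X, U)] PSec (tensorPresheaf M N) U := LinearEquiv.refl _ _

theorem pres_tensorSec (h : W ≤ U) (m : Γ(M, U)) (n : Γ(N, U)) :
    pres _ h (tensorSec M N U (.tmul _ m n)) =
      tensorSec M N W (.tmul _ (mres M h m) (mres N h n)) := rfl

/-- The section `m ⊗ n` of the tensor product. -/
def tmulSec (m : Γ(M, U)) (n : Γ(N, U)) : Γ(tensor M N, U) :=
  shf (tensorPresheaf M N) U (tensorSec M N U (.tmul _ m n))

theorem mres_tmulSec (h : W ≤ U) (m : Γ(M, U)) (n : Γ(N, U)) :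
    mres _ h (tmulSec m n) = tmulSec (mres M h m) (mres N h n) :=
  (mres_shf _ h _).trans (congrArg (shf _ W) (pres_tensorSec h m n))

theorem tmulSec_add (m m' : Γ(M, U)) (n : Γ(N, U)) :
    tmulSec (m + m') n = tmulSec m n + tmulSec m' n := by
  rw [tmulSec, TensorProduct.add_tmul, map_add, map_add]
  rfl

theorem smul_tmulSec (c : Γ(X, U)) (m : Γ(M, U)) (n : Γ(N, U)) :
    tmulSec (c • m) n = c • tmulSec m n := by
  rw [tmulSec, ← TensorProduct.smul_tmul', map_smul, shf_smul]
  rfl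

theorem tmulSec_smul (c : Γ(X, U)) (m : Γ(M, U)) (n : Γ(N, U)) :
    tmulSec m (c • n) = c • tmulSec m n := by
  rw [tmulSec, TensorProduct.tmul_smul, map_smul, shf_smul]
  rfl

theorem isGen_tmulSec {m : Γ(M, U)} {n : Γ(N, U)} (hm : IsGen M U m) (hn : IsGen N U n) :
    IsGen (tensor M N) U (tmulSec m n) := by
  have key : ∀ (W : X.Opens) (h : W ≤ U), ∃ E : Γ(X, W) ≃ₗ[Γ(X, W)] PSec (tensorPresheaf M N) W,
      ∀ c, E c = c • pres _ h (tensorSec M N U (.tmul _ m n)) := fun W h ↦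
    ⟨(TensorProduct.rid _ _).symm ≪≫ₗ TensorProduct.congr
      (.ofBijective (.toSpanSingleton _ _ (mres M h m)) (hm W h))
      (.ofBijective (.toSpanSingleton _ _ (mres N h n)) (hn W h)) ≪≫ₗ tensorSec M N W, fun c ↦ by
        rw [pres_tensorSec, ← map_smul, TensorProduct.smul_tmul']
        change tensorSec M N W (.tmul _ (c • mres M h m) ((1 : Γ(X, W)) • mres N h n)) = _
        rw [one_smul]⟩
  refine isGen_shf (fun W h c hc ↦ ?_) fun W h b ↦ ?_ <;> obtain ⟨E, hE⟩ := key W h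
  · exact E.map_eq_zero_iff.mp ((hE c).trans hc)
  · exact ⟨E.symm b, by rw [← hE, E.apply_symm_apply]⟩

/-- The section `1` of the line bundle of a divisor. -/
def oneSec (z : D ⟶ X) (U : X.Opens) : PSec (divisorSubmodule z).toPresheafOfModules U :=
  subMk (divisorSubmodule z) ((toAwayFrom (structureSheaf X) (complement z)).app U
    ((unitSec U).symm 1)) fun W h f _ ↦ ⟨f • mres _ h ((unitSec U).symm 1), by
      rw [Scheme.Modules.Hom.app_smul, ← mres_app]
      rfl⟩

theorem pres_oneSec (z : D ⟶ X) (h : W ≤ U) : pres _ h (oneSec z U) = oneSec z W := by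
  apply subVal_injective
  rw [subVal_pres]
  exact (mres_app (toAwayFrom (structureSheaf X) (complement z)) h _).trans
    (congrArg ((toAwayFrom _ _).app W) (congrArg (unitSec W).symm (map_one (fres h))))

theorem IsEqn.exists_isGen {z : D ⟶ X} [IsClosedImmersion z] {ε : Γ(X, U)} (hε : IsEqn z U ε) :
    ∃ d : PSec (divisorSubmodule z).toPresheafOfModules U,
      ε • d = oneSec z U ∧ IsGen (divisorSheaf z) U (shf _ U d) := by
  let A (W : X.Opens) : Γ(awayFrom (structureSheaf X) (complement z), W) ≃+
    Γ(X, away (complement z) W) := (awaySec _ _ W).trans (unitSec _)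
  have hA : ∀ (W : X.Opens) (c : Γ(X, W)) b, A W (c • b) = fres (away_le _ W) c * A W b :=
    fun W c b ↦ congrArg (unitSec _) (awaySec_smul c b)
  have hAr : ∀ {W W' : X.Opens} (h : W' ≤ W) b, A W' (mres _ h b) = fres (away_mono _ h) (A W b) :=
    fun h b ↦ rfl
  have hAt : ∀ (W : X.Opens) (c : Γ(X, W)), A W ((toAwayFrom _ _).app W ((unitSec W).symm c)) =
    fres (away_le _ W) c := fun W c ↦ rfl
  have hb : away (complement z) U ≤ X.basicOpen ε := by
    rw [hε.basicOpen_eq, away_eq, inf_comm]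
  obtain ⟨v, hv⟩ : ∃ v, fres (away_le (complement z) U) ε * v = 1 := by
    have h1 := (isUnit_fres_basicOpen ε).map (fres hb)
    rw [fres_fres] at h1
    exact h1.exists_right_inv
  have hv' : ∀ (W : X.Opens) (h : W ≤ U), fres (away_le (complement z) W) (fres h ε) *
      fres (away_mono (complement z) h) v = 1 := fun W h ↦ by
    have h1 := congrArg (fres (away_mono (complement z) h)) hv
    rwa [map_mul, map_one, fres_fres, ← fres_fres h (away_le _ W)] at h1
  let d : PSec (divisorSubmodule z).toPresheafOfModules U :=
    subMk (divisorSubmodule z) ((A U).symm v) fun W h f hf ↦ by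
      obtain ⟨g, rfl⟩ := hε.exists_mul W h f ((app_eq_fpull z f).symm.trans hf)
      refine ⟨(unitSec W).symm g, (A W).injective ?_⟩
      exact (hAt W g).trans (((hA W _ _).trans (by
        rw [map_mul, mul_right_comm]
        exact (congrArg (· * _) (hv' W h)).trans (one_mul _))).symm)
  have hd : ∀ (W : X.Opens) (h : W ≤ U) (c : Γ(X, W)), A W (subVal _ W (c • pres _ h d)) =
      fres (away_le _ W) c * fres (away_mono _ h) v := fun W h c ↦ hA W c _
  refine ⟨d, subVal_injective _ ((A U).injective ?_), isGen_shf (fun W h c hc ↦ ?_) fun W h b ↦ ?_⟩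
  · exact (hA U ε _).trans (hv.trans (map_one (fres (away_le (complement z) U))).symm)
  · have h1 := (hd W h c).symm.trans ((congrArg (fun b ↦ A W (subVal _ W b)) hc).trans (map_zero _))
    refine fun_eq_zero_of_isReg (hε.isReg.mono h) le_rfl ?_ (away_le (complement z) W) ?_
    · rw [(hε.mono h).basicOpen_eq, away_eq, inf_comm W]
      exact fun x hx ↦ ⟨hx.1.2, hx.1.1⟩
    · rw [← mul_one (fres (away_le (complement z) W) c), ← hv' W h, mul_left_comm, h1, mul_zero]
  · obtain ⟨y, hy⟩ := subVal_mem _ b W le_rfl (fres h ε) ((app_eq_fpull z _).trans (hε.mono h).zero)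
    refine ⟨(unitSec W) y, subVal_injective _ ((A W).injective ((hd W h _).trans ?_).symm)⟩
    have h1 : fres (away_le _ W) (unitSec W y) = fres (away_le _ W) (fres h ε) * A W (subVal _ W b) :=
      (congrArg (A W) hy).trans ((hA W _ _).trans
        (congrArg (fun b ↦ _ * A W b) (mres_self _ le_rfl _)))
    rw [h1, mul_right_comm, hv', one_mul]

end tensor

section tensorDivisor

variable {X D : Scheme.{u}} {G N : X.Modules} (θ : G ⟶ N) (z : D ⟶ X)

/-- The map `g ↦ g ⊗ 1` to the tensor product with the line bundle of a divisor. -/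
def tensorOne (G : X.Modules) (U : X.Opens) (g : Γ(G, U)) : Γ(tensor G (divisorSheaf z), U) :=
  tmulSec (N := divisorSheaf z) g (shf _ U (oneSec z U))

theorem mres_tensorOne {U W : X.Opens} (h : W ≤ U) (g : Γ(G, U)) :
    mres _ h (tensorOne z G U g) = tensorOne z G W (mres G h g) :=
  (mres_tmulSec h _ _).trans (congrArg (tmulSec _)
    ((mres_shf _ h _).trans (congrArg (shf _ W) (pres_oneSec z h))))

theorem tensorOne_add {U : X.Opens} (g g' : Γ(G, U)) :
    tensorOne z G U (g + g') = tensorOne z G U g + tensorOne z G U g' := tmulSec_add _ _ _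

theorem tensorOne_smul {U : X.Opens} (c : Γ(X, U)) (g : Γ(G, U)) :
    tensorOne z G U (c • g) = c • tensorOne z G U g := smul_tmulSec _ _ _

theorem IsEqn.exists_isGen_tensor [IsClosedImmersion z] {U : X.Opens} {ε : Γ(X, U)}
    (hε : IsEqn z U ε) {m : Γ(G, U)} (hm : IsGen G U m) :
    ∃ k, IsGen (tensor G (divisorSheaf z)) U k ∧ tensorOne z G U m = ε • k := by
  obtain ⟨d, hd, hgen⟩ := hε.exists_isGen
  refine ⟨_, isGen_tmulSec hm hgen, ?_⟩
  exact (congrArg (tmulSec m) ((congrArg (shf _ U) hd.symm).trans (shf_smul _ ε d))).trans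
    (tmulSec_smul ε m _)

theorem IsReg.mul {U : X.Opens} {a b : Γ(X, U)} (ha : IsReg a) (hb : IsReg b) : IsReg (a * b) :=
  fun W h c hc ↦ hb W h c (ha W h _ (by rwa [← mul_assoc, ← map_mul]))

theorem nonempty_iso_tensor_divisorSheaf [IsClosedImmersion z]
    (h : ∀ x : X, ∃ (W : X.Opens) (ε : Γ(X, W)) (m : Γ(G, W)) (n : Γ(N, W)), x ∈ W ∧
      IsEqn z W ε ∧ IsGen G W m ∧ IsGen N W n ∧ θ.app W m = ε • n) :
    Nonempty (N ≅ tensor G (divisorSheaf z)) := by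
  have key : ∀ x : X, ∃ (W : X.Opens) (ε : Γ(X, W)) (m : Γ(G, W)) (n : Γ(N, W))
      (k : Γ(tensor G (divisorSheaf z), W)), x ∈ W ∧ IsReg ε ∧ IsGen G W m ∧ IsGen N W n ∧
        IsGen _ W k ∧ θ.app W m = ε • n ∧ tensorOne z G W m = ε • k := fun x ↦ by
    obtain ⟨W, ε, m, n, hx, hε, hm, hn, h1⟩ := h x
    obtain ⟨k, hk, h2⟩ := hε.exists_isGen_tensor z hm
    exact ⟨W, ε, m, n, k, hx, hε.isReg, hm, hn, hk, h1, h2⟩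
  refine (exists_hom_of_relation (A := N) (G := tensor G (divisorSheaf z))
    (fun U a b ↦ ∃ (ε : Γ(X, U)) (g : Γ(G, U)), IsReg ε ∧ ε • a = θ.app U g ∧
      ε • b = tensorOne z G U g) ?_ ?_ ?_ ?_ ?_).elim fun φ hφ ↦ ?_
  · rintro U W h a b ⟨ε, g, hε, h1, h2⟩
    exact ⟨fres h ε, mres G h g, hε.mono h, by rw [← mres_smul, h1, mres_app],
      by rw [← mres_smul, h2, mres_tensorOne]⟩
  · rintro U a b a' b' ⟨ε, g, hε, h1, h2⟩ ⟨ε', g', hε', h1', h2'⟩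
    refine ⟨ε * ε', ε' • g + ε • g', hε.mul hε', ?_, ?_⟩
    · rw [map_add, Scheme.Modules.Hom.app_smul, Scheme.Modules.Hom.app_smul, ← h1, ← h1']
      module
    · rw [tensorOne_add, tensorOne_smul, tensorOne_smul, ← h2, ← h2']
      module
  · rintro U c a b ⟨ε, g, hε, h1, h2⟩
    exact ⟨ε, c • g, hε, by rw [Scheme.Modules.Hom.app_smul, ← h1, smul_comm],
      by rw [tensorOne_smul, ← h2, smul_comm]⟩
  · rintro U b ⟨ε, g, hε, h1, h2⟩
    refine section_ext fun x hx ↦ ?_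
    obtain ⟨W, ε', m, n, k, hxW, hε', hm, hn, hk, h3, h4⟩ := key x
    have hU : U ⊓ W ≤ U := inf_le_left
    have hW : U ⊓ W ≤ W := inf_le_right
    refine ⟨U ⊓ W, hU, ⟨hx, hxW⟩, ?_⟩
    obtain ⟨c, hc⟩ := hm.exists_smul hW (mres G hU g)
    obtain ⟨c', hc'⟩ := hk.exists_smul hW (mres _ hU b)
    have h5 : θ.app _ (mres G hU g) = 0 := by rw [← mres_app, ← h1, smul_zero, map_zero]
    rw [hc, Scheme.Modules.Hom.app_smul, ← mres_app, h3, mres_smul, smul_smul] at h5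
    have h6 : c = 0 := hε'.mono hW _ le_rfl _ (by
      rw [fres_self, mul_comm]
      exact hn.eq_zero_of_smul hW h5)
    have h7 := congrArg (mres _ hU) h2
    rw [mres_smul, mres_tensorOne, hc, h6, tensorOne_smul, zero_smul, hc', smul_smul] at h7
    rw [hc', hε.mono hU _ le_rfl _ ((congrArg (· * _) (fres_self _ _)).trans
      (hk.eq_zero_of_smul hW h7)), zero_smul, map_zero]
  · intro U a x hx
    obtain ⟨W, ε, m, n, k, hxW, hε, hm, hn, hk, h1, h2⟩ := key x
    have hU : U ⊓ W ≤ U := inf_le_left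
    have hW : U ⊓ W ≤ W := inf_le_right
    obtain ⟨c, hc⟩ := hn.exists_smul hW (mres N hU a)
    refine ⟨U ⊓ W, hU, ⟨hx, hxW⟩, c • mres _ hW k, fres hW ε, c • mres G hW m, hε.mono hW, ?_, ?_⟩
    · rw [hc, Scheme.Modules.Hom.app_smul, ← mres_app, h1, mres_smul, smul_comm]
    · rw [tensorOne_smul, ← mres_tensorOne, h2, mres_smul, smul_comm]
  · have : IsIso φ := isIso_of_isGen φ fun x ↦ by
      obtain ⟨W, ε, m, n, k, hx, hε, hm, hn, hk, h1, h2⟩ := key x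
      exact ⟨W, n, hx, hn, hφ W n k ⟨ε, m, hε, h1.symm, h2.symm⟩ ▸ hk⟩
    exact ⟨asIso φ⟩

end tensorDivisor

section blowupChart

variable {X D Y Y₀ T P : Scheme.{u}} {R : CommRingCat.{u}} {s : X ⟶ Spec R} {i : D ⟶ X}
  {V : X.Opens} {κ : Type} [Fintype κ] {t : Γ(X, V)}
  {ω : κ → Γ(differentials s, V)} {e : Option κ → Γ(logDifferentials s i, V)}
  {p : Y ⟶ X} {L : Y.Modules} {q : (Scheme.Modules.pullback p).obj (logDifferentials s i) ⟶ L}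
  {p₀ : Y₀ ⟶ X} {L₀ : Y₀.Modules} {q₀ : (Scheme.Modules.pullback p₀).obj (differentials s) ⟶ L₀}
  {f : T ⟶ Y} {f₀ : T ⟶ Y₀} {W : T.Opens}
  {θ : (Scheme.Modules.pullback f₀).obj L₀ ⟶ (Scheme.Modules.pullback f).obj L}
  {res : logDifferentials s i ⟶ (Scheme.Modules.pushforward i).obj (structureSheaf D)}
  {σ : D ⟶ Y} {pD : P ⟶ D} {LD : P.Modules}
  {qD : (Scheme.Modules.pullback pD).obj (differentials (i ≫ s)) ⟶ LD} {τ : P ⟶ Y₀}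
  (hX : LogPair s i) (hres : IsFrameResidue s i res)
  (hY : IsProjectiveBundle (logDifferentials s i) p q)
  (hσ : Classifies q σ (restrictToDivisor i res))
  (hY₀ : IsProjectiveBundle (differentials s) p₀ q₀)
  (hP : IsProjectiveBundle (differentials (i ≫ s)) pD qD) (hτ : Classifies q₀ τ (tauQuotient i qD))

  (hF : LogFrame s i V t ω e) (hV : IsAffineOpen V) (hθ : IsFormsMap s i q q₀ f f₀ θ)
  (hf : IsBlowup σ f)

include hX hres hY hσ hY₀ hP hτ hf hθ

theorem IsFormsMap.nonempty_iso_tensor :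
    Nonempty ((Scheme.Modules.pullback f).obj L ≅
      tensor ((Scheme.Modules.pullback f₀).obj L₀) (divisorSheaf (exceptional σ f))) := by
  have := hX.isClosedImmersion
  have := isClosedImmersion_sigma hX hres hY hσ
  have := hY₀.epi
  have hc := classifies_pullbackQuotient q f
  have hc₀ := classifies_pullbackQuotient q₀ f₀
  have key : ∀ {V : X.Opens} {ι : Type} [Fintype ι] {b : ι → Γ(differentials s, V)} {k : ι}
      {W : T.Opens} {n : Γ((Scheme.Modules.pullback f).obj L, W)} {c : Γ(T, W)}
      (h : W ≤ (f ≫ p) ⁻¹ᵁ V) (hW₀ : W ≤ f₀ ⁻¹ᵁ chart q₀ b k),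
      IsGen _ W n → n = c • qsec (pullbackQuotient q f) h ((toLog s i).app V (b k)) →
      IsEqn (pullback.fst f σ) W 1 → ∀ x ∈ W, ∃ (W : T.Opens) (ε : Γ(T, W))
        (m : Γ((Scheme.Modules.pullback f₀).obj L₀, W)) (n : Γ((Scheme.Modules.pullback f).obj L, W)),
        x ∈ W ∧ IsEqn (pullback.fst f σ) W ε ∧ IsGen _ W m ∧ IsGen _ W n ∧ θ.app W m = ε • n := by
    intro V ι _ b k W n c h hW₀ hn hnc hE x hx
    have h₀ : W ≤ (f₀ ≫ p₀) ⁻¹ᵁ V := hW₀.trans (f₀.preimage_mono (chart_le q₀ _ k))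
    refine ⟨W, 1, qsec (pullbackQuotient q₀ f₀) h₀ (b k), _, hx, hE, hc₀.isGen hW₀ h₀, ?_,
      (hθ.app h h₀ _).trans (one_smul _ _).symm⟩
    obtain ⟨c', hc'⟩ := hn.exists_smul le_rfl (qsec (pullbackQuotient q f) h ((toLog s i).app V (b k)))
    rw [mres_self] at hc'
    have h1 : c * c' = 1 := hn.smul_ext le_rfl (by
      rw [mres_self, one_smul, ← smul_smul, ← hc']
      exact hnc.symm)
    rw [hc']
    exact hn.unit_smul (.of_mul_eq_one_right c h1)
  refine nonempty_iso_tensor_divisorSheaf θ _ fun x ↦ ?_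
  rcases hX.chart_cases hY (f x) with ⟨V, κ, _, e, k, hVc, hV, he, hk⟩ |
    ⟨V, κ, _, t, ω, e, j, hV, hF, hj⟩
  · have hx : f₀ x ∈ p₀ ⁻¹ᵁ V := by
      have h1 : p (f x) = p₀ (f₀ x) := congrArg (fun m ↦ m x) hθ.comm
      exact (show p₀ (f₀ x) ∈ V from h1 ▸ chart_le q _ k hk)
    obtain ⟨k₀, hk₀⟩ := exists_mem_chart (q := q₀) hY₀.isInvertible he hx
    let W : T.Opens := f ⁻¹ᵁ chart q (fun k ↦ (toLog s i).app V (e k)) k ⊓ f₀ ⁻¹ᵁ chart q₀ e k₀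
    have h : W ≤ (f ≫ p) ⁻¹ᵁ V := inf_le_left.trans (f.preimage_mono (chart_le q _ k))
    refine key h inf_le_right (hc.isGen inf_le_left h) (hθ.qsec_toLog k₀ k h inf_le_right)
      (isEqn_one ?_) x ⟨hk, hk₀⟩
    exact fst_preimage_eq_bot
      (preimage_preimage_complement (hσ.1.trans (Category.id_comp i).symm)) f
        (h.trans (Scheme.Hom.preimage_mono _ hVc))
  · have hx : f₀ x ∈ p₀ ⁻¹ᵁ V := by
      have h1 : p (f x) = p₀ (f₀ x) := congrArg (fun m ↦ m x) hθ.comm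
      exact (show p₀ (f₀ x) ∈ V from h1 ▸ chart_le q _ j hj)
    obtain ⟨k, hk⟩ := exists_mem_chart (q := q₀) hY₀.isInvertible hF.isBasisOn hx
    let W : T.Opens := f ⁻¹ᵁ chart q e j ⊓ f₀ ⁻¹ᵁ chart q₀ (frameBasis s t ω) k
    have hW : W ≤ f ⁻¹ᵁ chart q e j := inf_le_left
    have hW₀ : W ≤ f₀ ⁻¹ᵁ chart q₀ (frameBasis s t ω) k := inf_le_right
    have h : W ≤ (f ≫ p) ⁻¹ᵁ V := hW.trans (f.preimage_mono (chart_le q e _))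
    cases j with
    | none =>
      have h₀ : W ≤ (f₀ ≫ p₀) ⁻¹ᵁ V := hW₀.trans (f₀.preimage_mono (chart_le q₀ _ k))
      have hreg := (hX.isRegOver_log hY).blowup hf
      refine ⟨W, _, qsec (pullbackQuotient q₀ f₀) h₀ (frameBasis s t ω k), _, ⟨hj, hk⟩,
        (hθ.isEqn_fst_none hX hres hY hσ hY₀ hP hτ hreg hF hV hW hW₀).1, hc₀.isGen hW₀ h₀,
        hc.isGen hW h, (hθ.app h h₀ _).trans ?_⟩
      rw [← logCoord_none]
      exact hF.qsec_toLog none k h hW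
    | some l =>
      refine key h hW₀ (hc.isGen hW h) (Eq.trans (congrArg _ ?_) (hθ.qsec_toLog k (some l) h hW₀))
        (isEqn_one (fst_preimage_eq_bot (sigma_preimage_some hres hY hσ hF l) f hW)) x ⟨hj, hk⟩
      exact hF.eq_toLog l

end blowupChart

end

end LogResolution

theorem mainTheorem10
    -- the log pair `(X, D)` with smooth boundary
    {X D : Scheme.{0}} (s : X ⟶ Spec (CommRingCat.of ℂ)) (i : D ⟶ X)
    (hXD : IsLogPairWithSmoothBoundary s i)
    -- `Y = ℙ(T_X(-log D)) = ℙ^*(Ω_X(log D))` and `𝒪_Y(1)`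
    {Y : Scheme.{0}} (p : Y ⟶ X) (L : Y.Modules)
    (q : (Scheme.Modules.pullback p).obj (logDifferentials s i) ⟶ L)
    (hY : IsProjectiveBundle (logDifferentials s i) p q)
    -- `Y₀ = ℙ(T_X) = ℙ^*(Ω_X)` and `𝒪_{Y₀}(1)`
    {Y₀ : Scheme.{0}} (p₀ : Y₀ ⟶ X) (L₀ : Y₀.Modules)
    (q₀ : (Scheme.Modules.pullback p₀).obj (differentials s) ⟶ L₀)
    (hY₀ : IsProjectiveBundle (differentials s) p₀ q₀)
    -- `ℙ(T_D) = ℙ^*(Ω_D)`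
    {P : Scheme.{0}} (pD : P ⟶ D) (LD : P.Modules)
    (qD : (Scheme.Modules.pullback pD).obj (differentials (i ≫ s)) ⟶ LD)
    (hP : IsProjectiveBundle (differentials (i ≫ s)) pD qD) :
    -- the Poincaré residue
    ∃ res : logDifferentials s i ⟶ (Scheme.Modules.pushforward i).obj (structureSheaf D),
      IsPoincareResidue s i res ∧
    -- the section `σ : D ⟶ Y` given by the residue, with image `Z`
    ∃ σ : D ⟶ Y, Classifies q σ (restrictToDivisor i res) ∧ IsClosedImmersion σ ∧
    -- the map `τ : ℙ(T_D) ⟶ ℙ(T_X)` given by `Ω_X|_D ⟶ Ω_D`, with image `Z₀`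
    ∃ τ : P ⟶ Y₀,
      Classifies q₀ τ (pullbackQuotient (differentialsPull (sX := i ≫ s) i rfl) pD ≫ qD) ∧
      IsClosedImmersion τ ∧
    -- the natural birational map `u : Y ⇢ Y₀`, an isomorphism over `X ∖ D`
    ∃ u : (p ⁻¹ᵁ complement i).toScheme ⟶ Y₀,
      Classifies q₀ u ((Scheme.Modules.pullback ((p ⁻¹ᵁ complement i).ι ≫ p)).map (toLog s i) ≫
        pullbackQuotient q (p ⁻¹ᵁ complement i).ι) ∧
      IsOpenImmersion u ∧ Set.range u = (p₀ ⁻¹ᵁ complement i : Y₀.Opens) ∧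
      Dense ((p ⁻¹ᵁ complement i : Y.Opens) : Set Y) ∧
      Dense ((p₀ ⁻¹ᵁ complement i : Y₀.Opens) : Set Y₀) ∧
    -- the isomorphism `N^*_{Z/Y} ≅ p^*(Ω_X|_D)`, where `Z` is identified with `D` by `σ` and `p`
    ∃ ν : conormal σ ≅ (Scheme.Modules.pullback i).obj (differentials s),
    -- the blowing-ups of `Z` and of `Z₀`
    ∀ (B B₀ : Scheme.{0}) (π : B ⟶ Y) (π₀ : B₀ ⟶ Y₀), IsBlowup σ π → IsBlowup τ π₀ →
      ∃ Φ : B ≅ B₀,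
        -- `Φ` is an isomorphism over `X` which is induced by `u`
        Φ.hom ≫ π₀ ≫ p₀ = π ≫ p ∧
        (π ⁻¹ᵁ p ⁻¹ᵁ complement i).ι ≫ Φ.hom ≫ π₀ = (π ∣_ (p ⁻¹ᵁ complement i)) ≫ u ∧
        -- strict transforms and exceptional divisors
        (strictTransform σ π (pullback.fst p i)).comap Φ.inv = (exceptional τ π₀).ker ∧
        (strictTransform τ π₀ (pullback.fst p₀ i)).comap Φ.hom = (exceptional σ π).ker ∧
        -- `π^* 𝒪_Y(1) ≅ π₀^* 𝒪_{Y₀}(1) ⊗ 𝒪(E)`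
        Nonempty ((Scheme.Modules.pullback π).obj L ≅
          tensor ((Scheme.Modules.pullback (Φ.hom ≫ π₀)).obj L₀)
            (divisorSheaf (exceptional σ π))) ∧
        -- `π₀` induces an isomorphism of `E` with `p₀⁻¹(D)`, as `D`-schemes
        IsPullback (exceptional σ π ≫ Φ.hom ≫ π₀) (pullback.snd π σ) p₀ i ∧
        -- through `ν`, `E = ℙ^*(N^*_{Z/Y})` is the projective bundle `ℙ^*(Ω_X|_D)`
        IsProjectiveBundle ((Scheme.Modules.pullback i).obj (differentials s)) (pullback.snd π σ)
          ((Scheme.Modules.pullback (pullback.snd π σ)).map ν.inv ≫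
            conormalMap (pullback.condition (f := π) (g := σ))) ∧
        -- and this determines the isomorphism of `E` with `p₀⁻¹(D)`
        Classifies q₀ (exceptional σ π ≫ Φ.hom ≫ π₀)
          ((Scheme.Modules.pullbackComp (pullback.snd π σ) i).inv.app (differentials s) ≫
            (Scheme.Modules.pullback (pullback.snd π σ)).map ν.inv ≫
              conormalMap (pullback.condition (f := π) (g := σ))) := by
  have := hXD.smooth
  have := hXD.smooth_boundary
  have hX : LogPair s i := logPair_of_smooth s hXD.divisor
  have := hX.isClosedImmersion
  obtain ⟨res, hres⟩ := hX.exists_residue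
  obtain ⟨σ, hσ⟩ := hX.exists_sigma hres hY
  obtain ⟨τ, hτ⟩ := hX.exists_tau hY₀ hP
  obtain ⟨u, hu⟩ := hX.exists_birational hY hY₀
  obtain ⟨ν, hν⟩ := exists_conormalIso hX hres hY hσ
  have hbir := isOpenImmersion_bir hX hY hY₀ hu
  refine ⟨res, hres.isPoincareResidue hX, σ, hσ, isClosedImmersion_sigma hX hres hY hσ, τ, hτ,
    isClosedImmersion_tau hX hY₀ hP hτ, u, hu, hbir.1, hbir.2, hX.dense_log hY, hX.dense hY₀, ν,
    fun B B₀ π π₀ hπ hπ₀ ↦ ?_⟩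
  obtain ⟨Φ, θ, θ', hθ, hθ', hπ'⟩ := hX.exists_blowup_iso hres hY hσ hY₀ hP hτ hu hπ hπ₀
  have := isClosedImmersion_sigma hX hres hY hσ
  have := isClosedImmersion_tau hX hY₀ hP hτ
  have hclass := hθ.classifies_conormal hX hres hY hσ hY₀ hP hτ hπ hν
  have hpull := hθ.isPullback hX hres hY hσ hY₀ hP hτ hπ
  refine ⟨Φ, ?_, ((hθ.agree hX hY hY₀ hu).bir _ _ (morphismRestrict_ι _ _)).symm, ?_, ?_,
    hθ.nonempty_iso_tensor hX hres hY hσ hY₀ hP hτ hπ, hpull,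
    hY₀.of_isPullback hpull hclass, hclass⟩
  · rw [← Category.assoc, hθ.comm]
  · rw [(hθ.strictTransform_eq hX hres hY hσ hY₀ hP hτ hπ).1,
      Scheme.IdealSheafData.ker_fst_of_isClosedImmersion,
      Scheme.IdealSheafData.ker_fst_of_isClosedImmersion, ← Scheme.IdealSheafData.comap_comp,
      Iso.inv_hom_id_assoc]
  · rw [(hθ'.strictTransform_eq hX hres hY hσ hY₀ hP hτ hπ').2,
      Scheme.IdealSheafData.ker_fst_of_isClosedImmersion,
      Scheme.IdealSheafData.ker_fst_of_isClosedImmersion, ← Scheme.IdealSheafData.comap_comp,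
      Iso.hom_inv_id_assoc]
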